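/- **Setting.** Let $A\in\mathbb R^{n\times n}$ ($n\ge 2$) be symmetric positive definite and $b\in\mathbb R^n$ a unit vector. The conjugate gradient (CG) iteration for $Ax=b$ starts from $x_0=0$, $r_0=p_0=b$ and computes, for $k=0,1,2,\dots$ as long as $r_k\neq 0$, $$\alpha_k=\frac{r_k^Tr_k}{p_k^TAp_k},\quad x_{k+1}=x_k+\alpha_kp_k,\quad r_{k+1}=r_k-\alpha_kAp_k,\quad \beta_k=\frac{r_{k+1}^Tr_{k+1}}{r_k^Tr_k},\quad p_{k+1}=r_{k+1}+\beta_kp_k .$$ For $m\ge1$ let $T_m$ be the symmetric tridiagonal $m\times m$ matrix with diagonal entries $1/\alpha_0$ and $1/\alpha_i+\beta_{i-1}/\alpha_{i-1}$ $(1\le i\le m-1)$ and off-diagonal entries $\sqrt{\beta_i}/\alpha_i$ $(0\le i\le m-2)$. Its extreme eigenvalues are the approximations to the extreme eigenvalues of $A$ given by $m$ steps of CG. **Machine.** A quantum computer with classical control has qubits with Hadamard, phase (arbitrary angle) and controlled-not gates and measurements, a classical memory of real numbers with arithmetic, square root, cosine, comparison, indirect addressing and bounded loops (each gate, measurement, elementary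 operation, test and loop round costs $1$), and an $n$-dimensional data register. On the data register it can apply, controlled by a qubit, a unitary $U$ with $U|0\rangle=|b\rangle$ or its inverse (cost $(\log n)^2$) and the Hamiltonian simulation $e^{-iAt}$, $t\in\mathbb R$ (cost $(1+|t|)(\log n)^2$); it can also flip a qubit if the register is in the state $|0\rangle$, and reset the register to $|0\rangle$ (cost $1+\log n$ each). Time is the total cost. **Proposition.** There are one program for this machine, with inputs $n,m,\varepsilon,\delta$, and a constant $C>0$ such that the following holds for all $n\ge2$, $m\ge1$, $0<\varepsilon\le1$, $0<\delta\le1$, all $A$, $b$ as above such that the eigenvalues of $A$ lie in $[\delta,1]$ and $\|r_k\|\ge\delta$ for all $k<m$ (CG has not stopped before step $m$), and every unitary $U$ with $U|0\rangle=|b\rangle$. 1. The program runs in time at most $$C\,\frac{(\log n)^2\,m^3}{\varepsilon\,\delta^{3m-2}} .$$ 2. With probability at least $2/3$ it outputs numbers $\tilde\lambda_{\max},\tilde\lambda_{\min},\tilde\kappa$ with $$|\tilde\lambda_{\max}-\lambda_{\max}(T_m)|\le\varepsilon,\qquad |\tilde\lambda_{\min}-\lambda_{\min}(T_m)|\le\varepsilon,\qquad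 |\tilde\kappa-\kappa|\le\frac{2\varepsilon}{\delta}\,\kappa,\quad \kappa=\frac{\lambda_{\max}(T_m)}{\lambda_{\min}(T_m)} .$$ 3. If CG stops at step $m$, i.e. $r_m=0$, and $b$ is orthogonal neither to the eigenspace of $A$ for its largest eigenvalue nor to the one for its smallest eigenvalue, then $\lambda_{\max}(T_m)=\lambda_{\max}(A)$ and $\lambda_{\min}(T_m)=\lambda_{\min}(A)$. Hence, with probability at least $2/3$, the output approximates the largest eigenvalue, the smallest eigenvalue and the condition number of $A$ itself with the error bounds of part 2. -/

import Mathlib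

open Matrix

noncomputable section

/-! ### The conjugate gradient iteration and its tridiagonal matrix -/

/-- The vectors kept by the conjugate gradient iteration: iterate, residual, direction. -/
structure CGState (n : ℕ) where
  x : Fin n → ℝ
  r : Fin n → ℝ
  p : Fin n → ℝ

namespace CGState

variable {n : ℕ}

/-- Step length `rᵀr / pᵀAp`. -/
def alpha (A : Matrix (Fin n) (Fin n) ℝ) (c : CGState n) : ℝ :=
  (c.r ⬝ᵥ c.r) / (c.p ⬝ᵥ (A *ᵥ c.p))

/-- The next residual `r - α A p`. -/
def nextR (A : Matrix (Fin n) (Fin n) ℝ) (c : CGState n) : Fin n → ℝ :=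
  c.r - c.alpha A • (A *ᵥ c.p)

/-- The ratio `r'ᵀr' / rᵀr`, where `r'` is the next residual. -/
def beta (A : Matrix (Fin n) (Fin n) ℝ) (c : CGState n) : ℝ :=
  (c.nextR A ⬝ᵥ c.nextR A) / (c.r ⬝ᵥ c.r)

/-- One step of the conjugate gradient iteration. -/
def step (A : Matrix (Fin n) (Fin n) ℝ) (c : CGState n) : CGState n where
  x := c.x + c.alpha A • c.p
  r := c.nextR A
  p := c.nextR A + c.beta A • c.p

end CGState

/-- The conjugate gradient iteration for `A x = b`, started at `x₀ = 0`, `r₀ = p₀ = b`. -/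
def cg {n : ℕ} (A : Matrix (Fin n) (Fin n) ℝ) (b : Fin n → ℝ) : ℕ → CGState n
  | 0 => ⟨0, b, b⟩
  | k + 1 => (cg A b k).step A

/-- The coefficient `α_k`. -/
def cgAlpha {n : ℕ} (A : Matrix (Fin n) (Fin n) ℝ) (b : Fin n → ℝ) (k : ℕ) : ℝ :=
  (cg A b k).alpha A

/-- The coefficient `β_k`. -/
def cgBeta {n : ℕ} (A : Matrix (Fin n) (Fin n) ℝ) (b : Fin n → ℝ) (k : ℕ) : ℝ :=
  (cg A b k).beta A

/-- The symmetric tridiagonal matrix `T_m`: diagonal `1/α₀`, `1/α_i + β_{i-1}/α_{i-1}`,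
off-diagonal `√β_i / α_i`. -/
def lanczosMatrix {n : ℕ} (A : Matrix (Fin n) (Fin n) ℝ) (b : Fin n → ℝ) (m : ℕ) :
    Matrix (Fin m) (Fin m) ℝ :=
  Matrix.of fun i j =>
    if i = j then
      1 / cgAlpha A b i +
        (if (i : ℕ) = 0 then 0 else cgBeta A b (i - 1) / cgAlpha A b (i - 1))
    else if (i : ℕ) + 1 = j then Real.sqrt (cgBeta A b i) / cgAlpha A b i
    else if (j : ℕ) + 1 = i then Real.sqrt (cgBeta A b j) / cgAlpha A b j
    else 0

/-- Largest eigenvalue of a real symmetric matrix. -/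
def maxEigenvalue {k : ℕ} (M : Matrix (Fin k) (Fin k) ℝ) : ℝ := sSup (spectrum ℝ M)

/-- Smallest eigenvalue of a real symmetric matrix. -/
def minEigenvalue {k : ℕ} (M : Matrix (Fin k) (Fin k) ℝ) : ℝ := sInf (spectrum ℝ M)

/-- The vector `b` is not orthogonal to the eigenspace of `A` for `μ`. -/
def HasOverlap {n : ℕ} (A : Matrix (Fin n) (Fin n) ℝ) (b : Fin n → ℝ) (μ : ℝ) : Prop :=
  ∃ v : Fin n → ℝ, A *ᵥ v = μ • v ∧ v ⬝ᵥ b ≠ 0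

/-! ### A quantum computer with classical control and a step count

The machine has a classical real-number memory, indexed by `ℕ`, an unlimited supply of qubits,
indexed by `ℕ`, and one quantum register of dimension `n`, the data register, which is reached
through the preparation of `|b⟩`, the Hamiltonian simulation of `A`, a test for the basis state
`|0⟩`, and re-initialisation. -/

/-- Unit-cost operations on real numbers (`sqrt` and `cos` ignore the second argument). -/
inductive RealOp
  | add | sub | mul | div | sqrt | cos

/-- The value of an operation. -/
def RealOp.eval : RealOp → ℝ → ℝ → ℝ
  | .add, x, y => x + y
  | .sub, x, y => x - y
  | .mul, x, y => x * y
  | .div, x, y => x / y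
  | .sqrt, x, _ => Real.sqrt x
  | .cos, x, _ => Real.cos x

/-- Programs. All arguments `d x y a q c t` are addresses of classical memory cells; qubits are
addressed through (the natural-number part of) the contents of such cells. -/
inductive QProg
  /-- `mem d := v` for a rational constant `v` -/
  | const (d : ℕ) (v : ℚ)
  /-- `mem d := π` -/
  | constPi (d : ℕ)
  /-- `mem d := mem x ∘ mem y` -/
  | op (f : RealOp) (d x y : ℕ)
  /-- `mem d := mem (mem a)` -/
  | load (d a : ℕ)
  /-- `mem (mem a) := mem x` -/
  | store (a x : ℕ)
  /-- Hadamard gate on qubit `mem q` -/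
  | had (q : ℕ)
  /-- phase gate `diag(1, exp(iθ))` with `θ = mem x` on qubit `mem q` -/
  | phase (q x : ℕ)
  /-- controlled-not with control `mem c` and target `mem t` (idle if they coincide) -/
  | cnot (c t : ℕ)
  /-- the preparation unitary of `|b⟩` on the data register, controlled by qubit `mem c` -/
  | prep (c : ℕ)
  /-- the inverse of the preparation unitary, controlled by qubit `mem c` -/
  | unprep (c : ℕ)
  /-- `exp(-iAt)`, `t = mem x`, on the data register, controlled by qubit `mem c` -/
  | evolve (c x : ℕ)
  /-- flip qubit `mem q` if the data register is in the basis state `|0⟩` -/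
  | flipZero (q : ℕ)
  /-- re-initialise the data register to `|0⟩` -/
  | reset
  /-- measure qubit `mem q` and put the outcome, 0 or 1, into `mem d` -/
  | meas (d q : ℕ)
  /-- sequential composition -/
  | seq (P Q : QProg)
  /-- if `mem x ≤ mem y` then `P` else `Q` -/
  | ite (x y : ℕ) (P Q : QProg)
  /-- repeat `P`; the number of rounds is the natural-number part of `mem x` at the start -/
  | loop (x : ℕ) (P : QProg)

/-- A configuration: classical memory, (unnormalised) quantum state, elapsed time. The set
`s : Finset ℕ` is the basis state in which exactly the qubits in `s` are 1, and `state s i` is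
the amplitude of `|s⟩|i⟩`. The squared norm of the state is the probability of the measurement
outcomes that led to the configuration. -/
structure QConfig (n : ℕ) where
  mem : ℕ → ℝ
  state : Finset ℕ → Fin n → ℂ
  time : ℝ

namespace QConfig

variable {n : ℕ}

/-- The address stored in a cell. -/
def idx (c : QConfig n) (a : ℕ) : ℕ := ⌊c.mem a⌋₊

/-- Let time pass. -/
def wait (τ : ℝ) (c : QConfig n) : QConfig n := { c with time := c.time + τ }

/-- Write to classical memory. -/
def write (d : ℕ) (v : ℝ) (c : QConfig n) : QConfig n := { c with mem := Function.update c.mem d v }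

/-- Transform the quantum state. -/
def act (F : (Finset ℕ → Fin n → ℂ) → (Finset ℕ → Fin n → ℂ)) (c : QConfig n) : QConfig n :=
  { c with state := F c.state }

/-- The probability of the branch. -/
def prob (c : QConfig n) : ℝ := ∑ᶠ s : Finset ℕ, ∑ i, ‖c.state s i‖ ^ 2

end QConfig

/-- The Hadamard gate on qubit `q`. -/
def hadGate {n : ℕ} (q : ℕ) (ψ : Finset ℕ → Fin n → ℂ) : Finset ℕ → Fin n → ℂ := fun s =>
  ((Real.sqrt 2 : ℝ) : ℂ)⁻¹ • (ψ (s.erase q) + (if q ∈ s then (-1 : ℂ) else 1) • ψ (insert q s))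

/-- The phase gate on qubit `q`. -/
def phaseGate {n : ℕ} (q : ℕ) (θ : ℝ) (ψ : Finset ℕ → Fin n → ℂ) : Finset ℕ → Fin n → ℂ :=
  fun s => (if q ∈ s then Complex.exp (θ * Complex.I) else 1) • ψ s

/-- The controlled-not gate. -/
def cnotGate {n : ℕ} (c t : ℕ) (ψ : Finset ℕ → Fin n → ℂ) : Finset ℕ → Fin n → ℂ :=
  fun s => if c ∈ s ∧ c ≠ t then ψ (symmDiff s {t}) else ψ s

/-- A matrix on the data register, controlled by qubit `c`. -/
def controlledGate {n : ℕ} (c : ℕ) (M : Matrix (Fin n) (Fin n) ℂ)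
    (ψ : Finset ℕ → Fin n → ℂ) : Finset ℕ → Fin n → ℂ :=
  fun s => if c ∈ s then M *ᵥ ψ s else ψ s

/-- Flip qubit `q` if the data register is in the basis state `|0⟩`. -/
def flipZeroGate {n : ℕ} (q : ℕ) (ψ : Finset ℕ → Fin n → ℂ) : Finset ℕ → Fin n → ℂ :=
  fun s i => if (i : ℕ) = 0 then ψ (symmDiff s {q}) i else ψ s i

/-- Outcome `v` of the measurement of qubit `q` (unnormalised). -/
def projectQubit {n : ℕ} (q : ℕ) (v : Bool) (ψ : Finset ℕ → Fin n → ℂ) :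
    Finset ℕ → Fin n → ℂ :=
  fun s => if decide (q ∈ s) = v then ψ s else 0

/-- The data register is found in the basis state `|j⟩` and set to `|0⟩` (unnormalised). -/
def resetTo {n : ℕ} (j : Fin n) (ψ : Finset ℕ → Fin n → ℂ) : Finset ℕ → Fin n → ℂ :=
  fun s i => if (i : ℕ) = 0 then ψ s j else 0

/-- The unitary `exp(-iAt)`. -/
def evolution {n : ℕ} (A : Matrix (Fin n) (Fin n) ℝ) (t : ℝ) : Matrix (Fin n) (Fin n) ℂ :=
  NormedSpace.exp ((-(Complex.I * (t : ℂ))) • A.map (fun x : ℝ => (x : ℂ)))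

/-- All branches of the execution of a program, where `A` is the matrix to be simulated and `U`
the unitary that prepares `|b⟩`. Costs: `(1 + |t|) (log n)²` for `exp(-iAt)`, `(log n)²` for the
preparation of `|b⟩` and its inverse, `1 + log n` for the other operations on the data register,
and 1 for all other instructions, for every test and for every round of a loop. -/
def QProg.run {n : ℕ} (A : Matrix (Fin n) (Fin n) ℝ) (U : Matrix (Fin n) (Fin n) ℂ) :
    QProg → QConfig n → List (QConfig n)
  | .const d v, c => [(c.write d v).wait 1]
  | .constPi d, c => [(c.write d Real.pi).wait 1]
  | .op f d x y, c => [(c.write d (f.eval (c.mem x) (c.mem y))).wait 1]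
  | .load d a, c => [(c.write d (c.mem (c.idx a))).wait 1]
  | .store a x, c => [(c.write (c.idx a) (c.mem x)).wait 1]
  | .had q, c => [(c.act (hadGate (c.idx q))).wait 1]
  | .phase q x, c => [(c.act (phaseGate (c.idx q) (c.mem x))).wait 1]
  | .cnot a t, c => [(c.act (cnotGate (c.idx a) (c.idx t))).wait 1]
  | .prep a, c => [(c.act (controlledGate (c.idx a) U)).wait (Real.log n ^ 2)]
  | .unprep a, c => [(c.act (controlledGate (c.idx a) Uᴴ)).wait (Real.log n ^ 2)]
  | .evolve a x, c =>
      [(c.act (controlledGate (c.idx a) (evolution A (c.mem x)))).wait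
        ((1 + |c.mem x|) * Real.log n ^ 2)]
  | .flipZero q, c => [(c.act (flipZeroGate (c.idx q))).wait (1 + Real.log n)]
  | .reset, c => (List.finRange n).map fun j => (c.act (resetTo j)).wait (1 + Real.log n)
  | .meas d q, c =>
      [((c.act (projectQubit (c.idx q) false)).write d 0).wait 1,
       ((c.act (projectQubit (c.idx q) true)).write d 1).wait 1]
  | .seq P Q, c => (P.run A U c).flatMap (Q.run A U)
  | .ite x y P Q, c =>
      if c.mem x ≤ c.mem y then P.run A U (c.wait 1) else Q.run A U (c.wait 1)
  | .loop x P, c =>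
      (fun L : List (QConfig n) => L.flatMap fun c' => P.run A U (c'.wait 1))^[c.idx x] [c.wait 1]

/-- The initial configuration: `n, m, ε, δ` in the cells `0, 1, 2, 3`, all other cells 0, all
qubits and the data register in the state `|0⟩`. -/
def initialConfig (n m : ℕ) (ε δ : ℝ) : QConfig n where
  mem := fun a => if a = 0 then (n : ℝ) else if a = 1 then (m : ℝ) else if a = 2 then ε
    else if a = 3 then δ else 0
  state := fun s i => if s = ∅ ∧ (i : ℕ) = 0 then 1 else 0
  time := 0

/-- The branches of the execution of `P` on the input `n, m, ε, δ`. -/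
def QProg.exec (P : QProg) {n : ℕ} (A : Matrix (Fin n) (Fin n) ℝ)
    (U : Matrix (Fin n) (Fin n) ℂ) (m : ℕ) (ε δ : ℝ) : List (QConfig n) :=
  P.run A U (initialConfig n m ε δ)

/-- `P` runs in time at most `τ`: so does every branch of positive probability. -/
def QProg.RunsInTime (P : QProg) {n : ℕ} (A : Matrix (Fin n) (Fin n) ℝ)
    (U : Matrix (Fin n) (Fin n) ℂ) (m : ℕ) (ε δ τ : ℝ) : Prop :=
  ∀ c ∈ P.exec A U m ε δ, 0 < c.prob → c.time ≤ τ

open Classical in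
/-- The probability that the final classical memory has the property `good`. -/
def QProg.successProb (P : QProg) {n : ℕ} (A : Matrix (Fin n) (Fin n) ℝ)
    (U : Matrix (Fin n) (Fin n) ℂ) (m : ℕ) (ε δ : ℝ) (good : (ℕ → ℝ) → Prop) : ℝ :=
  ((P.exec A U m ε δ).map fun c => if good c.mem then c.prob else 0).sum

/-- The cells `0, 1, 2` hold the extreme eigenvalues `lmax`, `lmin` to accuracy `ε`, and their
quotient, the condition number, to relative accuracy `2ε/δ`. -/
def GoodOutput (lmax lmin ε δ : ℝ) (mem : ℕ → ℝ) : Prop :=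
  |mem 0 - lmax| ≤ ε ∧ |mem 1 - lmin| ≤ ε ∧
    |mem 2 - lmax / lmin| ≤ 2 * ε / δ * (lmax / lmin)

end

/-! The matrix `T_m` is the compression of `A` to the Krylov space of `b`, written in the basis of
normalised residuals with alternating signs (`CGRun.lanczosVec_mulVec`). Its extreme eigenvalues are
therefore the extreme Rayleigh quotients of `A` on that space. In the basis `(A - 1/2)^i b` the two
quadratic forms become Hankel matrices of the central moments of the spectral measure of `b`
(`CGRun.hankelForm_powerCoord`, `CGRun.hankelForm_powerCoord_succ`). So `2 m` moments determine the
answer, and a bound `ρ` for the Ritz values relative to 1/2 can be tested by the signs of the pivots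
in Gaussian elimination (`schurComp_pos`, `blockForm_nonneg`). The change of basis magnifies errors
by at most `16^m / δ^(2m)` (`CGRun.sum_abs_powerCoord`): the monic orthogonal polynomials have
coefficient sums at most `2^k`, and norms at least `δ^(k+1)` because residual norms and the numbers
`1/α_i` are at least `δ`. Hence moment errors of order `ε δ^(2m) c^(-m)` are harmless, and a search
in steps of `ε/2` finds both extreme Ritz values.

The moments come from the time evolution. On the spectrum, `x - 1/2` is a cosine series with
coefficients of order `l^(-7)` (`hasSum_waveCoeff`), because a triangle wave can be smoothed five
times without changing it in the middle of its linear part. Multiplication by `x - 1/2` thus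
combines moments against `cos (jz)` into moments of the same kind with indices `j ± l`. With errors
weighted by `(1 + j)^5` and truncation at `J` of order `η^(-1/2)`, each multiplication costs only a
constant factor of accuracy (`abs_waveMoment_succ_sub_le`), and `2 m` of them lead to the central
moments (`det_tableProg`).

A cosine moment is encoded in a matrix element of a reflection built from `U` and the evolution for
time `j`. Composed with the reflection that negates `|−⟩|0⟩`, it rotates by an angle `φ`
(`minusAmp_walkU_iterate`), so an experiment with `k` steps succeeds with probability `cos² (kφ)`.
Newton's method with `N` or `N + 1` steps doubles the precision `N` of the phase. Sample numbers
proportional to `√(t/N)` turn total cost and total failure probability into geometric sums, and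
precision `t` costs `O(t)` (`wp_phaseLoop`). Summed over `j`, the allowed errors `η (1 + j)^5` make
cost and failure converge (`wp_momentLoop`): the estimation takes time `O(log² n / η)`, the table
`O(m²/η)` and the search `O(m³/ε)`.

The claimed time contains `δ^(-(3m-2))`, whereas `1/η` needs only `c^m δ^(-2m)`. The spare factor
absorbs `c^m`, because the energy of the iterates shows `m δ³ ≤ 1` (`CGRun.steps_le`,
`pow_mul_pow_le`); `m = 1` is treated apart. When `r_m = 0` the Krylov space is invariant, and
eigenvectors of `A` that `b` sees project to eigenvectors of `T_m` (`CGRun.exists_eigenvector`).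

The program is verified with two judgements: `Det` for classical code, and `Wp` for code with
measurements, which bounds the expected failure and asks all branches to return to multiples of one
quantum state. -/

noncomputable section

/-! ### Expressions and a program logic -/

/-- The memory with the scratch cells `64, …, 95` hidden. -/
def visible (M : ℕ → ℝ) : ℕ → ℝ := fun a => if 64 ≤ a ∧ a < 96 then 0 else M a

theorem visible_of_lt {M : ℕ → ℝ} {a : ℕ} (h : a < 64) : visible M a = M a := by
  unfold visible; rw [if_neg (by omega)]

theorem visible_of_ge {M : ℕ → ℝ} {a : ℕ} (h : 96 ≤ a) : visible M a = M a := by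
  unfold visible; rw [if_neg (by omega)]

theorem visible_update_scratch {M : ℕ → ℝ} {a : ℕ} {v : ℝ} (h : 64 ≤ a) (h' : a < 96) :
    visible (Function.update M a v) = visible M := by
  funext x
  unfold visible
  split_ifs with hx
  · rfl
  · rw [Function.update_of_ne]; rintro rfl; exact hx ⟨h, h'⟩

theorem visible_update {M : ℕ → ℝ} {a : ℕ} {v : ℝ} (h : a < 64 ∨ 96 ≤ a) :
    visible (Function.update M a v) = Function.update (visible M) a v := by
  funext x
  by_cases hx : x = a
  · subst hx; unfold visible; rw [if_neg (by omega)]; simp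
  · rw [Function.update_of_ne hx]; unfold visible; rw [Function.update_of_ne hx]

/-- Arithmetic expressions over memory cells. -/
inductive Ex
  | cell (a : ℕ)
  | rat (q : ℚ)
  | pi
  | bin (f : RealOp) (x y : Ex)

namespace Ex

/-- The value of an expression. -/
def eval (σ : ℕ → ℝ) : Ex → ℝ
  | cell a => σ a
  | rat q => q
  | pi => Real.pi
  | bin f x y => f.eval (x.eval σ) (y.eval σ)

/-- The cell that holds the value of an expression evaluated at scratch cell `k`. -/
def place (k : ℕ) : Ex → ℕ
  | cell a => a
  | _ => k

/-- Code that evaluates an expression with scratch cells from `k` on. -/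
def code : Ex → ℕ → QProg
  -- The dummy write stands for an empty program: the value stays in its own cell, as `place`
  -- records.
  | cell _, k => .const k 0
  | rat q, k => .const k q
  | pi, k => .constPi k
  | bin f x y, k => .seq (x.code k) (.seq (y.code (k + 1)) (.op f k (x.place k) (y.place (k + 1))))

/-- The cost of the code. -/
def cost : Ex → ℕ
  | bin _ x y => x.cost + y.cost + 1
  | _ => 1

/-- The expression only uses scalar cells, and scratch cells from `k` up to `90`. -/
def Ok : Ex → ℕ → Prop
  | cell a, k => a < 64 ∧ k < 90
  | rat _, k => k < 90
  | pi, k => k < 90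
  | bin _ x y, k => x.Ok k ∧ y.Ok (k + 1)

instance : Add Ex := ⟨bin .add⟩
instance : Sub Ex := ⟨bin .sub⟩
instance : Mul Ex := ⟨bin .mul⟩
instance : Div Ex := ⟨bin .div⟩
instance (k : ℕ) : OfNat Ex k := ⟨rat k⟩

/-- Square root. -/
def sqrt (x : Ex) : Ex := bin .sqrt x x
/-- Cosine. -/
def cos (x : Ex) : Ex := bin .cos x x

variable (σ : ℕ → ℝ) (x y : Ex) (k : ℕ)

@[simp] theorem eval_cell (a : ℕ) : (cell a).eval σ = σ a := rfl
@[simp] theorem eval_rat (q : ℚ) : (rat q).eval σ = q := rfl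
@[simp] theorem eval_pi : pi.eval σ = Real.pi := rfl
@[simp] theorem eval_add : (x + y).eval σ = x.eval σ + y.eval σ := rfl
@[simp] theorem eval_sub : (x - y).eval σ = x.eval σ - y.eval σ := rfl
@[simp] theorem eval_mul : (x * y).eval σ = x.eval σ * y.eval σ := rfl
@[simp] theorem eval_div : (x / y).eval σ = x.eval σ / y.eval σ := rfl
@[simp] theorem eval_ofNat (a : ℕ) [a.AtLeastTwo] :
    (ofNat(a) : Ex).eval σ = (OfNat.ofNat a : ℝ) := by
  show (((a : ℕ) : ℚ) : ℝ) = _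
  rw [Rat.cast_natCast]; rfl
@[simp] theorem eval_zero : (0 : Ex).eval σ = 0 := by show (((0 : ℕ) : ℚ) : ℝ) = _; simp
@[simp] theorem eval_one : (1 : Ex).eval σ = 1 := by show (((1 : ℕ) : ℚ) : ℝ) = _; simp
@[simp] theorem eval_sqrt : x.sqrt.eval σ = Real.sqrt (x.eval σ) := rfl
@[simp] theorem eval_cos : x.cos.eval σ = Real.cos (x.eval σ) := rfl

@[simp] theorem cost_cell (a : ℕ) : (cell a).cost = 1 := rfl
@[simp] theorem cost_rat (q : ℚ) : (rat q).cost = 1 := rfl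
@[simp] theorem cost_pi : pi.cost = 1 := rfl
@[simp] theorem cost_add : (x + y).cost = x.cost + y.cost + 1 := rfl
@[simp] theorem cost_sub : (x - y).cost = x.cost + y.cost + 1 := rfl
@[simp] theorem cost_mul : (x * y).cost = x.cost + y.cost + 1 := rfl
@[simp] theorem cost_div : (x / y).cost = x.cost + y.cost + 1 := rfl
@[simp] theorem cost_ofNat (a : ℕ) [a.AtLeastTwo] : (ofNat(a) : Ex).cost = 1 := rfl
@[simp] theorem cost_zero : (0 : Ex).cost = 1 := rfl
@[simp] theorem cost_one : (1 : Ex).cost = 1 := rfl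
@[simp] theorem cost_sqrt : x.sqrt.cost = x.cost + x.cost + 1 := rfl
@[simp] theorem cost_cos : x.cos.cost = x.cost + x.cost + 1 := rfl

@[simp] theorem ok_cell (a : ℕ) : (cell a).Ok k ↔ a < 64 ∧ k < 90 := Iff.rfl
@[simp] theorem ok_rat (q : ℚ) : (rat q).Ok k ↔ k < 90 := Iff.rfl
@[simp] theorem ok_pi : pi.Ok k ↔ k < 90 := Iff.rfl
@[simp] theorem ok_add : (x + y).Ok k ↔ x.Ok k ∧ y.Ok (k + 1) := Iff.rfl
@[simp] theorem ok_sub : (x - y).Ok k ↔ x.Ok k ∧ y.Ok (k + 1) := Iff.rfl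
@[simp] theorem ok_mul : (x * y).Ok k ↔ x.Ok k ∧ y.Ok (k + 1) := Iff.rfl
@[simp] theorem ok_div : (x / y).Ok k ↔ x.Ok k ∧ y.Ok (k + 1) := Iff.rfl
@[simp] theorem ok_ofNat (a : ℕ) [a.AtLeastTwo] : (ofNat(a) : Ex).Ok k ↔ k < 90 := Iff.rfl
@[simp] theorem ok_zero : (0 : Ex).Ok k ↔ k < 90 := Iff.rfl
@[simp] theorem ok_one : (1 : Ex).Ok k ↔ k < 90 := Iff.rfl
@[simp] theorem ok_sqrt : x.sqrt.Ok k ↔ x.Ok k ∧ x.Ok (k + 1) := Iff.rfl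
@[simp] theorem ok_cos : x.cos.Ok k ↔ x.Ok k ∧ x.Ok (k + 1) := Iff.rfl

variable {σ x y k}

theorem Ok.lt : ∀ {x : Ex} {k : ℕ}, x.Ok k → k < 90
  | cell _, _, h => h.2
  | rat _, _, h => h
  | pi, _, h => h
  | bin _ _ _, _, h => h.1.lt

/-- The code of an expression changes only scratch cells and leaves the value at its place. -/
theorem run_code {n : ℕ} (A : Matrix (Fin n) (Fin n) ℝ) (U : Matrix (Fin n) (Fin n) ℂ) :
    ∀ (x : Ex) (k : ℕ), 64 ≤ k → x.Ok k → ∀ c : QConfig n, ∃ M' : ℕ → ℝ,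
      (x.code k).run A U c = [⟨M', c.state, c.time + x.cost⟩] ∧
      visible M' = visible c.mem ∧ (∀ a < k, M' a = c.mem a) ∧
      M' (x.place k) = x.eval (visible c.mem)
  | cell a, k, hk, h, c => by
      refine ⟨Function.update c.mem k 0, ?_, visible_update_scratch hk (by linarith [h.2]), ?_, ?_⟩
      · simp [code, QProg.run, QConfig.write, QConfig.wait]
      · intro a ha; rw [Function.update_of_ne (by omega)]
      · have := h.1
        simp only [place, eval]
        rw [Function.update_of_ne (by omega), visible_of_lt h.1]
  | rat q, k, hk, h, c => by
      have := Ok.lt h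
      refine ⟨Function.update c.mem k q, ?_, visible_update_scratch hk (by omega), ?_, ?_⟩
      · simp [code, QProg.run, QConfig.write, QConfig.wait]
      · intro a ha; rw [Function.update_of_ne (by omega)]
      · simp [place, eval]
  | pi, k, hk, h, c => by
      have := Ok.lt h
      refine ⟨Function.update c.mem k Real.pi, ?_, visible_update_scratch hk (by omega), ?_, ?_⟩
      · simp [code, QProg.run, QConfig.write, QConfig.wait]
      · intro a ha; rw [Function.update_of_ne (by omega)]
      · simp [place, eval]
  | bin f x y, k, hk, h, c => by
      have hlt := Ok.lt h
      obtain ⟨M₁, h₁, hv₁, hb₁, hp₁⟩ := run_code A U x k hk h.1 c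
      obtain ⟨M₂, h₂, hv₂, hb₂, hp₂⟩ :=
        run_code A U y (k + 1) (by omega) h.2 ⟨M₁, c.state, c.time + x.cost⟩
      refine ⟨Function.update M₂ k (f.eval (x.eval (visible c.mem)) (y.eval (visible c.mem))),
        ?_, ?_, ?_, ?_⟩
      -- The second operand works in the cells from `k + 1` on, so the first value survives, whether
      -- it sits in cell `k` or in a scalar cell.
      · have hx : M₂ (x.place k) = x.eval (visible c.mem) := by
          rw [← hp₁]
          refine hb₂ _ ?_
          cases x <;> simp only [place] <;> first | omega | (have := h.1.1; omega)
        simp only [code, QProg.run, h₁, h₂, List.flatMap_cons, List.flatMap_nil, List.append_nil,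
          QConfig.write, QConfig.wait]
        rw [hx, hp₂]
        simp only [cost, hv₁]
        push_cast
        ring_nf
      · rw [visible_update_scratch hk (by omega), hv₂, hv₁]
      · intro a ha
        rw [Function.update_of_ne (by omega), hb₂ a (by omega)]; exact hb₁ a ha
      · simp [place, eval]

end Ex

/-- `mem d := e` -/
def asg (d : ℕ) (e : Ex) : QProg :=
  -- Adding 0 serves as a copy instruction. Cell 95 is free for the 0, since `Ex.Ok` keeps
  -- expressions below cell 90.
  .seq (e.code 64) (.seq (.const 95 0) (.op .add d (e.place 64) 95))

/-- `mem d := mem e` -/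
def lod (d : ℕ) (e : Ex) : QProg := .seq (e.code 64) (.load d (e.place 64))

/-- `mem e := mem x` -/
def sto (e : Ex) (x : ℕ) : QProg := .seq (e.code 64) (.store (e.place 64) x)

/-- Total correctness with a time bound for programs without measurement that leave the quantum
state alone. -/
def Det (P : QProg) (σ : ℕ → ℝ) (τ : ℝ) (Q : (ℕ → ℝ) → Prop) : Prop :=
  ∀ (n : ℕ) (A : Matrix (Fin n) (Fin n) ℝ) (U : Matrix (Fin n) (Fin n) ℂ) (c : QConfig n),
    visible c.mem = σ → ∃ c', P.run A U c = [c'] ∧ c'.state = c.state ∧ c'.time ≤ c.time + τ ∧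
      Q (visible c'.mem)

theorem Det.mono {P : QProg} {σ : ℕ → ℝ} {τ τ' : ℝ} {Q Q' : (ℕ → ℝ) → Prop}
    (h : Det P σ τ Q) (hτ : τ ≤ τ') (hQ : ∀ σ', Q σ' → Q' σ') : Det P σ τ' Q' := by
  intro n A U c hc
  obtain ⟨c', h₁, h₂, h₃, h₄⟩ := h n A U c hc
  exact ⟨c', h₁, h₂, by linarith, hQ _ h₄⟩

theorem Det.seq {P P' : QProg} {σ : ℕ → ℝ} {τ τ' : ℝ} {Q Q' : (ℕ → ℝ) → Prop}
    (h : Det P σ τ Q) (h' : ∀ σ', Q σ' → Det P' σ' τ' Q') :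
    Det (.seq P P') σ (τ + τ') Q' := by
  intro n A U c hc
  obtain ⟨c', h₁, h₂, h₃, h₄⟩ := h n A U c hc
  obtain ⟨c'', k₁, k₂, k₃, k₄⟩ := h' _ h₄ n A U c' rfl
  exact ⟨c'', by simp [QProg.run, h₁, k₁], by rw [k₂, h₂], by linarith, k₄⟩

theorem det_asg {d : ℕ} {e : Ex} {σ : ℕ → ℝ} (hd : d < 64) (he : e.Ok 64) :
    Det (asg d e) σ (e.cost + 2) (· = Function.update σ d (e.eval σ)) := by
  rintro n A U c rfl
  obtain ⟨M', h, hv, hb, hp⟩ := e.run_code A U 64 le_rfl he c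
  refine ⟨⟨Function.update (Function.update M' 95 0) d (e.eval (visible c.mem)), c.state,
    c.time + e.cost + 1 + 1⟩, ?_, rfl, by simp only; linarith, ?_⟩
  · have hne : e.place 64 ≠ 95 := by
      cases e <;> simp only [Ex.place] <;> first | omega | (have := he.1; omega)
    simp only [asg, QProg.run, h, List.flatMap_cons, List.flatMap_nil, List.append_nil,
      QConfig.write, QConfig.wait, RealOp.eval]
    rw [Function.update_of_ne hne, hp]
    simp
  · simp only
    rw [visible_update (Or.inl hd), visible_update_scratch (by norm_num) (by norm_num), hv]

theorem det_lod {d : ℕ} {e : Ex} {σ : ℕ → ℝ} (hd : d < 64) (he : e.Ok 64) {a : ℕ}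
    (ha : e.eval σ = a) (ha' : 96 ≤ a) :
    Det (lod d e) σ (e.cost + 1) (· = Function.update σ d (σ a)) := by
  rintro n A U c rfl
  obtain ⟨M', h, hv, hb, hp⟩ := e.run_code A U 64 le_rfl he c
  refine ⟨⟨Function.update M' d (visible c.mem a), c.state, c.time + e.cost + 1⟩, ?_, rfl,
    by simp only; linarith, ?_⟩
  · simp only [lod, QProg.run, h, List.flatMap_cons, List.flatMap_nil, List.append_nil,
      QConfig.write, QConfig.wait, QConfig.idx]
    rw [hp, ha, Nat.floor_natCast, ← hv, visible_of_ge ha']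
  · simp only
    rw [visible_update (Or.inl hd), hv]

theorem det_sto {x : ℕ} {e : Ex} {σ : ℕ → ℝ} (hx : x < 64) (he : e.Ok 64) {a : ℕ}
    (ha : e.eval σ = a) (ha' : 96 ≤ a) :
    Det (sto e x) σ (e.cost + 1) (· = Function.update σ a (σ x)) := by
  rintro n A U c rfl
  obtain ⟨M', h, hv, hb, hp⟩ := e.run_code A U 64 le_rfl he c
  refine ⟨⟨Function.update M' a (visible c.mem x), c.state, c.time + e.cost + 1⟩, ?_, rfl,
    by simp only; linarith, ?_⟩
  · simp only [sto, QProg.run, h, List.flatMap_cons, List.flatMap_nil, List.append_nil,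
      QConfig.write, QConfig.wait, QConfig.idx]
    rw [hp, ha, Nat.floor_natCast, hb x hx, ← visible_of_lt (M := c.mem) hx]
  · simp only
    rw [visible_update (Or.inr ha'), hv]

theorem det_ite {x y : ℕ} {P P' : QProg} {σ : ℕ → ℝ} {τ : ℝ} {Q : (ℕ → ℝ) → Prop}
    (hx : x < 64) (hy : y < 64) (h : σ x ≤ σ y → Det P σ τ Q) (h' : σ y < σ x → Det P' σ τ Q) :
    Det (.ite x y P P') σ (τ + 1) Q := by
  rintro n A U c rfl
  rw [visible_of_lt hx, visible_of_lt hy] at h h'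
  by_cases hc : c.mem x ≤ c.mem y
  · obtain ⟨c', h₁, h₂, h₃, h₄⟩ := h hc n A U (c.wait 1) rfl
    refine ⟨c', by simp [QProg.run, hc, h₁], h₂, ?_, h₄⟩
    simp only [QConfig.wait] at h₃; linarith
  · obtain ⟨c', h₁, h₂, h₃, h₄⟩ := h' (not_le.mp hc) n A U (c.wait 1) rfl
    refine ⟨c', by simp [QProg.run, hc, h₁], h₂, ?_, h₄⟩
    simp only [QConfig.wait] at h₃; linarith

/-- The number of rounds is read once on entry, so the body may overwrite cell `x`; the invariant is
indexed by the completed rounds. -/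
theorem det_loop {x : ℕ} {P : QProg} {σ : ℕ → ℝ} {k : ℕ} {τ : ℝ}
    (I : ℕ → (ℕ → ℝ) → Prop) (hx : x < 64) (hk : ⌊σ x⌋₊ = k) (h₀ : I 0 σ)
    (h : ∀ i < k, ∀ σ', I i σ' → Det P σ' τ (I (i + 1))) :
    Det (.loop x P) σ (1 + k * (τ + 1)) (I k) := by
  rintro n A U c rfl
  rw [visible_of_lt hx] at hk
  have key : ∀ i ≤ k, ∃ c', (fun L : List (QConfig n) =>
      L.flatMap fun c' => P.run A U (c'.wait 1))^[i] [c.wait 1] = [c'] ∧ c'.state = c.state ∧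
      c'.time ≤ c.time + (1 + i * (τ + 1)) ∧ I i (visible c'.mem) := by
    intro i
    induction i with
    | zero => exact fun _ => ⟨c.wait 1, by simp, rfl, by simp [QConfig.wait], h₀⟩
    | succ i ih =>
      intro hi
      obtain ⟨c', h₁, h₂, h₃, h₄⟩ := ih (by omega)
      obtain ⟨c'', k₁, k₂, k₃, k₄⟩ := h i (by omega) _ h₄ n A U (c'.wait 1) rfl
      refine ⟨c'', ?_, k₂.trans h₂, ?_, k₄⟩
      · rw [Function.iterate_succ_apply', h₁]; simp [k₁]
      · simp only [QConfig.wait] at k₃; push_cast; linarith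
  obtain ⟨c', h₁, h₂, h₃, h₄⟩ := key k le_rfl
  refine ⟨c', ?_, h₂, h₃, h₄⟩
  simp only [QProg.run, QConfig.idx, hk]
  exact h₁

theorem sum_flatMap' {α : Type*} (L : List α) (f : α → List ℝ) :
    (L.flatMap f).sum = (L.map fun a => (f a).sum).sum := by
  induction L with
  | nil => rfl
  | cons a L ih => simp [ih]

/-- The state between two estimations: qubit `0` is 1, everything else is 0. -/
def baseState (n : ℕ) : Finset ℕ → Fin n → ℂ := fun s i => if s = {0} ∧ (i : ℕ) = 0 then 1 else 0

/-! ### Expectation bounds for programs with measurements -/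

section Wp

variable {n : ℕ} (A : Matrix (Fin n) (Fin n) ℝ) (U : Matrix (Fin n) (Fin n) ℂ)

/-- Started with memory `σ` and base state, all branches of `P` end in the base state after time
at most `τ` with `Q`, no probability is lost, and the expectation of `F` is at most `v`. -/
def Wp (P : QProg) (σ : ℕ → ℝ) (τ : ℝ) (Q : (ℕ → ℝ) → Prop) (F : (ℕ → ℝ) → ℝ) (v : ℝ) : Prop :=
  ∀ (c : QConfig n) (a : ℂ), visible c.mem = σ → c.state = a • baseState n →
    (∀ c' ∈ P.run A U c, (∃ a' : ℂ, c'.state = a' • baseState n) ∧ c'.time ≤ c.time + τ ∧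
      Q (visible c'.mem)) ∧
    ((P.run A U c).map QConfig.prob).sum = c.prob ∧
    ((P.run A U c).map fun c' => c'.prob * F (visible c'.mem)).sum ≤ v * c.prob

theorem QConfig.prob_nonneg (c : QConfig n) : 0 ≤ c.prob :=
  finsum_nonneg fun _ => Finset.sum_nonneg fun _ _ => by positivity

variable {A U} {P P' : QProg} {σ : ℕ → ℝ} {τ τ' : ℝ} {Q Q' : (ℕ → ℝ) → Prop}
  {F G : (ℕ → ℝ) → ℝ} {v v' : ℝ}

theorem Wp.mono (h : Wp A U P σ τ Q F v) (hτ : τ ≤ τ') (hQ : ∀ σ', Q σ' → Q' σ')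
    (hF : ∀ σ', Q σ' → G σ' ≤ F σ') (hv : v ≤ v') : Wp A U P σ τ' Q' G v' := by
  intro c a hc hs
  obtain ⟨h₁, h₂, h₃⟩ := h c a hc hs
  refine ⟨fun c' hc' => ⟨(h₁ c' hc').1, by linarith [(h₁ c' hc').2.1], hQ _ (h₁ c' hc').2.2⟩,
    h₂, ?_⟩
  refine (List.sum_le_sum fun c' hc' => ?_).trans
    (h₃.trans (mul_le_mul_of_nonneg_right hv c.prob_nonneg))
  exact mul_le_mul_of_nonneg_left (hF _ (h₁ c' hc').2.2) c'.prob_nonneg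

/-- No probability is lost, so a bound that holds on every final memory also bounds the expectation.
-/
theorem Wp.of_bound (h : Wp A U P σ τ Q F v) (hF : ∀ σ', Q σ' → G σ' ≤ v') :
    Wp A U P σ τ Q G v' := by
  intro c a hc hs
  obtain ⟨h₁, h₂, h₃⟩ := h c a hc hs
  refine ⟨h₁, h₂, ?_⟩
  rw [← h₂, ← List.sum_map_mul_left]
  refine List.sum_le_sum fun c' hc' => ?_
  rw [mul_comm]
  exact mul_le_mul_of_nonneg_right (hF _ (h₁ c' hc').2.2) c'.prob_nonneg

theorem Det.wp (h : Det P σ τ Q) (hF : ∀ σ', Q σ' → F σ' ≤ v) : Wp A U P σ τ Q F v := by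
  intro c a hc hs
  obtain ⟨c', h₁, h₂, h₃, h₄⟩ := h n A U c hc
  have hp : c'.prob = c.prob := by simp [QConfig.prob, h₂]
  refine ⟨?_, by simp [h₁, hp], ?_⟩
  · rw [h₁]; intro c'' hc''
    rw [List.mem_singleton] at hc''
    subst hc''
    exact ⟨⟨a, h₂.trans hs⟩, h₃, h₄⟩
  · simp only [h₁, List.map_cons, List.map_nil, List.sum_cons, List.sum_nil, hp, add_zero]
    rw [mul_comm]
    exact mul_le_mul_of_nonneg_right (hF _ h₄) c.prob_nonneg

/-- The expectation is taken in stages: `G` is the value that the second program guarantees, as a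
function of the memory in which it starts. The common base state lets the second judgement apply to
every branch of the first program. -/
theorem Wp.seq (h : Wp A U P σ τ Q G v) (h' : ∀ σ', Q σ' → Wp A U P' σ' τ' Q' F (G σ')) :
    Wp A U (.seq P P') σ (τ + τ') Q' F v := by
  intro c a hc hs
  obtain ⟨h₁, h₂, h₃⟩ := h c a hc hs
  simp only [QProg.run]
  refine ⟨?_, ?_, ?_⟩
  · intro c'' hc''
    obtain ⟨c', hc', hc''⟩ := List.mem_flatMap.mp hc''
    obtain ⟨⟨a', ha'⟩, ht, hQ⟩ := h₁ c' hc'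
    obtain ⟨k₁, k₂, k₃⟩ := h' _ hQ c' a' rfl ha'
    exact ⟨(k₁ _ hc'').1, by linarith [(k₁ _ hc'').2.1], (k₁ _ hc'').2.2⟩
  · rw [List.map_flatMap, sum_flatMap', ← h₂]
    congr 1
    refine List.map_congr_left fun c' hc' => ?_
    obtain ⟨⟨a', ha'⟩, ht, hQ⟩ := h₁ c' hc'
    exact (h' _ hQ c' a' rfl ha').2.1
  · rw [List.map_flatMap, sum_flatMap']
    refine (List.sum_le_sum fun c' hc' => ?_).trans h₃
    obtain ⟨⟨a', ha'⟩, ht, hQ⟩ := h₁ c' hc'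
    rw [mul_comm]
    exact (h' _ hQ c' a' rfl ha').2.2

theorem wp_ite {x y : ℕ} (hx : x < 64) (hy : y < 64) (h : σ x ≤ σ y → Wp A U P σ τ Q F v)
    (h' : σ y < σ x → Wp A U P' σ τ Q F v) : Wp A U (.ite x y P P') σ (τ + 1) Q F v := by
  rintro c a rfl hs
  rw [visible_of_lt hx, visible_of_lt hy] at h h'
  simp only [QProg.run]
  have hp : (c.wait 1).prob = c.prob := rfl
  by_cases hc : c.mem x ≤ c.mem y
  · obtain ⟨h₁, h₂, h₃⟩ := h hc (c.wait 1) a rfl hs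
    rw [if_pos hc]
    rw [hp] at h₂ h₃
    refine ⟨fun c' hc' => ⟨(h₁ c' hc').1, ?_, (h₁ c' hc').2.2⟩, h₂, h₃⟩
    have := (h₁ c' hc').2.1
    simp only [QConfig.wait] at this; linarith
  · obtain ⟨h₁, h₂, h₃⟩ := h' (not_le.mp hc) (c.wait 1) a rfl hs
    rw [if_neg hc]
    rw [hp] at h₂ h₃
    refine ⟨fun c' hc' => ⟨(h₁ c' hc').1, ?_, (h₁ c' hc').2.2⟩, h₂, h₃⟩
    have := (h₁ c' hc').2.1
    simp only [QConfig.wait] at this; linarith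

/-- `F i` is a potential whose expectation does not increase from round to round, so its initial
value bounds the final expectation. The time may vary with the round, which the geometric costs of
the phase estimation need. -/
theorem wp_loop {x k : ℕ} (I : ℕ → (ℕ → ℝ) → Prop) (F : ℕ → (ℕ → ℝ) → ℝ) (τ : ℕ → ℝ)
    (hx : x < 64) (hk : ⌊σ x⌋₊ = k) (h₀ : I 0 σ)
    (h : ∀ i < k, ∀ σ', I i σ' → Wp A U P σ' (τ i) (I (i + 1)) (F (i + 1)) (F i σ')) :
    Wp A U (.loop x P) σ (1 + ∑ i ∈ Finset.range k, (τ i + 1)) (I k) (F k) (F 0 σ) := by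
  rintro c a rfl hs
  rw [visible_of_lt hx] at hk
  simp only [QProg.run, QConfig.idx, hk]
  have key : ∀ i ≤ k, (∀ c' ∈ (fun L : List (QConfig n) =>
      L.flatMap fun c' => P.run A U (c'.wait 1))^[i] [c.wait 1],
        (∃ a' : ℂ, c'.state = a' • baseState n) ∧
        c'.time ≤ c.time + (1 + ∑ i ∈ Finset.range i, (τ i + 1)) ∧ I i (visible c'.mem)) ∧
      (((fun L : List (QConfig n) =>
        L.flatMap fun c' => P.run A U (c'.wait 1))^[i] [c.wait 1]).map QConfig.prob).sum = c.prob ∧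
      (((fun L : List (QConfig n) =>
        L.flatMap fun c' => P.run A U (c'.wait 1))^[i] [c.wait 1]).map
          fun c' => c'.prob * F i (visible c'.mem)).sum ≤ F 0 (visible c.mem) * c.prob := by
    intro i
    induction i with
    | zero =>
      intro _
      refine ⟨?_, by simp; rfl, ?_⟩
      · intro c' hc'
        simp only [Function.iterate_zero, id, List.mem_singleton] at hc'
        subst hc'
        exact ⟨⟨a, hs⟩, by simp [QConfig.wait], h₀⟩
      · simp [QConfig.wait, QConfig.prob, mul_comm]
    | succ i ih =>
      intro hi
      obtain ⟨h₁, h₂, h₃⟩ := ih (by omega)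
      rw [Function.iterate_succ_apply']
      set L := (fun L : List (QConfig n) => L.flatMap fun c' => P.run A U (c'.wait 1))^[i] [c.wait 1]
      refine ⟨?_, ?_, ?_⟩
      · intro c'' hc''
        obtain ⟨c', hc', hc''⟩ := List.mem_flatMap.mp hc''
        obtain ⟨⟨a', ha'⟩, ht, hQ⟩ := h₁ c' hc'
        obtain ⟨k₁, k₂, k₃⟩ := h i (by omega) _ hQ (c'.wait 1) a' rfl ha'
        refine ⟨(k₁ _ hc'').1, ?_, (k₁ _ hc'').2.2⟩
        have := (k₁ _ hc'').2.1
        simp only [QConfig.wait] at this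
        rw [Finset.sum_range_succ]; linarith
      · rw [List.map_flatMap, sum_flatMap', ← h₂]
        congr 1
        refine List.map_congr_left fun c' hc' => ?_
        obtain ⟨⟨a', ha'⟩, ht, hQ⟩ := h₁ c' hc'
        exact (h i (by omega) _ hQ (c'.wait 1) a' rfl ha').2.1
      · rw [List.map_flatMap, sum_flatMap']
        refine (List.sum_le_sum fun c' hc' => ?_).trans h₃
        obtain ⟨⟨a', ha'⟩, ht, hQ⟩ := h₁ c' hc'
        rw [mul_comm]
        exact (h i (by omega) _ hQ (c'.wait 1) a' rfl ha').2.2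
  exact key k le_rfl

end Wp

end

noncomputable section

/-! ### Gates on the states of the data register and the qubits 1 and 2 -/

section Gates

variable {n : ℕ}

/-- Qubit `0` is set, and no qubit above `2` is. -/
def LowSet (s : Finset ℕ) : Prop := 0 ∈ s ∧ ∀ a ∈ s, a ≤ 2

open Classical in
/-- The state with amplitudes `w a b i`, where `a` and `b` are the values of the qubits 1 and 2 and
`i` is that of the data register; qubit 0 is 1. -/
def lowState (w : Bool → Bool → Fin n → ℂ) : Finset ℕ → Fin n → ℂ :=
  fun s => if LowSet s then w (decide (1 ∈ s)) (decide (2 ∈ s)) else 0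

theorem lowSet_erase {s : Finset ℕ} {q : ℕ} (h : 1 ≤ q) (h' : q ≤ 2) :
    LowSet (s.erase q) ↔ LowSet s := by
  unfold LowSet
  refine and_congr ?_ ⟨fun hs a ha => ?_, fun hs a ha => hs a (Finset.mem_of_mem_erase ha)⟩
  · rw [Finset.mem_erase]; exact and_iff_right (by omega)
  · by_cases haq : a = q
    · omega
    · exact hs a (Finset.mem_erase.2 ⟨haq, ha⟩)

theorem lowSet_insert {s : Finset ℕ} {q : ℕ} (h : 1 ≤ q) (h' : q ≤ 2) :
    LowSet (insert q s) ↔ LowSet s := by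
  rw [← lowSet_erase h h', Finset.erase_insert_eq_erase, lowSet_erase h h']

theorem lowSet_symmDiff {s : Finset ℕ} {q : ℕ} (h : 1 ≤ q) (h' : q ≤ 2) :
    LowSet (symmDiff s {q}) ↔ LowSet s := by
  rw [← lowSet_erase h h', ← lowSet_erase (s := s) h h']
  congr! 1
  ext a
  simp only [Finset.mem_erase, Finset.mem_symmDiff, Finset.mem_singleton]
  tauto

theorem hadGate_lowState_one (w : Bool → Bool → Fin n → ℂ) :
    hadGate 1 (lowState w) = lowState fun a b =>
      ((Real.sqrt 2 : ℝ) : ℂ)⁻¹ • (w false b + (if a then (-1 : ℂ) else 1) • w true b) := by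
  funext s
  have e1 := lowSet_erase (s := s) (q := 1) (by norm_num) (by norm_num)
  have e2 := lowSet_insert (s := s) (q := 1) (by norm_num) (by norm_num)
  by_cases h : LowSet s
  · by_cases h1 : 1 ∈ s <;> simp [hadGate, lowState, h, e1.2 h, e2.2 h, h1]
  · simp [hadGate, lowState, h, mt e1.1 h, mt e2.1 h]

theorem hadGate_lowState_two (w : Bool → Bool → Fin n → ℂ) :
    hadGate 2 (lowState w) = lowState fun a b =>
      ((Real.sqrt 2 : ℝ) : ℂ)⁻¹ • (w a false + (if b then (-1 : ℂ) else 1) • w a true) := by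
  funext s
  have e1 := lowSet_erase (s := s) (q := 2) (by norm_num) (by norm_num)
  have e2 := lowSet_insert (s := s) (q := 2) (by norm_num) (by norm_num)
  by_cases h : LowSet s
  · by_cases h1 : 2 ∈ s <;> simp [hadGate, lowState, h, e1.2 h, e2.2 h, h1]
  · simp [hadGate, lowState, h, mt e1.1 h, mt e2.1 h]

theorem phaseGate_lowState_one (θ : ℝ) (w : Bool → Bool → Fin n → ℂ) :
    phaseGate 1 θ (lowState w) = lowState fun a b =>
      (if a then Complex.exp (θ * Complex.I) else 1) • w a b := by
  funext s
  simp only [phaseGate, lowState]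
  split_ifs <;> simp_all

theorem phaseGate_lowState_two (θ : ℝ) (w : Bool → Bool → Fin n → ℂ) :
    phaseGate 2 θ (lowState w) = lowState fun a b =>
      (if b then Complex.exp (θ * Complex.I) else 1) • w a b := by
  funext s
  simp only [phaseGate, lowState]
  split_ifs <;> simp_all

theorem controlledGate_lowState_zero (M : Matrix (Fin n) (Fin n) ℂ)
    (w : Bool → Bool → Fin n → ℂ) :
    controlledGate 0 M (lowState w) = lowState fun a b => M *ᵥ w a b := by
  funext s
  simp only [controlledGate, lowState]
  by_cases h : LowSet s
  · simp [h, h.1]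
  · simp [h]

theorem controlledGate_lowState_one (M : Matrix (Fin n) (Fin n) ℂ)
    (w : Bool → Bool → Fin n → ℂ) :
    controlledGate 1 M (lowState w) = lowState fun a b => if a then M *ᵥ w a b else w a b := by
  funext s
  simp only [controlledGate, lowState]
  split_ifs <;> simp_all

theorem flipZeroGate_lowState_one (w : Bool → Bool → Fin n → ℂ) :
    flipZeroGate 1 (lowState w) = lowState fun a b i =>
      if (i : ℕ) = 0 then w (!a) b i else w a b i := by
  funext s i
  have e1 := lowSet_symmDiff (s := s) (q := 1) (by norm_num) (by norm_num)
  by_cases h : LowSet s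
  · simp [flipZeroGate, lowState, h, e1.2 h, Finset.mem_symmDiff]
  · simp [flipZeroGate, lowState, h, mt e1.1 h]

theorem flipZeroGate_lowState_two (w : Bool → Bool → Fin n → ℂ) :
    flipZeroGate 2 (lowState w) = lowState fun a b i =>
      if (i : ℕ) = 0 then w a (!b) i else w a b i := by
  funext s i
  have e1 := lowSet_symmDiff (s := s) (q := 2) (by norm_num) (by norm_num)
  by_cases h : LowSet s
  · simp [flipZeroGate, lowState, h, e1.2 h, Finset.mem_symmDiff]
  · simp [flipZeroGate, lowState, h, mt e1.1 h]

theorem projectQubit_lowState_one (v : Bool) (w : Bool → Bool → Fin n → ℂ) :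
    projectQubit 1 v (lowState w) = lowState fun a b => if a = v then w a b else 0 := by
  funext s
  simp only [projectQubit, lowState]
  split_ifs <;> simp_all

theorem projectQubit_lowState_two (v : Bool) (w : Bool → Bool → Fin n → ℂ) :
    projectQubit 2 v (lowState w) = lowState fun a b => if b = v then w a b else 0 := by
  funext s
  simp only [projectQubit, lowState]
  split_ifs <;> simp_all

theorem lowSet_only_zero {s : Finset ℕ} (h : LowSet s) (h1 : 1 ∉ s) (h2 : 2 ∉ s) : s = {0} := by
  ext a
  rw [Finset.mem_singleton]
  refine ⟨fun ha => ?_, fun ha => ha ▸ h.1⟩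
  have := h.2 a ha
  interval_cases a <;> simp_all

/-- With both work qubits back at 0, the reset keeps only the scalar `g j` of the old state. Every
branch of an experiment is therefore a multiple of the base state, as `Wp` demands. -/
theorem resetTo_lowState (j : Fin n) (g : Fin n → ℂ) :
    resetTo j (lowState fun a b => if a = false ∧ b = false then g else 0) =
      g j • baseState n := by
  funext s i
  simp only [resetTo, lowState, baseState, Pi.smul_apply]
  by_cases hs : s = {0}
  · subst hs
    have : LowSet {0} := ⟨by simp, by simp⟩
    simp [this]
  · by_cases h : LowSet s
    · by_cases h1 : 1 ∈ s
      · simp [h, h1, hs]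
      · by_cases h2 : 2 ∈ s
        · simp [h, h1, h2, hs]
        · exact absurd (lowSet_only_zero h h1 h2) hs
    · simp [h, hs]

theorem smul_baseState_eq (x : ℂ) :
    x • baseState n = lowState fun a b i =>
      if a = false ∧ b = false ∧ (i : ℕ) = 0 then x else 0 := by
  funext s i
  simp only [lowState, baseState, Pi.smul_apply]
  by_cases hs : s = {0}
  · subst hs
    have : LowSet {0} := ⟨by simp, by simp⟩
    simp [this]
  · by_cases h : LowSet s
    · by_cases h1 : 1 ∈ s
      · simp [h, h1, hs]
      · by_cases h2 : 2 ∈ s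
        · simp [h, h1, h2, hs]
        · exact absurd (lowSet_only_zero h h1 h2) hs
    · simp [h, hs]

theorem prob_baseState (hn : 0 < n) (x : ℂ) (M : ℕ → ℝ) (t : ℝ) :
    (⟨M, x • baseState n, t⟩ : QConfig n).prob = ‖x‖ ^ 2 := by
  unfold QConfig.prob
  rw [finsum_eq_single _ ({0} : Finset ℕ)]
  · simp only [Pi.smul_apply, baseState, true_and]
    rw [Finset.sum_eq_single ⟨0, hn⟩]
    · simp
    · intro i _ hi
      have : (i : ℕ) ≠ 0 := fun h => hi (Fin.ext h)
      simp [this]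
    · simp
  · intro s hs
    simp [baseState, hs]

/-- Undoing a measured bit: `H Z^v H` on the second qubit. -/
theorem had_phase_had_two (xf : Bool) (θ : ℝ) (hθ : θ = Real.pi * (if xf then 1 else 0))
    (g : Bool → Fin n → ℂ) :
    hadGate 2 (phaseGate 2 θ (hadGate 2 (lowState fun a b => if b = xf then g a else 0))) =
      lowState fun a b => if b = false then g a else 0 := by
  rw [hadGate_lowState_two, phaseGate_lowState_two, hadGate_lowState_two]
  congr 1
  funext a b
  have h2 : ((Real.sqrt 2 : ℝ) : ℂ)⁻¹ * ((Real.sqrt 2 : ℝ) : ℂ)⁻¹ = 1 / 2 := by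
    rw [← mul_inv, ← Complex.ofReal_mul, Real.mul_self_sqrt (by norm_num)]; norm_num
  subst hθ
  funext i
  cases xf <;> cases b <;> simp [Complex.exp_pi_mul_I] <;>
    linear_combination (2 * g a i) * h2

theorem had_phase_had_one (xq : Bool) (θ : ℝ) (hθ : θ = Real.pi * (if xq then 1 else 0))
    (g : Bool → Fin n → ℂ) :
    hadGate 1 (phaseGate 1 θ (hadGate 1 (lowState fun a b => if a = xq then g b else 0))) =
      lowState fun a b => if a = false then g b else 0 := by
  rw [hadGate_lowState_one, phaseGate_lowState_one, hadGate_lowState_one]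
  congr 1
  funext a b
  have h2 : ((Real.sqrt 2 : ℝ) : ℂ)⁻¹ * ((Real.sqrt 2 : ℝ) : ℂ)⁻¹ = 1 / 2 := by
    rw [← mul_inv, ← Complex.ofReal_mul, Real.mul_self_sqrt (by norm_num)]; norm_num
  subst hθ
  funext i
  cases xq <;> cases a <;> simp [Complex.exp_pi_mul_I] <;>
    linear_combination (2 * g b i) * h2

end Gates

/-! ### The walk as a linear operator -/

section Walk

variable {n : ℕ}

/-- Hadamard on qubit 1. -/
def hadU (u : Bool → Fin n → ℂ) : Bool → Fin n → ℂ := fun a =>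
  ((Real.sqrt 2 : ℝ) : ℂ)⁻¹ • (u false + (if a then (-1 : ℂ) else 1) • u true)

/-- Phase on qubit 1. -/
def phaseU (θ : ℝ) (u : Bool → Fin n → ℂ) : Bool → Fin n → ℂ := fun a =>
  (if a then Complex.exp (θ * Complex.I) else 1) • u a

/-- Matrix on the data register controlled by qubit 1. -/
def ctrlU (M : Matrix (Fin n) (Fin n) ℂ) (u : Bool → Fin n → ℂ) : Bool → Fin n → ℂ := fun a =>
  if a then M *ᵥ u a else u a

/-- Matrix on the data register. -/
def dataU (M : Matrix (Fin n) (Fin n) ℂ) (u : Bool → Fin n → ℂ) : Bool → Fin n → ℂ := fun a =>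
  M *ᵥ u a

/-- Flip qubit 1 if the data register is in the state `|0⟩`. -/
def flipU (u : Bool → Fin n → ℂ) : Bool → Fin n → ℂ := fun a i =>
  if (i : ℕ) = 0 then u (!a) i else u a i

/-- The state with qubit 2 equal to 0. -/
def liftState (u : Bool → Fin n → ℂ) : Finset ℕ → Fin n → ℂ :=
  lowState fun a b => if b = false then u a else 0

theorem hadGate_lift (u : Bool → Fin n → ℂ) : hadGate 1 (liftState u) = liftState (hadU u) := by
  rw [liftState, hadGate_lowState_one]; unfold liftState hadU
  congr 1; funext a b; cases b <;> simp

theorem phaseGate_lift (θ : ℝ) (u : Bool → Fin n → ℂ) :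
    phaseGate 1 θ (liftState u) = liftState (phaseU θ u) := by
  rw [liftState, phaseGate_lowState_one]; unfold liftState phaseU
  congr 1; funext a b; cases b <;> simp

theorem controlledGate_lift (M : Matrix (Fin n) (Fin n) ℂ) (u : Bool → Fin n → ℂ) :
    controlledGate 1 M (liftState u) = liftState (ctrlU M u) := by
  rw [liftState, controlledGate_lowState_one]; unfold liftState ctrlU
  congr 1; funext a b; cases b <;> simp

theorem controlledGate_lift_zero (M : Matrix (Fin n) (Fin n) ℂ) (u : Bool → Fin n → ℂ) :
    controlledGate 0 M (liftState u) = liftState (dataU M u) := by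
  rw [liftState, controlledGate_lowState_zero]; unfold liftState dataU
  congr 1; funext a b; cases b <;> simp

theorem flipZeroGate_lift (u : Bool → Fin n → ℂ) :
    flipZeroGate 1 (liftState u) = liftState (flipU u) := by
  rw [liftState, flipZeroGate_lowState_one]; unfold liftState flipU
  congr 1; funext a b i; cases b <;> simp

/-- The squared norm. -/
def sqNorm (u : Bool → Fin n → ℂ) : ℝ := ∑ i, (‖u false i‖ ^ 2 + ‖u true i‖ ^ 2)

theorem inv_sqrt_two_mul_self :
    ((Real.sqrt 2 : ℝ) : ℂ)⁻¹ * ((Real.sqrt 2 : ℝ) : ℂ)⁻¹ = 1 / 2 := by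
  rw [← mul_inv, ← Complex.ofReal_mul, Real.mul_self_sqrt (by norm_num)]; norm_num

theorem sqNorm_hadU (u : Bool → Fin n → ℂ) : sqNorm (hadU u) = sqNorm u := by
  unfold sqNorm hadU
  refine Finset.sum_congr rfl fun i _ => ?_
  have h := parallelogram_law_with_norm ℝ (u false i) (u true i)
  have h2 : ‖((Real.sqrt 2 : ℝ) : ℂ)⁻¹‖ ^ 2 = 1 / 2 := by
    rw [norm_inv, Complex.norm_real, inv_pow, Real.norm_eq_abs, sq_abs, Real.sq_sqrt (by norm_num)]
    norm_num
  simp only [Pi.smul_apply, Pi.add_apply, smul_eq_mul, norm_mul, mul_pow, h2]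
  simp only [Bool.false_eq_true, if_false, if_true, one_mul, neg_one_mul, ← sub_eq_add_neg]
  nlinarith

theorem sqNorm_phaseU (θ : ℝ) (u : Bool → Fin n → ℂ) : sqNorm (phaseU θ u) = sqNorm u := by
  unfold sqNorm phaseU
  simp [Complex.norm_exp_ofReal_mul_I]

theorem sum_norm_sq_mulVec {M : Matrix (Fin n) (Fin n) ℂ} (hM : Mᴴ * M = 1) (x : Fin n → ℂ) :
    ∑ i, ‖(M *ᵥ x) i‖ ^ 2 = ∑ i, ‖x i‖ ^ 2 := by
  have key : ∀ y : Fin n → ℂ, ((∑ i, ‖y i‖ ^ 2 : ℝ) : ℂ) = star y ⬝ᵥ y := by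
    intro y
    rw [dotProduct, Complex.ofReal_sum]
    refine Finset.sum_congr rfl fun i _ => ?_
    rw [Pi.star_apply, RCLike.star_def, Complex.conj_mul']
    push_cast; rfl
  have : ((∑ i, ‖(M *ᵥ x) i‖ ^ 2 : ℝ) : ℂ) = ((∑ i, ‖x i‖ ^ 2 : ℝ) : ℂ) := by
    rw [key, key, star_mulVec, dotProduct_mulVec, vecMul_vecMul, hM, vecMul_one]
  exact_mod_cast this

theorem sqNorm_dataU {M : Matrix (Fin n) (Fin n) ℂ} (hM : Mᴴ * M = 1) (u : Bool → Fin n → ℂ) :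
    sqNorm (dataU M u) = sqNorm u := by
  unfold sqNorm dataU
  rw [Finset.sum_add_distrib, Finset.sum_add_distrib, sum_norm_sq_mulVec hM, sum_norm_sq_mulVec hM]

theorem sqNorm_ctrlU {M : Matrix (Fin n) (Fin n) ℂ} (hM : Mᴴ * M = 1) (u : Bool → Fin n → ℂ) :
    sqNorm (ctrlU M u) = sqNorm u := by
  unfold sqNorm ctrlU
  simp only [Bool.false_eq_true, if_false, if_true]
  rw [Finset.sum_add_distrib, Finset.sum_add_distrib, sum_norm_sq_mulVec hM]

theorem sqNorm_flipU (u : Bool → Fin n → ℂ) : sqNorm (flipU u) = sqNorm u := by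
  unfold sqNorm flipU
  refine Finset.sum_congr rfl fun i _ => ?_
  split_ifs
  · simp [add_comm]
  · rfl

theorem hadU_hadU (u : Bool → Fin n → ℂ) : hadU (hadU u) = u := by
  funext a i
  have h2 := inv_sqrt_two_mul_self
  cases a <;> simp [hadU]
  · linear_combination (2 * u false i) * h2
  · linear_combination (2 * u true i) * h2

theorem phaseU_phaseU_neg (θ : ℝ) (u : Bool → Fin n → ℂ) : phaseU θ (phaseU (-θ) u) = u := by
  funext a i
  cases a
  · simp [phaseU]
  · simp only [phaseU, if_true, Pi.smul_apply, smul_eq_mul, ← mul_assoc, ← Complex.exp_add]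
    simp

theorem phaseU_neg_phaseU (θ : ℝ) (u : Bool → Fin n → ℂ) : phaseU (-θ) (phaseU θ u) = u := by
  have := phaseU_phaseU_neg (-θ) u
  rwa [neg_neg] at this

theorem dataU_dataU {M M' : Matrix (Fin n) (Fin n) ℂ} (h : M * M' = 1) (u : Bool → Fin n → ℂ) :
    dataU M (dataU M' u) = u := by
  funext a; simp [dataU, h]

theorem ctrlU_ctrlU {M M' : Matrix (Fin n) (Fin n) ℂ} (h : M * M' = 1) (u : Bool → Fin n → ℂ) :
    ctrlU M (ctrlU M' u) = u := by
  funext a; cases a <;> simp [ctrlU, h]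

variable (U V : Matrix (Fin n) (Fin n) ℂ) (ω α : ℝ)

/-- The reflection that encodes the matrix element of `V`. -/
def reflU (u : Bool → Fin n → ℂ) : Bool → Fin n → ℂ :=
  dataU Uᴴ (phaseU (-ω) (hadU (phaseU α (ctrlU V (hadU (ctrlU Vᴴ (phaseU (-α) (hadU (phaseU ω
    (dataU U u))))))))))

/-- One step of the walk. -/
def walkU (u : Bool → Fin n → ℂ) : Bool → Fin n → ℂ := flipU (reflU U V ω α u)

/-- The state `|−⟩|0⟩`. -/
def minusZero : Bool → Fin n → ℂ := fun a i =>
  if (i : ℕ) = 0 then (if a then -1 else 1) * ((Real.sqrt 2 : ℝ) : ℂ)⁻¹ else 0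

/-- The component in the direction of `|−⟩|0⟩`. -/
def minusAmp (hn : 0 < n) (u : Bool → Fin n → ℂ) : ℂ :=
  ((Real.sqrt 2 : ℝ) : ℂ)⁻¹ * (u false ⟨0, hn⟩ - u true ⟨0, hn⟩)

variable {U V ω α}

theorem sqNorm_walkU (hU : U ∈ Matrix.unitaryGroup (Fin n) ℂ)
    (hV : V ∈ Matrix.unitaryGroup (Fin n) ℂ) (u : Bool → Fin n → ℂ) :
    sqNorm (walkU U V ω α u) = sqNorm u := by
  have h1 : Uᴴ * U = 1 := Matrix.mem_unitaryGroup_iff'.1 hU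
  have h2 : U * Uᴴ = 1 := Matrix.mem_unitaryGroup_iff.1 hU
  have h3 : Vᴴ * V = 1 := Matrix.mem_unitaryGroup_iff'.1 hV
  have h4 : V * Vᴴ = 1 := Matrix.mem_unitaryGroup_iff.1 hV
  rw [walkU, reflU, sqNorm_flipU, sqNorm_dataU (by rwa [conjTranspose_conjTranspose]),
    sqNorm_phaseU, sqNorm_hadU, sqNorm_phaseU, sqNorm_ctrlU h3, sqNorm_hadU,
    sqNorm_ctrlU (by rwa [conjTranspose_conjTranspose]), sqNorm_phaseU, sqNorm_hadU, sqNorm_phaseU,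
    sqNorm_dataU h1]

/-- The gates form the conjugate of one Hadamard gate by the product of the gates that precede it,
and the Hadamard gate is an involution. -/
theorem reflU_reflU (hU : U ∈ Matrix.unitaryGroup (Fin n) ℂ)
    (hV : V ∈ Matrix.unitaryGroup (Fin n) ℂ) (u : Bool → Fin n → ℂ) :
    reflU U V ω α (reflU U V ω α u) = u := by
  have h1 : Uᴴ * U = 1 := Matrix.mem_unitaryGroup_iff'.1 hU
  have h2 : U * Uᴴ = 1 := Matrix.mem_unitaryGroup_iff.1 hU
  have h3 : Vᴴ * V = 1 := Matrix.mem_unitaryGroup_iff'.1 hV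
  have h4 : V * Vᴴ = 1 := Matrix.mem_unitaryGroup_iff.1 hV
  simp only [reflU]
  rw [dataU_dataU h2, phaseU_phaseU_neg, hadU_hadU, phaseU_neg_phaseU, ctrlU_ctrlU h3, hadU_hadU,
    ctrlU_ctrlU h4, phaseU_phaseU_neg, hadU_hadU, phaseU_neg_phaseU, dataU_dataU h1]

theorem walkU_add_smul (x y : ℂ) (u v : Bool → Fin n → ℂ) :
    walkU U V ω α (x • u + y • v) = x • walkU U V ω α u + y • walkU U V ω α v := by
  have hh : ∀ u v : Bool → Fin n → ℂ, hadU (x • u + y • v) = x • hadU u + y • hadU v := by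
    intro u v; funext a i; cases a <;> (simp [hadU]; ring)
  have hp : ∀ (θ : ℝ) (u v : Bool → Fin n → ℂ),
      phaseU θ (x • u + y • v) = x • phaseU θ u + y • phaseU θ v := by
    intro θ u v; funext a i; cases a
    · simp [phaseU]
    · simp [phaseU]; ring
  have hd : ∀ (M : Matrix (Fin n) (Fin n) ℂ) (u v : Bool → Fin n → ℂ),
      dataU M (x • u + y • v) = x • dataU M u + y • dataU M v := by
    intro M u v; funext a; simp [dataU, mulVec_add, mulVec_smul]
  have hc : ∀ (M : Matrix (Fin n) (Fin n) ℂ) (u v : Bool → Fin n → ℂ),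
      ctrlU M (x • u + y • v) = x • ctrlU M u + y • ctrlU M v := by
    intro M u v; funext a; cases a <;> simp [ctrlU, mulVec_add, mulVec_smul]
  have hf : ∀ u v : Bool → Fin n → ℂ, flipU (x • u + y • v) = x • flipU u + y • flipU v := by
    intro u v; funext a i; simp only [flipU, Pi.add_apply, Pi.smul_apply]; split_ifs <;> rfl
  simp only [walkU, reflU, hh, hp, hd, hc, hf]

/-- At the basis state `|0⟩` the flip exchanges the two amplitudes: it fixes `|+⟩|0⟩` and negates
`|−⟩|0⟩`. Elsewhere it does nothing, so it is the reflection along this one vector. -/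
theorem flipU_eq (hn : 0 < n) (u : Bool → Fin n → ℂ) :
    flipU u = u - (2 * minusAmp hn u) • minusZero := by
  have h2 := inv_sqrt_two_mul_self
  funext a i
  simp only [flipU, minusAmp, minusZero, Pi.sub_apply, Pi.smul_apply, smul_eq_mul]
  split_ifs with hi ha
  · have : i = ⟨0, hn⟩ := Fin.ext hi
    subst this
    subst ha
    simp only [Bool.not_true]
    linear_combination (-2 * (u false ⟨0, hn⟩ - u true ⟨0, hn⟩)) * h2
  · have : i = ⟨0, hn⟩ := Fin.ext hi
    subst this
    have : a = false := by simpa using ha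
    subst this
    simp only [Bool.not_false]
    linear_combination (2 * (u false ⟨0, hn⟩ - u true ⟨0, hn⟩)) * h2
  · simp

theorem minusAmp_minusZero (hn : 0 < n) : minusAmp hn minusZero = 1 := by
  have h2 := inv_sqrt_two_mul_self
  simp [minusAmp, minusZero]
  linear_combination 2 * h2

theorem sqNorm_minusZero (hn : 0 < n) : sqNorm (minusZero : Bool → Fin n → ℂ) = 1 := by
  unfold sqNorm
  rw [Finset.sum_eq_single ⟨0, hn⟩]
  · have h2 : ‖((Real.sqrt 2 : ℝ) : ℂ)⁻¹‖ ^ 2 = 1 / 2 := by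
      rw [norm_inv, Complex.norm_real, inv_pow, Real.norm_eq_abs, sq_abs,
        Real.sq_sqrt (by norm_num)]
      norm_num
    simp only [minusZero, if_true, Bool.false_eq_true, if_false, neg_mul, one_mul, norm_neg, h2]
    norm_num
  · intro i _ hi
    have : (i : ℕ) ≠ 0 := fun h => hi (Fin.ext h)
    simp [minusZero, this]
  · simp

theorem minusAmp_lin (hn : 0 < n) (x y : ℂ) (u v : Bool → Fin n → ℂ) :
    minusAmp hn (x • u + y • v) = x * minusAmp hn u + y * minusAmp hn v := by
  simp [minusAmp]; ring

/-- The walk rotates by the angle whose cosine is the matrix element of the reflection. -/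
theorem minusAmp_walkU_iterate (hn : 0 < n) (hU : U ∈ Matrix.unitaryGroup (Fin n) ℂ)
    (hV : V ∈ Matrix.unitaryGroup (Fin n) ℂ) {φ : ℝ}
    (hφ : minusAmp hn (reflU U V ω α minusZero) = ((-Real.cos φ : ℝ) : ℂ)) (k : ℕ) :
    minusAmp hn ((walkU U V ω α)^[k] minusZero) = ((Real.cos (k * φ) : ℝ) : ℂ) := by
  set W := walkU U V ω α with hW
  have h1 : W minusZero = reflU U V ω α minusZero + (2 * Real.cos φ : ℂ) • minusZero := by
    rw [hW, walkU, flipU_eq hn, hφ]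
    push_cast
    rw [mul_neg, neg_smul, sub_neg_eq_add]
  -- A product of two reflections satisfies `W² = 2 cos φ W - 1` on the plane that they span;
  -- applied to `minusZero` this is the recurrence of `cos (k φ)`.
  have h2 : W (W minusZero) = (2 * Real.cos φ : ℂ) • W minusZero + (-1 : ℂ) • minusZero := by
    conv_lhs => rw [h1]
    have := walkU_add_smul (U := U) (V := V) (ω := ω) (α := α) 1 (2 * Real.cos φ : ℂ)
      (reflU U V ω α minusZero) minusZero
    rw [one_smul, one_smul, ← hW] at this
    rw [this]
    have h3 : W (reflU U V ω α minusZero) = (-1 : ℂ) • minusZero := by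
      rw [hW, walkU, reflU_reflU hU hV, flipU_eq hn, minusAmp_minusZero]
      module
    rw [h3, add_comm]
  have key : ∀ k, W^[k + 2] minusZero =
      (2 * Real.cos φ : ℂ) • W^[k + 1] minusZero + (-1 : ℂ) • W^[k] minusZero := by
    intro k
    induction k with
    | zero => simpa using h2
    | succ k ih =>
      rw [Function.iterate_succ_apply' W (k + 2), ih, hW, walkU_add_smul, ← hW,
        ← Function.iterate_succ_apply' W (k + 1), ← Function.iterate_succ_apply' W k, ih]
  induction k using Nat.twoStepInduction with
  | zero => simp [minusAmp_minusZero]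
  | one =>
    rw [Function.iterate_one, h1]
    have := minusAmp_lin hn 1 (2 * Real.cos φ : ℂ) (reflU U V ω α minusZero) minusZero
    rw [one_smul] at this
    rw [this, hφ, minusAmp_minusZero]
    push_cast; ring_nf
  | more k ih1 ih2 =>
    rw [key, minusAmp_lin, ih1, ih2]
    have : Real.cos ((k + 2 : ℕ) * φ) =
        2 * Real.cos φ * Real.cos ((k + 1 : ℕ) * φ) - Real.cos (k * φ) := by
      have e1 : ((k + 2 : ℕ) : ℝ) * φ = (k + 1 : ℕ) * φ + φ := by push_cast; ring
      have e2 : (k : ℝ) * φ = (k + 1 : ℕ) * φ - φ := by push_cast; ring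
      rw [e1, e2, Real.cos_add, Real.cos_sub]; ring
    rw [this]; push_cast; ring

/-- The matrix element of the reflection. -/
theorem minusAmp_reflU (hn : 0 < n) (hV : V ∈ Matrix.unitaryGroup (Fin n) ℂ) {b : Fin n → ℝ} (hb : b ⬝ᵥ b = 1)
    (hUb : ∀ i, U i ⟨0, hn⟩ = (b i : ℂ)) :
    minusAmp hn (reflU U V ω α minusZero) =
      (((-Real.cos ω + Real.sin ω * (Complex.exp (α * Complex.I) *
        ((fun i => (b i : ℂ)) ⬝ᵥ V *ᵥ fun i => (b i : ℂ))).im) / Real.sqrt 2 : ℝ) : ℂ) := by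
  set β : Fin n → ℂ := fun i => (b i : ℂ) with hβ
  have hββ : β ⬝ᵥ β = 1 := by
    have : β ⬝ᵥ β = ((b ⬝ᵥ b : ℝ) : ℂ) := by simp [hβ, dotProduct]
    rw [this, hb]; simp
  set a := β ⬝ᵥ V *ᵥ β with ha
  have ha' : β ⬝ᵥ Vᴴ *ᵥ β = (starRingEnd ℂ) a := by
    have hs : star β = β := by funext i; simp [hβ]
    have : star (β ⬝ᵥ V *ᵥ β) = star (V *ᵥ β) ⬝ᵥ star β := star_dotProduct_star (V *ᵥ β) β |>.symm
    rw [ha, starRingEnd_apply, this, star_mulVec, hs, dotProduct_mulVec]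
  have hdata : dataU U minusZero = fun a =>
      ((if a then -1 else 1) * ((Real.sqrt 2 : ℝ) : ℂ)⁻¹) • β := by
    funext a i
    simp only [dataU, mulVec, dotProduct, minusZero]
    rw [Finset.sum_eq_single ⟨0, hn⟩]
    · simp only [if_true, hUb, hβ, Pi.smul_apply, smul_eq_mul]; ring
    · intro j _ hj
      have : (j : ℕ) ≠ 0 := fun h => hj (Fin.ext h)
      simp [this]
    · simp
  have hlast : ∀ u : Bool → Fin n → ℂ, minusAmp hn (dataU Uᴴ u) =
      ((Real.sqrt 2 : ℝ) : ℂ)⁻¹ * (β ⬝ᵥ u false - β ⬝ᵥ u true) := by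
    intro u
    simp [minusAmp, dataU, mulVec, hUb, hβ, dotProduct]
  set r := ((Real.sqrt 2 : ℝ) : ℂ)⁻¹ with hr
  have hr2 : r * r = 1 / 2 := inv_sqrt_two_mul_self
  set e := Complex.exp (ω * Complex.I) with he
  set f := Complex.exp (α * Complex.I) with hf
  have he' : Complex.exp (((-ω : ℝ) : ℂ) * Complex.I) = (starRingEnd ℂ) e := by
    rw [he, ← Complex.exp_conj]; simp
  have hf' : Complex.exp (((-α : ℝ) : ℂ) * Complex.I) = (starRingEnd ℂ) f := by
    rw [hf, ← Complex.exp_conj]; simp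
  have hff : f * (starRingEnd ℂ) f = 1 := by
    rw [Complex.mul_conj, hf, Complex.normSq_eq_norm_sq, Complex.norm_exp_ofReal_mul_I]; simp
  have hee : e * (starRingEnd ℂ) e = 1 := by
    rw [Complex.mul_conj, he, Complex.normSq_eq_norm_sq, Complex.norm_exp_ofReal_mul_I]; simp
  rw [reflU, hlast, hdata]
  have hVV : V *ᵥ Vᴴ *ᵥ β = β := by
    rw [mulVec_mulVec, ← star_eq_conjTranspose, Matrix.mem_unitaryGroup_iff.1 hV, one_mulVec]
  simp only [hadU, phaseU, ctrlU, Bool.false_eq_true, if_false, if_true, he', hf', ← he, ← hf,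
    one_smul, neg_smul, mulVec_add, mulVec_smul, mulVec_neg, dotProduct_add, dotProduct_smul,
    dotProduct_neg, smul_add, smul_neg, neg_mul, one_mul, smul_eq_mul, hββ, ha', hVV]
  rw [← ha, ← hr]
  have hr5 : r * r * r * r * r = r / 4 := by rw [hr2, mul_assoc (1 / 2), hr2]; ring
  have hcos : ((Real.cos ω : ℝ) : ℂ) = (e + (starRingEnd ℂ) e) / 2 := by
    rw [Complex.add_conj, he, Complex.exp_ofReal_mul_I_re]; push_cast; ring
  have hsin : ((Real.sin ω : ℝ) : ℂ) = -(e - (starRingEnd ℂ) e) * Complex.I / 2 := by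
    rw [Complex.sub_conj, he, Complex.exp_ofReal_mul_I_im]; push_cast
    linear_combination (Complex.sin ω) * Complex.I_mul_I
  have him : (((f * a).im : ℝ) : ℂ) =
      -(f * a - (starRingEnd ℂ) f * (starRingEnd ℂ) a) * Complex.I / 2 := by
    rw [← map_mul, Complex.sub_conj]; push_cast
    linear_combination ((f * a).im : ℂ) * Complex.I_mul_I
  have hrhs : (((-Real.cos ω + Real.sin ω * (f * a).im) / Real.sqrt 2 : ℝ) : ℂ) =
      r * (-((e + (starRingEnd ℂ) e) / 2) - (e - (starRingEnd ℂ) e) *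
        (f * a - (starRingEnd ℂ) f * (starRingEnd ℂ) a) / 4) := by
    rw [Complex.ofReal_div, Complex.ofReal_add, Complex.ofReal_mul, Complex.ofReal_neg, hcos, hsin,
      him, div_eq_mul_inv, ← hr]
    linear_combination (r * (e - (starRingEnd ℂ) e) *
        (f * a - (starRingEnd ℂ) f * (starRingEnd ℂ) a) / 4) * Complex.I_mul_I
  rw [hrhs]
  -- The amplitude contains `r ^ 5`, from three Hadamard gates and the two normalisations of `|−⟩`.
  -- It is reduced with `r ^ 5 = r / 4` and `|e| = |f| = 1`.
  linear_combination (1 - e + (starRingEnd ℂ) f * (starRingEnd ℂ) a * (1 + e) + f * a * (1 - e) -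
      f * (starRingEnd ℂ) f * (1 + e) - (starRingEnd ℂ) e * (1 - e +
      (starRingEnd ℂ) f * (starRingEnd ℂ) a * (1 + e) - f * a * (1 - e) +
      f * (starRingEnd ℂ) f * (1 + e))) * hr5 -
    r / 4 * (1 + e) * (1 + (starRingEnd ℂ) e) * hff -
    r / 4 * ((starRingEnd ℂ) f * (starRingEnd ℂ) a + f * a) * hee

end Walk

end

noncomputable section

/-! ### Unitarity of the time evolution -/

section Evolution

variable {n : ℕ} {A : Matrix (Fin n) (Fin n) ℝ}

theorem evolution_neg (hA : A.IsHermitian) (t : ℝ) : evolution A (-t) = (evolution A t)ᴴ := by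
  unfold evolution
  rw [← Matrix.exp_conjTranspose, conjTranspose_smul]
  congr 1
  have h1 : (A.map fun x : ℝ => (x : ℂ))ᴴ = A.map fun x : ℝ => (x : ℂ) := by
    ext i j
    rw [conjTranspose_apply, map_apply, map_apply, RCLike.star_def, Complex.conj_ofReal,
      ← hA.apply i j]
    rfl
  rw [h1]
  congr 1
  simp

theorem evolution_mem_unitaryGroup (hA : A.IsHermitian) (t : ℝ) :
    evolution A t ∈ Matrix.unitaryGroup (Fin n) ℂ := by
  rw [Matrix.mem_unitaryGroup_iff, star_eq_conjTranspose, ← evolution_neg hA]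
  unfold evolution
  rw [← Matrix.exp_add_of_commute]
  · rw [← add_smul]; simp
  · exact ((Commute.refl _).smul_left _).smul_right _

end Evolution

/-! ### The programs of one experiment -/

/-- One step of the walk. -/
def walkProg : QProg :=
  -- Cells 8 and 9 hold `ω` and `-ω`, cells 15 and 16 `α` and `-α`, cells 13 and 14 `t` and `-t`.
  -- Cell 4 names qubit 0, a control that is always 1, and cell 5 names qubit 1.
  .seq (.prep 4) <| .seq (.phase 5 8) <| .seq (.had 5) <| .seq (.phase 5 16) <|
  .seq (.evolve 5 14) <| .seq (.had 5) <| .seq (.evolve 5 13) <| .seq (.phase 5 15) <|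
  .seq (.had 5) <| .seq (.phase 5 9) <| .seq (.unprep 4) (.flipZero 5)

/-- Reset qubits and data register after a measurement, and count successes in cell 21. -/
def cleanProg : QProg :=
  -- Cells 26 and 27 receive `π` times the outcomes: a phase gate with this angle between two
  -- Hadamard gates flips the qubit just if the outcome was 1. The product of the outcomes is the
  -- success bit; the zeros at the end restore `TrialMem`.
  .seq (.op .mul 26 7 24) <| .seq (.op .mul 27 7 25) <| .seq (.had 6) <| .seq (.phase 6 26) <|
  .seq (.had 6) <| .seq (.had 5) <| .seq (.phase 5 27) <| .seq (.had 5) <| .seq .reset <|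
  .seq (.op .mul 24 24 25) <| .seq (.op .add 21 21 24) <| .seq (.const 24 0) <|
  .seq (.const 25 0) <| .seq (.const 26 0) (.const 27 0)

/-- The preparation of the state to be measured. -/
def rotateProg : QProg :=
  -- The first two gates prepare `|−⟩` in qubit 1. The last two turn the component along `|−⟩|0⟩`
  -- into the event that qubits 1 and 2 are both 1.
  .seq (.had 5) <| .seq (.phase 5 7) <| .seq (.loop 20 walkProg) <| .seq (.had 5) (.flipZero 6)

/-- One repetition of the experiment. -/
def trialProg : QProg :=
  .seq rotateProg <| .seq (.meas 24 6) <| .seq (.meas 25 5) cleanProg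

/-- The constants that the experiment needs. -/
structure TrialMem (σ : ℕ → ℝ) : Prop where
  c4 : σ 4 = 0
  c5 : σ 5 = 1
  c6 : σ 6 = 2
  c7 : σ 7 = Real.pi
  c9 : σ 9 = -σ 8
  c14 : σ 14 = -σ 13
  c16 : σ 16 = -σ 15
  c24 : σ 24 = 0
  c25 : σ 25 = 0
  c26 : σ 26 = 0
  c27 : σ 27 = 0

/-! ### Success probability of one experiment -/

section Trial

variable {n : ℕ} {A : Matrix (Fin n) (Fin n) ℝ} {U : Matrix (Fin n) (Fin n) ℂ}

theorem run_seq_of_eq {P Q : QProg} {c c' : QConfig n} (h : P.run A U c = [c']) :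
    (QProg.seq P Q).run A U c = Q.run A U c' := by
  simp [QProg.run, h]

/-- The cost of one step of the walk. -/
def walkCost (n : ℕ) (t : ℝ) : ℝ :=
  (4 + 2 * |t|) * Real.log n ^ 2 + Real.log n + 8

theorem run_walkProg (hA : A.IsHermitian) (M : ℕ → ℝ) (hM : TrialMem M) (u : Bool → Fin n → ℂ)
    (t : ℝ) :
    walkProg.run A U ⟨M, liftState u, t⟩ =
      [⟨M, liftState (walkU U (evolution A (M 13)) (M 8) (M 15) u), t + walkCost n (M 13)⟩] := by
  have i4 : ∀ s t', (⟨M, s, t'⟩ : QConfig n).idx 4 = 0 := by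
    intro s t'; simp [QConfig.idx, hM.c4]
  have i5 : ∀ s t', (⟨M, s, t'⟩ : QConfig n).idx 5 = 1 := by
    intro s t'; simp [QConfig.idx, hM.c5]
  simp only [walkProg, QProg.run, QConfig.act, QConfig.wait, List.flatMap_cons, List.flatMap_nil,
    List.append_nil, i4, i5, controlledGate_lift_zero, controlledGate_lift, hadGate_lift,
    phaseGate_lift, flipZeroGate_lift, hM.c9, hM.c14, hM.c16, evolution_neg hA, walkU, reflU,
    abs_neg]
  congr 2
  simp only [walkCost]; ring

theorem run_walk_loop (hA : A.IsHermitian) (M : ℕ → ℝ) (hM : TrialMem M) {k : ℕ}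
    (hk : M 20 = k) (u : Bool → Fin n → ℂ) (t : ℝ) :
    (QProg.loop 20 walkProg).run A U ⟨M, liftState u, t⟩ =
      [⟨M, liftState ((walkU U (evolution A (M 13)) (M 8) (M 15))^[k] u),
        t + (1 + k * (walkCost n (M 13) + 1))⟩] := by
  simp only [QProg.run, QConfig.idx, hk, Nat.floor_natCast]
  clear hk
  induction k with
  | zero => simp [QConfig.wait]
  | succ k ih =>
    rw [Function.iterate_succ_apply', ih]
    simp only [List.flatMap_cons, List.flatMap_nil, List.append_nil, QConfig.wait]
    rw [run_walkProg hA M hM, Function.iterate_succ_apply']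
    congr 2
    push_cast; ring

theorem run_rotateProg (hA : A.IsHermitian) (M : ℕ → ℝ) (hM : TrialMem M) {k : ℕ}
    (hk : M 20 = k) (x : ℂ) (t : ℝ) :
    rotateProg.run A U ⟨M, x • baseState n, t⟩ =
      [⟨M, lowState fun a b i =>
        if (b = true ↔ (i : ℕ) = 0) then
          x * hadU ((walkU U (evolution A (M 13)) (M 8) (M 15))^[k] minusZero) a i else 0,
        t + (k * (walkCost n (M 13) + 1) + Real.log n + 5)⟩] := by
  have i5 : ∀ s t', (⟨M, s, t'⟩ : QConfig n).idx 5 = 1 := by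
    intro s t'; simp [QConfig.idx, hM.c5]
  have i6 : ∀ s t', (⟨M, s, t'⟩ : QConfig n).idx 6 = 2 := by
    intro s t'; simp [QConfig.idx, hM.c6]
  have h0 : x • baseState n = liftState fun a i => if a = false ∧ (i : ℕ) = 0 then x else 0 := by
    rw [smul_baseState_eq, liftState]
    congr 1; funext a b i
    cases a <;> cases b <;> simp
  have h1 : phaseU Real.pi (hadU fun a i => if a = false ∧ (i : ℕ) = 0 then x else 0) =
      x • (minusZero : Bool → Fin n → ℂ) := by
    funext a i
    cases a
    · by_cases hi : (i : ℕ) = 0 <;> simp [phaseU, hadU, minusZero, hi, mul_comm]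
    · simp only [phaseU, hadU, minusZero, if_true, Complex.exp_pi_mul_I, Pi.smul_apply]
      by_cases hi : (i : ℕ) = 0 <;> simp [hi, mul_comm]
  have h2 : ∀ k : ℕ, (walkU U (evolution A (M 13)) (M 8) (M 15))^[k] (x • minusZero) =
      x • (walkU U (evolution A (M 13)) (M 8) (M 15))^[k] minusZero := by
    intro k
    induction k with
    | zero => rfl
    | succ k ih =>
      rw [Function.iterate_succ_apply', ih, Function.iterate_succ_apply']
      have := walkU_add_smul (U := U) (V := evolution A (M 13)) (ω := M 8) (α := M 15) x 0
        ((walkU U (evolution A (M 13)) (M 8) (M 15))^[k] minusZero) 0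
      simpa using this
  have h3 : ∀ v : Bool → Fin n → ℂ, hadU (x • v) = x • hadU v := by
    intro v; funext a i; cases a <;> (simp [hadU]; ring)
  rw [rotateProg, run_seq_of_eq (c' := ⟨M, liftState (hadU fun a i =>
      if a = false ∧ (i : ℕ) = 0 then x else 0), t + 1⟩), run_seq_of_eq (c' := ⟨M,
      liftState (x • minusZero), t + 1 + 1⟩), run_seq_of_eq (run_walk_loop hA M hM hk _ _),
      h2]
  · simp only [QProg.run, QConfig.act, QConfig.wait, List.flatMap_cons, List.flatMap_nil,
      List.append_nil, i5, i6, hadGate_lift, h3]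
    rw [liftState, flipZeroGate_lowState_two]
    congr 2
    · congr 1
      funext a b i
      by_cases hi : (i : ℕ) = 0 <;> cases b <;> simp [hi]
    · ring
  · simp only [QProg.run, QConfig.act, QConfig.wait, i5, phaseGate_lift, hM.c7, h1]
  · simp only [QProg.run, QConfig.act, QConfig.wait, i5, h0, hadGate_lift]

/-- The number of a bit. -/
def bitVal (v : Bool) : ℝ := if v then 1 else 0

theorem run_cleanProg (M : ℕ → ℝ) (hM : TrialMem M) (xf xq : Bool) (g : Fin n → ℂ) (t : ℝ) :
    cleanProg.run A U ⟨Function.update (Function.update M 24 (bitVal xf)) 25 (bitVal xq),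
      lowState (fun a b => if a = xq ∧ b = xf then g else 0), t⟩ =
    (List.finRange n).map fun j => ⟨Function.update M 21 (M 21 + bitVal xf * bitVal xq),
      g j • baseState n, t + (15 + Real.log n)⟩ := by
  have hmem : Function.update (Function.update (Function.update (Function.update
      (Function.update (Function.update (Function.update (Function.update (Function.update
      (Function.update M 24 (bitVal xf)) 25 (bitVal xq)) 26 (Real.pi * bitVal xf)) 27
      (Real.pi * bitVal xq)) 24 (bitVal xf * bitVal xq)) 21 (M 21 + bitVal xf * bitVal xq))
      24 0) 25 0) 26 0) 27 0 = Function.update M 21 (M 21 + bitVal xf * bitVal xq) := by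
    funext a
    have h24 := hM.c24
    have h25 := hM.c25
    have h26 := hM.c26
    have h27 := hM.c27
    simp only [Function.update_apply]
    split_ifs <;> simp_all
  have hst : hadGate 1 (phaseGate 1 (Real.pi * bitVal xq) (hadGate 1 (hadGate 2 (phaseGate 2
      (Real.pi * bitVal xf) (hadGate 2 (lowState fun a b => if a = xq ∧ b = xf then g else 0)))))) =
      lowState fun a b => if a = false ∧ b = false then g else 0 := by
    have e1 : (fun a b : Bool => if a = xq ∧ b = xf then g else 0) =
        fun a b => if b = xf then (if a = xq then g else 0) else 0 := by
      funext a b; split_ifs <;> simp_all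
    have e2 : (fun a b : Bool => if b = false then (if a = xq then g else 0) else 0) =
        fun a b => if a = xq then (if b = false then g else 0) else 0 := by
      funext a b; split_ifs <;> simp_all
    rw [e1, had_phase_had_two xf (Real.pi * bitVal xf) rfl (fun a => if a = xq then g else 0), e2,
      had_phase_had_one xq (Real.pi * bitVal xq) rfl (fun b => if b = false then g else 0)]
    congr 1; funext a b; split_ifs <;> simp_all
  rw [← hmem]
  simp only [cleanProg, QProg.run, QConfig.act, QConfig.wait, QConfig.write, List.flatMap_cons,
    List.flatMap_nil, List.append_nil, RealOp.eval, List.flatMap_map, QConfig.idx]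
  have c5 := hM.c5
  have c6 := hM.c6
  have c7 := hM.c7
  simp only [Function.update_apply, Nat.reduceEqDiff, if_false, if_true, c5, c6, c7,
    Nat.floor_one, Nat.floor_ofNat, hst, resetTo_lowState]
  rw [← List.map_eq_flatMap]
  refine List.map_congr_left fun j _ => ?_
  congr 1
  · simp
  · ring

theorem sum_finRange_prob (hn : 0 < n) (M : ℕ → ℝ) (t : ℝ) (g : Fin n → ℂ) :
    (((List.finRange n).map fun j => (⟨M, g j • baseState n, t⟩ : QConfig n)).map
      QConfig.prob).sum = ∑ j, ‖g j‖ ^ 2 := by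
  rw [List.map_map]
  simp only [Function.comp_def, prob_baseState hn]
  rw [← List.sum_ofFn, List.ofFn_eq_map]

/-- Both outcomes are 1 exactly on the component along `|−⟩|0⟩`, whose amplitude after `k` steps is
`cos (k φ)`. The other branches carry the rest of the norm, which the walk conserves. -/
theorem wp_trialProg (hn : 0 < n) (hA : A.IsHermitian) (hU : U ∈ Matrix.unitaryGroup (Fin n) ℂ)
    {σ : ℕ → ℝ} (hσ : TrialMem σ) {k : ℕ} (hk : σ 20 = k) {φ : ℝ}
    (hφ : minusAmp hn (reflU U (evolution A (σ 13)) (σ 8) (σ 15) minusZero) =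
      ((-Real.cos φ : ℝ) : ℂ)) (F : (ℕ → ℝ) → ℝ) :
    Wp A U trialProg σ (k * (walkCost n (σ 13) + 1) + 2 * Real.log n + 22)
      (fun σ' => σ' = σ ∨ σ' = Function.update σ 21 (σ 21 + 1)) F
      (Real.cos (k * φ) ^ 2 * F (Function.update σ 21 (σ 21 + 1)) +
        (1 - Real.cos (k * φ) ^ 2) * F σ) := by
  rintro ⟨M, s, t⟩ x rfl hs
  simp only at hs
  subst hs
  have hv : ∀ a < 64, visible M a = M a := fun a ha => visible_of_lt ha
  have hM : TrialMem M := by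
    obtain ⟨h1, h2, h3, h4, h5, h6, h7, h8, h9, h10, h11⟩ := hσ
    rw [hv _ (by norm_num)] at h1 h2 h3 h4 h5 h6 h7 h8 h9 h10 h11
    rw [hv _ (by norm_num)] at h5 h6 h7
    exact ⟨h1, h2, h3, h4, h5, h6, h7, h8, h9, h10, h11⟩
  simp only [hv 20 (by norm_num), hv 13 (by norm_num), hv 8 (by norm_num), hv 15 (by norm_num)]
    at hk hφ
  simp only [hv 13 (by norm_num), hv 21 (by norm_num), ← visible_update (M := M) (a := 21)
    (Or.inl (by norm_num : 21 < 64))]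
  have hamp := minusAmp_walkU_iterate hn hU (evolution_mem_unitaryGroup hA (M 13)) hφ k
  have hnorm : ∀ k, sqNorm ((walkU U (evolution A (M 13)) (M 8) (M 15))^[k] minusZero) = 1 := by
    intro k
    induction k with
    | zero => exact sqNorm_minusZero hn
    | succ k ih =>
      rw [Function.iterate_succ_apply', sqNorm_walkU hU (evolution_mem_unitaryGroup hA _), ih]
  set u := (walkU U (evolution A (M 13)) (M 8) (M 15))^[k] minusZero with hu
  set T := t + (k * (walkCost n (M 13) + 1) + Real.log n + 5) with hT
  let g : Bool → Bool → Fin n → ℂ := fun xf xq i =>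
    if (xf = true ↔ (i : ℕ) = 0) then x * hadU u xq i else 0
  let B : Bool → Bool → List (QConfig n) := fun xf xq => (List.finRange n).map fun j =>
    ⟨Function.update M 21 (M 21 + bitVal xf * bitVal xq), g xf xq j • baseState n,
      T + 1 + 1 + (15 + Real.log n)⟩
  have i5 : ∀ v s t', (⟨Function.update M 24 v, s, t'⟩ : QConfig n).idx 5 = 1 := by
    intro v s t'; simp [QConfig.idx, hM.c5]
  have i6 : ∀ s t', (⟨M, s, t'⟩ : QConfig n).idx 6 = 2 := by
    intro s t'; simp [QConfig.idx, hM.c6]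
  have hproj : ∀ xf xq : Bool, projectQubit 1 xq (projectQubit 2 xf (lowState fun a b i =>
      if (b = true ↔ (i : ℕ) = 0) then x * hadU u a i else 0)) =
      lowState fun a b => if a = xq ∧ b = xf then g xf xq else 0 := by
    intro xf xq
    rw [projectQubit_lowState_two, projectQubit_lowState_one]
    congr 1; funext a b i
    cases a <;> cases b <;> cases xf <;> cases xq <;> simp [g]
  have hrun : trialProg.run A U ⟨M, x • baseState n, t⟩ =
      B false false ++ (B false true ++ (B true false ++ B true true)) := by
    rw [trialProg, run_seq_of_eq (run_rotateProg hA M hM hk x t), ← hu, ← hT]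
    simp only [QProg.run, QConfig.act, QConfig.wait, QConfig.write, List.flatMap_cons,
      List.flatMap_nil, List.append_nil, i5, i6, hproj]
    have hc := fun xf xq => run_cleanProg (A := A) (U := U) M hM xf xq (g xf xq) (T + 1 + 1)
    have b0 : bitVal false = 0 := rfl
    have b1 : bitVal true = 1 := rfl
    have h00 := hc false false
    have h01 := hc false true
    have h10 := hc true false
    have h11 := hc true true
    simp only [b0, b1] at h00 h01 h10 h11
    rw [h00, h01, h10, h11]
    simp only [B, b0, b1, List.append_assoc]
  rw [hrun]
  have hsum : ∀ xf xq, ((B xf xq).map QConfig.prob).sum = ∑ j, ‖g xf xq j‖ ^ 2 :=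
    fun xf xq => sum_finRange_prob hn _ _ _
  have hpc : (⟨M, x • baseState n, t⟩ : QConfig n).prob = ‖x‖ ^ 2 := prob_baseState hn _ _ _
  have htot : ∑ j, ‖g false false j‖ ^ 2 + (∑ j, ‖g false true j‖ ^ 2 +
      (∑ j, ‖g true false j‖ ^ 2 + ∑ j, ‖g true true j‖ ^ 2)) = ‖x‖ ^ 2 := by
    have := (sqNorm_hadU u).trans (hnorm k)
    rw [sqNorm] at this
    rw [← mul_one (‖x‖ ^ 2), ← this, ← Finset.sum_add_distrib, ← Finset.sum_add_distrib,
      ← Finset.sum_add_distrib, Finset.mul_sum]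
    refine Finset.sum_congr rfl fun j _ => ?_
    by_cases hj : (j : ℕ) = 0 <;> simp [g, hj, mul_pow, mul_add]
  have h11 : ∑ j, ‖g true true j‖ ^ 2 = ‖x‖ ^ 2 * Real.cos (k * φ) ^ 2 := by
    rw [Finset.sum_eq_single ⟨0, hn⟩]
    · have : hadU u true ⟨0, hn⟩ = minusAmp hn u := by
        simp [hadU, minusAmp]; ring
      simp only [g, iff_self, if_true, this, hamp, norm_mul, mul_pow, Complex.norm_real,
        Real.norm_eq_abs, sq_abs]
    · intro i _ hi
      have : (i : ℕ) ≠ 0 := fun h => hi (Fin.ext h)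
      simp [g, this]
    · simp
  refine ⟨?_, ?_, ?_⟩
  · intro c' hc'
    have : ∃ xf xq, c' ∈ B xf xq := by
      simp only [List.mem_append] at hc'
      rcases hc' with h | h | h | h
      exacts [⟨_, _, h⟩, ⟨_, _, h⟩, ⟨_, _, h⟩, ⟨_, _, h⟩]
    obtain ⟨xf, xq, h⟩ := this
    obtain ⟨j, -, rfl⟩ := List.mem_map.1 h
    refine ⟨⟨_, rfl⟩, by simp only [hT]; linarith, ?_⟩
    cases xf <;> cases xq <;> simp [bitVal]
  · rw [hpc, ← htot]
    simp only [List.map_append, List.sum_append, hsum]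
  · have hF : ∀ xf xq, ((B xf xq).map fun c' => c'.prob * F (visible c'.mem)).sum =
        (∑ j, ‖g xf xq j‖ ^ 2) *
          F (visible (Function.update M 21 (M 21 + bitVal xf * bitVal xq))) := by
      intro xf xq
      rw [← hsum, ← List.sum_map_mul_right]
      simp only [B, List.map_map]
      rfl
    rw [hpc]
    simp only [List.map_append, List.sum_append, hF]
    simp only [bitVal, if_true, Bool.false_eq_true, if_false, mul_zero, mul_one, add_zero,
      Function.update_eq_self, h11]
    rw [h11] at htot
    refine le_of_eq ?_
    linear_combination (F (visible M)) * htot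

end Trial

end

noncomputable section

/-! ### Extreme eigenvalues of symmetric matrices -/

section Rayleigh

variable {k : ℕ} {M : Matrix (Fin k) (Fin k) ℝ}

theorem dotProduct_mulVec_comm (hM : M.IsHermitian) (x y : Fin k → ℝ) :
    x ⬝ᵥ M *ᵥ y = y ⬝ᵥ M *ᵥ x := by
  have h : Mᵀ = M := by rw [← conjTranspose_eq_transpose_of_trivial]; exact hM
  rw [dotProduct_mulVec, ← mulVec_transpose, h, dotProduct_comm]

/-- Coordinates with respect to the eigenbasis. -/
def eigCoord (hM : M.IsHermitian) (x : Fin k → ℝ) : Fin k → ℝ :=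
  (hM.eigenvectorUnitary : Matrix (Fin k) (Fin k) ℝ)ᵀ *ᵥ x

theorem spectral_transpose (hM : M.IsHermitian) :
    M = (hM.eigenvectorUnitary : Matrix (Fin k) (Fin k) ℝ) * diagonal hM.eigenvalues *
      (hM.eigenvectorUnitary : Matrix (Fin k) (Fin k) ℝ)ᵀ := by
  have := hM.spectral_theorem
  rw [Unitary.conjStarAlgAut_apply] at this
  rw [← conjTranspose_eq_transpose_of_trivial]
  exact this

theorem eigenvectorUnitary_mul_transpose (hM : M.IsHermitian) :
    (hM.eigenvectorUnitary : Matrix (Fin k) (Fin k) ℝ) *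
      (hM.eigenvectorUnitary : Matrix (Fin k) (Fin k) ℝ)ᵀ = 1 := by
  rw [← conjTranspose_eq_transpose_of_trivial]
  exact Matrix.mem_unitaryGroup_iff.1 hM.eigenvectorUnitary.2

theorem transpose_mul_eigenvectorUnitary (hM : M.IsHermitian) :
    (hM.eigenvectorUnitary : Matrix (Fin k) (Fin k) ℝ)ᵀ *
      (hM.eigenvectorUnitary : Matrix (Fin k) (Fin k) ℝ) = 1 :=
  mul_eq_one_comm.1 (eigenvectorUnitary_mul_transpose hM)

theorem eigCoord_mulVec (hM : M.IsHermitian) (x : Fin k → ℝ) (i : Fin k) :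
    eigCoord hM (M *ᵥ x) i = hM.eigenvalues i * eigCoord hM x i := by
  have h : eigCoord hM (M *ᵥ x) = diagonal hM.eigenvalues *ᵥ eigCoord hM x := by
    have h1 := congrArg (fun N => (hM.eigenvectorUnitary : Matrix (Fin k) (Fin k) ℝ)ᵀ * N)
      (spectral_transpose hM)
    simp only [← Matrix.mul_assoc] at h1
    rw [transpose_mul_eigenvectorUnitary, Matrix.one_mul] at h1
    unfold eigCoord
    rw [mulVec_mulVec, mulVec_mulVec, h1]
  rw [h, mulVec_diagonal]

theorem dotProduct_eq_eigCoord (hM : M.IsHermitian) (x y : Fin k → ℝ) :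
    x ⬝ᵥ y = ∑ i, eigCoord hM x i * eigCoord hM y i := by
  have : ∑ i, eigCoord hM x i * eigCoord hM y i = eigCoord hM x ⬝ᵥ eigCoord hM y := rfl
  rw [this]
  unfold eigCoord
  rw [dotProduct_mulVec, vecMul_transpose, mulVec_mulVec, eigenvectorUnitary_mul_transpose,
    one_mulVec]

theorem quad_eq_eigCoord (hM : M.IsHermitian) (x : Fin k → ℝ) :
    x ⬝ᵥ M *ᵥ x = ∑ i, hM.eigenvalues i * eigCoord hM x i ^ 2 := by
  rw [dotProduct_eq_eigCoord hM]
  refine Finset.sum_congr rfl fun i _ => ?_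
  rw [eigCoord_mulVec]; ring

theorem eigenvalues_mem_spectrum (hM : M.IsHermitian) (i : Fin k) :
    hM.eigenvalues i ∈ spectrum ℝ M := by
  rw [hM.spectrum_real_eq_range_eigenvalues]; exact ⟨i, rfl⟩

theorem quad_le_maxEigenvalue (hM : M.IsHermitian) (x : Fin k → ℝ) :
    x ⬝ᵥ M *ᵥ x ≤ maxEigenvalue M * (x ⬝ᵥ x) := by
  rw [quad_eq_eigCoord hM, dotProduct_eq_eigCoord hM, Finset.mul_sum]
  refine Finset.sum_le_sum fun i _ => ?_
  have : hM.eigenvalues i ≤ maxEigenvalue M := by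
    refine le_csSup ?_ (eigenvalues_mem_spectrum hM i)
    rw [hM.spectrum_real_eq_range_eigenvalues]
    exact (Set.finite_range _).bddAbove
  nlinarith [mul_self_nonneg (eigCoord hM x i)]

theorem minEigenvalue_le_quad (hM : M.IsHermitian) (x : Fin k → ℝ) :
    minEigenvalue M * (x ⬝ᵥ x) ≤ x ⬝ᵥ M *ᵥ x := by
  rw [quad_eq_eigCoord hM, dotProduct_eq_eigCoord hM, Finset.mul_sum]
  refine Finset.sum_le_sum fun i _ => ?_
  have : minEigenvalue M ≤ hM.eigenvalues i := by
    refine csInf_le ?_ (eigenvalues_mem_spectrum hM i)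
    rw [hM.spectrum_real_eq_range_eigenvalues]
    exact (Set.finite_range _).bddBelow
  nlinarith [mul_self_nonneg (eigCoord hM x i)]

theorem exists_quad_eq_eigenvalue (hM : M.IsHermitian) (i : Fin k) :
    ∃ x : Fin k → ℝ, x ⬝ᵥ x = 1 ∧ x ⬝ᵥ M *ᵥ x = hM.eigenvalues i := by
  refine ⟨(hM.eigenvectorUnitary : Matrix (Fin k) (Fin k) ℝ) *ᵥ Pi.single i 1, ?_⟩
  have h : eigCoord hM ((hM.eigenvectorUnitary : Matrix (Fin k) (Fin k) ℝ) *ᵥ Pi.single i 1) =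
      Pi.single i 1 := by
    unfold eigCoord
    rw [mulVec_mulVec, transpose_mul_eigenvectorUnitary, one_mulVec]
  constructor
  · rw [dotProduct_eq_eigCoord hM, h]; simp [Pi.single_apply]
  · rw [quad_eq_eigCoord hM, h]; simp [Pi.single_apply]

theorem exists_quad_eq_maxEigenvalue (hk : 0 < k) (hM : M.IsHermitian) :
    ∃ x : Fin k → ℝ, x ⬝ᵥ x = 1 ∧ x ⬝ᵥ M *ᵥ x = maxEigenvalue M := by
  have : Nonempty (Fin k) := ⟨⟨0, hk⟩⟩
  obtain ⟨i, hi⟩ : maxEigenvalue M ∈ Set.range hM.eigenvalues := by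
    rw [maxEigenvalue, hM.spectrum_real_eq_range_eigenvalues]
    exact (Set.range_nonempty _).csSup_mem (Set.finite_range _)
  rw [← hi]; exact exists_quad_eq_eigenvalue hM i

theorem exists_quad_eq_minEigenvalue (hk : 0 < k) (hM : M.IsHermitian) :
    ∃ x : Fin k → ℝ, x ⬝ᵥ x = 1 ∧ x ⬝ᵥ M *ᵥ x = minEigenvalue M := by
  have : Nonempty (Fin k) := ⟨⟨0, hk⟩⟩
  obtain ⟨i, hi⟩ : minEigenvalue M ∈ Set.range hM.eigenvalues := by
    rw [minEigenvalue, hM.spectrum_real_eq_range_eigenvalues]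
    exact (Set.range_nonempty _).csInf_mem (Set.finite_range _)
  rw [← hi]; exact exists_quad_eq_eigenvalue hM i

end Rayleigh

/-! ### Moments of the spectral measure -/

section Moments

variable {n : ℕ} {A : Matrix (Fin n) (Fin n) ℝ}

/-- Integration against the spectral measure of `b`. -/
def specInt (hA : A.IsHermitian) (b : Fin n → ℝ) (f : ℝ → ℝ) : ℝ :=
  ∑ i, eigCoord hA b i ^ 2 * f (hA.eigenvalues i)

/-- In the eigenbasis `A - x` multiplies each coordinate by the shifted eigenvalue, so inner
products of Krylov vectors are moments and depend on `k + l` only. This is the source of the Hankel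
structure. -/
theorem specInt_pow (hA : A.IsHermitian) (b : Fin n → ℝ) (k l : ℕ) (x : ℝ) :
    ((A - x • 1) ^ k *ᵥ b) ⬝ᵥ ((A - x • 1) ^ l *ᵥ b) = specInt hA b fun t => (t - x) ^ (k + l) := by
  have h : ∀ k i, eigCoord hA ((A - x • 1) ^ k *ᵥ b) i =
      (hA.eigenvalues i - x) ^ k * eigCoord hA b i := by
    intro k i
    induction k with
    | zero => simp
    | succ k ih =>
      have e : eigCoord hA ((A - x • 1) ^ (k + 1) *ᵥ b) =
          eigCoord hA (A *ᵥ ((A - x • 1) ^ k *ᵥ b)) - x • eigCoord hA ((A - x • 1) ^ k *ᵥ b) := by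
        rw [pow_succ', ← mulVec_mulVec, sub_mulVec, smul_mulVec, one_mulVec]
        unfold eigCoord
        rw [mulVec_sub, mulVec_smul]
      rw [e, Pi.sub_apply, Pi.smul_apply, eigCoord_mulVec, ih, smul_eq_mul]; ring
  rw [dotProduct_eq_eigCoord hA, specInt]
  refine Finset.sum_congr rfl fun i _ => ?_
  rw [h, h, pow_add]; ring

theorem specInt_mono (hA : A.IsHermitian) (b : Fin n → ℝ) {f g : ℝ → ℝ}
    (h : ∀ i, f (hA.eigenvalues i) ≤ g (hA.eigenvalues i)) : specInt hA b f ≤ specInt hA b g :=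
  Finset.sum_le_sum fun i _ => mul_le_mul_of_nonneg_left (h i) (sq_nonneg _)

theorem specInt_const (hA : A.IsHermitian) {b : Fin n → ℝ} (hb : b ⬝ᵥ b = 1) (x : ℝ) :
    specInt hA b (fun _ => x) = x := by
  rw [specInt, ← Finset.sum_mul]
  rw [dotProduct_eq_eigCoord hA] at hb
  simp only [sq]
  rw [hb, one_mul]

theorem abs_specInt_le (hA : A.IsHermitian) {b : Fin n → ℝ} (hb : b ⬝ᵥ b = 1) {f : ℝ → ℝ} {x : ℝ}
    (h : ∀ i, |f (hA.eigenvalues i)| ≤ x) : |specInt hA b f| ≤ x := by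
  rw [abs_le]
  constructor
  · rw [← specInt_const hA hb (-x)]
    exact specInt_mono hA b fun i => (abs_le.1 (h i)).1
  · rw [← specInt_const hA hb x]
    exact specInt_mono hA b fun i => (abs_le.1 (h i)).2

/-- Matrix elements of the time evolution. -/
theorem dotProduct_evolution (hA : A.IsHermitian) (b : Fin n → ℝ) (t : ℝ) :
    (fun i => (b i : ℂ)) ⬝ᵥ evolution A t *ᵥ (fun i => (b i : ℂ)) =
      ∑ i, ((eigCoord hA b i ^ 2 : ℝ) : ℂ) *
        Complex.exp (-(hA.eigenvalues i * t : ℝ) * Complex.I) := by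
  set E : Matrix (Fin n) (Fin n) ℝ := (hA.eigenvectorUnitary : Matrix (Fin n) (Fin n) ℝ) with hE
  let φ : ℝ →+* ℂ := Complex.ofRealHom
  have h1 : E.map φ * (Eᵀ).map φ = 1 := by
    rw [← Matrix.map_mul, eigenvectorUnitary_mul_transpose]; simp [φ]
  have h2 : (Eᵀ).map φ * E.map φ = 1 := mul_eq_one_comm.1 h1
  -- The real eigenbasis as an invertible complex matrix: conjugation by it moves the exponential to
  -- a diagonal matrix.
  let u : (Matrix (Fin n) (Fin n) ℂ)ˣ := ⟨E.map φ, (Eᵀ).map φ, h1, h2⟩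
  have hA' : (-(Complex.I * (t : ℂ))) • A.map (fun x : ℝ => (x : ℂ)) =
      (u : Matrix (Fin n) (Fin n) ℂ) *
        diagonal (fun i => -(hA.eigenvalues i * t : ℝ) * Complex.I) *
        ((u⁻¹ : (Matrix (Fin n) (Fin n) ℂ)ˣ) : Matrix (Fin n) (Fin n) ℂ) := by
    have : diagonal (fun i => -((hA.eigenvalues i * t : ℝ) : ℂ) * Complex.I) =
        (-(Complex.I * (t : ℂ))) • (diagonal hA.eigenvalues).map φ := by
      ext i j
      by_cases hij : i = j
      · subst hij; simp [φ]; ring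
      · simp [hij, φ]
    rw [this, Matrix.mul_smul, Matrix.smul_mul]
    congr 1
    show A.map φ = E.map φ * (diagonal hA.eigenvalues).map φ * (Eᵀ).map φ
    rw [← Matrix.map_mul, ← Matrix.map_mul, ← spectral_transpose hA]
  unfold evolution
  rw [hA', Matrix.exp_units_conj, Matrix.exp_diagonal]
  have h3 : (Eᵀ).map φ *ᵥ (fun i => (b i : ℂ)) = fun i => ((eigCoord hA b i : ℝ) : ℂ) := by
    funext i
    simp [mulVec, dotProduct, eigCoord, φ, hE]
  have h4 : (fun i => (b i : ℂ)) ᵥ* E.map φ = fun i => ((eigCoord hA b i : ℝ) : ℂ) := by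
    rw [← h3, ← vecMul_transpose]; rfl
  show _ ⬝ᵥ (E.map φ * _ * (Eᵀ).map φ) *ᵥ _ = _
  rw [← mulVec_mulVec, ← mulVec_mulVec, h3, dotProduct_mulVec, h4, dotProduct]
  refine Finset.sum_congr rfl fun i _ => ?_
  rw [mulVec_diagonal]
  have : NormedSpace.exp (fun i => -((hA.eigenvalues i * t : ℝ) : ℂ) * Complex.I) i =
      Complex.exp (-((hA.eigenvalues i * t : ℝ) : ℂ) * Complex.I) := by
    rw [Pi.coe_exp, Complex.exp_eq_exp_ℂ]
  rw [this]; push_cast; ring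

/-- The phase `α` shifts the sine, so one circuit yields every trigonometric moment of frequency
`t`. -/
theorem im_dotProduct_evolution (hA : A.IsHermitian) (b : Fin n → ℝ) (t α : ℝ) :
    (Complex.exp (α * Complex.I) * ((fun i => (b i : ℂ)) ⬝ᵥ evolution A t *ᵥ
      (fun i => (b i : ℂ)))).im = specInt hA b fun x => Real.sin (α - x * t) := by
  rw [dotProduct_evolution hA, Finset.mul_sum, Complex.im_sum, specInt]
  refine Finset.sum_congr rfl fun i _ => ?_
  rw [mul_left_comm, ← Complex.exp_add, ← add_mul, ← Complex.ofReal_neg, ← Complex.ofReal_add,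
    Complex.im_ofReal_mul, Complex.exp_ofReal_mul_I_im, ← sub_eq_add_neg]

end Moments

end

noncomputable section

/-! ### Orthogonality relations of the conjugate gradient iteration -/

section CG

variable {n : ℕ} {A : Matrix (Fin n) (Fin n) ℝ} {b : Fin n → ℝ}

theorem cg_r_succ (k : ℕ) :
    (cg A b (k + 1)).r = (cg A b k).r - cgAlpha A b k • (A *ᵥ (cg A b k).p) := rfl

theorem cg_p_succ (k : ℕ) :
    (cg A b (k + 1)).p = (cg A b (k + 1)).r + cgBeta A b k • (cg A b k).p := rfl

theorem cgBeta_eq (k : ℕ) : cgBeta A b k =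
    ((cg A b (k + 1)).r ⬝ᵥ (cg A b (k + 1)).r) / ((cg A b k).r ⬝ᵥ (cg A b k).r) := rfl

theorem cgAlpha_eq (k : ℕ) : cgAlpha A b k =
    ((cg A b k).r ⬝ᵥ (cg A b k).r) / ((cg A b k).p ⬝ᵥ (A *ᵥ (cg A b k).p)) := rfl

/-- The iteration is applied to a symmetric matrix with quadratic form between `δ` and `1`, and has
not stopped before step `m`. -/
structure CGRun (A : Matrix (Fin n) (Fin n) ℝ) (b : Fin n → ℝ) (m : ℕ) (δ : ℝ) : Prop where
  herm : A.IsHermitian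
  lower : ∀ x, δ * (x ⬝ᵥ x) ≤ x ⬝ᵥ A *ᵥ x
  upper : ∀ x, x ⬝ᵥ A *ᵥ x ≤ x ⬝ᵥ x
  pos : 0 < δ
  unit : b ⬝ᵥ b = 1
  run : ∀ k < m, δ ^ 2 ≤ (cg A b k).r ⬝ᵥ (cg A b k).r

theorem dotProduct_self_nonneg' {k : ℕ} (x : Fin k → ℝ) : 0 ≤ x ⬝ᵥ x :=
  Finset.sum_nonneg fun _ _ => mul_self_nonneg _

theorem dotProduct_self_pos {k : ℕ} {x : Fin k → ℝ} (h : x ≠ 0) : 0 < x ⬝ᵥ x := by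
  refine lt_of_le_of_ne (dotProduct_self_nonneg' x) fun h' => h ?_
  exact dotProduct_self_eq_zero.1 h'.symm

variable {m : ℕ} {δ : ℝ}

theorem CGRun.r_pos (h : CGRun A b m δ) {k : ℕ} (hk : k < m) :
    0 < (cg A b k).r ⬝ᵥ (cg A b k).r := lt_of_lt_of_le (pow_pos h.pos 2) (h.run k hk)

theorem CGRun.quad_pos (h : CGRun A b m δ) {x : Fin n → ℝ} (hx : x ≠ 0) : 0 < x ⬝ᵥ A *ᵥ x :=
  lt_of_lt_of_le (mul_pos h.pos (dotProduct_self_pos hx)) (h.lower x)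

/-- The orthogonality relations up to step `k`. -/
theorem CGRun.orth (h : CGRun A b m δ) (k : ℕ) (hk : k ≤ m) :
    (∀ i < k, (cg A b k).r ⬝ᵥ (cg A b i).p = 0) ∧
    (∀ i < k, (cg A b k).p ⬝ᵥ A *ᵥ (cg A b i).p = 0) ∧
    (∀ i < k, (cg A b k).r ⬝ᵥ (cg A b i).r = 0) ∧
    (cg A b k).r ⬝ᵥ (cg A b k).p = (cg A b k).r ⬝ᵥ (cg A b k).r ∧
    (∀ i < k, 0 < (cg A b i).p ⬝ᵥ A *ᵥ (cg A b i).p) := by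
  induction k with
  | zero => exact ⟨by simp, by simp, by simp, rfl, by simp⟩
  | succ k ih =>
    obtain ⟨h1, h2, h3, h4, h5⟩ := ih (by omega)
    have hr := h.r_pos (show k < m by omega)
    -- `p_k` cannot vanish, since its inner product with `r_k` is `r_k ⬝ᵥ r_k > 0`.
    have hp : 0 < (cg A b k).p ⬝ᵥ A *ᵥ (cg A b k).p := by
      refine h.quad_pos fun hz => ?_
      rw [hz, dotProduct_zero] at h4
      exact hr.ne h4
    have hpos : ∀ i < k + 1, 0 < (cg A b i).p ⬝ᵥ A *ᵥ (cg A b i).p := by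
      intro i hi
      rcases Nat.lt_succ_iff_lt_or_eq.1 hi with hi | rfl
      exacts [h5 i hi, hp]
    have ha : cgAlpha A b k * ((cg A b k).p ⬝ᵥ A *ᵥ (cg A b k).p) =
        (cg A b k).r ⬝ᵥ (cg A b k).r := by
      rw [cgAlpha_eq]; field_simp
    have hR : ∀ i < k + 1, (cg A b (k + 1)).r ⬝ᵥ (cg A b i).p = 0 := by
      intro i hi
      rw [cg_r_succ, sub_dotProduct, smul_dotProduct, smul_eq_mul, dotProduct_comm (A *ᵥ _),
        dotProduct_mulVec_comm h.herm]
      rcases Nat.lt_succ_iff_lt_or_eq.1 hi with hi | rfl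
      · rw [h1 i hi, h2 i hi]; ring
      · rw [h4, ha, sub_self]
    have hRR : ∀ i < k + 1, (cg A b (k + 1)).r ⬝ᵥ (cg A b i).r = 0 := by
      intro i hi
      rcases i with _ | i
      · exact hR 0 hi
      · have : (cg A b (i + 1)).r = (cg A b (i + 1)).p - cgBeta A b i • (cg A b i).p := by
          rw [cg_p_succ]; abel
        rw [this, dotProduct_sub, dotProduct_smul, hR _ hi, hR _ (by omega)]; simp
    have h4' : (cg A b (k + 1)).r ⬝ᵥ (cg A b (k + 1)).p =
        (cg A b (k + 1)).r ⬝ᵥ (cg A b (k + 1)).r := by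
      rw [cg_p_succ, dotProduct_add, dotProduct_smul, hR k (by omega)]; simp
    refine ⟨hR, ?_, hRR, h4', hpos⟩
    intro i hi
    have hai : cgAlpha A b i ≠ 0 := by
      rw [cgAlpha_eq]
      exact div_ne_zero (h.r_pos (by omega)).ne' (hpos i hi).ne'
    -- `A p_i` is a multiple of `r_i - r_{i+1}`, which turns conjugacy of directions into
    -- orthogonality of residuals.
    have hAp : A *ᵥ (cg A b i).p = (cgAlpha A b i)⁻¹ • ((cg A b i).r - (cg A b (i + 1)).r) := by
      rw [cg_r_succ, sub_sub_cancel, smul_smul, inv_mul_cancel₀ hai, one_smul]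
    rw [cg_p_succ, add_dotProduct, smul_dotProduct]
    rcases Nat.lt_succ_iff_lt_or_eq.1 hi with hi | rfl
    · rw [h2 i hi, hAp, dotProduct_smul, dotProduct_sub, hRR i (by omega), hRR (i + 1) (by omega)]
      simp
    -- For the last direction the orthogonality leaves one term, and `β` is the number that cancels
    -- it.
    · rw [hAp, dotProduct_smul (_ : ℝ) (cg A b (i + 1)).r, dotProduct_sub, hRR i (by omega), ← hAp,
        cgBeta_eq, smul_eq_mul, smul_eq_mul, cgAlpha_eq]
      have := hp.ne'
      have := hr.ne'
      field_simp
      ring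

theorem CGRun.p_pos (h : CGRun A b m δ) {k : ℕ} (hk : k < m) :
    0 < (cg A b k).p ⬝ᵥ A *ᵥ (cg A b k).p := (h.orth (k + 1) hk).2.2.2.2 k (by omega)

theorem CGRun.alpha_pos (h : CGRun A b m δ) {k : ℕ} (hk : k < m) : 0 < cgAlpha A b k :=
  div_pos (h.r_pos hk) (h.p_pos hk)

theorem CGRun.r_orth (h : CGRun A b m δ) {i j : ℕ} (hi : i ≤ m) (hj : j ≤ m) (hij : i ≠ j) :
    (cg A b i).r ⬝ᵥ (cg A b j).r = 0 := by
  rcases Nat.lt_or_gt_of_ne hij with hlt | hlt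
  · rw [dotProduct_comm]; exact (h.orth j hj).2.2.1 i hlt
  · exact (h.orth i hi).2.2.1 j hlt

theorem CGRun.mulVec_p (h : CGRun A b m δ) {k : ℕ} (hk : k < m) :
    A *ᵥ (cg A b k).p = (cgAlpha A b k)⁻¹ • ((cg A b k).r - (cg A b (k + 1)).r) := by
  rw [cg_r_succ, sub_sub_cancel, smul_smul, inv_mul_cancel₀ (h.alpha_pos hk).ne', one_smul]

theorem CGRun.mulVec_r_zero (h : CGRun A b m δ) (hm : 0 < m) :
    A *ᵥ (cg A b 0).r = (cgAlpha A b 0)⁻¹ • ((cg A b 0).r - (cg A b 1).r) := h.mulVec_p hm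

theorem CGRun.mulVec_r_succ (h : CGRun A b m δ) {k : ℕ} (hk : k + 1 < m) :
    A *ᵥ (cg A b (k + 1)).r =
      (cgAlpha A b (k + 1))⁻¹ • ((cg A b (k + 1)).r - (cg A b (k + 2)).r) -
        (cgBeta A b k * (cgAlpha A b k)⁻¹) • ((cg A b k).r - (cg A b (k + 1)).r) := by
  have : (cg A b (k + 1)).r = (cg A b (k + 1)).p - cgBeta A b k • (cg A b k).p := by
    rw [cg_p_succ]; abel
  conv_lhs => rw [this]
  rw [mulVec_sub, mulVec_smul, h.mulVec_p hk, h.mulVec_p (by omega : k < m), smul_smul]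

/-- `p` arises from `r` by adding a multiple of the old direction. That direction is orthogonal to
`r`, so `p ⬝ᵥ p ≥ r ⬝ᵥ r`, and `A`-orthogonal to `p`, so `pᵀAp ≤ rᵀAr`. The bounds on the form of
`A` do the rest. -/
theorem CGRun.alpha_inv_mem (h : CGRun A b m δ) {k : ℕ} (hk : k < m) :
    δ ≤ (cgAlpha A b k)⁻¹ ∧ (cgAlpha A b k)⁻¹ ≤ 1 := by
  have hr := h.r_pos hk
  rw [cgAlpha_eq, inv_div]
  rcases k with _ | k
  · have h1 := h.lower (cg A b 0).p
    have h2 := h.upper (cg A b 0).p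
    rw [le_div_iff₀ hr, div_le_iff₀ hr, one_mul]
    exact ⟨h1, h2⟩
  · obtain ⟨h1, h2, -⟩ := h.orth (k + 1) hk.le
    have e1 := h1 k (by omega)
    have e2 := h2 k (by omega)
    have e3 := h.p_pos (show k < m by omega)
    have e4 := dotProduct_self_nonneg' (cg A b k).p
    have l := h.lower (cg A b (k + 1)).p
    have u := h.upper (cg A b (k + 1)).r
    rw [le_div_iff₀ hr, div_le_iff₀ hr, one_mul]
    constructor
    · refine le_trans (mul_le_mul_of_nonneg_left ?_ h.pos.le) l
      rw [cg_p_succ, add_dotProduct, dotProduct_add, dotProduct_add, smul_dotProduct,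
        smul_dotProduct, dotProduct_smul, dotProduct_smul, dotProduct_comm (cg A b k).p (cg A b (k+1)).r,
        e1]
      simp only [smul_eq_mul, mul_zero, zero_add, add_zero]
      nlinarith [mul_nonneg (mul_self_nonneg (cgBeta A b k)) e4]
    · refine le_trans ?_ u
      have : (cg A b (k + 1)).r = (cg A b (k + 1)).p - cgBeta A b k • (cg A b k).p := by
        rw [cg_p_succ]; abel
      rw [this, mulVec_sub, mulVec_smul, sub_dotProduct, dotProduct_sub, dotProduct_sub,
        smul_dotProduct, smul_dotProduct, dotProduct_smul, dotProduct_smul,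
        dotProduct_mulVec_comm h.herm (cg A b k).p (cg A b (k+1)).p, e2]
      simp only [smul_eq_mul, mul_zero, zero_sub, sub_zero]
      nlinarith [mul_nonneg (mul_self_nonneg (cgBeta A b k)) e3.le]

/-- The iteration cannot run for long when `δ` is not small. -/
theorem CGRun.steps_le (h : CGRun A b m δ) : (m : ℝ) * δ ^ 3 ≤ 1 := by
  -- The energy `b ⬝ᵥ x_k = x_kᵀAx_k` grows in each step by `α_k ‖r_k‖² ≥ δ²`, because `α_k ≥ 1`.
  -- The first clause, conjugacy of `x_k` to the directions still to come, carries the induction.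
  have key : ∀ k ≤ m, (∀ j, k ≤ j → j < m → (cg A b k).x ⬝ᵥ A *ᵥ (cg A b j).p = 0) ∧
      b ⬝ᵥ (cg A b k).x = (cg A b k).x ⬝ᵥ A *ᵥ (cg A b k).x ∧
      k * δ ^ 2 ≤ b ⬝ᵥ (cg A b k).x := by
    intro k
    induction k with
    | zero => intro _; refine ⟨?_, ?_, ?_⟩ <;> simp [cg]
    | succ k ih =>
      intro hk
      obtain ⟨h1, h2, h3⟩ := ih (by omega)
      have hx : (cg A b (k + 1)).x = (cg A b k).x + cgAlpha A b k • (cg A b k).p := rfl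
      have hbp : b ⬝ᵥ (cg A b k).p = (cg A b k).r ⬝ᵥ (cg A b k).r := by
        clear ih h1 h2 h3 hx
        induction k with
        | zero => rfl
        | succ k ih =>
          have : b ⬝ᵥ (cg A b (k + 1)).r = 0 :=
            h.r_orth (i := 0) (by omega) (by omega) (by omega)
          rw [cg_p_succ, dotProduct_add, dotProduct_smul, ih (by omega), this, cgBeta_eq,
            smul_eq_mul]
          have := (h.r_pos (show k < m by omega)).ne'
          field_simp
          ring
      have ha : cgAlpha A b k * ((cg A b k).p ⬝ᵥ A *ᵥ (cg A b k).p) =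
          (cg A b k).r ⬝ᵥ (cg A b k).r := by
        rw [cgAlpha_eq]
        have := (h.p_pos (show k < m by omega)).ne'
        field_simp
      refine ⟨fun j hj hjm => ?_, ?_, ?_⟩
      · rw [hx, add_dotProduct, smul_dotProduct, h1 j (by omega) hjm,
          dotProduct_mulVec_comm h.herm, (h.orth j hjm.le).2.1 k (by omega)]
        simp
      · rw [hx, dotProduct_add, dotProduct_smul, hbp, h2, mulVec_add, mulVec_smul, add_dotProduct,
          dotProduct_add, dotProduct_add, smul_dotProduct, smul_dotProduct, dotProduct_smul,
          dotProduct_smul, dotProduct_mulVec_comm h.herm (cg A b k).p (cg A b k).x,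
          h1 k le_rfl (by omega)]
        simp only [smul_eq_mul, mul_zero, add_zero, zero_add]
        rw [ha]
      · rw [hx, dotProduct_add, dotProduct_smul, hbp, smul_eq_mul]
        have h4 := h.run k (by omega)
        have h5 : 1 ≤ cgAlpha A b k := by
          have := (h.alpha_inv_mem (show k < m by omega)).2
          rwa [inv_le_one₀ (h.alpha_pos (by omega))] at this
        push_cast
        nlinarith [pow_pos h.pos 2]
  obtain ⟨-, h2, h3⟩ := key m le_rfl
  set x := (cg A b m).x
  have h4 := h.lower x
  have h5 : (b ⬝ᵥ x) ^ 2 ≤ (b ⬝ᵥ b) * (x ⬝ᵥ x) := by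
    have := Finset.sum_mul_sq_le_sq_mul_sq Finset.univ b x
    simpa [dotProduct, sq] using this
  rw [h.unit, one_mul] at h5
  rw [← h2] at h4
  -- Coercivity and Cauchy–Schwarz bound the energy by `1 / δ`.
  have h6 : δ * (b ⬝ᵥ x) ≤ 1 := by
    by_contra hc
    push Not at hc
    nlinarith [h.pos]
  nlinarith [h.pos]

end CG

end

noncomputable section

/-! ### The Lanczos basis -/

section Lanczos

variable {n : ℕ} {A : Matrix (Fin n) (Fin n) ℝ} {b : Fin n → ℝ} {m : ℕ} {δ : ℝ}

/-- The norm of the residual. -/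
def cgNorm (A : Matrix (Fin n) (Fin n) ℝ) (b : Fin n → ℝ) (k : ℕ) : ℝ :=
  Real.sqrt ((cg A b k).r ⬝ᵥ (cg A b k).r)

/-- The Lanczos vectors. -/
def lanczosVec (A : Matrix (Fin n) (Fin n) ℝ) (b : Fin n → ℝ) (k : ℕ) : Fin n → ℝ :=
  -- The alternating sign makes the off-diagonal entries of the compression equal to `+√β_i / α_i`.
  ((-1) ^ k / cgNorm A b k) • (cg A b k).r

theorem cgNorm_sq (k : ℕ) : cgNorm A b k ^ 2 = (cg A b k).r ⬝ᵥ (cg A b k).r :=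
  Real.sq_sqrt (dotProduct_self_nonneg' _)

theorem CGRun.cgNorm_pos (h : CGRun A b m δ) {k : ℕ} (hk : k < m) : 0 < cgNorm A b k :=
  Real.sqrt_pos.2 (h.r_pos hk)

theorem CGRun.lanczosVec_orth (h : CGRun A b m δ) {i j : ℕ} (hi : i < m) (hj : j < m) :
    lanczosVec A b i ⬝ᵥ lanczosVec A b j = if i = j then 1 else 0 := by
  rw [lanczosVec, lanczosVec, smul_dotProduct, dotProduct_smul, smul_eq_mul, smul_eq_mul]
  split_ifs with hij
  · subst hij
    rw [← cgNorm_sq]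
    have := (h.cgNorm_pos hi).ne'
    field_simp
    rw [← pow_mul, mul_comm, pow_mul]; simp
  · rw [h.r_orth hi.le hj.le hij]; simp

theorem sqrt_cgBeta (k : ℕ) :
    Real.sqrt (cgBeta A b k) = cgNorm A b (k + 1) / cgNorm A b k := by
  rw [cgBeta_eq, Real.sqrt_div (dotProduct_self_nonneg' _)]; rfl

theorem lanczosMatrix_isHermitian : (lanczosMatrix A b m).IsHermitian := by
  ext i j
  simp only [conjTranspose_apply, lanczosMatrix, of_apply, star_trivial]
  by_cases hij : i = j
  · subst hij; rfl
  · have hij' : ¬j = i := fun h => hij h.symm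
    simp only [hij, hij', if_false]
    by_cases h1 : (i : ℕ) + 1 = j
    · have h2 : ¬(j : ℕ) + 1 = i := by omega
      simp only [h1, h2, if_true, if_false]
    · simp only [h1, if_false]

/-- The entries of the tridiagonal matrix are the matrix elements in the Lanczos basis, on and
above the diagonal. -/
theorem CGRun.lanczosVec_mulVec_le (h : CGRun A b m δ) {i j : Fin m} (hij : i ≤ j) :
    lanczosVec A b i ⬝ᵥ A *ᵥ lanczosVec A b j = lanczosMatrix A b m i j := by
  have hi := i.2
  have hj := j.2
  have hij' : (i : ℕ) ≤ j := hij
  have hni := (h.cgNorm_pos hi).ne'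
  have hnj := (h.cgNorm_pos hj).ne'
  have hsq : ∀ k : ℕ, ((-1 : ℝ) ^ k) ^ 2 = 1 := fun k => by rw [← pow_mul, mul_comm, pow_mul]; simp
  have key : lanczosVec A b i ⬝ᵥ A *ᵥ lanczosVec A b j =
      ((-1) ^ (i : ℕ) / cgNorm A b i) * ((-1) ^ (j : ℕ) / cgNorm A b j) *
        ((cg A b i).r ⬝ᵥ A *ᵥ (cg A b j).r) := by
    rw [lanczosVec, lanczosVec, mulVec_smul, smul_dotProduct, dotProduct_smul, smul_eq_mul,
      smul_eq_mul, mul_assoc]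
  rw [key, lanczosMatrix, of_apply]
  by_cases hij : i = j
  · subst hij
    rw [if_pos rfl]
    have e : ((-1 : ℝ) ^ (i : ℕ) / cgNorm A b i) * ((-1) ^ (i : ℕ) / cgNorm A b i) =
        1 / cgNorm A b i ^ 2 := by
      rw [div_mul_div_comm, ← sq, hsq, ← sq]
    rw [e]
    obtain ⟨i, hi⟩ := i
    simp only at *
    rcases i with _ | i
    · rw [h.mulVec_r_zero hi, dotProduct_smul, dotProduct_sub, ← cgNorm_sq]
      by_cases h1 : 1 ≤ m
      · rw [h.r_orth (i := 0) (j := 1) (by omega) h1 (by omega)]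
        simp only [smul_eq_mul, if_true]
        field_simp
        ring
      · omega
    · rw [h.mulVec_r_succ hi, dotProduct_sub, dotProduct_smul, dotProduct_smul, dotProduct_sub,
        dotProduct_sub, h.r_orth (i := i + 1) (j := i + 2) (by omega) (by omega) (by omega),
        h.r_orth (i := i + 1) (j := i) (by omega) (by omega) (by omega), ← cgNorm_sq]
      simp only [smul_eq_mul, Nat.add_sub_cancel, Nat.succ_ne_zero, if_false]
      field_simp
      ring
  · rw [if_neg hij]
    have hlt : (i : ℕ) < j := lt_of_le_of_ne hij' fun h => hij (Fin.ext h)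
    rw [dotProduct_mulVec_comm h.herm]
    obtain ⟨i, hi⟩ := i
    obtain ⟨j, hj⟩ := j
    simp only at *
    have orth : ∀ k, k ≤ m → k ≠ j → (cg A b j).r ⬝ᵥ (cg A b k).r = 0 :=
      fun k hk hkj => h.r_orth hj.le hk hkj.symm
    by_cases h1 : i + 1 = j
    · subst h1
      rw [if_pos rfl, sqrt_cgBeta]
      have e2 : (cg A b (i + 1)).r ⬝ᵥ A *ᵥ (cg A b i).r =
          -(cgNorm A b (i + 1) ^ 2 * (cgAlpha A b i)⁻¹) := by
        rw [cgNorm_sq]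
        rcases i with _ | i
        · rw [h.mulVec_r_zero hi, dotProduct_smul, dotProduct_sub, orth 0 (by omega) (by omega)]
          simp only [smul_eq_mul]; ring
        · rw [h.mulVec_r_succ hi, dotProduct_sub, dotProduct_smul, dotProduct_smul, dotProduct_sub,
            dotProduct_sub, orth i (by omega) (by omega), orth (i + 1) (by omega) (by omega)]
          simp only [smul_eq_mul]; ring
      rw [e2]
      have e3 : ((-1 : ℝ) ^ i) * (-1) ^ (i + 1) = -1 := by
        rw [pow_succ, ← mul_assoc, ← sq, hsq]; ring
      have : (-1 : ℝ) ^ i / cgNorm A b i * ((-1) ^ (i + 1) / cgNorm A b (i + 1)) *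
          -(cgNorm A b (i + 1) ^ 2 * (cgAlpha A b i)⁻¹) = -(((-1 : ℝ) ^ i) * (-1) ^ (i + 1)) *
          (cgNorm A b (i + 1) / cgNorm A b i / cgAlpha A b i) := by
        field_simp
      rw [this, e3]; ring
    · rw [if_neg h1, if_neg (by omega)]
      have e2 : (cg A b j).r ⬝ᵥ A *ᵥ (cg A b i).r = 0 := by
        rcases i with _ | i
        · rw [h.mulVec_r_zero hi, dotProduct_smul, dotProduct_sub, orth 0 (by omega) (by omega),
            orth 1 (by omega) (by omega)]
          simp
        · rw [h.mulVec_r_succ hi, dotProduct_sub, dotProduct_smul, dotProduct_smul, dotProduct_sub,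
            dotProduct_sub, orth i (by omega) (by omega), orth (i + 1) (by omega) (by omega),
            orth (i + 2) (by omega) (by omega)]
          simp
      rw [e2, mul_zero]

/-- The tridiagonal matrix is the compression of `A` in the Lanczos basis. -/
theorem CGRun.lanczosVec_mulVec (h : CGRun A b m δ) (i j : Fin m) :
    lanczosVec A b i ⬝ᵥ A *ᵥ lanczosVec A b j = lanczosMatrix A b m i j := by
  rcases le_total i j with hij | hij
  · exact h.lanczosVec_mulVec_le hij
  · rw [dotProduct_mulVec_comm h.herm, h.lanczosVec_mulVec_le hij,
      ← (lanczosMatrix_isHermitian (A := A) (b := b) (m := m)).apply]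
    rfl

/-- The vector with given coordinates in the Lanczos basis. -/
def lanczosComb (A : Matrix (Fin n) (Fin n) ℝ) (b : Fin n → ℝ) (w : Fin m → ℝ) : Fin n → ℝ :=
  ∑ k : Fin m, w k • lanczosVec A b k

theorem CGRun.lanczosComb_dot (h : CGRun A b m δ) (w : Fin m → ℝ) :
    lanczosComb A b w ⬝ᵥ lanczosComb A b w = w ⬝ᵥ w := by
  simp only [lanczosComb, sum_dotProduct, dotProduct_sum, smul_dotProduct, dotProduct_smul,
    smul_eq_mul]
  rw [dotProduct]
  refine Finset.sum_congr rfl fun i _ => ?_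
  rw [Finset.sum_eq_single i]
  · rw [h.lanczosVec_orth i.2 i.2]; simp
  · intro j _ hj
    rw [h.lanczosVec_orth j.2 i.2, if_neg (fun e => hj (Fin.ext e))]; simp
  · simp

/-- With `lanczosComb_dot` this identifies the Rayleigh quotients of the tridiagonal matrix with
those of `A` on the Krylov space. -/
theorem CGRun.lanczosComb_quad (h : CGRun A b m δ) (w : Fin m → ℝ) :
    lanczosComb A b w ⬝ᵥ A *ᵥ lanczosComb A b w = w ⬝ᵥ lanczosMatrix A b m *ᵥ w := by
  simp only [lanczosComb, mulVec_sum, sum_dotProduct, dotProduct_sum, smul_dotProduct, mulVec_smul,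
    dotProduct_smul, smul_eq_mul, h.lanczosVec_mulVec]
  simp only [dotProduct, mulVec, Finset.mul_sum]
  rw [Finset.sum_comm]
  refine Finset.sum_congr rfl fun i _ => Finset.sum_congr rfl fun j _ => ?_
  ring

theorem CGRun.le_one (h : CGRun A b m δ) : δ ≤ 1 := by
  have h1 := h.lower b
  have h2 := h.upper b
  rw [h.unit] at h1 h2
  linarith

/-- The norms of the monic orthogonal polynomials. -/
def monicNorm (A : Matrix (Fin n) (Fin n) ℝ) (b : Fin n → ℝ) (k : ℕ) : ℝ :=
  -- The residual is a polynomial in `A` applied to `b`, with leading coefficient `∏ (-α_i)`; hence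
  -- the inverse product.
  cgNorm A b k * ∏ i ∈ Finset.range k, (cgAlpha A b i)⁻¹

theorem CGRun.monicNorm_zero (h : CGRun A b m δ) : monicNorm A b 0 = 1 := by
  simp only [monicNorm, cgNorm, Finset.range_zero, Finset.prod_empty, mul_one]
  show Real.sqrt (b ⬝ᵥ b) = 1
  rw [h.unit, Real.sqrt_one]

theorem CGRun.monicNorm_pos (h : CGRun A b m δ) {k : ℕ} (hk : k < m) : 0 < monicNorm A b k :=
  mul_pos (h.cgNorm_pos hk) (Finset.prod_pos fun _ hi =>
    inv_pos.2 (h.alpha_pos ((Finset.mem_range.1 hi).trans hk)))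

/-- Residual norms are at least `δ` before step `m`, and so are all factors `1 / α_i`. Here the
powers of `δ` in the required accuracy originate. -/
theorem CGRun.pow_le_monicNorm (h : CGRun A b m δ) {k : ℕ} (hk : k < m) :
    δ ^ (k + 1) ≤ monicNorm A b k := by
  have h1 : δ ≤ cgNorm A b k := by
    rw [cgNorm]; exact Real.le_sqrt_of_sq_le (h.run k hk)
  have h2 : δ ^ k ≤ ∏ i ∈ Finset.range k, (cgAlpha A b i)⁻¹ := by
    calc δ ^ k = ∏ _i ∈ Finset.range k, δ := by simp
      _ ≤ _ := Finset.prod_le_prod (fun _ _ => h.pos.le) fun _ hi =>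
        (h.alpha_inv_mem ((Finset.mem_range.1 hi).trans hk)).1
  rw [pow_succ', monicNorm]
  exact mul_le_mul h1 h2 (pow_nonneg h.pos.le _) (h.cgNorm_pos hk).le

/-- The monic Lanczos vectors. -/
def monicVec (A : Matrix (Fin n) (Fin n) ℝ) (b : Fin n → ℝ) (k : ℕ) : Fin n → ℝ :=
  monicNorm A b k • lanczosVec A b k

theorem CGRun.monicVec_eq (h : CGRun A b m δ) {k : ℕ} (hk : k < m) : monicVec A b k =
    (∏ i ∈ Finset.range k, -(cgAlpha A b i)⁻¹) • (cg A b k).r := by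
  rw [monicVec, lanczosVec, smul_smul, monicNorm, Finset.prod_neg, Finset.card_range]
  have := (h.cgNorm_pos hk).ne'
  congr 1
  field_simp

/-- The diagonal recurrence coefficient. -/
def recA (A : Matrix (Fin n) (Fin n) ℝ) (b : Fin n → ℝ) (k : ℕ) : ℝ :=
  lanczosVec A b k ⬝ᵥ A *ᵥ lanczosVec A b k

/-- The off-diagonal recurrence coefficient. -/
def recB (A : Matrix (Fin n) (Fin n) ℝ) (b : Fin n → ℝ) (k : ℕ) : ℝ :=
  (lanczosVec A b k ⬝ᵥ A *ᵥ lanczosVec A b (k + 1)) ^ 2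

theorem CGRun.recA_mem (h : CGRun A b m δ) {k : ℕ} (hk : k < m) :
    0 ≤ recA A b k ∧ recA A b k ≤ 1 := by
  have h1 := h.lower (lanczosVec A b k)
  have h2 := h.upper (lanczosVec A b k)
  rw [h.lanczosVec_orth hk hk, if_pos rfl] at h1 h2
  exact ⟨by have := h.pos; unfold recA; linarith, h2⟩

/-- The form of `A` is nonnegative at the sum and the difference of two Lanczos vectors, so the
mixed term is at most the mean of two values that are at most 1. -/
theorem CGRun.recB_mem (h : CGRun A b m δ) {k : ℕ} (hk : k + 1 < m) :
    0 ≤ recB A b k ∧ recB A b k ≤ 1 := by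
  refine ⟨sq_nonneg _, ?_⟩
  set x := lanczosVec A b k
  set y := lanczosVec A b (k + 1)
  have hx := h.upper x
  have hy := h.upper y
  have h1 := h.lower (x + y)
  have h2 := h.lower (x - y)
  have h3 := dotProduct_self_nonneg' (x + y)
  have h4 := dotProduct_self_nonneg' (x - y)
  rw [h.lanczosVec_orth (by omega) (by omega), if_pos rfl] at hx hy
  have e1 : (x + y) ⬝ᵥ A *ᵥ (x + y) = x ⬝ᵥ A *ᵥ x + 2 * (x ⬝ᵥ A *ᵥ y) + y ⬝ᵥ A *ᵥ y := by
    rw [mulVec_add, add_dotProduct, dotProduct_add, dotProduct_add,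
      dotProduct_mulVec_comm h.herm y x]; ring
  have e2 : (x - y) ⬝ᵥ A *ᵥ (x - y) = x ⬝ᵥ A *ᵥ x - 2 * (x ⬝ᵥ A *ᵥ y) + y ⬝ᵥ A *ᵥ y := by
    rw [mulVec_sub, sub_dotProduct, dotProduct_sub, dotProduct_sub,
      dotProduct_mulVec_comm h.herm y x]; ring
  have h5 := mul_nonneg h.pos.le h3
  have h6 := mul_nonneg h.pos.le h4
  show (x ⬝ᵥ A *ᵥ y) ^ 2 ≤ 1
  rw [sq_le_one_iff_abs_le_one, abs_le]
  constructor <;> linarith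

theorem CGRun.recA_eq (h : CGRun A b m δ) {k : ℕ} (hk : k < m) :
    recA A b k = 1 / cgAlpha A b k +
      (if k = 0 then 0 else cgBeta A b (k - 1) / cgAlpha A b (k - 1)) := by
  have := h.lanczosVec_mulVec ⟨k, hk⟩ ⟨k, hk⟩
  rw [recA, this, lanczosMatrix, of_apply, if_pos rfl]

theorem CGRun.recB_eq (h : CGRun A b m δ) {k : ℕ} (hk : k + 1 < m) :
    recB A b k = cgBeta A b k / cgAlpha A b k ^ 2 := by
  have := h.lanczosVec_mulVec ⟨k, by omega⟩ ⟨k + 1, hk⟩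
  rw [recB, this, lanczosMatrix, of_apply, if_neg (by simp), if_pos rfl, div_pow, Real.sq_sqrt]
  rw [cgBeta_eq]
  exact div_nonneg (dotProduct_self_nonneg' _) (dotProduct_self_nonneg' _)

theorem CGRun.monicVec_one (h : CGRun A b m δ) (hm : 1 < m) :
    monicVec A b 1 = A *ᵥ monicVec A b 0 - recA A b 0 • monicVec A b 0 := by
  rw [h.monicVec_eq hm, h.monicVec_eq (by omega : 0 < m), h.recA_eq (by omega)]
  simp only [Finset.range_zero, Finset.prod_empty, one_smul, Finset.range_one,
    Finset.prod_singleton, if_true, add_zero, one_div]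
  rw [h.mulVec_r_zero (by omega)]
  module

/-- This is the expression of `A r_{k+1}` by three neighbouring residuals, rescaled to leading
coefficient 1. -/
theorem CGRun.monicVec_succ_succ (h : CGRun A b m δ) {k : ℕ} (hk : k + 2 < m) :
    monicVec A b (k + 2) = A *ᵥ monicVec A b (k + 1) - recA A b (k + 1) • monicVec A b (k + 1) -
      recB A b k • monicVec A b k := by
  rw [h.monicVec_eq hk, h.monicVec_eq (by omega : k + 1 < m), h.monicVec_eq (by omega : k < m),
    h.recA_eq (by omega), h.recB_eq (by omega), mulVec_smul, h.mulVec_r_succ (by omega),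
    Finset.prod_range_succ, Finset.prod_range_succ]
  simp only [Nat.succ_ne_zero, if_false, Nat.add_sub_cancel]
  set D := ∏ i ∈ Finset.range k, -(cgAlpha A b i)⁻¹
  have := (h.alpha_pos (show k < m by omega)).ne'
  have := (h.alpha_pos (show k + 1 < m by omega)).ne'
  match_scalars <;> field_simp <;> ring

end Lanczos
end

noncomputable section

/-! ### Coordinates in the basis of powers -/

section Krylov

open Polynomial

variable {n : ℕ} {A : Matrix (Fin n) (Fin n) ℝ} {b : Fin n → ℝ} {m : ℕ} {δ : ℝ}

/-- The monic Lanczos polynomials in the variable `A - 1/2`. -/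
def monicPoly (A : Matrix (Fin n) (Fin n) ℝ) (b : Fin n → ℝ) : ℕ → ℝ[X]
  | 0 => 1
  | 1 => X - C (recA A b 0 - 1 / 2)
  | k + 2 => (X - C (recA A b (k + 1) - 1 / 2)) * monicPoly A b (k + 1) -
      C (recB A b k) * monicPoly A b k

/-- The sum of the absolute values of the first `N` coefficients. -/
def coeffSum (N : ℕ) (p : ℝ[X]) : ℝ := ∑ i ∈ Finset.range N, |p.coeff i|

theorem coeffSum_sub_le (N : ℕ) (p q : ℝ[X]) : coeffSum N (p - q) ≤ coeffSum N p + coeffSum N q := by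
  unfold coeffSum
  rw [← Finset.sum_add_distrib]
  exact Finset.sum_le_sum fun i _ => by rw [coeff_sub]; exact abs_sub _ _

theorem coeffSum_C_mul (N : ℕ) (a : ℝ) (p : ℝ[X]) : coeffSum N (C a * p) = |a| * coeffSum N p := by
  unfold coeffSum
  rw [Finset.mul_sum]
  exact Finset.sum_congr rfl fun i _ => by rw [coeff_C_mul, abs_mul]

theorem coeffSum_X_mul_le (N : ℕ) (p : ℝ[X]) : coeffSum N (X * p) ≤ coeffSum N p := by
  unfold coeffSum
  cases N with
  | zero => simp
  | succ N =>
    rw [Finset.sum_range_succ']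
    simp only [coeff_X_mul, coeff_X_mul_zero, abs_zero, add_zero]
    exact Finset.sum_le_sum_of_subset_of_nonneg (Finset.range_subset_range.2 (by omega))
      fun _ _ _ => abs_nonneg _

theorem coeffSum_linear_mul_le (N : ℕ) (a : ℝ) (p : ℝ[X]) :
    coeffSum N ((X - C a) * p) ≤ (1 + |a|) * coeffSum N p := by
  rw [sub_mul]
  refine (coeffSum_sub_le _ _ _).trans ?_
  rw [coeffSum_C_mul]
  linarith [coeffSum_X_mul_le N p]

theorem coeffSum_one_le (N : ℕ) : coeffSum N 1 ≤ 1 := by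
  unfold coeffSum
  cases N with
  | zero => simp
  | succ N =>
    rw [Finset.sum_range_succ']
    simp [coeff_one]

theorem coeffSum_nonneg (N : ℕ) (p : ℝ[X]) : 0 ≤ coeffSum N p :=
  Finset.sum_nonneg fun _ _ => abs_nonneg _

/-- Centring at 1/2 makes the diagonal coefficients at most 1/2 in absolute value, and the
recurrence then gives `(1 + 1/2) 2^(k+1) + 2^k = 2^(k+2)`. -/
theorem CGRun.coeffSum_monicPoly (h : CGRun A b m δ) (N : ℕ) {k : ℕ} (hk : k < m) :
    coeffSum N (monicPoly A b k) ≤ 2 ^ k := by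
  have hrec : ∀ k < m, |recA A b k - 1 / 2| ≤ 1 / 2 := fun k hk => by
    have := h.recA_mem hk
    rw [abs_le]; constructor <;> linarith
  induction k using Nat.twoStepInduction with
  | zero => simpa [monicPoly] using coeffSum_one_le N
  | one =>
    rw [monicPoly, ← mul_one (X - C _)]
    refine (coeffSum_linear_mul_le _ _ _).trans ?_
    nlinarith [hrec 0 (by omega), coeffSum_one_le N, coeffSum_nonneg N 1,
      abs_nonneg (recA A b 0 - 1 / 2)]
  | more k ih1 ih2 =>
    rw [monicPoly]
    refine (coeffSum_sub_le _ _ _).trans ?_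
    rw [coeffSum_C_mul]
    have h1 := coeffSum_linear_mul_le N (recA A b (k + 1) - 1 / 2) (monicPoly A b (k + 1))
    have h2 := hrec (k + 1) (by omega)
    have h3 := h.recB_mem (show k + 1 < m by omega)
    have h4 := ih1 (by omega)
    have h5 := ih2 (by omega)
    have h6 := coeffSum_nonneg N (monicPoly A b (k + 1))
    have h7 := coeffSum_nonneg N (monicPoly A b k)
    rw [abs_of_nonneg h3.1]
    have h8 : recB A b k * coeffSum N (monicPoly A b k) ≤ 1 * 2 ^ k :=
      mul_le_mul h3.2 h4 h7 zero_le_one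
    have h9 : (1 + |recA A b (k + 1) - 1 / 2|) * coeffSum N (monicPoly A b (k + 1)) ≤
        (1 + 1 / 2) * 2 ^ (k + 1) := mul_le_mul (by linarith) h5 h6 (by norm_num)
    have : (2 : ℝ) ^ (k + 2) = 4 * 2 ^ k := by ring
    have : (2 : ℝ) ^ (k + 1) = 2 * 2 ^ k := by ring
    linarith

theorem natDegree_monicPoly (k : ℕ) : (monicPoly A b k).natDegree ≤ k := by
  induction k using Nat.twoStepInduction with
  | zero => simp [monicPoly]
  | one => rw [monicPoly]; exact natDegree_X_sub_C_le _
  | more k ih1 ih2 =>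
    rw [monicPoly]
    refine (natDegree_sub_le _ _).trans (max_le ?_ ?_)
    · refine natDegree_mul_le.trans ?_
      have := natDegree_X_sub_C_le (recA A b (k + 1) - 1 / 2)
      omega
    · refine natDegree_mul_le.trans ?_
      rw [natDegree_C]; omega

theorem CGRun.monicVec_eq_aeval (h : CGRun A b m δ) {k : ℕ} (hk : k < m) :
    monicVec A b k = aeval (A - (1 / 2 : ℝ) • (1 : Matrix (Fin n) (Fin n) ℝ)) (monicPoly A b k) *ᵥ b := by
  have hlin : ∀ (a : ℝ) (p : ℝ[X]), aeval (A - (1 / 2 : ℝ) • (1 : Matrix (Fin n) (Fin n) ℝ))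
      ((X - C (a - 1 / 2)) * p) *ᵥ b =
      A *ᵥ (aeval (A - (1 / 2 : ℝ) • (1 : Matrix (Fin n) (Fin n) ℝ)) p *ᵥ b) -
      a • (aeval (A - (1 / 2 : ℝ) • (1 : Matrix (Fin n) (Fin n) ℝ)) p *ᵥ b) := by
    intro a p
    rw [map_mul, ← mulVec_mulVec, map_sub, aeval_X, aeval_C, Algebra.algebraMap_eq_smul_one,
      sub_mulVec, sub_mulVec, smul_mulVec, smul_mulVec, one_mulVec]
    module
  have h0 : monicVec A b 0 = b := by
    rw [h.monicVec_eq (by omega)]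
    simp; rfl
  induction k using Nat.twoStepInduction with
  | zero => rw [h0, monicPoly, map_one, one_mulVec]
  | one =>
    rw [h.monicVec_one hk, monicPoly, ← mul_one (X - C _), hlin, map_one, one_mulVec, h0]
  | more k ih1 ih2 =>
    rw [h.monicVec_succ_succ hk, monicPoly, map_sub, sub_mulVec, hlin, ih1 (by omega),
      ih2 (by omega), map_mul, aeval_C, Algebra.algebraMap_eq_smul_one, smul_mul_assoc, one_mul,
      smul_mulVec]

/-- The moments of the spectral measure about `1/2`. -/
def centralMoment (hA : A.IsHermitian) (b : Fin n → ℝ) (k : ℕ) : ℝ :=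
  specInt hA b fun t => (t - 1 / 2) ^ k

/-- The quadratic form of the Hankel matrix of a sequence. -/
def hankelForm (μ : ℕ → ℝ) (c : Fin m → ℝ) : ℝ :=
  ∑ i : Fin m, ∑ j : Fin m, c i * c j * μ (i + j)

/-- The linear map from Lanczos coordinates to coordinates in the basis of powers. -/
def powerCoord (A : Matrix (Fin n) (Fin n) ℝ) (b : Fin n → ℝ) (m : ℕ) :
    (Fin m → ℝ) →ₗ[ℝ] (Fin m → ℝ) where
  toFun w i := ∑ k : Fin m, w k / monicNorm A b k * (monicPoly A b k).coeff i
  map_add' w w' := by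
    funext i; simp only [Pi.add_apply, ← Finset.sum_add_distrib]
    exact Finset.sum_congr rfl fun k _ => by ring
  map_smul' x w := by
    funext i; simp only [Pi.smul_apply, smul_eq_mul, RingHom.id_apply, Finset.mul_sum]
    exact Finset.sum_congr rfl fun k _ => by ring

theorem CGRun.lanczosComb_eq (h : CGRun A b m δ) (w : Fin m → ℝ) :
    lanczosComb A b w = ∑ i : Fin m, powerCoord A b m w i •
      ((A - (1 / 2 : ℝ) • (1 : Matrix (Fin n) (Fin n) ℝ)) ^ (i : ℕ) *ᵥ b) := by
  have h1 : ∀ k : Fin m, w k • lanczosVec A b k =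
      ∑ i : Fin m, (w k / monicNorm A b k * (monicPoly A b k).coeff i) •
        ((A - (1 / 2 : ℝ) • (1 : Matrix (Fin n) (Fin n) ℝ)) ^ (i : ℕ) *ᵥ b) := by
    intro k
    have h2 : lanczosVec A b k = (monicNorm A b k)⁻¹ • monicVec A b k := by
      rw [monicVec, smul_smul, inv_mul_cancel₀ (h.monicNorm_pos k.2).ne', one_smul]
    have h3 := natDegree_monicPoly (A := A) (b := b) k
    rw [h2, h.monicVec_eq_aeval k.2, aeval_eq_sum_range' (show _ < m by omega),
      Finset.sum_range, sum_mulVec, Finset.smul_sum, Finset.smul_sum]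
    refine Finset.sum_congr rfl fun i _ => ?_
    rw [smul_mulVec, smul_smul, smul_smul, div_eq_mul_inv (w k), mul_assoc]
  simp only [lanczosComb, h1]
  rw [Finset.sum_comm]
  refine Finset.sum_congr rfl fun i _ => ?_
  rw [← Finset.sum_smul]; rfl

/-- The Gram matrix of the vectors `(A - 1/2)^i b` is the Hankel matrix of the central moments,
while the Lanczos basis is orthonormal. -/
theorem CGRun.hankelForm_powerCoord (h : CGRun A b m δ) (w : Fin m → ℝ) :
    hankelForm (centralMoment h.herm b) (powerCoord A b m w) = w ⬝ᵥ w := by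
  rw [← h.lanczosComb_dot, h.lanczosComb_eq]
  simp only [sum_dotProduct, dotProduct_sum, smul_dotProduct, dotProduct_smul, smul_eq_mul,
    specInt_pow h.herm]
  unfold hankelForm
  refine Finset.sum_congr rfl fun i _ => ?_
  rw [Finset.mul_sum]
  refine Finset.sum_congr rfl fun j _ => ?_
  rw [centralMoment, add_comm (i : ℕ)]; ring

/-- One more factor `A - 1/2` between the vectors raises the index of every moment by one. The Ritz
values thus depend on `2 m` moments only. -/
theorem CGRun.hankelForm_powerCoord_succ (h : CGRun A b m δ) (w : Fin m → ℝ) :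
    hankelForm (fun k => centralMoment h.herm b (k + 1)) (powerCoord A b m w) =
      w ⬝ᵥ lanczosMatrix A b m *ᵥ w - 1 / 2 * (w ⬝ᵥ w) := by
  have h0 : ∀ x : Fin n → ℝ, x ⬝ᵥ A *ᵥ x - 1 / 2 * (x ⬝ᵥ x) =
      x ⬝ᵥ (A - (1 / 2 : ℝ) • (1 : Matrix (Fin n) (Fin n) ℝ)) *ᵥ x := by
    intro x
    rw [sub_mulVec, smul_mulVec, one_mulVec, dotProduct_sub, dotProduct_smul, smul_eq_mul]
  rw [← h.lanczosComb_dot, ← h.lanczosComb_quad, h0, h.lanczosComb_eq]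
  simp only [mulVec_sum, mulVec_smul, sum_dotProduct, dotProduct_sum, smul_dotProduct,
    dotProduct_smul, smul_eq_mul]
  simp only [mulVec_mulVec, ← pow_succ', specInt_pow h.herm]
  unfold hankelForm
  refine Finset.sum_congr rfl fun i _ => ?_
  rw [Finset.mul_sum]
  refine Finset.sum_congr rfl fun j _ => ?_
  simp only [centralMoment]
  rw [show (i : ℕ) + j + 1 = j + (i + 1) by ring]; ring

/-- The factor by which the change of coordinates may increase the norm. -/
def coordBound (m : ℕ) (δ : ℝ) : ℝ := if m = 1 then 1 else 16 ^ m / δ ^ (2 * m)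

/-- The normalised polynomials have coefficient sums at most `2^m / δ^m`. Cauchy–Schwarz over the `m
≤ 4^m` coordinates and squaring give `16^m / δ^(2m)`. -/
theorem CGRun.sum_abs_powerCoord (h : CGRun A b m δ) (w : Fin m → ℝ) :
    (∑ i, |powerCoord A b m w i|) ^ 2 ≤ coordBound m δ * (w ⬝ᵥ w) := by
  have h1 : ∑ i, |powerCoord A b m w i| ≤ ∑ k : Fin m, |w k| / monicNorm A b k * 2 ^ (k : ℕ) := by
    calc ∑ i, |powerCoord A b m w i|
        ≤ ∑ i : Fin m, ∑ k : Fin m, |w k| / monicNorm A b k * |(monicPoly A b k).coeff i| := by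
          refine Finset.sum_le_sum fun i _ => ?_
          show |∑ k : Fin m, w k / monicNorm A b k * (monicPoly A b k).coeff i| ≤ _
          refine (Finset.abs_sum_le_sum_abs _ _).trans ?_
          refine Finset.sum_le_sum fun k _ => ?_
          rw [abs_mul, abs_div, abs_of_pos (h.monicNorm_pos k.2)]
      _ = ∑ k : Fin m, |w k| / monicNorm A b k * coeffSum m (monicPoly A b k) := by
          rw [Finset.sum_comm]
          refine Finset.sum_congr rfl fun k _ => ?_
          rw [← Finset.mul_sum, coeffSum, Finset.sum_range]
      _ ≤ _ := by
          refine Finset.sum_le_sum fun k _ => ?_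
          exact mul_le_mul_of_nonneg_left (h.coeffSum_monicPoly m k.2)
            (div_nonneg (abs_nonneg _) (h.monicNorm_pos k.2).le)
  have h0 : 0 ≤ ∑ i, |powerCoord A b m w i| := Finset.sum_nonneg fun _ _ => abs_nonneg _
  unfold coordBound
  split_ifs with hm
  -- For `m = 1` the only polynomial is the constant 1. The factor 1 in place of `16 / δ²` is
  -- needed, as the time bound then contains only `δ⁻¹`.
  · subst hm
    rw [Fin.sum_univ_one, Fin.sum_univ_one, Fin.val_zero, h.monicNorm_zero, pow_zero, div_one,
      mul_one] at h1
    calc _ ≤ |w 0| ^ 2 := by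
          rw [Fin.sum_univ_one] at h0 ⊢; exact pow_le_pow_left₀ h0 h1 2
      _ = _ := by simp [dotProduct, sq]
  · have hδ := h.pos
    have hδ1 := h.le_one
    have h2 : ∀ k : Fin m, |w k| / monicNorm A b k * 2 ^ (k : ℕ) ≤ |w k| * (2 ^ m / δ ^ m) := by
      intro k
      have h3 : δ ^ m ≤ monicNorm A b k :=
        (pow_le_pow_of_le_one hδ.le hδ1 (by omega)).trans (h.pow_le_monicNorm k.2)
      rw [div_mul_eq_mul_div, mul_div_assoc]
      refine mul_le_mul_of_nonneg_left ?_ (abs_nonneg _)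
      exact div_le_div₀ (by positivity) (pow_le_pow_right₀ (by norm_num) k.2.le) (by positivity) h3
    have h3 : ∑ i, |powerCoord A b m w i| ≤ (∑ k, |w k|) * (2 ^ m / δ ^ m) := by
      rw [Finset.sum_mul]; exact h1.trans (Finset.sum_le_sum fun k _ => h2 k)
    have h4 : (∑ k, |w k|) ^ 2 ≤ m * (w ⬝ᵥ w) := by
      have := sq_sum_le_card_mul_sum_sq (s := Finset.univ) (f := fun k => |w k|)
      simpa [dotProduct, sq] using this
    have h5 : (m : ℝ) ≤ 4 ^ m := by
      have : m < 4 ^ m := Nat.lt_pow_self (by norm_num)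
      exact_mod_cast this.le
    calc (∑ i, |powerCoord A b m w i|) ^ 2 ≤ ((∑ k, |w k|) * (2 ^ m / δ ^ m)) ^ 2 :=
          pow_le_pow_left₀ h0 h3 2
      _ = (∑ k, |w k|) ^ 2 * (4 ^ m / δ ^ (2 * m)) := by
          rw [mul_pow, div_pow, ← pow_mul, ← pow_mul, mul_comm m 2, pow_mul]; norm_num
      _ ≤ (4 ^ m * (w ⬝ᵥ w)) * (4 ^ m / δ ^ (2 * m)) := by
          refine mul_le_mul_of_nonneg_right (h4.trans ?_) (by positivity)
          exact mul_le_mul_of_nonneg_right h5 (dotProduct_self_nonneg' w)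
      _ = _ := by
          rw [show (16 : ℝ) = 4 * 4 by norm_num, mul_pow]; ring

theorem CGRun.powerCoord_injective (h : CGRun A b m δ) : Function.Injective (powerCoord A b m) := by
  rw [← LinearMap.ker_eq_bot, LinearMap.ker_eq_bot']
  intro w hw
  have := h.hankelForm_powerCoord w
  rw [hw] at this
  simp only [hankelForm, Pi.zero_apply, mul_zero, zero_mul, Finset.sum_const_zero] at this
  exact dotProduct_self_eq_zero.1 this.symm

theorem CGRun.powerCoord_surjective (h : CGRun A b m δ) : Function.Surjective (powerCoord A b m) :=
  LinearMap.injective_iff_surjective.1 h.powerCoord_injective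

/-! ### Ritz values -/

theorem CGRun.exists_quad_lanczosMatrix (h : CGRun A b m δ) (w : Fin m → ℝ) :
    δ * (w ⬝ᵥ w) ≤ w ⬝ᵥ lanczosMatrix A b m *ᵥ w ∧ w ⬝ᵥ lanczosMatrix A b m *ᵥ w ≤ w ⬝ᵥ w := by
  rw [← h.lanczosComb_quad, ← h.lanczosComb_dot]
  exact ⟨h.lower _, h.upper _⟩

theorem CGRun.maxEigenvalue_mem (h : CGRun A b m δ) (hm : 0 < m) :
    δ ≤ maxEigenvalue (lanczosMatrix A b m) ∧ maxEigenvalue (lanczosMatrix A b m) ≤ 1 := by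
  obtain ⟨w, h1, h2⟩ := exists_quad_eq_maxEigenvalue hm (lanczosMatrix_isHermitian (A := A) (b := b))
  have := h.exists_quad_lanczosMatrix w
  rwa [h1, h2, mul_one] at this

theorem CGRun.minEigenvalue_mem (h : CGRun A b m δ) (hm : 0 < m) :
    δ ≤ minEigenvalue (lanczosMatrix A b m) ∧ minEigenvalue (lanczosMatrix A b m) ≤ 1 := by
  obtain ⟨w, h1, h2⟩ := exists_quad_eq_minEigenvalue hm (lanczosMatrix_isHermitian (A := A) (b := b))
  have := h.exists_quad_lanczosMatrix w
  rwa [h1, h2, mul_one] at this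

/-- When the iteration stops, eigenvalues that `b` sees are eigenvalues of the tridiagonal
matrix. -/
theorem CGRun.exists_eigenvector (h : CGRun A b m δ) (hm : 0 < m) (hr : (cg A b m).r = 0) {μ : ℝ}
    (hμ : HasOverlap A b μ) :
    ∃ w : Fin m → ℝ, 0 < w ⬝ᵥ w ∧ w ⬝ᵥ lanczosMatrix A b m *ᵥ w = μ * (w ⬝ᵥ w) := by
  obtain ⟨v, hv, hvb⟩ := hμ
  set S := Submodule.span ℝ (Set.range fun k : Fin m => lanczosVec A b k) with hS
  have hrS : ∀ k ≤ m, (cg A b k).r ∈ S := by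
    intro k hk
    rcases hk.lt_or_eq with hk | rfl
    · have : (cg A b k).r = (cgNorm A b k / (-1) ^ k) • lanczosVec A b k := by
        have := (h.cgNorm_pos hk).ne'
        rw [lanczosVec, smul_smul, div_mul_div_cancel₀ (by simp), div_self this, one_smul]
      rw [this]
      exact Submodule.smul_mem _ _ (Submodule.subset_span ⟨⟨k, hk⟩, rfl⟩)
    · rw [hr]; exact Submodule.zero_mem _
  -- As `r_m = 0`, the expressions for `A r_k` never leave the span of the Lanczos vectors: it is
  -- invariant under `A`.
  have hAS : ∀ k < m, A *ᵥ lanczosVec A b k ∈ S := by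
    intro k hk
    rw [lanczosVec, mulVec_smul]
    refine Submodule.smul_mem _ _ ?_
    rcases k with _ | k
    · rw [h.mulVec_r_zero hk]
      exact Submodule.smul_mem _ _ (Submodule.sub_mem _ (hrS _ (by omega)) (hrS _ (by omega)))
    · rw [h.mulVec_r_succ hk]
      exact Submodule.sub_mem _
        (Submodule.smul_mem _ _ (Submodule.sub_mem _ (hrS _ (by omega)) (hrS _ (by omega))))
        (Submodule.smul_mem _ _ (Submodule.sub_mem _ (hrS _ (by omega)) (hrS _ (by omega))))
  have hexp : ∀ x ∈ S, x = ∑ k : Fin m, (lanczosVec A b k ⬝ᵥ x) • lanczosVec A b k := by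
    intro x hx
    obtain ⟨c, rfl⟩ := (Submodule.mem_span_range_iff_exists_fun ℝ).1 hx
    refine Finset.sum_congr rfl fun k _ => ?_
    congr 1
    rw [dotProduct_sum, Finset.sum_eq_single k]
    · rw [dotProduct_smul, h.lanczosVec_orth k.2 k.2]; simp
    · intro j _ hj
      rw [dotProduct_smul, h.lanczosVec_orth k.2 j.2, if_neg (fun e => hj (Fin.ext e.symm))]; simp
    · simp
  -- The witness is the projection of `v` to the invariant span, which is again an eigenvector; it
  -- is nonzero because its first coordinate is `b ⬝ᵥ v`.
  refine ⟨fun k => lanczosVec A b k ⬝ᵥ v, ?_, ?_⟩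
  · refine dotProduct_self_pos fun hz => hvb ?_
    have h0 := congrFun hz ⟨0, hm⟩
    have h1 : lanczosVec A b 0 = b := by
      have := h.monicNorm_zero
      simp only [monicNorm, Finset.range_zero, Finset.prod_empty, mul_one] at this
      rw [lanczosVec, this, pow_zero, div_one, one_smul]; rfl
    rw [dotProduct_comm]
    simpa [h1] using h0
  · have : lanczosMatrix A b m *ᵥ (fun k => lanczosVec A b k ⬝ᵥ v) =
        μ • fun k : Fin m => lanczosVec A b k ⬝ᵥ v := by
      funext j
      rw [Pi.smul_apply, ← dotProduct_smul, ← hv, dotProduct_mulVec_comm h.herm, dotProduct_comm v,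
        hexp _ (hAS j j.2), sum_dotProduct]
      simp only [mulVec, dotProduct_comm (lanczosMatrix A b m j), smul_dotProduct]
      rw [dotProduct]
      refine Finset.sum_congr rfl fun k _ => ?_
      rw [h.lanczosVec_mulVec, smul_eq_mul,
        ← (lanczosMatrix_isHermitian (A := A) (b := b) (m := m)).apply]
      exact mul_comm _ _
    rw [this, dotProduct_smul, smul_eq_mul]

/-- Compression cannot enlarge the range of the Rayleigh quotient, and the vectors from
`exists_eigenvector` show that its ends are still attained. -/
theorem CGRun.eigenvalues_eq (h : CGRun A b m δ) (hm : 0 < m)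
    (hr : (cg A b m).r = 0) (h1 : HasOverlap A b (maxEigenvalue A))
    (h2 : HasOverlap A b (minEigenvalue A)) :
    maxEigenvalue (lanczosMatrix A b m) = maxEigenvalue A ∧
      minEigenvalue (lanczosMatrix A b m) = minEigenvalue A := by
  have hT := lanczosMatrix_isHermitian (A := A) (b := b) (m := m)
  constructor
  · apply le_antisymm
    · obtain ⟨w, e1, e2⟩ := exists_quad_eq_maxEigenvalue hm hT
      have := quad_le_maxEigenvalue h.herm (lanczosComb A b w)
      rwa [h.lanczosComb_quad, h.lanczosComb_dot, e1, e2, mul_one] at this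
    · obtain ⟨w, e1, e2⟩ := h.exists_eigenvector hm hr h1
      have := quad_le_maxEigenvalue hT w
      rw [e2] at this
      exact le_of_mul_le_mul_right this e1
  · apply le_antisymm
    · obtain ⟨w, e1, e2⟩ := h.exists_eigenvector hm hr h2
      have := minEigenvalue_le_quad hT w
      rw [e2] at this
      exact le_of_mul_le_mul_right this e1
    · obtain ⟨w, e1, e2⟩ := exists_quad_eq_minEigenvalue hm hT
      have := minEigenvalue_le_quad h.herm (lanczosComb A b w)
      rwa [h.lanczosComb_quad, h.lanczosComb_dot, e1, e2, mul_one] at this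

end Krylov
end

noncomputable section

/-! ### A rapidly decreasing cosine series for the identity -/

section Wave

/-- On one period `∑ cos (2πlx) / l²` is a quadratic Bernoulli polynomial; its difference from the
shift by half a period is affine on the first half. -/
theorem hasSum_triangle {z : ℝ} (hz : z ∈ Set.Icc 0 Real.pi) :
    HasSum (fun l : ℕ => -(2 / Real.pi) * (1 - Real.cos (Real.pi * l)) / (l : ℝ) ^ 2 *
      Real.cos (l * z)) (z - Real.pi / 2) := by
  have hπ := Real.pi_pos
  have h1 := hasSum_one_div_nat_pow_mul_cos one_ne_zero (x := z / (2 * Real.pi))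
    ⟨div_nonneg hz.1 (by positivity), (div_le_one (by positivity)).2 (by linarith [hz.2])⟩
  have h2 := hasSum_one_div_nat_pow_mul_cos one_ne_zero (x := z / (2 * Real.pi) + 1 / 2)
    ⟨add_nonneg (div_nonneg hz.1 (by positivity)) (by norm_num), by
      have : z / (2 * Real.pi) ≤ 1 / 2 := by rw [div_le_iff₀ (by positivity)]; linarith [hz.2]
      linarith⟩
  have h3 := (h1.sub h2).mul_left (-(2 / Real.pi))
  convert! h3 using 1
  · funext l
    have e1 : 2 * Real.pi * l * (z / (2 * Real.pi)) = l * z := by field_simp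
    have e2 : 2 * Real.pi * l * (z / (2 * Real.pi) + 1 / 2) = Real.pi * l + l * z := by
      field_simp; ring
    rw [e1, e2, Real.cos_add, mul_comm Real.pi, Real.sin_nat_mul_pi]
    simp only [mul_one]
    ring
  · simp [Polynomial.bernoulli, Finset.sum_range_succ, _root_.bernoulli]
    field_simp
    ring

/-- Averaging a cosine series over intervals. -/
theorem hasSum_box {c : ℕ → ℝ} {a b w : ℝ} (hw : 0 < w) (hc : Summable fun l => |c l|)
    (h0 : c 0 = 0)
    (h : ∀ z ∈ Set.Icc a b, HasSum (fun l : ℕ => c l * Real.cos (l * z)) (z - Real.pi / 2))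
    {z : ℝ} (hz : z ∈ Set.Icc (a + w) (b - w)) :
    HasSum (fun l : ℕ => c l * (Real.sin (l * w) / (l * w)) * Real.cos (l * z))
      (z - Real.pi / 2) := by
  -- An affine function equals its mean over a symmetric window, whereas `cos (l t)` gains the
  -- factor `sin (l w) / (l w)`. The price is a margin `w` at each end of the interval.
  have h1 : HasSum (fun l : ℕ => ∫ t in (z - w)..(z + w), c l * Real.cos (l * t))
      (∫ t in (z - w)..(z + w), (t - Real.pi / 2)) := by
    refine intervalIntegral.hasSum_integral_of_dominated_convergence (fun l _ => |c l|)
      (fun l => ?_) (fun l => ?_) ?_ ?_ ?_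
    · exact Continuous.aestronglyMeasurable (by fun_prop)
    · filter_upwards with t _
      rw [Real.norm_eq_abs, abs_mul]
      exact mul_le_of_le_one_right (abs_nonneg _) (Real.abs_cos_le_one _)
    · filter_upwards with t _ using hc
    · exact intervalIntegrable_const
    · filter_upwards with t ht
      rw [Set.uIoc_of_le (by linarith)] at ht
      exact h t ⟨by linarith [hz.1, ht.1], by linarith [hz.2, ht.2]⟩
  convert! h1.mul_left (1 / (2 * w)) using 1
  · funext l
    rcases eq_or_ne l 0 with rfl | hl
    · simp [h0]
    · have hl' : (l : ℝ) ≠ 0 := Nat.cast_ne_zero.2 hl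
      rw [intervalIntegral.integral_const_mul, intervalIntegral.integral_comp_mul_left _ hl',
        integral_cos, mul_sub, mul_add, Real.sin_sub, Real.sin_add, smul_eq_mul]
      field_simp
      ring
  · rw [intervalIntegral.integral_sub (by simp) (by simp), integral_id,
      intervalIntegral.integral_const, smul_eq_mul]
    field_simp
    ring

/-- The coefficients of the series. -/
def waveCoeff (l : ℕ) : ℝ :=
  -(2 / Real.pi) * (1 - Real.cos (Real.pi * l)) / (l : ℝ) ^ 2 *
    (Real.sin (l * (1 / 5)) / (l * (1 / 5))) ^ 5

theorem abs_sin_div_le (x : ℝ) : |Real.sin x / x| ≤ 1 := by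
  rw [abs_div]
  exact div_le_one_of_le₀ Real.abs_sin_le_abs (abs_nonneg _)

/-- Five averagings of half-width 1/5 shorten the interval `[0, π]` of the triangle wave by 1 at
each end. The rest still contains `π/2 ± 1/2`. -/
theorem hasSum_waveCoeff {y : ℝ} (hy : |y| ≤ 1 / 2) :
    HasSum (fun l : ℕ => waveCoeff l * Real.cos (l * (y + Real.pi / 2))) y := by
  set d : ℕ → ℕ → ℝ := fun k l => -(2 / Real.pi) * (1 - Real.cos (Real.pi * l)) / (l : ℝ) ^ 2 *
    (Real.sin (l * (1 / 5)) / (l * (1 / 5))) ^ k with hd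
  have hbase : Summable fun l : ℕ => (4 / Real.pi) * (1 / (l : ℝ) ^ 2) :=
    (Real.summable_one_div_nat_pow.2 (by norm_num)).mul_left _
  have hsum : ∀ k, Summable fun l => |d k l| := by
    intro k
    refine Summable.of_nonneg_of_le (fun _ => abs_nonneg _) (fun l => ?_) hbase
    rw [hd]
    simp only
    rw [abs_mul, abs_pow]
    refine (mul_le_of_le_one_right (abs_nonneg _)
      (pow_le_one₀ (abs_nonneg _) (abs_sin_div_le _))).trans ?_
    rw [abs_div, abs_mul, abs_neg, abs_of_pos (show 0 < 2 / Real.pi by positivity),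
      abs_of_nonneg (show 0 ≤ (l : ℝ) ^ 2 by positivity), mul_one_div]
    refine div_le_div_of_nonneg_right ?_ (by positivity)
    have : |1 - Real.cos (Real.pi * l)| ≤ 2 := by
      rw [abs_le]
      constructor <;> linarith [Real.cos_le_one (Real.pi * l), Real.neg_one_le_cos (Real.pi * l)]
    calc 2 / Real.pi * |1 - Real.cos (Real.pi * l)| ≤ 2 / Real.pi * 2 :=
          mul_le_mul_of_nonneg_left this (by positivity)
      _ = _ := by ring
  have key : ∀ k : ℕ, ∀ z ∈ Set.Icc (0 + k * (1 / 5 : ℝ)) (Real.pi - k * (1 / 5 : ℝ)),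
      HasSum (fun l : ℕ => d k l * Real.cos (l * z)) (z - Real.pi / 2) := by
    intro k
    induction k with
    | zero =>
      intro z hz
      simpa [hd] using hasSum_triangle (by simpa using hz)
    | succ k ih =>
      intro z hz
      have := hasSum_box (show (0 : ℝ) < 1 / 5 by norm_num) (hsum k) (by simp [hd]) ih (z := z)
        (by push_cast at hz; constructor <;> linarith [hz.1, hz.2])
      simpa [hd, pow_succ, mul_assoc] using this
  have h5 := key 5 (y + Real.pi / 2) (by
    have := abs_le.1 hy
    have := Real.pi_gt_three
    have := Real.pi_gt_d2
    push_cast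
    constructor <;> linarith)
  simpa [hd, waveCoeff] using h5

theorem waveCoeff_zero : waveCoeff 0 = 0 := by simp [waveCoeff]

/-- The coefficients are of order `l^(-7)`: two powers from the triangle wave and five from the
averagings. The weight uses up five of them. The constant in the comparison is `2 · 5⁵ · 2⁵`. -/
theorem summable_waveCoeff : Summable fun l : ℕ => |waveCoeff l| * (1 + l) ^ 5 := by
  have hbase : Summable fun l : ℕ => 200000 * (1 / (l : ℝ) ^ 2) :=
    (Real.summable_one_div_nat_pow.2 (by norm_num)).mul_left _
  refine Summable.of_nonneg_of_le (fun _ => by positivity) (fun l => ?_) hbase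
  rcases eq_or_ne l 0 with rfl | hl
  · simp [waveCoeff_zero]
  have hl' : (1 : ℝ) ≤ l := by exact_mod_cast Nat.one_le_iff_ne_zero.2 hl
  have h1 : |1 - Real.cos (Real.pi * l)| ≤ 2 := by
    rw [abs_le]
    constructor <;> linarith [Real.cos_le_one (Real.pi * l), Real.neg_one_le_cos (Real.pi * l)]
  have h2 : |Real.sin (l * (1 / 5)) / (l * (1 / 5))| ≤ 5 / l := by
    rw [abs_div, abs_of_pos (show (0 : ℝ) < l * (1 / 5) by positivity)]
    rw [div_le_div_iff₀ (by positivity) (by positivity)]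
    nlinarith [Real.abs_sin_le_one (l * (1 / 5))]
  have h3 : 2 / Real.pi ≤ 1 := by
    rw [div_le_one Real.pi_pos]; linarith [Real.pi_gt_three]
  have h4 : |waveCoeff l| ≤ 1 * 2 / (l : ℝ) ^ 2 * (5 / l) ^ 5 := by
    rw [waveCoeff, abs_mul, abs_pow, abs_div, abs_mul, abs_neg,
      abs_of_pos (show 0 < 2 / Real.pi by positivity),
      abs_of_nonneg (show 0 ≤ (l : ℝ) ^ 2 by positivity)]
    gcongr
  calc |waveCoeff l| * (1 + l) ^ 5 ≤ 1 * 2 / (l : ℝ) ^ 2 * (5 / l) ^ 5 * (l + l) ^ 5 := by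
        gcongr
    _ = 200000 * (1 / (l : ℝ) ^ 2) := by field_simp; norm_num

/-- A bound for the weighted sum of the coefficients. -/
def waveConst : ℝ := 1 + ∑' l : ℕ, |waveCoeff l| * (1 + l) ^ 5

theorem one_le_waveConst : 1 ≤ waveConst :=
  le_add_of_nonneg_right (tsum_nonneg fun _ => by positivity)

/-- The errors of the terms up to `J` and the omitted terms are charged to the same weighted sum:
for `l > J` the weight is at least `J²`, so `1 ≤ η (1 + l)^5`. -/
theorem abs_truncated_sub_le {f τ : ℕ → ℝ} {s B η : ℝ} {J : ℕ} (hf : ∀ l, |f l| ≤ 1)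
    (hs : HasSum (fun l => waveCoeff l * f l) s) (hB : 0 ≤ B) (hη : 0 ≤ η)
    (hτ : ∀ l ≤ J, |τ l - f l| ≤ B * (1 + l) ^ 5) (hJ : 1 ≤ η * (J : ℝ) ^ 2) :
    |∑ l ∈ Finset.range (J + 1), waveCoeff l * τ l - s| ≤ (B + η) * waveConst := by
  have h1 : HasSum (fun l => if l ∈ Finset.range (J + 1) then waveCoeff l * τ l else 0)
      (∑ l ∈ Finset.range (J + 1), waveCoeff l * τ l) := by
    have := hasSum_sum_of_ne_finset_zero (L := .unconditional ℕ) (f := fun l =>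
      if l ∈ Finset.range (J + 1) then waveCoeff l * τ l else 0) (s := Finset.range (J + 1))
      (fun l hl => by simp only [if_neg hl])
    rwa [Finset.sum_congr rfl (fun l hl => if_pos hl)] at this
  have h2 := (summable_waveCoeff.hasSum.mul_left (B + η))
  refine ((h1.sub hs).norm_le_of_bounded h2 fun l => ?_).trans ?_
  · rw [Real.norm_eq_abs]
    split_ifs with hl
    · rw [← mul_sub, abs_mul]
      calc |waveCoeff l| * |τ l - f l| ≤ |waveCoeff l| * (B * (1 + l) ^ 5) :=
            mul_le_mul_of_nonneg_left (hτ l (by simpa [Nat.lt_succ_iff] using hl)) (abs_nonneg _)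
        _ = B * (|waveCoeff l| * (1 + l) ^ 5) := by ring
        _ ≤ _ := mul_le_mul_of_nonneg_right (by linarith) (by positivity)
    · have hl' : (J : ℝ) ≤ l := by
        have : J < l := by simpa [Nat.lt_succ_iff] using hl
        exact_mod_cast this.le
      have e1 : (J : ℝ) ^ 2 ≤ (1 + l) ^ 5 := by
        calc (J : ℝ) ^ 2 ≤ (1 + l) ^ 2 := pow_le_pow_left₀ (Nat.cast_nonneg _) (by linarith) 2
          _ ≤ (1 + (l : ℝ)) ^ 5 := pow_le_pow_right₀ (by
            linarith [Nat.cast_nonneg (α := ℝ) l]) (by norm_num)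
      have e2 : 1 ≤ (B + η) * (1 + (l : ℝ)) ^ 5 := by
        refine hJ.trans ?_
        exact mul_le_mul (by linarith) e1 (by positivity) (by linarith)
      rw [zero_sub, abs_neg, abs_mul]
      calc |waveCoeff l| * |f l| ≤ |waveCoeff l| * 1 :=
            mul_le_mul_of_nonneg_left (hf l) (abs_nonneg _)
        _ ≤ |waveCoeff l| * ((B + η) * (1 + (l : ℝ)) ^ 5) :=
            mul_le_mul_of_nonneg_left e2 (abs_nonneg _)
        _ = _ := by ring
  · exact mul_le_mul_of_nonneg_left (by rw [waveConst]; linarith) (by linarith)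

end Wave

/-! ### Recursion for moments against cosine waves -/

section Moments

variable {n : ℕ} {A : Matrix (Fin n) (Fin n) ℝ}

/-- Moments of the spectral measure against a wave. -/
def waveMoment (hA : A.IsHermitian) (b : Fin n → ℝ) (i j : ℕ) : ℝ :=
  specInt hA b fun x => Real.cos (j * (x - 1 / 2 + Real.pi / 2)) * (x - 1 / 2) ^ i

theorem waveMoment_zero_zero (hA : A.IsHermitian) {b : Fin n → ℝ} (hb : b ⬝ᵥ b = 1) :
    waveMoment hA b 0 0 = 1 := by
  simp [waveMoment, specInt_const hA hb]

theorem waveMoment_zero_right (hA : A.IsHermitian) (b : Fin n → ℝ) (i : ℕ) :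
    waveMoment hA b i 0 = centralMoment hA b i := by
  simp [waveMoment, centralMoment]

theorem cos_dist_mul (j l : ℕ) (z : ℝ) :
    Real.cos ((Nat.dist j l : ℕ) * z) = Real.cos (j * z - l * z) := by
  rcases le_total j l with h | h
  · rw [Nat.dist_eq_sub_of_le h, Nat.cast_sub h, ← Real.cos_neg]; ring_nf
  · rw [Nat.dist_eq_sub_of_le_right h, Nat.cast_sub h]; ring_nf

theorem natDist_le (j l : ℕ) : Nat.dist j l ≤ j + l := by
  unfold Nat.dist; omega

/-- The cosine series replaces one factor `x - 1/2`, and `2 cos (jz) cos (lz) = cos ((j+l)z) + cos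
((j-l)z)` leads back to waves. The distance suffices as an index because the cosine is even. -/
theorem hasSum_waveMoment (hA : A.IsHermitian)
    (hspec : ∀ i, hA.eigenvalues i ∈ Set.Icc (0 : ℝ) 1) (b : Fin n → ℝ) (i j : ℕ) :
    HasSum (fun l => waveCoeff l *
      ((waveMoment hA b i (j + l) + waveMoment hA b i (Nat.dist j l)) / 2))
      (waveMoment hA b (i + 1) j) := by
  have h1 : ∀ k, HasSum (fun l : ℕ => eigCoord hA b k ^ 2 *
      ((waveCoeff l * Real.cos (l * (hA.eigenvalues k - 1 / 2 + Real.pi / 2))) *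
      (Real.cos (j * (hA.eigenvalues k - 1 / 2 + Real.pi / 2)) * (hA.eigenvalues k - 1 / 2) ^ i)))
      (eigCoord hA b k ^ 2 * ((hA.eigenvalues k - 1 / 2) *
        (Real.cos (j * (hA.eigenvalues k - 1 / 2 + Real.pi / 2)) *
          (hA.eigenvalues k - 1 / 2) ^ i))) := by
    intro k
    refine ((hasSum_waveCoeff ?_).mul_right _).mul_left _
    have := hspec k
    rw [abs_le]; constructor <;> linarith [this.1, this.2]
  convert! hasSum_sum (s := Finset.univ) fun k _ => h1 k using 1
  · funext l
    rw [waveMoment, waveMoment, specInt, specInt, ← Finset.sum_add_distrib, Finset.sum_div,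
      Finset.mul_sum]
    refine Finset.sum_congr rfl fun k _ => ?_
    rw [cos_dist_mul, Nat.cast_add, add_mul, Real.cos_add, Real.cos_sub]
    ring
  · rw [waveMoment, specInt]
    refine Finset.sum_congr rfl fun k _ => ?_
    ring

theorem abs_waveMoment_le (hA : A.IsHermitian)
    (hspec : ∀ i, hA.eigenvalues i ∈ Set.Icc (0 : ℝ) 1) {b : Fin n → ℝ} (hb : b ⬝ᵥ b = 1) (i j : ℕ) :
    |waveMoment hA b i j| ≤ 1 := by
  refine abs_specInt_le hA hb fun k => ?_
  have := hspec k
  rw [abs_mul, abs_pow]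
  refine mul_le_one₀ (Real.abs_cos_le_one _) (by positivity) (pow_le_one₀ (abs_nonneg _) ?_)
  rw [abs_le]; constructor <;> linarith [this.1, this.2]

/-- One step of the recursion for the moments, with its error. -/
theorem abs_waveMoment_succ_sub_le (hA : A.IsHermitian)
    (hspec : ∀ i, hA.eigenvalues i ∈ Set.Icc (0 : ℝ) 1) {b : Fin n → ℝ} (hb : b ⬝ᵥ b = 1) {i j J : ℕ} {B η : ℝ}
    {τ : ℕ → ℝ} (hη : 0 ≤ η) (hB : 0 ≤ B) (hJ : 1 ≤ η * (J : ℝ) ^ 2)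
    (hτ : ∀ k ≤ j + J, |τ k - waveMoment hA b i k| ≤ B * η * (1 + k) ^ 5) :
    |∑ l ∈ Finset.range (J + 1), waveCoeff l * ((τ (j + l) + τ (Nat.dist j l)) / 2) -
      waveMoment hA b (i + 1) j| ≤ (waveConst * (B + 1)) * η * (1 + j) ^ 5 := by
  have h1 := abs_truncated_sub_le
    (f := fun l => (waveMoment hA b i (j + l) + waveMoment hA b i (Nat.dist j l)) / 2)
    (τ := fun l => (τ (j + l) + τ (Nat.dist j l)) / 2) (B := B * η * (1 + j) ^ 5)
    (fun l => ?_) (hasSum_waveMoment hA hspec b i j) (by positivity) hη (fun l hl => ?_) hJ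
  · refine h1.trans ?_
    have h2 : (1 : ℝ) ≤ (1 + j) ^ 5 := one_le_pow₀ (by linarith [Nat.cast_nonneg (α := ℝ) j])
    have h3 := one_le_waveConst
    calc (B * η * (1 + j) ^ 5 + η) * waveConst
        ≤ (B * η * (1 + j) ^ 5 + η * (1 + j) ^ 5) * waveConst := by
          refine mul_le_mul_of_nonneg_right ?_ (by linarith)
          have := mul_le_mul_of_nonneg_left h2 hη
          linarith
      _ = _ := by ring
  · have h2 := abs_le.1 (abs_waveMoment_le hA hspec hb i (j + l))
    have h3 := abs_le.1 (abs_waveMoment_le hA hspec hb i (Nat.dist j l))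
    rw [abs_le]; constructor <;> linarith
  · have hd := natDist_le j l
    have h2 := hτ (j + l) (by omega)
    have h3 := hτ (Nat.dist j l) (by omega)
    have hBη : 0 ≤ B * η := mul_nonneg hB hη
    -- The weight is submultiplicative, since `1 + j + l ≤ (1 + j)(1 + l)`. So errors that grow like
    -- the fifth power of the index reproduce this growth in the next row.
    have h4 : ∀ k ≤ j + l, (1 + (k : ℝ)) ^ 5 ≤ (1 + j) ^ 5 * (1 + l) ^ 5 := by
      intro k hk
      rw [← mul_pow]
      refine pow_le_pow_left₀ (by positivity) ?_ 5
      have : (k : ℝ) ≤ j + l := by exact_mod_cast hk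
      nlinarith [mul_nonneg (Nat.cast_nonneg (α := ℝ) j) (Nat.cast_nonneg (α := ℝ) l)]
    have h5 := mul_le_mul_of_nonneg_left (h4 _ le_rfl) hBη
    have h6 := mul_le_mul_of_nonneg_left (h4 _ hd) hBη
    have h7 := abs_le.1 (h2.trans h5)
    have h8 := abs_le.1 (h3.trans h6)
    rw [abs_le]
    constructor <;> linarith [h7.1, h7.2, h8.1, h8.2]

end Moments
end

noncomputable section

/-! ### Gaussian elimination and definiteness -/

section Elimination

/-- The Schur complements that occur in Gaussian elimination without pivoting. -/
def schurComp (E : ℕ → ℕ → ℝ) : ℕ → ℕ → ℕ → ℝ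
  | 0 => E
  | k + 1 => fun i j =>
      schurComp E k i j - schurComp E k i k * schurComp E k k j / schurComp E k k k

/-- The quadratic form of the block of a matrix with indices in `[k, m)`. -/
def blockForm (E : ℕ → ℕ → ℝ) (k m : ℕ) (c : ℕ → ℝ) : ℝ :=
  ∑ i ∈ Finset.Ico k m, ∑ j ∈ Finset.Ico k m, c i * c j * E i j

theorem schurComp_symm {E : ℕ → ℕ → ℝ} (h : ∀ i j, E i j = E j i) (k i j : ℕ) :
    schurComp E k i j = schurComp E k j i := by
  induction k generalizing i j with
  | zero => exact h i j
  | succ k ih =>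
    simp only [schurComp]
    rw [ih i j, ih i k, ih k j, mul_comm]

/-- Completing the square in the variable `c k`. -/
theorem blockForm_step {E : ℕ → ℕ → ℝ} (h : ∀ i j, E i j = E j i) {k m : ℕ} (hk : k < m)
    (hp : schurComp E k k k ≠ 0) (c : ℕ → ℝ) :
    blockForm (schurComp E k) k m c = schurComp E k k k *
      (c k + (∑ j ∈ Finset.Ico (k + 1) m, schurComp E k k j * c j) / schurComp E k k k) ^ 2 +
      blockForm (schurComp E (k + 1)) (k + 1) m c := by
  set S := schurComp E k with hS
  set s := ∑ j ∈ Finset.Ico (k + 1) m, S k j * c j with hs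
  have h1 : blockForm S k m c = c k * c k * S k k + 2 * c k * s +
      ∑ i ∈ Finset.Ico (k + 1) m, ∑ j ∈ Finset.Ico (k + 1) m, c i * c j * S i j := by
    rw [blockForm, Finset.sum_eq_sum_Ico_succ_bot hk, Finset.sum_eq_sum_Ico_succ_bot hk]
    have e1 : ∑ j ∈ Finset.Ico (k + 1) m, c k * c j * S k j = c k * s := by
      rw [hs, Finset.mul_sum]; exact Finset.sum_congr rfl fun j _ => by ring
    have e2 : ∑ i ∈ Finset.Ico (k + 1) m, ∑ j ∈ Finset.Ico k m, c i * c j * S i j = c k * s +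
        ∑ i ∈ Finset.Ico (k + 1) m, ∑ j ∈ Finset.Ico (k + 1) m, c i * c j * S i j := by
      rw [hs, Finset.mul_sum, ← Finset.sum_add_distrib]
      refine Finset.sum_congr rfl fun i _ => ?_
      rw [Finset.sum_eq_sum_Ico_succ_bot hk, hS, schurComp_symm h k i k]; ring
    rw [e1, e2]; ring
  have h2 : blockForm (schurComp E (k + 1)) (k + 1) m c =
      ∑ i ∈ Finset.Ico (k + 1) m, ∑ j ∈ Finset.Ico (k + 1) m, c i * c j * S i j - s * s / S k k := by
    have e : s * s / S k k = ∑ i ∈ Finset.Ico (k + 1) m, ∑ j ∈ Finset.Ico (k + 1) m,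
        c i * c j * (S i k * S k j / S k k) := by
      rw [hs, Finset.sum_mul_sum, Finset.sum_div]
      refine Finset.sum_congr rfl fun i _ => ?_
      rw [Finset.sum_div]
      refine Finset.sum_congr rfl fun j _ => ?_
      rw [hS, schurComp_symm h k i k]; ring
    rw [e, blockForm, ← Finset.sum_sub_distrib]
    refine Finset.sum_congr rfl fun i _ => ?_
    rw [← Finset.sum_sub_distrib]
    refine Finset.sum_congr rfl fun j _ => ?_
    simp only [schurComp, ← hS]; ring
  rw [h1, h2]
  field_simp
  ring

/-- For a positive pivot, the form of the next Schur complement is the minimum of the present one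
over `c k`, so positivity is inherited; a pivot is a value at a unit vector. -/
theorem schurComp_pos {E : ℕ → ℕ → ℝ} (h : ∀ i j, E i j = E j i) {m : ℕ}
    (hE : ∀ c : ℕ → ℝ, (∃ i < m, c i ≠ 0) → 0 < blockForm E 0 m c) :
    ∀ k < m, 0 < schurComp E k k k := by
  have key : ∀ k ≤ m, ∀ c : ℕ → ℝ, (∃ i, k ≤ i ∧ i < m ∧ c i ≠ 0) →
      0 < blockForm (schurComp E k) k m c := by
    intro k
    have piv : ∀ k < m, (∀ c : ℕ → ℝ, (∃ i, k ≤ i ∧ i < m ∧ c i ≠ 0) →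
        0 < blockForm (schurComp E k) k m c) → 0 < schurComp E k k k := by
      intro k hk ih
      have := ih (fun i => if i = k then 1 else 0) ⟨k, le_rfl, hk, by simp⟩
      simpa [blockForm, hk] using this
    induction k with
    | zero => exact fun _ c ⟨i, _, hi, hc⟩ => hE c ⟨i, hi, hc⟩
    | succ k ih =>
      rintro hk c ⟨i, hi, him, hc⟩
      have hp := piv k (by omega) (ih (by omega))
      set s := ∑ j ∈ Finset.Ico (k + 1) m, schurComp E k k j * c j with hs
      have h1 := ih (by omega) (Function.update c k (-(s / schurComp E k k k)))
        ⟨i, by omega, him, by rwa [Function.update_of_ne (by omega)]⟩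
      have hcongr : ∀ j ∈ Finset.Ico (k + 1) m,
          Function.update c k (-(s / schurComp E k k k)) j = c j := fun j hj => by
        rw [Function.update_of_ne]; have := (Finset.mem_Ico.1 hj).1; omega
      rw [blockForm_step h (by omega) hp.ne', Function.update_self,
        Finset.sum_congr rfl (fun j hj => by rw [hcongr j hj]), ← hs] at h1
      rw [neg_add_cancel] at h1
      have h2 : blockForm (schurComp E (k + 1)) (k + 1) m
          (Function.update c k (-(s / schurComp E k k k))) =
          blockForm (schurComp E (k + 1)) (k + 1) m c :=
        Finset.sum_congr rfl fun i hi => Finset.sum_congr rfl fun j hj => by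
          rw [hcongr i hi, hcongr j hj]
      rw [h2] at h1
      linarith
  intro k hk
  have := key k hk.le (fun i => if i = k then 1 else 0) ⟨k, le_rfl, hk, by simp⟩
  simpa [blockForm, hk] using this

/-- Conversely, positive pivots exhibit the form as a sum of squares with positive weights. -/
theorem blockForm_nonneg {E : ℕ → ℕ → ℝ} (h : ∀ i j, E i j = E j i) {m : ℕ}
    (hE : ∀ k < m, 0 < schurComp E k k k) (c : ℕ → ℝ) : 0 ≤ blockForm E 0 m c := by
  have key : ∀ d k, k + d = m → 0 ≤ blockForm (schurComp E k) k m c := by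
    intro d
    induction d with
    | zero => intro k hk; simp [blockForm, ← hk]
    | succ d ih =>
      intro k hk
      have hp := hE k (by omega)
      rw [blockForm_step h (by omega) hp.ne']
      have := ih (k + 1) (by omega)
      positivity
  exact key m 0 (by omega)

end Elimination

/-! ### Definiteness of the perturbed moment matrices -/

section Decision

variable {n : ℕ} {A : Matrix (Fin n) (Fin n) ℝ} {b : Fin n → ℝ} {m : ℕ} {δ : ℝ}

theorem abs_hankelForm_sub_le {μ ν : ℕ → ℝ} {e : ℝ} (h : ∀ k < 2 * m - 1, |μ k - ν k| ≤ e)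
    (c : Fin m → ℝ) : |hankelForm μ c - hankelForm ν c| ≤ e * (∑ i, |c i|) ^ 2 := by
  have h1 : hankelForm μ c - hankelForm ν c =
      ∑ i : Fin m, ∑ j : Fin m, c i * c j * (μ (i + j) - ν (i + j)) := by
    rw [hankelForm, hankelForm, ← Finset.sum_sub_distrib]
    refine Finset.sum_congr rfl fun i _ => ?_
    rw [← Finset.sum_sub_distrib]
    exact Finset.sum_congr rfl fun j _ => by ring
  rw [h1, sq, Finset.sum_mul_sum, Finset.mul_sum]
  refine (Finset.abs_sum_le_sum_abs _ _).trans (Finset.sum_le_sum fun i _ => ?_)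
  rw [Finset.mul_sum]
  refine (Finset.abs_sum_le_sum_abs _ _).trans (Finset.sum_le_sum fun j _ => ?_)
  rw [abs_mul, abs_mul, mul_comm e]
  exact mul_le_mul_of_nonneg_left (h _ (by omega)) (by positivity)

/-- The matrix whose definiteness is tested in the search for an extreme Ritz value. -/
def shiftMatrix (μ : ℕ → ℝ) (ρ s : ℝ) (i j : ℕ) : ℝ := ρ * μ (i + j) - s * μ (i + j + 1)

theorem shiftMatrix_symm (μ : ℕ → ℝ) (ρ s : ℝ) (i j : ℕ) :
    shiftMatrix μ ρ s i j = shiftMatrix μ ρ s j i := by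
  rw [shiftMatrix, shiftMatrix, add_comm i j]

theorem blockForm_shiftMatrix (μ : ℕ → ℝ) (ρ s : ℝ) (c : ℕ → ℝ) :
    blockForm (shiftMatrix μ ρ s) 0 m c =
      hankelForm (m := m) (fun k => ρ * μ k - s * μ (k + 1)) fun i => c i := by
  rw [blockForm, hankelForm, ← Finset.range_eq_Ico, Finset.sum_range]
  refine Finset.sum_congr rfl fun i _ => ?_
  rw [Finset.sum_range]; rfl

/-- In Lanczos coordinates the exact form is that of `ρ - s (T - 1/2)`. Errors `e` of the moments
change each entry by at most `(|ρ| + |s|) e ≤ 3 e`, and this acts through the squared sum of the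
absolute coordinates. -/
theorem CGRun.abs_shift_form_sub_le (h : CGRun A b m δ) {μ : ℕ → ℝ} {e ρ s : ℝ} (hs : |s| ≤ 1)
    (hρ : |ρ| ≤ 2) (hμ : ∀ k < 2 * m, |μ k - centralMoment h.herm b k| ≤ e) (w : Fin m → ℝ) :
    |hankelForm (fun k => ρ * μ k - s * μ (k + 1)) (powerCoord A b m w) -
      (ρ * (w ⬝ᵥ w) - s * (w ⬝ᵥ lanczosMatrix A b m *ᵥ w - 1 / 2 * (w ⬝ᵥ w)))| ≤
      3 * e * coordBound m δ * (w ⬝ᵥ w) := by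
  rcases Nat.eq_zero_or_pos m with rfl | hm
  · simp [hankelForm, dotProduct]
  have he : 0 ≤ e := (abs_nonneg _).trans (hμ 0 (by omega))
  have h1 : ρ * (w ⬝ᵥ w) - s * (w ⬝ᵥ lanczosMatrix A b m *ᵥ w - 1 / 2 * (w ⬝ᵥ w)) =
      hankelForm (fun k => ρ * centralMoment h.herm b k - s * centralMoment h.herm b (k + 1))
        (powerCoord A b m w) := by
    rw [← h.hankelForm_powerCoord_succ, ← h.hankelForm_powerCoord, hankelForm, hankelForm,
      hankelForm, Finset.mul_sum, Finset.mul_sum, ← Finset.sum_sub_distrib]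
    refine Finset.sum_congr rfl fun i _ => ?_
    rw [Finset.mul_sum, Finset.mul_sum, ← Finset.sum_sub_distrib]
    exact Finset.sum_congr rfl fun j _ => by ring
  rw [h1]
  refine (abs_hankelForm_sub_le (e := 3 * e) (fun k hk => ?_) _).trans ?_
  · have e1 := hμ k (by omega)
    have e2 := hμ (k + 1) (by omega)
    have e3 : |ρ * (μ k - centralMoment h.herm b k)| ≤ 2 * e := by
      rw [abs_mul]; exact mul_le_mul hρ e1 (abs_nonneg _) (by norm_num)
    have e4 : |s * (μ (k + 1) - centralMoment h.herm b (k + 1))| ≤ 1 * e := by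
      rw [abs_mul]; exact mul_le_mul hs e2 (abs_nonneg _) (by norm_num)
    rw [abs_le] at e3 e4 ⊢
    constructor <;> linarith [e3.1, e3.2, e4.1, e4.2]
  · rw [mul_assoc _ (coordBound m δ)]
    exact mul_le_mul_of_nonneg_left (h.sum_abs_powerCoord w) (by positivity)

/-- As soon as `ρ` exceeds the bound `θ` for `s (T - 1/2)` by more than the perturbation, the
perturbed form is positive definite. -/
theorem CGRun.schurComp_shift_pos (h : CGRun A b m δ) {μ : ℕ → ℝ} {e ρ s θ : ℝ} (hs : |s| ≤ 1)
    (hρ : |ρ| ≤ 2) (hμ : ∀ k < 2 * m, |μ k - centralMoment h.herm b k| ≤ e)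
    (hθ : ∀ w : Fin m → ℝ,
      s * (w ⬝ᵥ lanczosMatrix A b m *ᵥ w - 1 / 2 * (w ⬝ᵥ w)) ≤ θ * (w ⬝ᵥ w))
    (hlt : θ + 3 * e * coordBound m δ < ρ) :
    ∀ k < m, 0 < schurComp (shiftMatrix μ ρ s) k k k := by
  refine schurComp_pos (shiftMatrix_symm μ ρ s) fun c ⟨i, hi, hc⟩ => ?_
  rw [blockForm_shiftMatrix]
  obtain ⟨w, hw⟩ := h.powerCoord_surjective fun i => c i
  have hw0 : 0 < w ⬝ᵥ w := by
    refine dotProduct_self_pos fun h0 => hc ?_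
    rw [h0, map_zero] at hw
    exact (congrFun hw ⟨i, hi⟩).symm
  rw [← hw]
  have h1 := abs_le.1 (h.abs_shift_form_sub_le hs hρ hμ w)
  nlinarith [hθ w, mul_pos (sub_pos.2 hlt) hw0, h1.1]

/-- Positive pivots make the perturbed form nonnegative, in particular at the vector that attains
`θ`. Together with `schurComp_shift_pos`, the pivots decide `θ < ρ` up to the perturbation. -/
theorem CGRun.le_of_schurComp_shift (h : CGRun A b m δ) {μ : ℕ → ℝ} {e ρ s θ : ℝ} (hs : |s| ≤ 1)
    (hρ : |ρ| ≤ 2) (hμ : ∀ k < 2 * m, |μ k - centralMoment h.herm b k| ≤ e)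
    {w : Fin m → ℝ} (hw : w ⬝ᵥ w = 1)
    (hθ : s * (w ⬝ᵥ lanczosMatrix A b m *ᵥ w - 1 / 2 * (w ⬝ᵥ w)) = θ)
    (hE : ∀ k < m, 0 < schurComp (shiftMatrix μ ρ s) k k k) :
    θ - 3 * e * coordBound m δ ≤ ρ := by
  have h1 := blockForm_nonneg (shiftMatrix_symm μ ρ s) hE
    (fun i => if hi : i < m then powerCoord A b m w ⟨i, hi⟩ else 0)
  rw [blockForm_shiftMatrix] at h1
  simp only [Fin.is_lt, dite_true, Fin.eta] at h1
  have h2 := abs_le.1 (h.abs_shift_form_sub_le hs hρ hμ w)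
  rw [hθ, hw] at h2
  linarith [h2.2]

end Decision
end

noncomputable section

/-! ### Phase refinement -/

section Phase

theorem abs_cos_sub_linear_le {a h : ℝ} (hh : |h| ≤ 1 / 5) :
    |Real.cos (a + h) - Real.cos a + h * Real.sin a| ≤ 11 / 500 := by
  have h1 : |Real.cos h - 1| ≤ 1 / 50 := by
    rw [abs_le]
    have := Real.one_sub_sq_div_two_le_cos (x := h)
    have := Real.cos_le_one h
    have : h ^ 2 ≤ (1 / 5) ^ 2 := sq_le_sq' (by linarith [(abs_le.1 hh).1]) (abs_le.1 hh).2
    constructor <;> linarith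
  have h2 : |Real.sin h - h| ≤ 1 / 500 := by
    have key : ∀ x : ℝ, 0 < x → x ≤ 1 / 5 → |Real.sin x - x| ≤ 1 / 500 := by
      intro x h0 hx
      have e1 := Real.sin_gt_sub_cube h0
      have e2 := Real.sin_lt h0
      have e3 : x ^ 3 ≤ (1 / 5) ^ 3 := pow_le_pow_left₀ h0.le hx 3
      rw [abs_le]; constructor <;> linarith
    rcases lt_trichotomy h 0 with h0 | h0 | h0
    · have := key (-h) (by linarith) (by linarith [(abs_le.1 hh).1])
      rw [Real.sin_neg, ← abs_neg] at this
      convert this using 2; ring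
    · simp [h0]
    · exact key h h0 (abs_le.1 hh).2
  have e : Real.cos (a + h) - Real.cos a + h * Real.sin a =
      Real.cos a * (Real.cos h - 1) - Real.sin a * (Real.sin h - h) := by rw [Real.cos_add]; ring
  rw [e]
  refine (abs_sub _ _).trans ?_
  rw [abs_mul, abs_mul]
  have e1 : |Real.cos a| * |Real.cos h - 1| ≤ 1 * (1 / 50) :=
    mul_le_mul (Real.abs_cos_le_one _) h1 (abs_nonneg _) zero_le_one
  have e2 : |Real.sin a| * |Real.sin h - h| ≤ 1 * (1 / 500) :=
    mul_le_mul (Real.abs_sin_le_one _) h2 (abs_nonneg _) zero_le_one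
  linarith

/-- One step of Newton's method for the phase. -/
theorem newton_step {θ x y : ℝ} {N k : ℕ} (hN : 1 ≤ N) (hk : N ≤ k) (hk' : k ≤ 2 * N)
    (hsin : 1 / 2 ≤ |Real.sin (k * x)|) (h : |x - θ| ≤ 1 / 10 / N)
    (hy : |y - Real.cos (k * θ)| ≤ 1 / 400) :
    |x + (Real.cos (k * x) - y) / (k * Real.sin (k * x)) - θ| ≤ 1 / 10 / (2 * N) := by
  have hN' : (1 : ℝ) ≤ N := by exact_mod_cast hN
  have hkN : (N : ℝ) ≤ k := by exact_mod_cast hk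
  have hkN' : (k : ℝ) ≤ 2 * N := by exact_mod_cast hk'
  have hk0 : (0 : ℝ) < k := by linarith
  have hs0 : Real.sin (k * x) ≠ 0 := by
    intro h0; rw [h0] at hsin; norm_num at hsin
  have h1 : |(k : ℝ) * (θ - x)| ≤ 1 / 5 := by
    rw [abs_mul, abs_of_pos hk0, abs_sub_comm]
    calc (k : ℝ) * |x - θ| ≤ 2 * N * (1 / 10 / N) := by gcongr
      _ = 1 / 5 := by field_simp; norm_num
  have h2 := abs_cos_sub_linear_le (a := k * x) h1
  rw [show (k : ℝ) * x + k * (θ - x) = k * θ by ring] at h2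
  set R := Real.cos (k * θ) - Real.cos (k * x) + k * (θ - x) * Real.sin (k * x) with hR
  have h3 : x + (Real.cos (k * x) - y) / (k * Real.sin (k * x)) - θ =
      -(R + (y - Real.cos (k * θ))) / (k * Real.sin (k * x)) := by
    rw [hR]
    generalize Real.sin (k * x) = s at hs0
    generalize Real.cos (k * x) = c
    field_simp; ring
  rw [h3, abs_div, abs_neg, abs_mul, abs_of_pos hk0]
  -- `49/2000 = 11/500 + 1/400`. Division by `k |sin (k x)| ≥ N/2` leaves `49/1000` over `N`, just
  -- below the required `1/20` over `N`.
  have h4 : |R + (y - Real.cos (k * θ))| ≤ 49 / 2000 :=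
    (abs_add_le _ _).trans (by linarith)
  calc |R + (y - Real.cos (k * θ))| / (k * |Real.sin (k * x)|) ≤ (49 / 2000) / (N * (1 / 2)) := by
        gcongr
    _ ≤ 1 / 10 / (2 * N) := by
        rw [div_le_div_iff₀ (by positivity) (by positivity)]; linarith

theorem abs_cos_le_of_near {x : ℝ} (h : |x - Real.pi / 2| ≤ 1 / 5) : |Real.cos x| ≤ 1 / 5 := by
  have : Real.cos x = -Real.sin (x - Real.pi / 2) := by rw [Real.sin_sub_pi_div_two]; ring
  rw [this, abs_neg]
  exact Real.abs_sin_le_abs.trans h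

/-- If `sin (N x)` is small, then `cos (N x)` is large in absolute value; as `x` is near `π/2`, one
more step turns by almost a right angle and exchanges sine and cosine. -/
theorem half_le_abs_sin {x : ℝ} (N : ℕ) (h : |x - Real.pi / 2| ≤ 1 / 5) :
    (Real.cos (N * x) * Real.cos (N * x) ≤ 3 / 4 → 1 / 2 ≤ |Real.sin (N * x)|) ∧
    (3 / 4 < Real.cos (N * x) * Real.cos (N * x) → 1 / 2 ≤ |Real.sin ((N + 1 : ℕ) * x)|) := by
  have h1 := Real.sin_sq_add_cos_sq (N * x)
  constructor
  · intro h2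
    refine (sq_le_sq₀ (by norm_num) (abs_nonneg _)).1 ?_
    rw [sq_abs]; nlinarith
  · intro h2
    have h3 : 4 / 5 ≤ |Real.cos (N * x)| := by
      refine (sq_le_sq₀ (by norm_num) (abs_nonneg _)).1 ?_
      rw [sq_abs]; nlinarith
    have h4 : |Real.sin (N * x)| ≤ 1 / 2 := by
      refine (sq_le_sq₀ (abs_nonneg _) (by norm_num)).1 ?_
      rw [sq_abs]; nlinarith
    have h5 := abs_cos_le_of_near h
    have h6 : 9 / 10 ≤ |Real.sin x| := by
      refine (sq_le_sq₀ (by norm_num) (abs_nonneg _)).1 ?_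
      have h7 : Real.cos x ^ 2 ≤ (1 / 5) ^ 2 := by rw [← sq_abs]; gcongr
      rw [sq_abs]; nlinarith [Real.sin_sq_add_cos_sq x]
    have h8 : Real.sin ((N + 1 : ℕ) * x) = Real.cos (N * x) * Real.sin x -
        -(Real.sin (N * x) * Real.cos x) := by
      push_cast; rw [add_mul, one_mul, Real.sin_add]; ring
    have h9 : 4 / 5 * (9 / 10) ≤ |Real.cos (N * x) * Real.sin x| := by
      rw [abs_mul]; gcongr
    have h10 : |-(Real.sin (N * x) * Real.cos x)| ≤ 1 / 2 * (1 / 5) := by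
      rw [abs_neg, abs_mul]; gcongr
    have h11 := abs_sub_abs_le_abs_sub (Real.cos (N * x) * Real.sin x)
      (-(Real.sin (N * x) * Real.cos x))
    rw [h8]
    linarith

theorem walk_angle_bounds : 24 / 25 ≤ Real.cos (1 / 25) ∧ 39 / 1000 ≤ Real.sin (1 / 25) ∧
    Real.sin (1 / 25) ≤ 1 / 25 ∧ 999 / 1000 ≤ Real.cos (1 / 25) := by
  have h1 := Real.one_sub_sq_div_two_le_cos (x := 1 / 25)
  have h2 := Real.sin_gt_sub_cube (x := 1 / 25) (by norm_num)
  have h3 := Real.sin_lt (x := 1 / 25) (by norm_num)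
  refine ⟨?_, ?_, h3.le, ?_⟩ <;> norm_num at h1 h2 ⊢ <;> linarith

/-- The phase that encodes a number in `[-1, 1]`. -/
theorem exists_phase {g : ℝ} (hg : |g| ≤ 1) : ∃ φ : ℝ,
    (-Real.cos (1 / 25) + Real.sin (1 / 25) * g) / Real.sqrt 2 = -Real.cos φ ∧
    |2 * φ - Real.pi / 2| ≤ 1 / 10 ∧
    g = (Real.cos (1 / 25) - Real.sqrt 2 * Real.cos φ) / Real.sin (1 / 25) := by
  obtain ⟨-, hs1, hs2, hc⟩ := walk_angle_bounds
  have hc' := Real.cos_le_one (1 / 25)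
  have hg' := abs_le.1 hg
  have hsg : |Real.sin (1 / 25) * g| ≤ 1 / 25 := by
    rw [abs_mul, abs_of_pos (by linarith)]
    exact (mul_le_mul hs2 hg (abs_nonneg _) (by norm_num)).trans (by norm_num)
  have hsg' := abs_le.1 hsg
  set u := Real.cos (1 / 25) - Real.sin (1 / 25) * g with hu
  have hu1 : 959 / 1000 ≤ u := by linarith [hsg'.2]
  have hu2 : u ≤ 26 / 25 := by linarith [hsg'.1]
  have h2 : Real.sqrt 2 ^ 2 = 2 := Real.sq_sqrt (by norm_num)
  have h2p : 0 < Real.sqrt 2 := by positivity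
  have hv0 : 0 ≤ u / Real.sqrt 2 := div_nonneg (by linarith) h2p.le
  have hvsq : (u / Real.sqrt 2) ^ 2 = u ^ 2 / 2 := by rw [div_pow, h2]
  have hv1 : u / Real.sqrt 2 ≤ 1 := by
    refine (sq_le_sq₀ hv0 zero_le_one).1 ?_
    rw [hvsq]; nlinarith
  have hcos : Real.cos (Real.arccos (u / Real.sqrt 2)) = u / Real.sqrt 2 :=
    Real.cos_arccos (by linarith) hv1
  refine ⟨Real.arccos (u / Real.sqrt 2), ?_, ?_, ?_⟩
  · rw [hcos, hu]; ring
  · have hφ0 := Real.arccos_nonneg (u / Real.sqrt 2)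
    have hφ1 := Real.arccos_le_pi_div_two.2 hv0
    -- `u` is near 1 because the angle 1/25 is small, so `cos (2 φ) = u² - 1` stays below `sin
    -- (1/10)` in absolute value. This keeps `2 φ` near `π/2`, where `half_le_abs_sin` works.
    have hcos2 : Real.sin (Real.pi / 2 - 2 * Real.arccos (u / Real.sqrt 2)) = u ^ 2 - 1 := by
      rw [Real.sin_pi_div_two_sub, Real.cos_two_mul, hcos, hvsq]; ring
    have hs : 99 / 1000 ≤ Real.sin (1 / 10) := by
      have := Real.sin_gt_sub_cube (x := 1 / 10) (by norm_num)
      norm_num at this ⊢; linarith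
    rw [abs_sub_comm, abs_le]
    have hπ := Real.pi_gt_three
    constructor
    · by_contra! hlt
      have := Real.sin_lt_sin_of_lt_of_le_pi_div_two (by linarith) (by linarith) hlt
      rw [hcos2, Real.sin_neg] at this
      nlinarith
    · by_contra! hlt
      have := Real.sin_lt_sin_of_lt_of_le_pi_div_two (by linarith) (by linarith) hlt
      rw [hcos2] at this
      nlinarith
  · rw [hcos, hu]
    have : Real.sin (1 / 25) ≠ 0 := by linarith
    field_simp
    ring

/-- Decoding divides by `sin (1/25) ≥ 39/1000`, which costs a constant: `(3/2) (1/20) / (39/1000) <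
2`. -/
theorem abs_decode_sub_le {x φ N : ℝ} (h : |x - 2 * φ| ≤ 1 / 10 / N) (hN : 0 < N) :
    |(Real.cos (1 / 25) - Real.sqrt 2 * Real.cos (x / 2)) / Real.sin (1 / 25) -
      (Real.cos (1 / 25) - Real.sqrt 2 * Real.cos φ) / Real.sin (1 / 25)| ≤ 2 / N := by
  obtain ⟨-, hs1, -, -⟩ := walk_angle_bounds
  have h1 : |Real.cos φ - Real.cos (x / 2)| ≤ 1 / 20 / N := by
    refine (Real.abs_cos_sub_cos_le _ _).trans ?_
    rw [show φ - x / 2 = -((x - 2 * φ) / 2) by ring, abs_neg, abs_div, abs_two]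
    calc |x - 2 * φ| / 2 ≤ 1 / 10 / N / 2 := by gcongr
      _ = _ := by ring
  have h2 : Real.sqrt 2 ≤ 3 / 2 := by
    rw [Real.sqrt_le_left (by norm_num)]; norm_num
  rw [← sub_div, show Real.cos (1 / 25) - Real.sqrt 2 * Real.cos (x / 2) -
    (Real.cos (1 / 25) - Real.sqrt 2 * Real.cos φ) =
      Real.sqrt 2 * (Real.cos φ - Real.cos (x / 2)) by ring, abs_div, abs_mul,
    abs_of_pos (show 0 < Real.sqrt 2 by positivity), abs_of_pos (show 0 < Real.sin (1 / 25) by linarith)]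
  calc Real.sqrt 2 * |Real.cos φ - Real.cos (x / 2)| / Real.sin (1 / 25) ≤
        3 / 2 * (1 / 20 / N) / (39 / 1000) := by gcongr
    _ ≤ 2 / N := by
        rw [show 3 / 2 * (1 / 20 / N) / (39 / 1000) = 75 / 39 / N by field_simp; norm_num]
        gcongr; norm_num

variable {n : ℕ} {A : Matrix (Fin n) (Fin n) ℝ} {U : Matrix (Fin n) (Fin n) ℂ}

/-- The angle for which the walk encodes the wave moment. -/
def waveAngle (j : ℝ) : ℝ := Real.pi / 2 + j * (1 - Real.pi) / 2

/-- `waveAngle j` is the angle `α` for which `sin (α - x j) = cos (j (x - 1/2 + π/2))`; the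
evolution time is `j` itself. -/
theorem exists_walk_phase (hn : 0 < n) (hA : A.IsHermitian)
    (hspec : ∀ i, hA.eigenvalues i ∈ Set.Icc (0 : ℝ) 1) {b : Fin n → ℝ} (hb : b ⬝ᵥ b = 1)
    (hUb : ∀ i, U i ⟨0, hn⟩ = (b i : ℂ)) (j : ℕ) : ∃ φ : ℝ,
    minusAmp hn (reflU U (evolution A j) (1 / 25) (waveAngle j) minusZero) =
      ((-Real.cos φ : ℝ) : ℂ) ∧
    |2 * φ - Real.pi / 2| ≤ 1 / 10 ∧
    waveMoment hA b 0 j = (Real.cos (1 / 25) - Real.sqrt 2 * Real.cos φ) / Real.sin (1 / 25) := by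
  obtain ⟨φ, h1, h2, h3⟩ := exists_phase (abs_waveMoment_le hA hspec hb 0 j)
  refine ⟨φ, ?_, h2, h3⟩
  rw [minusAmp_reflU hn (evolution_mem_unitaryGroup hA _) hb hUb, im_dotProduct_evolution hA, ← h1]
  congr 4
  rw [waveMoment]
  congr 1
  funext x
  rw [pow_zero, mul_one, ← Real.sin_pi_div_two_sub]
  congr 1
  rw [waveAngle]; ring

end Phase
end

noncomputable section

/-! ### The estimation of one wave moment -/

section Estimation

variable {n : ℕ} {A : Matrix (Fin n) (Fin n) ℝ} {U : Matrix (Fin n) (Fin n) ℂ}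

theorem det_asg_seq {P : QProg} {d : ℕ} {e : Ex} {σ : ℕ → ℝ} {τ : ℝ} {Q : (ℕ → ℝ) → Prop}
    (hd : d < 64) (he : e.Ok 64) (h : Det P (Function.update σ d (e.eval σ)) τ Q) :
    Det (.seq (asg d e) P) σ (e.cost + 2 + τ) Q :=
  (det_asg hd he).seq fun σ' hσ' => by subst hσ'; exact h

theorem wp_asg_seq {P : QProg} {d : ℕ} {e : Ex} {σ : ℕ → ℝ} {τ v : ℝ} {Q : (ℕ → ℝ) → Prop}
    {F : (ℕ → ℝ) → ℝ} (hd : d < 64) (he : e.Ok 64)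
    (h : Wp A U P (Function.update σ d (e.eval σ)) τ Q F v) :
    Wp A U (.seq (asg d e) P) σ (e.cost + 2 + τ) Q F v :=
  ((det_asg hd he).wp (F := fun _ => v) fun _ _ => le_rfl).seq fun σ' hσ' => by
    subst hσ'; exact h

/-- Repeat the measurement and count the rounds. -/
def sampleLoop : QProg := .loop 22 (.seq trialProg (asg 23 (.cell 23 + 1)))

theorem TrialMem.congr {σ σ' : ℕ → ℝ} (h : TrialMem σ)
    (h' : ∀ x, x < 17 ∨ (23 < x ∧ x < 28) → σ' x = σ x) : TrialMem σ' := by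
  obtain ⟨h1, h2, h3, h4, h5, h6, h7, h8, h9, h10, h11⟩ := h
  constructor <;> simp only [h' 4 (by norm_num), h' 5 (by norm_num),
    h' 6 (by norm_num), h' 7 (by norm_num), h' 8 (by norm_num), h' 9 (by norm_num),
    h' 13 (by norm_num), h' 14 (by norm_num), h' 15 (by norm_num), h' 16 (by norm_num),
    h' 24 (by norm_num), h' 25 (by norm_num), h' 26 (by norm_num), h' 27 (by norm_num)] <;>
    assumption

/-- For the number `S` of successes in `i` rounds, `(S - i p)² + (c - i) p (1 - p)` is a martingale.
It yields the binomial variance without the distribution. -/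
theorem wp_sampleLoop (hn : 0 < n) (hA : A.IsHermitian) (hU : U ∈ Matrix.unitaryGroup (Fin n) ℂ)
    {σ : ℕ → ℝ} (hσ : TrialMem σ) {k c : ℕ} {φ : ℝ} (hk : σ 20 = k) (hc : ⌊σ 22⌋₊ = c)
    (h21 : σ 21 = 0) (h23 : σ 23 = 0)
    (hφ : minusAmp hn (reflU U (evolution A (σ 13)) (σ 8) (σ 15) minusZero) =
      ((-Real.cos φ : ℝ) : ℂ)) (a t : ℝ) :
    Wp A U sampleLoop σ (1 + c * (k * (walkCost n (σ 13) + 1) + 2 * Real.log n + 28))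
      (fun σ' => ∃ S, σ' = Function.update (Function.update σ 21 S) 23 c)
      (fun σ' => a + t * (σ' 21 - c * Real.cos (k * φ) ^ 2) ^ 2)
      (a + t * (c * (Real.cos (k * φ) ^ 2 * (1 - Real.cos (k * φ) ^ 2)))) := by
  set p := Real.cos (k * φ) ^ 2 with hp
  have main := wp_loop (A := A) (U := U) (P := .seq trialProg (asg 23 (.cell 23 + 1))) (σ := σ)
    (x := 22) (k := c)
    (fun i σ' => ∃ S, σ' = Function.update (Function.update σ 21 S) 23 i)
    (fun i σ' => a + t * ((σ' 21 - i * p) ^ 2 + (c - i) * (p * (1 - p))))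
    (fun _ => k * (walkCost n (σ 13) + 1) + 2 * Real.log n + 27) (by norm_num) hc
    ⟨0, by
      rw [← h21, Function.update_eq_self, Nat.cast_zero, ← h23, Function.update_eq_self]⟩ ?_
  · refine main.mono ?_ (fun _ h => h) (fun _ _ => ?_) ?_
    · rw [Finset.sum_const, Finset.card_range, nsmul_eq_mul]
      exact le_of_eq (by ring)
    · exact le_of_eq (by ring)
    · rw [h21]; exact le_of_eq (by push_cast; ring)
  · rintro i hi σ' ⟨S, rfl⟩
    set σ' := Function.update (Function.update σ 21 S) 23 (i : ℝ) with hσ'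
    have hag : ∀ x, x < 21 ∨ 23 < x → σ' x = σ x := by
      intro x hx
      rw [hσ', Function.update_of_ne (by omega), Function.update_of_ne (by omega)]
    have h1 := wp_trialProg hn hA hU (hσ.congr (σ' := σ') fun x hx => hag x (by omega))
      ((hag 20 (by norm_num)).trans hk) (φ := φ)
      (by rw [hag 13 (by norm_num), hag 8 (by norm_num), hag 15 (by norm_num)]; exact hφ)
      (fun σ'' => a + t * ((σ'' 21 - (i + 1 : ℕ) * p) ^ 2 + (c - (i + 1 : ℕ)) * (p * (1 - p))))
    rw [hag 13 (by norm_num)] at h1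
    have h2 := h1.seq (P' := asg 23 (.cell 23 + 1)) (τ' := 5)
      (Q' := fun σ'' => ∃ S, σ'' = Function.update (Function.update σ 21 S) 23 ((i + 1 : ℕ) : ℝ))
      (F := fun σ'' => a + t * ((σ'' 21 - (i + 1 : ℕ) * p) ^ 2 +
        (c - (i + 1 : ℕ)) * (p * (1 - p)))) ?_
    · refine h2.mono (by linarith) (fun _ h => h) (fun _ _ => le_rfl) ?_
      have e1 : σ' 21 = S := by simp [hσ']
      simp only [Function.update_self, e1, ← hp]
      push_cast
      exact le_of_eq (by ring)
    · rintro σ'' hσ''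
      refine Wp.mono ((det_asg (by norm_num) (by simp)).wp
        (F := fun σ'' => a + t * ((σ'' 21 - (i + 1 : ℕ) * p) ^ 2 + (c - (i + 1 : ℕ)) * (p * (1 - p))))
        (v := a + t * ((σ'' 21 - (i + 1 : ℕ) * p) ^ 2 + (c - (i + 1 : ℕ)) * (p * (1 - p)))) ?_)
        (by norm_num) ?_ (fun _ _ => le_rfl) le_rfl
      · rintro _ rfl
        rw [Function.update_of_ne (by norm_num)]
      · rintro _ rfl
        rcases hσ'' with rfl | rfl
        · refine ⟨S, ?_⟩
          simp [hσ']
        · refine ⟨S + 1, ?_⟩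
          funext x
          simp only [hσ', Function.update_apply]
          split_ifs <;> simp_all

/-- Sine. -/
def Ex.sin (x : Ex) : Ex := (x - Ex.pi / 2).cos

@[simp] theorem Ex.eval_sin (σ : ℕ → ℝ) (x : Ex) : x.sin.eval σ = Real.sin (x.eval σ) := by
  simp [Ex.sin, Real.cos_sub_pi_div_two]

@[simp] theorem Ex.cost_sin (x : Ex) : x.sin.cost = 2 * x.cost + 9 := by
  simp [Ex.sin]; ring

@[simp] theorem Ex.ok_sin (x : Ex) (k : ℕ) :
    x.sin.Ok k ↔ (x.Ok k ∧ k + 2 < 90) ∧ (x.Ok (k + 1) ∧ k + 3 < 90) := by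
  simp only [Ex.sin, Ex.ok_cos, Ex.ok_sub, Ex.ok_div, Ex.ok_pi, Ex.ok_ofNat]
  constructor
  · rintro ⟨⟨h1, -, h2⟩, h3, -, h4⟩; exact ⟨⟨h1, h2⟩, h3, h4⟩
  · rintro ⟨⟨h1, h2⟩, h3, h4⟩; exact ⟨⟨h1, by omega, h2⟩, h3, by omega, h4⟩

/-- Choose the number of rounds of the walk and the number of samples. -/
def stageStart (P : QProg) : QProg :=
  .seq (asg 28 ((Ex.cell 18 * .cell 19).cos * (Ex.cell 18 * .cell 19).cos)) <|
  .seq (asg 29 (3 / 4)) <|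
  -- The choice between `N` and `N + 1` steps is the one of `half_le_abs_sin`.
  .seq (.ite 28 29 (asg 20 (.cell 18)) (asg 20 (.cell 18 + 1))) <|
  -- Coarse stages have cheap samples and get more of them: with `√(t/N)` samples, time goes like
  -- `√(t N)` and failure like `√(N/t)`, both geometric in the stages. The factor `(1 + j)²` makes
  -- the failures summable over the moments.
  .seq (asg 22 (1920000 * ((1 + .cell 13) * (1 + .cell 13)) * (Ex.cell 17 / .cell 18).sqrt + 1)) <|
  .seq (asg 21 0) <|
  .seq (asg 23 0) P

/-- Improve the estimate of the phase and double the precision. -/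
def stageEnd : QProg :=
  .seq (asg 19 (.cell 19 + ((Ex.cell 20 * .cell 19).cos - (2 * .cell 21 / .cell 23 - 1)) /
    (.cell 20 * (Ex.cell 20 * .cell 19).sin))) <|
  asg 18 (2 * .cell 18)

/-- One stage of the phase estimation. -/
def stageBody : QProg := stageStart (.seq sampleLoop stageEnd)

/-- The number of samples. -/
def sampleCount (j t N : ℝ) : ℕ := ⌊1920000 * ((1 + j) * (1 + j)) * Real.sqrt (t / N) + 1⌋₊

theorem sampleCount_pos {j : ℝ} (hj : 0 ≤ j) (t N : ℝ) : 0 < sampleCount j t N := by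
  rw [sampleCount, Nat.floor_pos]
  have : 0 ≤ 1920000 * ((1 + j) * (1 + j)) * Real.sqrt (t / N) := by positivity
  linarith

theorem det_stageEnd (σ : ℕ → ℝ) :
    Det stageEnd σ 60 (fun σ' => (∀ x, x ≠ 18 → x ≠ 19 → σ' x = σ x) ∧ σ' 18 = 2 * σ 18 ∧
      σ' 19 = σ 19 + (Real.cos (σ 20 * σ 19) - (2 * σ 21 / σ 23 - 1)) /
        (σ 20 * Real.sin (σ 20 * σ 19))) := by
  refine Det.mono (det_asg_seq (by norm_num) (by simp) (det_asg (by norm_num) (by simp)))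
    (by simp; norm_num) ?_
  rintro _ rfl
  refine ⟨fun x h1 h2 => ?_, ?_, ?_⟩
  · rw [Function.update_of_ne h1, Function.update_of_ne h2]
  · simp
  · simp

theorem wp_stageStart {P : QProg} {σ : ℕ → ℝ} {N : ℕ} (hN : 1 ≤ N) (h18 : σ 18 = N) {τ v : ℝ}
    {Q : (ℕ → ℝ) → Prop} {F : (ℕ → ℝ) → ℝ}
    (h : ∀ (σ' : ℕ → ℝ) (k : ℕ), (∀ x, x < 20 ∨ (23 < x ∧ x < 28) ∨ 29 < x → σ' x = σ x) →
      σ' 20 = k → N ≤ k → k ≤ 2 * N → σ' 21 = 0 → σ' 23 = 0 →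
      ⌊σ' 22⌋₊ = sampleCount (σ 13) (σ 17) N →
      (|σ 19 - Real.pi / 2| ≤ 1 / 5 → 1 / 2 ≤ |Real.sin (k * σ 19)|) → Wp A U P σ' τ Q F v) :
    Wp A U (stageStart P) σ (80 + τ) Q F v := by
  set k : ℕ := if Real.cos (N * σ 19) * Real.cos (N * σ 19) ≤ 3 / 4 then N else N + 1 with hk
  have hite : ∀ σ' : ℕ → ℝ, σ' 28 = Real.cos (N * σ 19) * Real.cos (N * σ 19) → σ' 29 = 3 / 4 →
      σ' 18 = N → Det (.ite 28 29 (asg 20 (.cell 18)) (asg 20 (.cell 18 + 1))) σ' 6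
        (· = Function.update σ' 20 (k : ℝ)) := by
    intro σ' e1 e2 e3
    refine Det.mono (det_ite (τ := 5) (by norm_num) (by norm_num) (fun hle => ?_) (fun hlt => ?_))
      (by norm_num) fun _ h => h
    · rw [e1, e2] at hle
      rw [hk, if_pos hle]
      refine (det_asg (by norm_num) (by simp)).mono (by norm_num) ?_
      rintro _ rfl
      simp [e3]
    · rw [e1, e2] at hlt
      rw [hk, if_neg (not_le.2 hlt)]
      refine (det_asg (by norm_num) (by simp)).mono (by norm_num) ?_
      rintro _ rfl
      simp [e3]
  refine Wp.mono (wp_asg_seq (by norm_num) (by simp) <| wp_asg_seq (by norm_num) (by simp) <|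
    ((hite _ ?_ ?_ ?_).wp (F := fun _ => v) fun _ _ => le_rfl).seq (P' := _) (τ' := 40 + τ)
      ?_) ?_ (fun _ h => h) (fun _ _ => le_rfl) le_rfl
  · simp [h18]
  · simp
  · simp [h18]
  · rintro _ rfl
    refine Wp.mono (wp_asg_seq (by norm_num) (by simp) <| wp_asg_seq (by norm_num) (by simp) <|
      wp_asg_seq (by norm_num) (by simp) <| h _ k ?_ ?_ ?_ ?_ ?_ ?_ ?_ ?_) ?_
      (fun _ h => h) (fun _ _ => le_rfl) le_rfl
    · intro x hx
      iterate 6 rw [Function.update_of_ne (by omega)]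
    · simp
    · rw [hk]; split_ifs <;> omega
    · rw [hk]; split_ifs <;> omega
    · simp
    · simp
    · simp [sampleCount, h18]
    · intro hx
      have := half_le_abs_sin N hx
      rw [hk]
      split_ifs with hle
      · exact this.1 hle
      · exact this.2 (not_le.1 hle)
    · simp; linarith
  · simp; linarith

/-- Chebyshev's inequality: the scaled squared deviation is at least 1 whenever the Newton step
misses its precision, and its expectation is at most `160000 / c`. After an earlier failure only the
trivial bound 1 is claimed. -/
theorem wp_stageBody (hn : 0 < n) (hA : A.IsHermitian) (hU : U ∈ Matrix.unitaryGroup (Fin n) ℂ)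
    {σ : ℕ → ℝ} (hσ : TrialMem σ) {N : ℕ} {φ a : ℝ} (hN : 1 ≤ N) (h18 : σ 18 = N)
    (h13 : 0 ≤ σ 13)
    (hφ : minusAmp hn (reflU U (evolution A (σ 13)) (σ 8) (σ 15) minusZero) =
      ((-Real.cos φ : ℝ) : ℂ)) (hφ' : |2 * φ - Real.pi / 2| ≤ 1 / 10) (ha : 0 ≤ a) (ha1 : a ≤ 1) :
    Wp A U stageBody σ
      (sampleCount (σ 13) (σ 17) N * (2 * N * (walkCost n (σ 13) + 1) + 2 * Real.log n + 28) + 141)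
      (fun σ' => (∀ x, x < 18 ∨ (23 < x ∧ x < 28) ∨ 29 < x → σ' x = σ x) ∧ σ' 18 = (2 * N : ℕ))
      (fun σ' => if |σ' 19 - 2 * φ| ≤ 1 / 10 / (2 * N : ℕ) then a else 1)
      (if |σ 19 - 2 * φ| ≤ 1 / 10 / N then a + 160000 / sampleCount (σ 13) (σ 17) N else 1) := by
  set c := sampleCount (σ 13) (σ 17) N with hc
  have hc0 : (0 : ℝ) < c := by exact_mod_cast sampleCount_pos h13 _ _
  have hN' : (1 : ℝ) ≤ N := by exact_mod_cast hN
  have hwc : 0 ≤ walkCost n (σ 13) := by unfold walkCost; positivity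
  refine (wp_stageStart hN h18 (τ := c * (2 * N * (walkCost n (σ 13) + 1) + 2 * Real.log n + 28) + 61)
    ?_).mono (by linarith) (fun _ h => h) (fun _ _ => le_rfl) le_rfl
  intro σ₁ k hag h20 hk1 hk2 h21 h23 h22 hsin
  -- `640000 = 4 · 400²`: the estimate `2 S / c - 1` of `cos (2 k φ)` has to be accurate to 1/400.
  set t : ℝ := 640000 / c ^ 2 with ht
  have hp0 : 0 ≤ Real.cos (k * φ) ^ 2 := sq_nonneg _
  have hp1 : Real.cos (k * φ) ^ 2 * (1 - Real.cos (k * φ) ^ 2) ≤ 1 / 4 := by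
    nlinarith [sq_nonneg (Real.cos (k * φ) ^ 2 - 1 / 2)]
  have h1 := wp_sampleLoop hn hA hU (hσ.congr (σ' := σ₁) fun x hx => hag x (by omega)) h20 h22 h21 h23
    (φ := φ) (by rw [hag 13 (by norm_num), hag 8 (by norm_num), hag 15 (by norm_num)]; exact hφ) a t
  rw [hag 13 (by norm_num)] at h1
  have hcost : 1 + (c : ℝ) * (k * (walkCost n (σ 13) + 1) + 2 * Real.log n + 28) + 60 ≤
      c * (2 * N * (walkCost n (σ 13) + 1) + 2 * Real.log n + 28) + 61 := by
    have : (k : ℝ) ≤ 2 * N := by exact_mod_cast hk2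
    have : (c : ℝ) * (k * (walkCost n (σ 13) + 1) + 2 * Real.log n + 28) ≤
        c * (2 * N * (walkCost n (σ 13) + 1) + 2 * Real.log n + 28) := by gcongr
    linarith
  have hQ : ∀ σ₂, (∃ S, σ₂ = Function.update (Function.update σ₁ 21 S) 23 (c : ℝ)) →
      ∀ σ₃ : ℕ → ℝ, ((∀ x, x ≠ 18 → x ≠ 19 → σ₃ x = σ₂ x) ∧ σ₃ 18 = 2 * σ₂ 18 ∧
      σ₃ 19 = σ₂ 19 + (Real.cos (σ₂ 20 * σ₂ 19) - (2 * σ₂ 21 / σ₂ 23 - 1)) /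
        (σ₂ 20 * Real.sin (σ₂ 20 * σ₂ 19))) →
      ((∀ x, x < 18 ∨ (23 < x ∧ x < 28) ∨ 29 < x → σ₃ x = σ x) ∧ σ₃ 18 = (2 * N : ℕ)) := by
    rintro _ ⟨S, rfl⟩ σ₃ ⟨e1, e2, -⟩
    refine ⟨fun x hx => ?_, ?_⟩
    · rw [e1 x (by omega) (by omega), Function.update_of_ne (by omega),
        Function.update_of_ne (by omega), hag x (by omega)]
    · rw [e2, Function.update_of_ne (by norm_num), Function.update_of_ne (by norm_num),
        hag 18 (by norm_num), h18]
      push_cast; ring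
  split_ifs with hgood
  · refine (h1.seq (P' := stageEnd) (τ' := 60) (F := fun σ' =>
      if |σ' 19 - 2 * φ| ≤ 1 / 10 / (2 * N : ℕ) then a else 1) fun σ₂ hσ₂ =>
      ((det_stageEnd σ₂).wp fun σ₃ hσ₃ => ?_).mono le_rfl (hQ σ₂ hσ₂) (fun _ _ => le_rfl) le_rfl).mono
      hcost (fun _ h => h) (fun _ _ => le_rfl) ?_
    · obtain ⟨S, rfl⟩ := hσ₂
      obtain ⟨-, -, e3⟩ := hσ₃
      rw [Function.update_self, Function.update_of_ne (by norm_num), Function.update_of_ne (by norm_num),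
        Function.update_of_ne (by norm_num), Function.update_of_ne (by norm_num),
        Function.update_of_ne (by norm_num), Function.update_self, h20, hag 19 (by norm_num)] at e3
      rw [Function.update_of_ne (by norm_num), Function.update_self]
      have ht0 : 0 ≤ t * (S - c * Real.cos (k * φ) ^ 2) ^ 2 := by positivity
      have hnear : |σ 19 - Real.pi / 2| ≤ 1 / 5 := by
        have e4 : (1 : ℝ) / 10 / N ≤ 1 / 10 := div_le_self (by norm_num) hN'
        have := abs_sub_le (σ 19) (2 * φ) (Real.pi / 2)
        linarith
      split_ifs with hbad
      · linarith
      · have hdev : ¬ |2 * S / c - 1 - Real.cos (k * (2 * φ))| ≤ 1 / 400 := by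
          intro hy
          refine hbad ?_
          rw [e3]
          have := newton_step hN hk1 hk2 (hsin hnear) hgood hy
          push_cast
          exact this
        have e5 : 2 * S / c - 1 - Real.cos (k * (2 * φ)) =
            2 / c * (S - c * Real.cos (k * φ) ^ 2) := by
          rw [show (k : ℝ) * (2 * φ) = 2 * (k * φ) by ring, Real.cos_two_mul]
          field_simp
          ring
        have e6 : (1 / 400 : ℝ) ^ 2 ≤ (2 / c * (S - c * Real.cos (k * φ) ^ 2)) ^ 2 := by
          rw [← e5, ← sq_abs (2 * S / c - 1 - _)]
          exact pow_le_pow_left₀ (by norm_num) (not_le.1 hdev).le 2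
        have e7 : t * (S - c * Real.cos (k * φ) ^ 2) ^ 2 =
            160000 * (2 / c * (S - c * Real.cos (k * φ) ^ 2)) ^ 2 := by
          rw [ht, mul_pow, div_pow]; ring
        linarith
    · have e8 : t * (c * (Real.cos (k * φ) ^ 2 * (1 - Real.cos (k * φ) ^ 2))) ≤ t * (c * (1 / 4)) := by
        gcongr
      have e9 : t * (c * (1 / 4)) = 160000 / c := by rw [ht]; field_simp; norm_num
      linarith
  · refine ((h1.seq (P' := stageEnd) (τ' := 60) (F := fun _ => a) (v := a + t * (c *
      (Real.cos (k * φ) ^ 2 * (1 - Real.cos (k * φ) ^ 2)))) fun σ₂ hσ₂ =>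
      ((det_stageEnd σ₂).mono le_rfl fun σ₃ hσ₃ => hQ σ₂ hσ₂ σ₃ hσ₃).wp fun σ₃ hσ₃ => ?_).mono
      hcost (fun _ h => h) (fun _ _ => le_rfl) le_rfl).of_bound fun σ' _ => ?_
    · have : 0 ≤ t * (σ₂ 21 - c * Real.cos (k * φ) ^ 2) ^ 2 := by positivity
      linarith
    · split_ifs <;> linarith

end Estimation
end

noncomputable section

/-! ### The sequence of doubled precisions -/

section Levels

/-- The precisions that the phase estimation runs through until the target is reached. -/
def level (t : ℝ) : ℕ → ℕ
  | 0 => 1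
  | i + 1 => if t ≤ level t i then level t i else 2 * level t i

theorem one_le_level (t : ℝ) (i : ℕ) : 1 ≤ level t i := by
  induction i with
  | zero => exact le_rfl
  | succ i ih => rw [level]; split_ifs <;> omega

theorem level_le (t : ℝ) (i : ℕ) : level t i = 1 ∨ (level t i : ℝ) < 2 * t := by
  induction i with
  | zero => exact Or.inl rfl
  | succ i ih =>
    rw [level]
    split_ifs with h
    · exact ih
    · right; push_cast; linarith [not_le.1 h]

/-- Since `2 ^ i > i`, doubling reaches `t` within `⌊t⌋` rounds. That many rounds are affordable
because those after the target are idle. -/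
theorem le_level (t : ℝ) : t ≤ level t ⌊t⌋₊ := by
  have key : ∀ i, t ≤ level t i ∨ level t i = 2 ^ i := by
    intro i
    induction i with
    | zero => right; rfl
    | succ i ih =>
      rw [level]
      split_ifs with h
      · exact Or.inl h
      · rcases ih with ih | ih
        · exact absurd ih h
        · right; rw [ih, pow_succ]; ring
  rcases key ⌊t⌋₊ with h | h
  · exact h
  · rw [h]
    have h1 : (⌊t⌋₊ : ℝ) + 1 ≤ (2 ^ ⌊t⌋₊ : ℕ) := by exact_mod_cast Nat.lt_two_pow_self
    linarith [Nat.lt_floor_add_one t]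

theorem sqrt_two_bounds : 7 / 5 ≤ Real.sqrt 2 ∧ Real.sqrt 2 ≤ 3 / 2 := by
  constructor
  · rw [Real.le_sqrt (by norm_num) (by norm_num)]; norm_num
  · rw [Real.sqrt_le_left (by norm_num)]; norm_num

/-- The terms grow by the factor `√2`, and `5/2 (√2 - 1) ≥ 1` bounds the sum by a telescoping one.
The last level is 1 or below `2 t`. -/
theorem sum_sqrt_level {t : ℝ} (ht : 0 ≤ t) (r : ℕ) :
    ∑ i ∈ Finset.range r, (if t ≤ level t i then 0 else Real.sqrt (t * level t i)) ≤ 4 * t := by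
  have key : ∑ i ∈ Finset.range r, (if t ≤ level t i then 0 else Real.sqrt (t * level t i)) ≤
      5 / 2 * (Real.sqrt (t * level t r) - Real.sqrt t) := by
    induction r with
    | zero => simp [level]
    | succ r ih =>
      rw [Finset.sum_range_succ, level]
      split_ifs with h
      · simpa using ih
      · have e : Real.sqrt (t * (2 * level t r : ℕ)) = Real.sqrt 2 * Real.sqrt (t * level t r) := by
          rw [← Real.sqrt_mul (by norm_num)]; congr 1; push_cast; ring
        rw [e]
        nlinarith [sqrt_two_bounds.1, Real.sqrt_nonneg (t * level t r)]
  refine key.trans ?_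
  rcases level_le t r with h | h
  · rw [h, Nat.cast_one, mul_one, sub_self, mul_zero]; positivity
  · have h1 : Real.sqrt (t * level t r) ≤ Real.sqrt 2 * t := by
      rw [Real.sqrt_le_left (by positivity), mul_pow, Real.sq_sqrt (by norm_num)]
      nlinarith
    nlinarith [sqrt_two_bounds.2, Real.sqrt_nonneg t]

end Levels

/-! ### Phase estimation and the estimation of a single moment -/

section Estimation

variable {n : ℕ} {A : Matrix (Fin n) (Fin n) ℝ} {U : Matrix (Fin n) (Fin n) ℂ}

/-- The estimation of a phase. -/
def phaseLoop : QProg := .loop 17 (.ite 17 18 (asg 21 0) stageBody)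

theorem log_bounds {n : ℕ} (hn : 2 ≤ n) : 1 ≤ 4 * Real.log n ^ 2 ∧ Real.log n ≤ 2 * Real.log n ^ 2 ∧
    1 / 2 ≤ Real.log n := by
  have h1 : 1 / 2 ≤ Real.log n := by
    have := Real.log_two_gt_d9
    have h2 : Real.log 2 ≤ Real.log n := Real.log_le_log (by norm_num) (by exact_mod_cast hn)
    linarith
  exact ⟨by nlinarith, by nlinarith, h1⟩

/-- `√(t/N)` samples of `N` steps give `√(t N)`. Of the three powers of `1 + j`, two come from the
number of samples and one from the evolution time. -/
theorem stage_cost_le (hn : 2 ≤ n) {j t : ℝ} {N : ℕ} (hj : 0 ≤ j) (hN : 1 ≤ N) (ht : N < t) :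
    sampleCount j t N * (2 * N * (walkCost n j + 1) + 2 * Real.log n + 28) + 143 ≤
      400000000 * ((1 + j) ^ 3 * Real.log n ^ 2) * Real.sqrt (t * N) := by
  obtain ⟨h1, h2, h3⟩ := log_bounds hn
  set L := Real.log n ^ 2 with hL
  have hN' : (1 : ℝ) ≤ N := by exact_mod_cast hN
  have hs : 1 ≤ Real.sqrt (t / N) := by
    rw [Real.one_le_sqrt, one_le_div (by linarith)]; exact ht.le
  have ht0 : 0 < t := by linarith
  have hsN : Real.sqrt (t / N) * N = Real.sqrt (t * N) := by
    have : t * N = t / N * (N : ℝ) ^ 2 := by field_simp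
    rw [this, Real.sqrt_mul (by positivity), Real.sqrt_sq (by positivity)]
  have hj2 : 1 ≤ (1 + j) * (1 + j) := by nlinarith
  have hc : (sampleCount j t N : ℝ) ≤ 1920001 * ((1 + j) * (1 + j)) * Real.sqrt (t / N) := by
    refine (Nat.floor_le (by positivity)).trans ?_
    nlinarith [mul_le_mul hj2 hs zero_le_one (by positivity)]
  have hw : walkCost n j + 1 ≤ 42 * ((1 + j) * L) := by
    rw [walkCost, abs_of_nonneg hj, ← hL]
    have : 0 ≤ j * L := by positivity
    nlinarith
  have hL0 : 0 ≤ L := by positivity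
  have hNj : 1 ≤ N * (1 + j) := by nlinarith
  have hNjL : L ≤ N * (1 + j) * L := le_mul_of_one_le_left hL0 hNj
  have hw2 : 2 * N * (walkCost n j + 1) + 2 * Real.log n + 28 ≤ 200 * (N * (1 + j) * L) := by
    have : 2 * N * (walkCost n j + 1) ≤ 2 * N * (42 * ((1 + j) * L)) := by gcongr
    nlinarith
  have h143 : (143 : ℝ) ≤ 572 * ((1 + j) * (1 + j)) * Real.sqrt (t / N) * (N * (1 + j) * L) := by
    have e1 : 1 ≤ ((1 + j) * (1 + j)) * Real.sqrt (t / N) := by nlinarith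
    have e2 : 1 / 4 ≤ N * (1 + j) * L := by linarith
    nlinarith [mul_le_mul e1 e2 (by norm_num) (by positivity)]
  calc _ ≤ 1920001 * ((1 + j) * (1 + j)) * Real.sqrt (t / N) * (200 * (N * (1 + j) * L)) +
        572 * ((1 + j) * (1 + j)) * Real.sqrt (t / N) * (N * (1 + j) * L) := by
        refine add_le_add ?_ h143
        exact mul_le_mul hc hw2 (by unfold walkCost; positivity) (by positivity)
    _ = 384000772 * ((1 + j) ^ 3 * L) * (Real.sqrt (t / N) * N) := by ring
    _ ≤ _ := by
        rw [hsN]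
        gcongr
        norm_num

theorem wp_phaseLoop (hn : 2 ≤ n) (hA : A.IsHermitian) (hU : U ∈ Matrix.unitaryGroup (Fin n) ℂ)
    {σ : ℕ → ℝ} (hσ : TrialMem σ) {j : ℕ} {t φ a : ℝ} (h13 : σ 13 = j) (h17 : σ 17 = t) (ht : 0 < t)
    (h18 : σ 18 = 1) (h19 : σ 19 = Real.pi / 2)
    (hφ : minusAmp (by omega) (reflU U (evolution A j) (σ 8) (σ 15) minusZero) =
      ((-Real.cos φ : ℝ) : ℂ)) (hφ' : |2 * φ - Real.pi / 2| ≤ 1 / 10) (ha : 0 ≤ a)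
    (ha1 : a + 1 / (3 * (1 + (j : ℝ)) ^ 2) ≤ 1) :
    Wp A U phaseLoop σ (1 + 5 * t + 1600000000 * ((1 + (j : ℝ)) ^ 3 * Real.log n ^ 2) * t)
      (fun σ' => (∀ x, x < 18 ∨ (23 < x ∧ x < 28) ∨ 29 < x → σ' x = σ x))
      (fun σ' => if |σ' 19 - 2 * φ| ≤ 1 / 10 / t then a else 1)
      (a + 1 / (3 * (1 + (j : ℝ)) ^ 2)) := by
  set κ : ℝ := 1 / (12 * (1 + (j : ℝ)) ^ 2) with hκ
  have hκ0 : 0 < κ := by positivity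
  have hκ4 : 1 / (3 * (1 + (j : ℝ)) ^ 2) = κ * 4 := by rw [hκ]; field_simp; norm_num
  rw [hκ4] at ha1 ⊢
  -- `κ R N` bounds the failure probability still to come at level `N`. A stage spends at most `κ
  -- √(N/t)`, where `1/12 = 160000/1920000`, and `5/2 (√2 - 1) ≥ 1` makes the budget suffice.
  set R : ℕ → ℝ := fun N => if t ≤ N then 0 else 4 - 5 / 2 * Real.sqrt (N / t) with hR
  have hR4 : ∀ N, R N ≤ 4 := by
    intro N; simp only [hR]; split_ifs
    · norm_num
    · linarith [Real.sqrt_nonneg ((N : ℝ) / t)]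
  have hR0 : ∀ N, 0 ≤ R N := by
    intro N; simp only [hR]; split_ifs with h
    · exact le_rfl
    · have : Real.sqrt ((N : ℝ) / t) ≤ 1 := by
        exact Real.sqrt_le_one.2 ((div_le_one ht).2 (not_le.1 h).le)
      linarith
  have main := wp_loop (A := A) (U := U) (P := .ite 17 18 (asg 21 0) stageBody) (σ := σ)
    (x := 17) (k := ⌊t⌋₊)
    (fun i σ' => (∀ x, x < 18 ∨ (23 < x ∧ x < 28) ∨ 29 < x → σ' x = σ x) ∧ σ' 18 = level t i)
    (fun i σ' => if |σ' 19 - 2 * φ| ≤ 1 / 10 / level t i then a + κ * R (level t i) else 1)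
    (fun i => 4 + 400000000 * ((1 + (j : ℝ)) ^ 3 * Real.log n ^ 2) *
      (if t ≤ level t i then 0 else Real.sqrt (t * level t i))) (by norm_num) (by rw [h17])
    ⟨fun _ _ => rfl, by rw [h18]; simp [level]⟩ ?_
  · refine main.mono ?_ (fun _ h => h.1) (fun σ' hσ' => ?_) ?_
    · have e1 : ∑ i ∈ Finset.range ⌊t⌋₊, (4 + 400000000 * ((1 + (j : ℝ)) ^ 3 * Real.log n ^ 2) *
          (if t ≤ level t i then 0 else Real.sqrt (t * level t i)) + 1) = 5 * ⌊t⌋₊ +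
          400000000 * ((1 + (j : ℝ)) ^ 3 * Real.log n ^ 2) * ∑ i ∈ Finset.range ⌊t⌋₊,
          (if t ≤ level t i then 0 else Real.sqrt (t * level t i)) := by
        rw [Finset.mul_sum, Finset.sum_add_distrib, Finset.sum_add_distrib]
        simp only [Finset.sum_const, Finset.card_range, nsmul_eq_mul]
        ring
      have e2 := mul_le_mul_of_nonneg_left (sum_sqrt_level ht.le ⌊t⌋₊)
        (show 0 ≤ 400000000 * ((1 + (j : ℝ)) ^ 3 * Real.log n ^ 2) by positivity)
      have e3 := Nat.floor_le ht.le
      rw [e1]; linarith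
    · have e1 := le_level t
      have e2 : (1 : ℝ) / 10 / level t ⌊t⌋₊ ≤ 1 / 10 / t := by gcongr
      have e3 : R (level t ⌊t⌋₊) = 0 := by simp only [hR]; rw [if_pos e1]
      rw [e3, mul_zero, add_zero]
      split_ifs with h4 h5 h5
      · exact le_rfl
      · nlinarith
      · exact absurd (h5.trans e2) h4
      · exact le_rfl
    · have e1 : |σ 19 - 2 * φ| ≤ 1 / 10 / level t 0 := by
        rw [h19, abs_sub_comm]; simpa [level] using hφ'
      rw [if_pos e1]
      have := mul_le_mul_of_nonneg_left (hR4 (level t 0)) hκ0.le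
      linarith
  · rintro i - σ' ⟨hag, hlev⟩
    have hN := one_le_level t i
    set N := level t i with hNdef
    have hN' : (1 : ℝ) ≤ N := by exact_mod_cast hN
    have e17 : σ' 17 = t := by rw [hag 17 (by norm_num), h17]
    refine (wp_ite (τ := 3 + 400000000 * ((1 + (j : ℝ)) ^ 3 * Real.log n ^ 2) *
      (if t ≤ N then 0 else Real.sqrt (t * N))) (by norm_num) (by norm_num) (fun hle => ?_)
      (fun hlt => ?_)).mono (by linarith) (fun _ h => h) (fun _ _ => le_rfl) le_rfl
    · rw [e17, hlev] at hle
      have e1 : level t (i + 1) = N := by rw [level, if_pos hle]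
      rw [e1, if_pos hle, mul_zero, add_zero]
      refine ((det_asg (by norm_num) (by simp)).wp fun σ'' hσ'' => ?_).mono (by norm_num)
        (fun σ'' hσ'' => ?_) (fun _ _ => le_rfl) le_rfl
      · rw [hσ'', Function.update_of_ne (by norm_num)]
      · subst hσ''
        refine ⟨fun x hx => ?_, ?_⟩
        · rw [Function.update_of_ne (by omega), hag x hx]
        · rw [Function.update_of_ne (by norm_num), hlev]
    · rw [e17, hlev] at hlt
      have e1 : level t (i + 1) = 2 * N := by rw [level, if_neg (not_le.2 hlt)]
      rw [e1, if_neg (not_le.2 hlt)]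
      have e13 : σ' 13 = j := by rw [hag 13 (by norm_num), h13]
      have hR1 : 0 ≤ κ * R (2 * N) := mul_nonneg hκ0.le (hR0 _)
      have hR2 : a + κ * R (2 * N) ≤ 1 := by
        have := mul_le_mul_of_nonneg_left (hR4 (2 * N)) hκ0.le
        linarith
      have h1 := wp_stageBody (by omega) hA hU (hσ.congr (σ' := σ') fun x hx => hag x (by omega))
        (N := N) (φ := φ) (a := a + κ * R (2 * N)) hN hlev (by rw [e13]; positivity)
        (by rw [e13, hag 8 (by norm_num), hag 15 (by norm_num)]; exact hφ) hφ' (by linarith) hR2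
      rw [e13, e17] at h1
      refine h1.mono ?_ (fun σ'' hσ'' => ⟨fun x hx => ?_, hσ''.2⟩) (fun _ _ => le_rfl) ?_
      · have := stage_cost_le hn (j := j) (by positivity) hN hlt
        linarith
      · rw [hσ''.1 x hx, hag x hx]
      · have hsq : 0 < Real.sqrt (N / t) := by positivity
        have hsq1 : Real.sqrt ((N : ℝ) / t) ≤ 1 := by
          exact Real.sqrt_le_one.2 ((div_le_one ht).2 hlt.le)
        have hc : 1920000 * (1 + (j : ℝ)) ^ 2 / Real.sqrt (N / t) ≤ sampleCount j t N := by
          have e2 : Real.sqrt (t / N) = 1 / Real.sqrt (N / t) := by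
            rw [← inv_div, Real.sqrt_inv, one_div]
          have e3 := Nat.lt_floor_add_one (1920000 * ((1 + (j : ℝ)) * (1 + j)) * Real.sqrt (t / N) + 1)
          rw [sampleCount]
          rw [e2] at e3 ⊢
          have e4 : 1920000 * (1 + (j : ℝ)) ^ 2 / Real.sqrt (N / t) =
            1920000 * ((1 + (j : ℝ)) * (1 + j)) * (1 / Real.sqrt (N / t)) := by ring
          linarith
        have hfail : 160000 / (sampleCount j t N : ℝ) ≤ κ * Real.sqrt (N / t) := by
          calc 160000 / (sampleCount j t N : ℝ) ≤
              160000 / (1920000 * (1 + (j : ℝ)) ^ 2 / Real.sqrt (N / t)) := by gcongr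
            _ = _ := by rw [hκ]; field_simp; norm_num
        have hdiff : R (2 * N) + Real.sqrt (N / t) ≤ R N := by
          simp only [hR]
          rw [if_neg (not_le.2 hlt)]
          split_ifs with h2
          · linarith
          · have e5 : Real.sqrt (((2 * N : ℕ) : ℝ) / t) = Real.sqrt 2 * Real.sqrt (N / t) := by
              rw [← Real.sqrt_mul (by norm_num)]; congr 1; push_cast; ring
            rw [e5]
            nlinarith [sqrt_two_bounds.1]
        split_ifs with h6
        · have := mul_le_mul_of_nonneg_left hdiff hκ0.le
          linarith
        · exact le_rfl

/-- The constants that the estimation needs. -/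
structure BaseMem (σ : ℕ → ℝ) : Prop where
  c4 : σ 4 = 0
  c5 : σ 5 = 1
  c6 : σ 6 = 2
  c7 : σ 7 = Real.pi
  c8 : σ 8 = 1 / 25
  c9 : σ 9 = -(1 / 25)
  c24 : σ 24 = 0
  c25 : σ 25 = 0
  c26 : σ 26 = 0
  c27 : σ 27 = 0

theorem BaseMem.congr {σ σ' : ℕ → ℝ} (h : BaseMem σ)
    (h' : ∀ x, (3 < x ∧ x < 10) ∨ (23 < x ∧ x < 28) → σ' x = σ x) : BaseMem σ' := by
  obtain ⟨h1, h2, h3, h4, h5, h6, h7, h8, h9, h10⟩ := h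
  constructor <;> simp only [h' 4 (by norm_num), h' 5 (by norm_num),
    h' 6 (by norm_num), h' 7 (by norm_num), h' 8 (by norm_num), h' 9 (by norm_num),
    h' 24 (by norm_num), h' 25 (by norm_num), h' 26 (by norm_num), h' 27 (by norm_num)] <;>
    assumption

/-- The estimation of the wave moment whose index is in cell 13. -/
def momentProg : QProg :=
  .seq (asg 14 (0 - .cell 13)) <|
  .seq (asg 15 (.pi / 2 + .cell 13 * (1 - .pi) / 2)) <|
  .seq (asg 16 (0 - .cell 15)) <|
  .seq (asg 17 (2 / (.cell 10 * (((1 + .cell 13) * (1 + .cell 13)) * ((1 + .cell 13) *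
    (1 + .cell 13)) * (1 + .cell 13))))) <|
  .seq (asg 18 1) <|
  .seq (asg 19 (.pi / 2)) <|
  .seq phaseLoop <|
  .seq (asg 30 (((Ex.cell 8).cos - (2 : Ex).sqrt * (Ex.cell 19 / 2).cos) / (Ex.cell 8).sin)) <|
  .seq (sto (96 + 2 * .cell 13) 30) <|
  asg 13 (.cell 13 + 1)

/-- The allowed error grows like `(1 + j)^5`, so the phase precision may fall by this factor. It
outweighs the cost `(1 + j)³` per unit of precision, and a time proportional to `(1 + j)⁻²` remains.
-/
theorem wp_momentProg (hn : 2 ≤ n) (hA : A.IsHermitian) (hU : U ∈ Matrix.unitaryGroup (Fin n) ℂ)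
    (hspec : ∀ i, hA.eigenvalues i ∈ Set.Icc (0 : ℝ) 1) {b : Fin n → ℝ} (hb : b ⬝ᵥ b = 1)
    (hUb : ∀ i, U i ⟨0, Nat.zero_lt_two.trans_le hn⟩ = (b i : ℂ))
    {σ : ℕ → ℝ} (hσ : BaseMem σ) {j : ℕ} {η a : ℝ} (h13 : σ 13 = j) (h10 : σ 10 = η) (hη : 0 < η)
    (ha : 0 ≤ a) (ha1 : a + 1 / (3 * (1 + (j : ℝ)) ^ 2) ≤ 1) :
    Wp A U momentProg σ (200 + 4000000000 * Real.log n ^ 2 / (η * (1 + (j : ℝ)) ^ 2))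
      (fun σ' => (∀ x, x < 13 ∨ (23 < x ∧ x < 28) ∨ (30 < x ∧ x ≠ 96 + 2 * j) → σ' x = σ x) ∧
        σ' 13 = (j + 1 : ℕ))
      (fun σ' => if |σ' (96 + 2 * j) - waveMoment hA b 0 j| ≤ η * (1 + j) ^ 5 then a else 1)
      (a + 1 / (3 * (1 + (j : ℝ)) ^ 2)) := by
  obtain ⟨φ, hφ, hφ', hg⟩ := exists_walk_phase (U := U) (by omega) hA hspec hb hUb j
  -- The 2 is the loss in `abs_decode_sub_le`. For `t < 1` the loop makes no round, and the start
  -- value `π/2` is already good enough.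
  set t : ℝ := 2 / (η * (1 + (j : ℝ)) ^ 5) with ht
  have ht0 : 0 < t := by positivity
  set σ₁ := Function.update (Function.update (Function.update (Function.update (Function.update
    (Function.update σ 14 (-(j : ℝ))) 15 (waveAngle j)) 16 (-(waveAngle j))) 17 t) 18 1) 19
      (Real.pi / 2) with hσ₁
  have hag₁ : ∀ x, x < 14 ∨ 19 < x → σ₁ x = σ x := by
    intro x hx
    rw [hσ₁]
    iterate 6 rw [Function.update_of_ne (by omega)]
  have hmem : TrialMem σ₁ := by
    obtain ⟨h1, h2, h3, h4, h5, h6, h7, h8, h9, h10⟩ := hσ.congr (σ' := σ₁) fun x hx =>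
      hag₁ x (by omega)
    constructor <;> first | assumption | skip
    · rw [h5, h6]
    · rw [hag₁ 13 (by norm_num), h13]; simp [hσ₁]
    · simp [hσ₁]
  have h8 : σ₁ 8 = 1 / 25 := by rw [hag₁ 8 (by norm_num), hσ.c8]
  have hloop := wp_phaseLoop hn hA hU hmem (j := j) (t := t) (φ := φ) (a := a)
    (by rw [hag₁ 13 (by norm_num), h13]) (by simp [hσ₁]) ht0 (by simp [hσ₁]) (by simp [hσ₁])
    (by
      rw [h8, show σ₁ 15 = waveAngle j by simp [hσ₁]]; exact hφ) hφ' ha ha1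
  have hfin : ∀ σ₂ : ℕ → ℝ, (∀ x, x < 18 ∨ (23 < x ∧ x < 28) ∨ 29 < x → σ₂ x = σ₁ x) →
      Det (.seq (asg 30 (((Ex.cell 8).cos - (2 : Ex).sqrt * (Ex.cell 19 / 2).cos) / (Ex.cell 8).sin)) <|
        .seq (sto (96 + 2 * .cell 13) 30) <| asg 13 (.cell 13 + 1)) σ₂ 50
        (fun σ₃ => ((∀ x, x < 13 ∨ (23 < x ∧ x < 28) ∨ (30 < x ∧ x ≠ 96 + 2 * j) → σ₃ x = σ x) ∧
          σ₃ 13 = (j + 1 : ℕ)) ∧ σ₃ (96 + 2 * j) =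
            (Real.cos (1 / 25) - Real.sqrt 2 * Real.cos (σ₂ 19 / 2)) / Real.sin (1 / 25)) := by
    intro σ₂ hag₂
    have e13 : σ₂ 13 = j := by rw [hag₂ 13 (by norm_num), hag₁ 13 (by norm_num), h13]
    have e8 : σ₂ 8 = 1 / 25 := by rw [hag₂ 8 (by norm_num), h8]
    refine Det.mono (det_asg_seq (by norm_num) (by simp) <|
      (det_sto (a := 96 + 2 * j) (by norm_num) (by simp) ?_ (by omega)).seq
        (Q' := fun σ₃ => ((∀ x, x < 13 ∨ (23 < x ∧ x < 28) ∨ (30 < x ∧ x ≠ 96 + 2 * j) →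
          σ₃ x = σ x) ∧ σ₃ 13 = (j + 1 : ℕ)) ∧ σ₃ (96 + 2 * j) =
            (Real.cos (1 / 25) - Real.sqrt 2 * Real.cos (σ₂ 19 / 2)) / Real.sin (1 / 25))
        (τ' := 5) ?_) ?_ fun _ h => h
    · simp [e13]
    · rintro _ rfl
      refine (det_asg (by norm_num) (by simp)).mono (by norm_num) ?_
      rintro _ rfl
      refine ⟨⟨fun x hx => ?_, ?_⟩, ?_⟩
      · rw [Function.update_of_ne (by omega), Function.update_of_ne (by omega),
          Function.update_of_ne (by omega), hag₂ x (by omega), hag₁ x (by omega)]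
      · have : (13 : ℕ) ≠ 96 + 2 * j := by omega
        simp [e13, Function.update_of_ne this]
      · rw [Function.update_of_ne (by omega), Function.update_self, Function.update_self]
        simp [e8]
    · simp; norm_num
  have hseq := hloop.seq (F := fun σ' => if |σ' (96 + 2 * j) - waveMoment hA b 0 j| ≤
    η * (1 + j) ^ 5 then a else 1) (P' := _) (τ' := 50) fun σ₂ hσ₂ =>
      ((hfin σ₂ hσ₂).wp fun σ₃ hσ₃ => ?_).mono le_rfl (fun _ h => h.1) (fun _ _ => le_rfl) le_rfl
  · refine Wp.mono (wp_asg_seq (by norm_num) (by simp) <| wp_asg_seq (by norm_num) (by simp) <|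
      wp_asg_seq (by norm_num) (by simp) <| wp_asg_seq (by norm_num) (by simp) <|
      wp_asg_seq (by norm_num) (by simp) <| wp_asg_seq (by norm_num) (by simp)
      (τ := 1 + 5 * t + 1600000000 * ((1 + (j : ℝ)) ^ 3 * Real.log n ^ 2) * t + 50) <| ?_)
      ?_ (fun _ h => h) (fun _ _ => le_rfl) le_rfl
    · convert! hseq using 1
      simp [hσ₁, h13, h10, ht, waveAngle]
      congr 2
      ring_nf
    · obtain ⟨l1, -, -⟩ := log_bounds hn
      have hj : (1 : ℝ) ≤ 1 + j := by linarith [Nat.cast_nonneg (α := ℝ) j]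
      have e1 : ((1 + (j : ℝ)) ^ 3 * Real.log n ^ 2) * t = 2 * (Real.log n ^ 2 / (η * (1 + (j : ℝ)) ^ 2)) := by
        rw [ht]; field_simp
      have e2 : t ≤ 8 * (Real.log n ^ 2 / (η * (1 + (j : ℝ)) ^ 2)) := by
        have : t ≤ 2 / (η * (1 + (j : ℝ)) ^ 2) := by
          rw [ht]; gcongr; norm_num
        refine this.trans ?_
        rw [mul_div_assoc']
        gcongr
        linarith
      have e3 : 0 ≤ Real.log n ^ 2 / (η * (1 + (j : ℝ)) ^ 2) := by positivity
      simp only [Ex.cost_sub, Ex.cost_cell, Ex.cost_zero, Ex.cost_one, Ex.cost_ofNat, Ex.cost_add,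
        Ex.cost_mul, Ex.cost_div, Ex.cost_pi]
      push_cast
      rw [mul_assoc, e1, mul_div_assoc]
      linarith
  · obtain ⟨-, e⟩ := hσ₃
    rw [e, hg]
    split_ifs with h1 h2 h2
    · exact le_rfl
    · exact le_trans ha1 (by norm_num) |>.trans' (by linarith [show 0 < 1 / (3 * (1 + (j : ℝ)) ^ 2) by positivity])
    · refine absurd ((abs_decode_sub_le h2 ht0).trans (le_of_eq ?_)) h1
      rw [ht]; field_simp
    · exact le_rfl

end Estimation
end

noncomputable section

/-! ### The estimation of all moments -/

section Estimation

variable {n : ℕ} {A : Matrix (Fin n) (Fin n) ℝ} {U : Matrix (Fin n) (Fin n) ℂ}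

/-- The estimation of all wave moments. -/
def momentLoop : QProg := .loop 31 momentProg

theorem sum_inv_sq_le (k : ℕ) :
    ∑ i ∈ Finset.range k, 1 / (1 + ((i + 1 : ℕ) : ℝ)) ^ 2 ≤ 1 - 1 / ((k : ℝ) + 1) := by
  induction k with
  | zero => simp
  | succ k ih =>
    rw [Finset.sum_range_succ]
    have : 1 / (1 + ((k + 1 : ℕ) : ℝ)) ^ 2 ≤ 1 / ((k : ℝ) + 1) - 1 / (((k + 1 : ℕ) : ℝ) + 1) := by
      push_cast
      rw [div_sub_div _ _ (by positivity) (by positivity), div_le_div_iff₀ (by positivity)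
        (by positivity)]
      nlinarith [Nat.cast_nonneg (α := ℝ) k]
    linarith

-- Cost and failure of the `j`-th moment are both of order `(1 + j)⁻²`, so apart from a constant per
-- round the totals do not depend on the number of moments.
open Classical in
theorem wp_momentLoop (hn : 2 ≤ n) (hA : A.IsHermitian) (hU : U ∈ Matrix.unitaryGroup (Fin n) ℂ)
    (hspec : ∀ i, hA.eigenvalues i ∈ Set.Icc (0 : ℝ) 1) {b : Fin n → ℝ} (hb : b ⬝ᵥ b = 1)
    (hUb : ∀ i, U i ⟨0, Nat.zero_lt_two.trans_le hn⟩ = (b i : ℂ))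
    {σ : ℕ → ℝ} (hσ : BaseMem σ) {k : ℕ} {η : ℝ} (h13 : σ 13 = 1) (h31 : ⌊σ 31⌋₊ = k)
    (h10 : σ 10 = η) (hη : 0 < η) :
    Wp A U momentLoop σ (1 + 201 * k + 4000000000 * Real.log n ^ 2 / η)
      (fun σ' => ∀ x, x < 13 ∨ (23 < x ∧ x < 28) ∨ (30 < x ∧ x < 97) → σ' x = σ x)
      (fun σ' => if ∀ j, 1 ≤ j → j ≤ k →
        |σ' (96 + 2 * j) - waveMoment hA b 0 j| ≤ η * (1 + j) ^ 5 then 0 else 1) (1 / 3) := by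
  have main := wp_loop (A := A) (U := U) (P := momentProg) (σ := σ) (x := 31) (k := k)
    (fun i σ' => (∀ x, x < 13 ∨ (23 < x ∧ x < 28) ∨ (30 < x ∧ x < 97) → σ' x = σ x) ∧
      σ' 13 = (i + 1 : ℕ))
    -- The budget `1 / (3 (i + 1))` covers all later failures, since `1 / (i+2) + 1 / (i+2)² ≤ 1 /
    -- (i+1)`.
    (fun i σ' => if ∀ j, 1 ≤ j → j ≤ i →
        |σ' (96 + 2 * j) - waveMoment hA b 0 j| ≤ η * (1 + j) ^ 5 then 1 / (3 * ((i : ℝ) + 1)) else 1)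
    (fun i => 200 + 4000000000 * Real.log n ^ 2 / η * (1 / (1 + ((i + 1 : ℕ) : ℝ)) ^ 2))
    (by norm_num) h31 ⟨fun _ _ => rfl, by rw [h13]; norm_num⟩ ?_
  · refine main.mono ?_ (fun _ h => h.1) (fun σ' hσ' => ?_) ?_
    · have e1 : 0 ≤ 4000000000 * Real.log n ^ 2 / η := by positivity
      have e2 := mul_le_mul_of_nonneg_left ((sum_inv_sq_le k).trans
        (sub_le_self _ (show 0 ≤ 1 / ((k : ℝ) + 1) by positivity))) e1
      rw [Finset.sum_add_distrib, Finset.sum_add_distrib, ← Finset.mul_sum]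
      simp only [Finset.sum_const, Finset.card_range, nsmul_eq_mul]
      linarith
    · split_ifs
      · positivity
      · exact le_rfl
    · rw [if_pos (fun j h1 h2 => by omega)]; norm_num
  · rintro i hi σ' ⟨hag, hi13⟩
    have hi0 : (0 : ℝ) ≤ i := Nat.cast_nonneg i
    have hrem : 1 / (3 * (((i + 1 : ℕ) : ℝ) + 1)) + 1 / (3 * (1 + ((i + 1 : ℕ) : ℝ)) ^ 2) ≤
        1 / (3 * ((i : ℝ) + 1)) := by
      push_cast
      rw [div_add_div _ _ (by positivity) (by positivity), div_le_div_iff₀ (by positivity)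
        (by positivity)]
      nlinarith [mul_nonneg hi0 hi0, mul_nonneg hi0 (mul_nonneg hi0 hi0)]
    have hone : 1 / (3 * ((i : ℝ) + 1)) ≤ 1 := by
      rw [div_le_one (by positivity)]; linarith
    have h1 := wp_momentProg (U := U) hn hA hU hspec hb hUb
      (hσ.congr (σ' := σ') fun x hx => hag x (by omega)) (j := i + 1)
      (a := 1 / (3 * (((i + 1 : ℕ) : ℝ) + 1))) hi13
      (by rw [hag 10 (by norm_num), h10]) hη (by positivity) (hrem.trans hone)
    have hcost : 200 + 4000000000 * Real.log n ^ 2 / (η * (1 + ((i + 1 : ℕ) : ℝ)) ^ 2) ≤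
        200 + 4000000000 * Real.log n ^ 2 / η * (1 / (1 + ((i + 1 : ℕ) : ℝ)) ^ 2) :=
      le_of_eq (by rw [div_mul_div_comm, mul_one])
    have hQ : ∀ σ'' : ℕ → ℝ, ((∀ x, x < 13 ∨ (23 < x ∧ x < 28) ∨ (30 < x ∧ x ≠ 96 + 2 * (i + 1)) →
        σ'' x = σ' x) ∧ σ'' 13 = (i + 1 + 1 : ℕ)) →
        ((∀ x, x < 13 ∨ (23 < x ∧ x < 28) ∨ (30 < x ∧ x < 97) → σ'' x = σ x) ∧
          σ'' 13 = (i + 1 + 1 : ℕ)) := fun σ'' h => ⟨fun x hx => by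
      rw [h.1 x (by omega), hag x hx], h.2⟩
    split_ifs with hgood
    · refine h1.mono hcost hQ (fun σ'' hσ'' => ?_) hrem
      have hold : ∀ j, 1 ≤ j → j ≤ i → |σ'' (96 + 2 * j) - waveMoment hA b 0 j| ≤ η * (1 + j) ^ 5 := by
        intro j hj1 hj2
        rw [hσ''.1 (96 + 2 * j) (by omega)]
        exact hgood j hj1 hj2
      split_ifs with h2 h3 h3
      · exact le_rfl
      · have : 1 / (3 * (((i + 1 : ℕ) : ℝ) + 1)) ≤ 1 := by
          have : 0 < 1 / (3 * (1 + ((i + 1 : ℕ) : ℝ)) ^ 2) := by positivity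
          linarith
        exact this
      · refine absurd (fun j hj1 hj2 => ?_) h2
        rcases Nat.lt_or_ge i j with h | h
        · have : j = i + 1 := by omega
          subst this
          exact h3
        · exact hold j hj1 h
      · exact le_rfl
    · refine (h1.of_bound (v' := 1) fun σ'' _ => ?_).mono hcost hQ (fun _ _ => le_rfl) le_rfl
      split_ifs
      · have : 0 < 1 / (3 * (1 + ((i + 1 : ℕ) : ℝ)) ^ 2) := by positivity
        linarith
      · exact le_rfl

end Estimation
end

noncomputable section

/-! ### The table of moments -/

section Table

theorem det_lod_seq {P : QProg} {d : ℕ} {e : Ex} {σ : ℕ → ℝ} {τ : ℝ} {Q : (ℕ → ℝ) → Prop} (a : ℕ)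
    (hd : d < 64) (he : e.Ok 64) (ha : e.eval σ = a) (ha' : 96 ≤ a)
    (h : Det P (Function.update σ d (σ a)) τ Q) : Det (.seq (lod d e) P) σ (e.cost + 1 + τ) Q :=
  (det_lod hd he ha ha').seq fun σ' hσ' => by subst hσ'; exact h

/-- One term of the recursion for the moments. -/
def tableTerm : QProg :=
  -- The table occupies even cells from 96 on, row by row with `D` columns; odd cells are left to
  -- the elimination.
  .seq (lod 37 (96 + 2 * (.cell 33 * .cell 12 + (.cell 34 + .cell 35)))) <|
  -- The root of the square is `|j - l|`.
  .seq (lod 38 (96 + 2 * (.cell 33 * .cell 12 +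
    ((Ex.cell 34 - .cell 35) * (Ex.cell 34 - .cell 35)).sqrt))) <|
  .seq (asg 39 ((Ex.cell 35 * (1 / 5)).sin / (.cell 35 * (1 / 5)))) <|
  .seq (asg 36 (.cell 36 + (0 - 2 / .pi) * (1 - (Ex.pi * .cell 35).cos) / (.cell 35 * .cell 35) *
    (.cell 39 * .cell 39 * .cell 39 * .cell 39 * .cell 39) * ((.cell 37 + .cell 38) / 2))) <|
  asg 35 (.cell 35 + 1)

theorem natDist_cast (j l : ℕ) : ((Nat.dist j l : ℕ) : ℝ) = Real.sqrt (((j : ℝ) - l) * (j - l)) := by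
  rw [Real.sqrt_mul_self_eq_abs]
  rcases le_total j l with h | h
  · rw [Nat.dist_eq_sub_of_le h, Nat.cast_sub h, abs_of_nonpos]
    · ring
    · have : (j : ℝ) ≤ l := by exact_mod_cast h
      linarith
  · rw [Nat.dist_eq_sub_of_le_right h, Nat.cast_sub h, abs_of_nonneg]
    have : (l : ℝ) ≤ j := by exact_mod_cast h
    linarith

theorem det_tableTerm {σ : ℕ → ℝ} {i j l D : ℕ} (h33 : σ 33 = i) (h34 : σ 34 = j) (h35 : σ 35 = l)
    (h12 : σ 12 = D) :
    Det tableTerm σ 130 (fun σ' => (∀ x, x < 35 ∨ 39 < x → σ' x = σ x) ∧ σ' 35 = (l + 1 : ℕ) ∧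
      σ' 36 = σ 36 + waveCoeff l *
        ((σ (96 + 2 * (i * D + (j + l))) + σ (96 + 2 * (i * D + Nat.dist j l))) / 2)) := by
  refine Det.mono (det_lod_seq (96 + 2 * (i * D + (j + l))) (by norm_num) (by simp) ?_ (by omega) <|
    det_lod_seq (96 + 2 * (i * D + Nat.dist j l)) (by norm_num) (by simp) ?_ (by omega) <|
    det_asg_seq (by norm_num) (by simp) <| det_asg_seq (by norm_num) (by simp) <|
    det_asg (by norm_num) (by simp)) ?_ ?_
  · simp [h33, h34, h35, h12]
  · simp [h33, h34, h35, h12, natDist_cast]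
  · simp; norm_num
  · rintro _ rfl
    refine ⟨fun x hx => ?_, ?_, ?_⟩
    · iterate 5 rw [Function.update_of_ne (by omega)]
    · simp [h35]
    · have e : 96 + 2 * (i * D + Nat.dist j l) ≠ 37 := by omega
      simp [h35, waveCoeff, Function.update_of_ne e]
      left; ring

/-- One entry of the table. -/
def tableEntry : QProg :=
  -- The sum starts with `l = 1`, as `waveCoeff 0 = 0`.
  .seq (asg 36 0) <| .seq (asg 35 1) <| .seq (.loop 11 tableTerm) <|
  .seq (sto (96 + 2 * ((.cell 33 + 1) * .cell 12 + .cell 34)) 36) <| asg 34 (.cell 34 + 1)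

theorem det_tableEntry {σ : ℕ → ℝ} {i j J D : ℕ} (h33 : σ 33 = i) (h34 : σ 34 = j)
    (h12 : σ 12 = D) (h11 : σ 11 = J) :
    Det tableEntry σ (30 + 131 * J) (fun σ' =>
      (∀ x, x < 34 ∨ (39 < x ∧ x ≠ 96 + 2 * ((i + 1) * D + j)) → σ' x = σ x) ∧
      σ' 34 = (j + 1 : ℕ) ∧ σ' (96 + 2 * ((i + 1) * D + j)) =
        ∑ l ∈ Finset.range (J + 1), waveCoeff l *
          ((σ (96 + 2 * (i * D + (j + l))) + σ (96 + 2 * (i * D + Nat.dist j l))) / 2)) := by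
  set σ₁ := Function.update (Function.update σ 36 0) 35 1 with hσ₁
  have hag : ∀ x, x < 35 ∨ 36 < x → σ₁ x = σ x := fun x hx => by
    rw [hσ₁, Function.update_of_ne (by omega), Function.update_of_ne (by omega)]
  have hloop := det_loop (x := 11) (P := tableTerm) (σ := σ₁) (k := J) (τ := 130)
    (fun l σ' => (∀ x, x < 35 ∨ 39 < x → σ' x = σ x) ∧ σ' 35 = (l + 1 : ℕ) ∧
      σ' 36 = ∑ l ∈ Finset.range (l + 1), waveCoeff l *
        ((σ (96 + 2 * (i * D + (j + l))) + σ (96 + 2 * (i * D + Nat.dist j l))) / 2))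
    (by norm_num) (by rw [hag 11 (by norm_num), h11, Nat.floor_natCast])
    ⟨fun x hx => hag x (by omega), by simp [hσ₁], by simp [hσ₁, waveCoeff_zero]⟩ ?_
  · refine Det.mono (det_asg_seq (by norm_num) (by simp) <| det_asg_seq (by norm_num) (by simp) <|
      Det.seq (Q := fun σ' => (∀ x, x < 35 ∨ 39 < x → σ' x = σ x) ∧ σ' 35 = (J + 1 : ℕ) ∧
        σ' 36 = ∑ l ∈ Finset.range (J + 1), waveCoeff l *
          ((σ (96 + 2 * (i * D + (j + l))) + σ (96 + 2 * (i * D + Nat.dist j l))) / 2))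
        (τ := 1 + J * 131) (τ' := 20) ?_ fun σ₂ ⟨e1, e2, e3⟩ => ?_) ?_ fun _ h => h
    · simpa [hσ₁] using hloop.mono (le_of_eq (by ring)) fun _ h => h
    · refine Det.mono ((det_sto (a := 96 + 2 * ((i + 1) * D + j)) (by norm_num) (by simp) ?_
        (by omega)).seq (τ' := 5) (Q' := fun σ' =>
      (∀ x, x < 34 ∨ (39 < x ∧ x ≠ 96 + 2 * ((i + 1) * D + j)) → σ' x = σ x) ∧
      σ' 34 = (j + 1 : ℕ) ∧ σ' (96 + 2 * ((i + 1) * D + j)) =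
        ∑ l ∈ Finset.range (J + 1), waveCoeff l *
          ((σ (96 + 2 * (i * D + (j + l))) + σ (96 + 2 * (i * D + Nat.dist j l))) / 2)) ?_) ?_
          fun _ h => h
      · simp [e1 33 (by norm_num), e1 34 (by norm_num), e1 12 (by norm_num), h33, h34, h12]
      · rintro _ rfl
        refine (det_asg (by norm_num) (by simp)).mono (by norm_num) ?_
        rintro _ rfl
        have e : (34 : ℕ) ≠ 96 + 2 * ((i + 1) * D + j) := by omega
        refine ⟨fun x hx => ?_, ?_, ?_⟩
        · rw [Function.update_of_ne (by omega), Function.update_of_ne (by omega), e1 x (by omega)]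
        · simp [Function.update_of_ne e, e1 34 (by norm_num), h34]
        · rw [Function.update_of_ne e.symm, Function.update_self, e3]
      · norm_num
    · norm_num; linarith
  · rintro l - σ' ⟨e1, e2, e3⟩
    refine (det_tableTerm (i := i) (j := j) (l := l + 1) (D := D) (by rw [e1 33 (by norm_num), h33])
      (by rw [e1 34 (by norm_num), h34]) e2 (by rw [e1 12 (by norm_num), h12])).mono le_rfl ?_
    rintro σ'' ⟨f1, f2, f3⟩
    refine ⟨fun x hx => by rw [f1 x hx, e1 x hx], f2, ?_⟩
    rw [f3, e3, Finset.sum_range_succ _ (l + 1), e1 (96 + 2 * (i * D + (j + (l + 1)))) (by omega),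
      e1 (96 + 2 * (i * D + Nat.dist j (l + 1))) (by omega)]

/-- The table of moments up to a given order. -/
def tableProg : QProg :=
  .seq (asg 33 0) <| .loop 32 (.seq (asg 34 0) <| .seq (.loop 12 tableEntry) (asg 33 (.cell 33 + 1)))

variable {n : ℕ} {A : Matrix (Fin n) (Fin n) ℝ}

/-- An entry in column `k` uses the previous row up to column `k + J`. So in row `i` only columns
with `k + i J < D` are meaningful; the others are computed but never trusted. The premise `p`, that
the estimates are correct, guards the accuracy and not the running time. -/
theorem det_tableProg (hA : A.IsHermitian) (hspec : ∀ i, hA.eigenvalues i ∈ Set.Icc (0 : ℝ) 1)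
    {b : Fin n → ℝ} (hb : b ⬝ᵥ b = 1) {σ : ℕ → ℝ} {r J D : ℕ} {η : ℝ}
    {p : Prop} (hη : 0 ≤ η) (hJ : 1 ≤ η * (J : ℝ) ^ 2) (h12 : σ 12 = D) (h11 : σ 11 = J) (h32 : σ 32 = r)
    (hT : p → ∀ k < D, |σ (96 + 2 * k) - waveMoment hA b 0 k| ≤ η * (1 + k) ^ 5) :
    Det tableProg σ (4 + r * (11 + D * (31 + 131 * J))) (fun σ' =>
      (∀ x, x < 33 ∨ (39 < x ∧ x < 96) → σ' x = σ x) ∧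
      (p → ∀ i ≤ r, i * J < D → |σ' (96 + 2 * (i * D)) - waveMoment hA b i 0| ≤ (2 * waveConst) ^ i * η)) := by
  have hK := one_le_waveConst
  set T : ℕ → ℕ → (ℕ → ℝ) → Prop := fun i k σ' =>
    p → |σ' (96 + 2 * (i * D + k)) - waveMoment hA b i k| ≤ (2 * waveConst) ^ i * η * (1 + k) ^ 5 with hTd
  have hrow : ∀ i : ℕ, ∀ σ' : ℕ → ℝ, ((∀ x, x < 33 ∨ (39 < x ∧ x < 96) → σ' x = σ x) ∧ σ' 33 = i ∧
      ∀ i' ≤ i, ∀ k : ℕ, k + i' * J < D → T i' k σ') →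
      Det (.seq (asg 34 0) <| .seq (.loop 12 tableEntry) (asg 33 (.cell 33 + 1))) σ'
      (10 + D * (31 + 131 * J)) (fun σ' => (∀ x, x < 33 ∨ (39 < x ∧ x < 96) → σ' x = σ x) ∧
        σ' 33 = (i + 1 : ℕ) ∧ ∀ i' ≤ i + 1, ∀ k : ℕ, k + i' * J < D → T i' k σ') := by
    rintro i σ' ⟨hag, h33, hTi⟩
    set σ₁ := Function.update σ' 34 0 with hσ₁
    have hag₁ : ∀ x, x ≠ 34 → σ₁ x = σ' x := fun x hx => by rw [hσ₁, Function.update_of_ne hx]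
    have hTi₁ : ∀ i' ≤ i, ∀ k : ℕ, k + i' * J < D → T i' k σ₁ := by
      intro i' hi' k hk
      have := hTi i' hi' k hk
      simp only [hTd] at this ⊢
      rwa [hag₁ _ (by omega)]
    have hloop := det_loop (x := 12) (P := tableEntry) (σ := σ₁) (k := D) (τ := 30 + 131 * J)
      (fun j σ'' => (∀ x, x < 33 ∨ (39 < x ∧ x < 96) → σ'' x = σ x) ∧ σ'' 33 = i ∧ σ'' 34 = j ∧
        (∀ i' ≤ i, ∀ k : ℕ, k + i' * J < D → T i' k σ'') ∧ ∀ k < j, k + (i + 1) * J < D → T (i + 1) k σ'')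
      (by norm_num) (by rw [hag₁ 12 (by norm_num), hag 12 (by norm_num), h12, Nat.floor_natCast])
      ⟨fun x hx => by rw [hag₁ x (by omega), hag x hx], by rw [hag₁ 33 (by norm_num), h33],
        by simp [hσ₁], hTi₁, fun k hk => absurd hk (by omega)⟩ ?_
    · refine Det.mono (det_asg_seq (by norm_num) (by simp) <| Det.seq
        (Q := fun σ'' => (∀ x, x < 33 ∨ (39 < x ∧ x < 96) → σ'' x = σ x) ∧ σ'' 33 = i ∧ σ'' 34 = D ∧
        (∀ i' ≤ i, ∀ k : ℕ, k + i' * J < D → T i' k σ'') ∧ ∀ k < D, k + (i + 1) * J < D → T (i + 1) k σ'')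
        (τ := 1 + D * (30 + 131 * J + 1)) (τ' := 5) ?_ fun σ₂ ⟨e1, e2, e3, e4, e5⟩ => ?_) ?_ fun _ h => h
      · simpa [hσ₁] using hloop
      · refine (det_asg (by norm_num) (by simp)).mono (by norm_num) ?_
        rintro _ rfl
        refine ⟨fun x hx => ?_, by simp [e2], fun i' hi' k hk => ?_⟩
        · rw [Function.update_of_ne (by omega), e1 x hx]
        · have : T i' k σ₂ := by
            rcases Nat.lt_or_ge i i' with h | h
            · obtain rfl : i' = i + 1 := by omega
              exact e5 k (by omega) hk
            · exact e4 i' h k hk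
          simp only [hTd] at this ⊢
          rwa [Function.update_of_ne (by omega)]
      · norm_num; linarith
    · rintro j hj σ₂ ⟨e1, e2, e3, e4, e5⟩
      refine (det_tableEntry e2 e3 (by rw [e1 12 (by norm_num), h12])
        (by rw [e1 11 (by norm_num), h11])).mono le_rfl ?_
      rintro σ₃ ⟨f1, f2, f3⟩
      have hlow : ∀ i' ≤ i, ∀ k < D, i' * D + k ≠ (i + 1) * D + j := by
        intro i' hi' k hk
        have := Nat.mul_le_mul_right D hi'
        have : (i + 1) * D = i * D + D := by ring
        omega
      refine ⟨fun x hx => by rw [f1 x (by omega), e1 x hx], by rw [f1 33 (by norm_num), e2], f2,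
        fun i' hi' k hk => ?_, fun k hkj hk => ?_⟩
      · have := e4 i' hi' k hk
        have hne := hlow i' hi' k (by omega)
        simp only [hTd] at this ⊢
        rwa [f1 _ (by omega)]
      · rcases Nat.lt_or_ge k j with h | h
        · have := e5 k h hk
          simp only [hTd] at this ⊢
          rwa [f1 _ (by omega)]
        · obtain rfl : k = j := by omega
          simp only [hTd]
          intro hp
          rw [f3]
          have hiJ : (i + 1) * J = i * J + J := by ring
          have := abs_waveMoment_succ_sub_le hA hspec hb (i := i) (j := k) (J := J)
            (B := (2 * waveConst) ^ i) (η := η) (τ := fun k => σ₂ (96 + 2 * (i * D + k))) hη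
            (by positivity) hJ (fun k' hk' => e4 i le_rfl k' (by omega) hp)
          refine this.trans ?_
          have h1 : (1 : ℝ) ≤ (2 * waveConst) ^ i := one_le_pow₀ (by linarith)
          -- The summand 1 is the truncation error of this row; the factor 2 absorbs it.
          have h2 : waveConst * ((2 * waveConst) ^ i + 1) ≤ (2 * waveConst) ^ (i + 1) := by
            rw [pow_succ]; nlinarith
          gcongr
  have hloop := fun σ' h0 h1 => det_loop (x := 32) (P := .seq (asg 34 0) <| .seq (.loop 12 tableEntry)
      (asg 33 (.cell 33 + 1))) (σ := σ') (k := r) (τ := 10 + D * (31 + 131 * J))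
    (fun i σ' => (∀ x, x < 33 ∨ (39 < x ∧ x < 96) → σ' x = σ x) ∧ σ' 33 = i ∧
      ∀ i' ≤ i, ∀ k : ℕ, k + i' * J < D → T i' k σ') (by norm_num) h1 h0 fun i _ σ' h => hrow i σ' h
  refine Det.mono (det_asg_seq (by norm_num) (by simp) (hloop _ ?_ ?_)) ?_ ?_
  · refine ⟨fun x hx => by rw [Function.update_of_ne (by omega)], by simp, fun i' hi' k hk => ?_⟩
    obtain rfl : i' = 0 := by omega
    have := fun hp => hT hp k (by simpa using hk)
    simp only [hTd, zero_mul, zero_add, pow_zero, one_mul]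
    rwa [Function.update_of_ne (by omega)]
  · rw [Function.update_of_ne (by norm_num), h32, Nat.floor_natCast]
  · norm_num; linarith
  · rintro σ' ⟨e1, -, e3⟩
    refine ⟨e1, fun hp i hi hiD => ?_⟩
    simpa [hTd] using e3 i hi 0 (by simpa using hiD) hp

end Table
end

noncomputable section

/-! ### Elimination and search -/

section Grid

/-- Run a program for all pairs of row and column indices in the cells 44 and 45. -/
def gridProg (P : QProg) : QProg :=
  .seq (asg 44 0) <| .loop 1 <| .seq (asg 45 0) <| .seq (.loop 1 (.seq P (asg 45 (.cell 45 + 1)))) <|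
  asg 44 (.cell 44 + 1)

/-- The cells that the filling of a matrix may change. -/
def gridCell (m base x : ℕ) : Prop :=
  x = 44 ∨ x = 45 ∨ (49 ≤ x ∧ x ≤ 52) ∨ ∃ i < m, ∃ j < m, x = base + 2 * (i * m + j)

theorem grid_index_inj {m i j i' j' : ℕ} (hj : j < m) (hj' : j' < m)
    (h : i * m + j = i' * m + j') : i = i' ∧ j = j' := by
  have hm : 0 < m := by omega
  have h1 : (i * m + j) / m = (i' * m + j') / m := by rw [h]
  rw [mul_comm i, mul_comm i', Nat.mul_add_div hm, Nat.mul_add_div hm, Nat.div_eq_of_lt hj,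
    Nat.div_eq_of_lt hj'] at h1
  obtain rfl : i = i' := by omega
  exact ⟨rfl, by omega⟩

/-- The body is given control only of the cells outside `gridCell` and of the two indices, so an
entry must be computed from data that the filling does not overwrite. -/
theorem det_gridProg {P : QProg} {σ : ℕ → ℝ} {m base : ℕ} {val : ℕ → ℕ → ℝ} {τ : ℝ}
    (h1 : σ 1 = m) (hbase : 96 ≤ base)
    (hP : ∀ σ' : ℕ → ℝ, ∀ i < m, ∀ j < m, (∀ x, ¬ gridCell m base x → σ' x = σ x) →
      σ' 44 = i → σ' 45 = j → Det P σ' τ fun σ'' => σ'' (base + 2 * (i * m + j)) = val i j ∧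
        ∀ x, ¬ (49 ≤ x ∧ x ≤ 52) → x ≠ base + 2 * (i * m + j) → σ'' x = σ' x) :
    Det (gridProg P) σ (4 + m * (10 + m * (τ + 6))) fun σ' =>
      (∀ x, ¬ gridCell m base x → σ' x = σ x) ∧
      ∀ i < m, ∀ j < m, σ' (base + 2 * (i * m + j)) = val i j := by
  have hg1 : ¬ gridCell m base 1 := by
    rintro (h | h | h | ⟨i, -, j, -, h⟩) <;> omega
  have g44 : gridCell m base 44 := Or.inl rfl
  have g45 : gridCell m base 45 := Or.inr (Or.inl rfl)
  have hrow : ∀ σ' : ℕ → ℝ, ∀ i < m, ((∀ x, ¬ gridCell m base x → σ' x = σ x) ∧ σ' 44 = i ∧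
      ∀ i' < i, ∀ j < m, σ' (base + 2 * (i' * m + j)) = val i' j) →
      Det (.seq (asg 45 0) <| .seq (.loop 1 (.seq P (asg 45 (.cell 45 + 1)))) <|
        asg 44 (.cell 44 + 1)) σ' (9 + m * (τ + 6)) fun σ' =>
      (∀ x, ¬ gridCell m base x → σ' x = σ x) ∧ σ' 44 = (i + 1 : ℕ) ∧
      ∀ i' < i + 1, ∀ j < m, σ' (base + 2 * (i' * m + j)) = val i' j := by
    rintro σ' i hi ⟨e1, e2, e3⟩
    have hloop := fun σ₁ h0 hk => det_loop (x := 1) (P := .seq P (asg 45 (.cell 45 + 1))) (σ := σ₁)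
      (k := m) (τ := τ + 5)
      (fun j σ'' => (∀ x, ¬ gridCell m base x → σ'' x = σ x) ∧ σ'' 44 = i ∧ σ'' 45 = j ∧
        (∀ i' < i, ∀ j < m, σ'' (base + 2 * (i' * m + j)) = val i' j) ∧
        ∀ j' < j, σ'' (base + 2 * (i * m + j')) = val i j') (by norm_num) hk h0 ?_
    · refine Det.mono (det_asg_seq (by norm_num) (by simp) <| (hloop _ ?_ ?_).seq (τ' := 5)
        (Q' := fun σ' => (∀ x, ¬ gridCell m base x → σ' x = σ x) ∧ σ' 44 = (i + 1 : ℕ) ∧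
          ∀ i' < i + 1, ∀ j < m, σ' (base + 2 * (i' * m + j)) = val i' j) ?_) ?_ fun _ h => h
      · refine ⟨fun x hx => ?_, ?_, by simp, fun i' hi' j hj => ?_, fun j hj => absurd hj (by omega)⟩
        · rw [Function.update_of_ne (by rintro rfl; exact hx g45), e1 x hx]
        · rw [Function.update_of_ne (by norm_num), e2]
        · rw [Function.update_of_ne (by omega), e3 i' hi' j hj]
      · rw [Function.update_of_ne (by norm_num), e1 1 hg1, h1, Nat.floor_natCast]
      · rintro σ₂ ⟨f1, f2, f3, f4, f5⟩
        refine (det_asg (by norm_num) (by simp)).mono (by norm_num) ?_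
        rintro _ rfl
        refine ⟨fun x hx => ?_, by simp [f2], fun i' hi' j hj => ?_⟩
        · rw [Function.update_of_ne (by rintro rfl; exact hx g44), f1 x hx]
        · rw [Function.update_of_ne (by omega)]
          rcases Nat.lt_or_ge i' i with h | h
          · exact f4 i' h j hj
          · obtain rfl : i' = i := by omega
            exact f5 j hj
      · norm_num; linarith
    · rintro j hj σ₂ ⟨f1, f2, f3, f4, f5⟩
      refine ((hP σ₂ i hi j hj f1 f2 f3).seq (τ' := 5) (Q' := _) fun σ₃ hσ₃ =>
        (det_asg (by norm_num) (by simp)).mono (by norm_num) ?_)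
      rintro _ rfl
      obtain ⟨k1, k2⟩ := hσ₃
      refine ⟨fun x hx => ?_, ?_, ?_, fun i' hi' j' hj' => ?_, fun j' hj' => ?_⟩
      · rw [Function.update_of_ne (by rintro rfl; exact hx g45), k2 x (fun h => hx (Or.inr (Or.inr (Or.inl h))))
          (fun h => hx (Or.inr (Or.inr (Or.inr ⟨i, hi, j, hj, h⟩)))), f1 x hx]
      · rw [Function.update_of_ne (by norm_num), k2 44 (by omega) (by omega), f2]
      · rw [Function.update_self]; simp [k2 45 (by omega) (by omega), f3]
      · rw [Function.update_of_ne (by omega), k2 _ (by omega) (fun h => ?_), f4 i' hi' j' hj']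
        have := (grid_index_inj (m := m) (i := i') (i' := i) hj' hj (by omega)).1
        omega
      · rw [Function.update_of_ne (by omega)]
        rcases Nat.lt_or_ge j' j with h | h
        · rw [k2 _ (by omega) (by omega), f5 j' h]
        · obtain rfl : j' = j := by omega
          exact k1
  have hloop := fun σ' h0 hk => det_loop (x := 1) (P := .seq (asg 45 0) <| .seq (.loop 1 (.seq P
      (asg 45 (.cell 45 + 1)))) <| asg 44 (.cell 44 + 1)) (σ := σ') (k := m) (τ := 9 + m * (τ + 6))
    (fun i σ' => (∀ x, ¬ gridCell m base x → σ' x = σ x) ∧ σ' 44 = i ∧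
      ∀ i' < i, ∀ j < m, σ' (base + 2 * (i' * m + j)) = val i' j) (by norm_num) hk h0
      fun i hi σ' h => hrow σ' i hi h
  refine Det.mono (det_asg_seq (by norm_num) (by simp) (hloop _ ?_ ?_)) ?_ fun _ h => ⟨h.1, h.2.2⟩
  · refine ⟨fun x hx => ?_, by simp, fun i' hi' => absurd hi' (by omega)⟩
    rw [Function.update_of_ne (by rintro rfl; exact hx g44)]
  · rw [Function.update_of_ne (by norm_num), h1, Nat.floor_natCast]
  · norm_num; linarith

end Grid

/-! ### The elimination as a program -/

section Elimination

/-- Write the matrix that is to be tested for definiteness. -/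
def fillProg : QProg := gridProg <|
  .seq (lod 49 (96 + 2 * ((.cell 44 + .cell 45) * .cell 12))) <|
  .seq (lod 50 (96 + 2 * ((.cell 44 + .cell 45 + 1) * .cell 12))) <|
  .seq (asg 52 (.cell 41 * .cell 49 - .cell 40 * .cell 50)) <|
  sto (97 + 2 * (.cell 44 * .cell 1 + .cell 45)) 52

theorem not_gridCell_of_even {m base : ℕ} (hb : base % 2 = 1) {x : ℕ} (hx : 53 ≤ x) (hx' : x % 2 = 0) :
    ¬ gridCell m base x := by
  rintro (h | h | h | ⟨i, -, j, -, h⟩) <;> omega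

theorem not_gridCell_of_lt {m base : ℕ} (hb : 96 ≤ base) {x : ℕ}
    (hx : x < 44 ∨ (45 < x ∧ x < 49) ∨ (52 < x ∧ x < 96)) : ¬ gridCell m base x := by
  rintro (h | h | h | ⟨i, -, j, -, h⟩) <;> omega

theorem det_fillProg {σ : ℕ → ℝ} {m D : ℕ} {ρ s : ℝ} (h1 : σ 1 = m) (h12 : σ 12 = D)
    (h40 : σ 40 = s) (h41 : σ 41 = ρ) :
    Det fillProg σ (4 + m * (10 + m * 106)) fun σ' => (∀ x, ¬ gridCell m 97 x → σ' x = σ x) ∧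
      ∀ i < m, ∀ j < m, σ' (97 + 2 * (i * m + j)) =
        shiftMatrix (fun k => σ (96 + 2 * (k * D))) ρ s i j := by
  refine (det_gridProg (τ := 100) h1 (by norm_num) ?_).mono (by norm_num) fun _ h => h
  intro σ' i hi j hj hag h44 h45
  have e12 : σ' 12 = D := by rw [hag 12 (not_gridCell_of_lt (by norm_num) (by norm_num)), h12]
  have e1 : σ' 1 = m := by rw [hag 1 (not_gridCell_of_lt (by norm_num) (by norm_num)), h1]
  have e40 : σ' 40 = s := by rw [hag 40 (not_gridCell_of_lt (by norm_num) (by norm_num)), h40]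
  have e41 : σ' 41 = ρ := by rw [hag 41 (not_gridCell_of_lt (by norm_num) (by norm_num)), h41]
  refine Det.mono (det_lod_seq (96 + 2 * ((i + j) * D)) (by norm_num) (by simp) ?_ (by omega) <|
    det_lod_seq (96 + 2 * ((i + j + 1) * D)) (by norm_num) (by simp) ?_ (by omega) <|
    det_asg_seq (by norm_num) (by simp) <|
    det_sto (a := 97 + 2 * (i * m + j)) (by norm_num) (by simp) ?_ (by omega)) ?_ ?_
  · simp [h44, h45, e12]
  · simp [h44, h45, e12]
  · simp [h44, h45, e1]
  · simp; norm_num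
  · rintro _ rfl
    refine ⟨?_, fun x hx hx' => ?_⟩
    · have n1 : 96 + 2 * ((i + j + 1) * D) ≠ 49 := by omega
      simp only [Function.update_self, Ex.eval_sub, Ex.eval_mul, Ex.eval_cell,
        Function.update_of_ne n1]
      simp [e40, e41, shiftMatrix, hag _ (not_gridCell_of_even (m := m) (base := 97) (by norm_num)
        (show 53 ≤ 96 + 2 * ((i + j) * D) by omega) (by omega)),
        hag _ (not_gridCell_of_even (m := m) (base := 97) (by norm_num)
        (show 53 ≤ 96 + 2 * ((i + j + 1) * D) by omega) (by omega))]
    · rw [Function.update_of_ne hx', Function.update_of_ne (by omega), Function.update_of_ne (by omega),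
        Function.update_of_ne (by omega)]

/-- The address of an entry of the elimination. -/
def Ex.entry (k i j : Ex) : Ex := 97 + 2 * ((k * .cell 1 + i) * .cell 1 + j)

/-- One step of the elimination. -/
def elimProg : QProg :=
  .seq (lod 48 (.entry (.cell 46) (.cell 46) (.cell 46))) <|
  -- A nonpositive pivot clears the flag in cell 43 for good; the write to cell 47 is a dummy for an
  -- empty alternative. The elimination continues in either case.
  .seq (.ite 48 4 (asg 43 0) (asg 47 0)) <|
  .seq (gridProg <|
    .seq (lod 49 (.entry (.cell 46) (.cell 44) (.cell 45))) <|
    .seq (lod 50 (.entry (.cell 46) (.cell 44) (.cell 46))) <|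
    .seq (lod 51 (.entry (.cell 46) (.cell 46) (.cell 45))) <|
    .seq (asg 52 (.cell 49 - .cell 50 * .cell 51 / .cell 48)) <|
    sto (.entry (.cell 46 + 1) (.cell 44) (.cell 45)) 52) <|
  asg 46 (.cell 46 + 1)

/-- The cells that the elimination may change. -/
def elimCell (x : ℕ) : Prop := (43 ≤ x ∧ x ≤ 52) ∨ (97 ≤ x ∧ x % 2 = 1)

/-- Every Schur complement has its own block of `m²` cells, so a step reads the old block
undisturbed while it fills the new one. -/
theorem not_gridCell_entry {m k i j : ℕ} (hi : i < m) (hj : j < m) :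
    ¬ gridCell m (97 + 2 * ((k + 1) * m * m)) (97 + 2 * ((k * m + i) * m + j)) := by
  have h1 : (k * m + i) * m + j < (k + 1) * m * m := by
    have e1 : (k * m + i + 1) * m ≤ (k * m + m) * m := Nat.mul_le_mul_right _ (by omega)
    have e2 : (k * m + i + 1) * m = (k * m + i) * m + m := by ring
    have e3 : (k + 1) * m * m = (k * m + m) * m := by ring
    omega
  rintro (h | h | h | ⟨i, -, j, -, h⟩) <;> omega

theorem det_elimProg {σ : ℕ → ℝ} {E : ℕ → ℕ → ℝ} {m k : ℕ} (hk : k < m) (h1 : σ 1 = m)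
    (h4 : σ 4 = 0) (h46 : σ 46 = k)
    (hE : ∀ i < m, ∀ j < m, σ (97 + 2 * ((k * m + i) * m + j)) = schurComp E k i j) :
    Det elimProg σ (40 + m * (10 + m * 106)) fun σ' => (∀ x, ¬ elimCell x → σ' x = σ x) ∧
      σ' 46 = (k + 1 : ℕ) ∧ σ' 43 = (if schurComp E k k k ≤ 0 then 0 else σ 43) ∧
      ∀ i < m, ∀ j < m, σ' (97 + 2 * (((k + 1) * m + i) * m + j)) = schurComp E (k + 1) i j := by
  set p := schurComp E k k k with hp
  set base := 97 + 2 * ((k + 1) * m * m) with hbase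
  have hb : 96 ≤ base := by omega
  have hb2 : base % 2 = 1 := by omega
  have haddr : ∀ i j, 97 + 2 * (((k + 1) * m + i) * m + j) = base + 2 * (i * m + j) := by
    intro i j; rw [hbase]; ring
  have hstart : ∀ σ₁ : ℕ → ℝ, σ₁ 48 = p → σ₁ 4 = 0 → Det (.ite 48 4 (asg 43 0) (asg 47 0)) σ₁ 4
      fun σ₂ => σ₂ 43 = (if p ≤ 0 then 0 else σ₁ 43) ∧ ∀ x, x ≠ 43 → x ≠ 47 → σ₂ x = σ₁ x := by
    intro σ₁ e48 e4
    refine (det_ite (τ := 3) (by norm_num) (by norm_num) (fun hle => ?_) (fun hlt => ?_)).mono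
      (by norm_num) fun _ h => h
    · rw [e48, e4] at hle
      refine (det_asg (by norm_num) (by simp)).mono (by norm_num) ?_
      rintro _ rfl
      exact ⟨by simp [hle], fun x hx _ => by rw [Function.update_of_ne hx]⟩
    · rw [e48, e4] at hlt
      refine (det_asg (by norm_num) (by simp)).mono (by norm_num) ?_
      rintro _ rfl
      exact ⟨by simp [not_le.2 hlt], fun x _ hx => by rw [Function.update_of_ne hx]⟩
  have hgrid : ∀ σ₂ : ℕ → ℝ, σ₂ 1 = m → σ₂ 46 = k → σ₂ 48 = p →
      (∀ i < m, ∀ j < m, σ₂ (97 + 2 * ((k * m + i) * m + j)) = schurComp E k i j) →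
      Det (gridProg <|
    .seq (lod 49 (.entry (.cell 46) (.cell 44) (.cell 45))) <|
    .seq (lod 50 (.entry (.cell 46) (.cell 44) (.cell 46))) <|
    .seq (lod 51 (.entry (.cell 46) (.cell 46) (.cell 45))) <|
    .seq (asg 52 (.cell 49 - .cell 50 * .cell 51 / .cell 48)) <|
    sto (.entry (.cell 46 + 1) (.cell 44) (.cell 45)) 52) σ₂ (4 + m * (10 + m * (100 + 6))) fun σ' =>
      (∀ x, ¬ gridCell m base x → σ' x = σ₂ x) ∧
      ∀ i < m, ∀ j < m, σ' (base + 2 * (i * m + j)) = schurComp E (k + 1) i j := by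
    intro σ₂ f1 f46 f48 fE
    refine det_gridProg f1 hb fun σ' i hi j hj hag h44 h45 => ?_
    have e1 : σ' 1 = m := by rw [hag 1 (not_gridCell_of_lt hb (by norm_num)), f1]
    have e46 : σ' 46 = k := by rw [hag 46 (not_gridCell_of_lt hb (by norm_num)), f46]
    have e48 : σ' 48 = p := by rw [hag 48 (not_gridCell_of_lt hb (by norm_num)), f48]
    have eE : ∀ i < m, ∀ j < m, σ' (97 + 2 * ((k * m + i) * m + j)) = schurComp E k i j := by
      intro i hi j hj
      rw [hag _ (not_gridCell_entry hi hj), fE i hi j hj]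
    refine Det.mono (det_lod_seq (97 + 2 * ((k * m + i) * m + j)) (by norm_num) (by simp [Ex.entry]) ?_
        (by omega) <|
      det_lod_seq (97 + 2 * ((k * m + i) * m + k)) (by norm_num) (by simp [Ex.entry]) ?_ (by omega) <|
      det_lod_seq (97 + 2 * ((k * m + k) * m + j)) (by norm_num) (by simp [Ex.entry]) ?_ (by omega) <|
      det_asg_seq (by norm_num) (by simp) <|
      det_sto (a := 97 + 2 * (((k + 1) * m + i) * m + j)) (by norm_num) (by simp [Ex.entry]) ?_
        (by omega)) ?_ ?_
    · simp [Ex.entry, h44, h45, e1, e46]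
    · simp [Ex.entry, h44, e1, e46]
    · simp [Ex.entry, h45, e1, e46]
    · simp [Ex.entry, h44, h45, e1, e46]
    · simp [Ex.entry]; norm_num
    · rintro _ rfl
      rw [haddr]
      refine ⟨?_, fun x hx hx' => ?_⟩
      · have n1 : 97 + 2 * ((k * m + i) * m + k) ≠ 49 := by omega
        have n2 : 97 + 2 * ((k * m + k) * m + j) ≠ 50 := by omega
        have n3 : 97 + 2 * ((k * m + k) * m + j) ≠ 49 := by omega
        simp only [Function.update_self, Ex.eval_sub, Ex.eval_mul, Ex.eval_div, Ex.eval_cell,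
          Function.update_of_ne n1, Function.update_of_ne n2, Function.update_of_ne n3,
          eE i hi j hj, eE i hi k hk, eE k hk j hj]
        simp [e48, schurComp, hp]
      · rw [Function.update_of_ne hx', Function.update_of_ne (by omega),
          Function.update_of_ne (by omega), Function.update_of_ne (by omega),
          Function.update_of_ne (by omega)]
  refine Det.mono (det_lod_seq (97 + 2 * ((k * m + k) * m + k)) (by norm_num) (by simp [Ex.entry]) ?_
    (by omega) <| (hstart _ ?_ ?_).seq (τ' := 10 + m * (10 + m * 106)) (Q' := fun σ' =>
      (∀ x, ¬ elimCell x → σ' x = σ x) ∧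
      σ' 46 = (k + 1 : ℕ) ∧ σ' 43 = (if p ≤ 0 then 0 else σ 43) ∧
      ∀ i < m, ∀ j < m, σ' (97 + 2 * (((k + 1) * m + i) * m + j)) = schurComp E (k + 1) i j) ?_) ?_
      fun _ h => h
  · simp [Ex.entry, h46, h1]
  · rw [Function.update_self, hE k hk k hk]
  · rw [Function.update_of_ne (by norm_num), h4]
  · rintro σ₂ ⟨f43, fag⟩
    have fag' : ∀ x, x ≠ 43 → x ≠ 47 → x ≠ 48 → σ₂ x = σ x := fun x h1 h2 h3 => by
      rw [fag x h1 h2, Function.update_of_ne h3]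
    refine Det.mono ((hgrid σ₂ (by rw [fag' 1 (by norm_num) (by norm_num) (by norm_num), h1])
      (by rw [fag' 46 (by norm_num) (by norm_num) (by norm_num), h46])
      (by rw [fag 48 (by norm_num) (by norm_num), Function.update_self, hE k hk k hk])
      (fun i hi j hj => by rw [fag' _ (by omega) (by omega) (by omega), hE i hi j hj])).seq (τ' := 5)
      (Q' := fun σ' => (∀ x, ¬ elimCell x → σ' x = σ x) ∧
      σ' 46 = (k + 1 : ℕ) ∧ σ' 43 = (if p ≤ 0 then 0 else σ 43) ∧
      ∀ i < m, ∀ j < m, σ' (97 + 2 * (((k + 1) * m + i) * m + j)) = schurComp E (k + 1) i j)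
      fun σ₃ ⟨g1, g2⟩ => ?_) (by linarith) fun _ h => h
    refine (det_asg (by norm_num) (by simp)).mono (by norm_num) ?_
    rintro _ rfl
    refine ⟨fun x hx => ?_, ?_, ?_, fun i hi j hj => ?_⟩
    · have hx46 : x ≠ 46 := by rintro rfl; exact hx (Or.inl (by norm_num))
      rw [Function.update_of_ne hx46, g1, fag']
      · rintro rfl; exact hx (Or.inl (by norm_num))
      · rintro rfl; exact hx (Or.inl (by norm_num))
      · rintro rfl; exact hx (Or.inl (by norm_num))
      · unfold elimCell at hx
        rintro (h | h | h | ⟨i, -, j, -, h⟩) <;> omega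
    · simp [g1 46 (not_gridCell_of_lt hb (by norm_num)), fag' 46, h46]
    · rw [Function.update_of_ne (by norm_num), g1 43 (not_gridCell_of_lt hb (by norm_num)), f43,
        Function.update_of_ne (by norm_num)]
    · rw [haddr, Function.update_of_ne (by omega), g2 i hi j hj]
  · simp [Ex.entry]; linarith

end Elimination
end

noncomputable section

/-! ### Search for an extreme Ritz value -/

section Search

/-- Test the shifted moment matrix for definiteness; if the test fails, increase the shift. -/
def testProg : QProg :=
  .seq (asg 43 1) <| .seq fillProg <| .seq (asg 46 0) <| .seq (.loop 1 elimProg) <|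
  -- Cell 5 holds 1, so the comparison asks whether the flag has survived.
  .ite 5 43 (asg 42 1) (asg 41 (.cell 41 + .cell 2 / 2))

theorem elimCell_of_gridCell {m x : ℕ} (h : gridCell m 97 x) : elimCell x := by
  unfold elimCell
  rcases h with h | h | h | ⟨i, -, j, -, h⟩ <;> omega

theorem not_elimCell_of_lt {x : ℕ} (h : x < 43 ∨ (52 < x ∧ x < 97)) : ¬ elimCell x := by
  unfold elimCell; omega

open Classical in
theorem det_testProg {σ : ℕ → ℝ} {m D : ℕ} {ρ s ε : ℝ} (hm : 1 ≤ m) (h1 : σ 1 = m) (h2 : σ 2 = ε)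
    (h4 : σ 4 = 0) (h5 : σ 5 = 1) (h12 : σ 12 = D) (h40 : σ 40 = s) (h41 : σ 41 = ρ) :
    Det testProg σ (300 * m ^ 3) fun σ' =>
      (∀ x, ¬ elimCell x → x ≠ 41 → x ≠ 42 → σ' x = σ x) ∧
      if ∀ k < m, 0 < schurComp (shiftMatrix (fun k => σ (96 + 2 * (k * D))) ρ s) k k k then
        σ' 42 = 1 ∧ σ' 41 = ρ else σ' 42 = σ 42 ∧ σ' 41 = ρ + ε / 2 := by
  set E := shiftMatrix (fun k => σ (96 + 2 * (k * D))) ρ s with hE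
  have hm' : (1 : ℝ) ≤ m := by exact_mod_cast hm
  have hloop : ∀ σ₁ : ℕ → ℝ, (∀ x, ¬ elimCell x → σ₁ x = σ x) → σ₁ 46 = 0 → σ₁ 43 = 1 →
      (∀ i < m, ∀ j < m, σ₁ (97 + 2 * (i * m + j)) = E i j) →
      Det (.loop 1 elimProg) σ₁ (1 + m * (40 + m * (10 + m * 106) + 1)) fun σ' =>
        (∀ x, ¬ elimCell x → σ' x = σ x) ∧ σ' 46 = m ∧
        σ' 43 = (if ∀ k < m, 0 < schurComp E k k k then 1 else 0) ∧
        ∀ i < m, ∀ j < m, σ' (97 + 2 * ((m * m + i) * m + j)) = schurComp E m i j := by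
    intro σ₁ e1 e46 e43 eE
    refine det_loop (fun k σ' => (∀ x, ¬ elimCell x → σ' x = σ x) ∧ σ' 46 = k ∧
        σ' 43 = (if ∀ k' < k, 0 < schurComp E k' k' k' then 1 else 0) ∧
        ∀ i < m, ∀ j < m, σ' (97 + 2 * ((k * m + i) * m + j)) = schurComp E k i j) (by norm_num)
        (by rw [e1 1 (not_elimCell_of_lt (by norm_num)), h1, Nat.floor_natCast])
        ⟨e1, by simpa using e46, by simpa using e43, by simpa [schurComp] using eE⟩ ?_
    rintro k hk σ₂ ⟨f1, f46, f43, fE⟩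
    refine (det_elimProg hk (by rw [f1 1 (not_elimCell_of_lt (by norm_num)), h1])
      (by rw [f1 4 (not_elimCell_of_lt (by norm_num)), h4]) f46 fE).mono le_rfl ?_
    rintro σ₃ ⟨g1, g46, g43, gE⟩
    refine ⟨fun x hx => by rw [g1 x hx, f1 x hx], g46, ?_, gE⟩
    rw [g43, f43]
    by_cases hall : ∀ k' < k + 1, 0 < schurComp E k' k' k'
    · rw [if_neg (not_le.2 (hall k (by omega))), if_pos (fun k' hk' => hall k' (by omega)), if_pos hall]
    · rw [if_neg hall]
      split_ifs with c1 c2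
      · rfl
      · refine absurd (fun k' hk' => ?_) hall
        rcases Nat.lt_or_ge k' k with h | h
        · exact c2 k' h
        · obtain rfl : k' = k := by omega
          exact not_le.1 c1
      · rfl
  refine Det.mono (det_asg_seq (by norm_num) (by simp) <|
    (det_fillProg (m := m) (D := D) (ρ := ρ) (s := s) ?_ ?_ ?_ ?_).seq
      (τ' := 3 + (1 + m * (40 + m * (10 + m * 106) + 1)) + 8) (Q' := fun σ' =>
      (∀ x, ¬ elimCell x → x ≠ 41 → x ≠ 42 → σ' x = σ x) ∧
      if ∀ k < m, 0 < schurComp E k k k then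
        σ' 42 = 1 ∧ σ' 41 = ρ else σ' 42 = σ 42 ∧ σ' 41 = ρ + ε / 2)
      fun σ₁ ⟨e1, e2⟩ => ?_) ?_ fun _ h => h
  · rw [Function.update_of_ne (by norm_num), h1]
  · rw [Function.update_of_ne (by norm_num), h12]
  · rw [Function.update_of_ne (by norm_num), h40]
  · rw [Function.update_of_ne (by norm_num), h41]
  · have e1' : ∀ x, ¬ elimCell x → σ₁ x = σ x := fun x hx => by
      rw [e1 x (fun h => hx (elimCell_of_gridCell h)), Function.update_of_ne]
      rintro rfl; exact hx (Or.inl (by norm_num))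
    refine Det.mono (det_asg_seq (by norm_num) (by simp) <| (hloop _ ?_ ?_ ?_ ?_).seq
      (τ' := 8) (Q' := fun σ' =>
      (∀ x, ¬ elimCell x → x ≠ 41 → x ≠ 42 → σ' x = σ x) ∧
      if ∀ k < m, 0 < schurComp E k k k then
        σ' 42 = 1 ∧ σ' 41 = ρ else σ' 42 = σ 42 ∧ σ' 41 = ρ + ε / 2)
      fun σ₂ ⟨f1, f46, f43, fE⟩ => ?_) ?_ fun _ h => h
    · intro x hx
      rw [Function.update_of_ne, e1' x hx]
      rintro rfl; exact hx (Or.inl (by norm_num))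
    · simp
    · rw [Function.update_of_ne (by norm_num), e1 43 (not_gridCell_of_lt (by norm_num) (by norm_num)),
        Function.update_self]
      simp
    · intro i hi j hj
      rw [Function.update_of_ne (by omega), e2 i hi j hj, hE]
      simp only [shiftMatrix]
      rw [Function.update_of_ne (by omega), Function.update_of_ne (by omega)]
    · have f5 : σ₂ 5 = 1 := by rw [f1 5 (not_elimCell_of_lt (by norm_num)), h5]
      have f41 : σ₂ 41 = ρ := by rw [f1 41 (not_elimCell_of_lt (by norm_num)), h41]
      have f42 : σ₂ 42 = σ 42 := f1 42 (not_elimCell_of_lt (by norm_num))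
      have f2 : σ₂ 2 = ε := by rw [f1 2 (not_elimCell_of_lt (by norm_num)), h2]
      refine (det_ite (τ := 7) (by norm_num) (by norm_num) (fun hle => ?_) (fun hlt => ?_)).mono
        (by norm_num) fun _ h => h
      · rw [f5, f43] at hle
        have hall : ∀ k < m, 0 < schurComp E k k k := by
          by_contra hc
          rw [if_neg hc] at hle; norm_num at hle
        refine (det_asg (by norm_num) (by simp)).mono (by norm_num) ?_
        rintro _ rfl
        refine ⟨fun x hx _ hx2 => by rw [Function.update_of_ne hx2, f1 x hx], ?_⟩
        rw [if_pos hall]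
        simp [f41]
      · rw [f5, f43] at hlt
        have hall : ¬ ∀ k < m, 0 < schurComp E k k k := fun hc => by
          rw [if_pos hc] at hlt; norm_num at hlt
        refine (det_asg (by norm_num) (by simp)).mono (by norm_num) ?_
        rintro _ rfl
        refine ⟨fun x hx hx1 _ => by rw [Function.update_of_ne hx1, f1 x hx], ?_⟩
        rw [if_neg hall]
        simp [f41, f42, f2]
    · norm_num; linarith
  · have q1 : (m : ℝ) ≤ m ^ 3 := le_self_pow₀ hm' (by norm_num)
    have q2 : (m : ℝ) ^ 2 ≤ m ^ 3 := pow_le_pow_right₀ hm' (by norm_num)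
    have q3 : (1 : ℝ) ≤ m ^ 3 := one_le_pow₀ hm'
    norm_num
    nlinarith

/-- Search for the largest Ritz value relative to `1/2`, up to the sign in cell 40. -/
def searchProg : QProg :=
  -- Centred Ritz values lie in `[-1/2, 1/2]`, so the search starts at the lower end, and `8/ε`
  -- steps of `ε/2` more than cover the interval. A linear search is affordable, as its cost is of
  -- order `m³/ε`.
  .seq (asg 41 (0 - 1 / 2)) <| .seq (asg 42 0) <| .seq (asg 53 (8 / .cell 2)) <|
  .loop 53 (.ite 5 42 (asg 47 0) testProg)

/-- The cells that the search may change. -/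
def searchCell (x : ℕ) : Prop := elimCell x ∨ x = 41 ∨ x = 42 ∨ x = 53

/-- The test fails below `θ - ε/4` and succeeds above `θ + ε/4`. The last failing shift is at most
`θ + ε/4`, so with steps of `ε/2` the first success is within `3/4 ε` of `θ`. -/
theorem det_searchProg {σ : ℕ → ℝ} {m D : ℕ} {s ε θ : ℝ} {p : Prop} (hm : 1 ≤ m) (h1 : σ 1 = m) (h2 : σ 2 = ε)
    (h4 : σ 4 = 0) (h5 : σ 5 = 1) (h12 : σ 12 = D) (h40 : σ 40 = s) (hε : 0 < ε) (hε1 : ε ≤ 1)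
    (hθ : -(1 / 2) ≤ θ) (hθ' : θ ≤ 1 / 2)
    (hyes : p → ∀ ρ, |ρ| ≤ 2 → θ + ε / 4 < ρ →
      ∀ k < m, 0 < schurComp (shiftMatrix (fun k => σ (96 + 2 * (k * D))) ρ s) k k k)
    (hno : p → ∀ ρ, |ρ| ≤ 2 →
      (∀ k < m, 0 < schurComp (shiftMatrix (fun k => σ (96 + 2 * (k * D))) ρ s) k k k) →
      θ - ε / 4 ≤ ρ) :
    Det searchProg σ (2500 * (m ^ 3 / ε)) fun σ' => (∀ x, ¬ searchCell x → σ' x = σ x) ∧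
      (p → |σ' 41 - θ| ≤ 3 / 4 * ε) := by
  have hm' : (1 : ℝ) ≤ m := by exact_mod_cast hm
  set r := ⌊8 / ε⌋₊ with hr
  have hloop : ∀ σ₁ : ℕ → ℝ, (∀ x, ¬ searchCell x → σ₁ x = σ x) → σ₁ 53 = 8 / ε → σ₁ 42 = 0 →
      σ₁ 41 = -(1 / 2) → Det (.loop 53 (.ite 5 42 (asg 47 0) testProg)) σ₁
        (1 + r * (300 * m ^ 3 + 1 + 1)) fun σ' =>
        (∀ x, ¬ searchCell x → σ' x = σ x) ∧ ((σ' 42 = 1 ∧ (p → |σ' 41 - θ| ≤ 3 / 4 * ε)) ∨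
        (σ' 42 = 0 ∧ σ' 41 = -(1 / 2) + r * (ε / 2) ∧ (p → σ' 41 ≤ θ + 3 / 4 * ε))) := by
    intro σ₁ e1 e53 e42 e41
    refine det_loop (fun i σ' => (∀ x, ¬ searchCell x → σ' x = σ x) ∧
      ((σ' 42 = 1 ∧ (p → |σ' 41 - θ| ≤ 3 / 4 * ε)) ∨
        (σ' 42 = 0 ∧ σ' 41 = -(1 / 2) + i * (ε / 2) ∧ (p → σ' 41 ≤ θ + 3 / 4 * ε)))) (by norm_num)
      (by rw [e53]) ⟨e1, Or.inr ⟨e42, by simp [e41], fun _ => by rw [e41]; linarith⟩⟩ ?_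
    rintro i - σ₂ ⟨f1, f2⟩
    have g : ∀ x, x < 41 → σ₂ x = σ x := fun x hx => f1 x (by
      unfold searchCell elimCell; omega)
    refine det_ite (by norm_num) (by norm_num) (fun hle => ?_) (fun hlt => ?_)
    · refine (det_asg (by norm_num) (by simp)).mono ?_ ?_
      · have : (1 : ℝ) ≤ m ^ 3 := one_le_pow₀ hm'
        norm_num; linarith
      · rintro _ rfl
        refine ⟨fun x hx => ?_, ?_⟩
        · rw [Function.update_of_ne, f1 x hx]
          rintro rfl; exact hx (Or.inl (Or.inl (by norm_num)))
        · rw [Function.update_of_ne (by norm_num), Function.update_of_ne (by norm_num)]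
          rw [g 5 (by norm_num), h5] at hle
          rcases f2 with f2 | ⟨f2, -⟩
          · exact Or.inl f2
          · rw [f2] at hle; norm_num at hle
    · rw [g 5 (by norm_num), h5] at hlt
      obtain ⟨f42, f41, fle⟩ := f2.resolve_left fun h => by rw [h.1] at hlt; norm_num at hlt
      have hμ : (fun k => σ₂ (96 + 2 * (k * D))) = fun k => σ (96 + 2 * (k * D)) := by
        funext k
        refine f1 _ ?_
        unfold searchCell elimCell; omega
      refine (det_testProg (ρ := σ₂ 41) hm (by rw [g 1 (by norm_num), h1])
        (by rw [g 2 (by norm_num), h2]) (by rw [g 4 (by norm_num), h4]) (by rw [g 5 (by norm_num), h5])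
        (by rw [g 12 (by norm_num), h12]) (by rw [g 40 (by norm_num), h40]) rfl).mono le_rfl ?_
      rintro σ₃ ⟨k1, k2⟩
      refine ⟨fun x hx => ?_, ?_⟩
      · unfold searchCell at hx
        rw [k1 x (by tauto) (by tauto) (by tauto), f1 x hx]
      · have hi0 : (0 : ℝ) ≤ i * (ε / 2) := by positivity
        have hρ : p → |σ₂ 41| ≤ 2 := fun hp => by
          have := fle hp
          rw [abs_le]; constructor <;> linarith
        rw [hμ] at k2
        split_ifs at k2 with hall
        · left
          refine ⟨k2.1, fun hp => ?_⟩
          have := hno hp _ (hρ hp) hall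
          have := fle hp
          rw [k2.2, abs_le]; constructor <;> linarith
        · right
          refine ⟨k2.1.trans f42, ?_, fun hp => ?_⟩
          · rw [k2.2, f41]; push_cast; ring
          · have : ¬ θ + ε / 4 < σ₂ 41 := fun h => hall (hyes hp _ (hρ hp) h)
            rw [k2.2]; linarith
  refine Det.mono (det_asg_seq (by norm_num) (by simp) <| det_asg_seq (by norm_num) (by simp) <|
    det_asg_seq (by norm_num) (by simp) <| hloop _ ?_ ?_ ?_ ?_) ?_ ?_
  · intro x hx
    unfold searchCell at hx
    iterate 3 rw [Function.update_of_ne (by tauto)]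
  · simp [h2]
  · simp
  · simp
  · have e1 : (r : ℝ) ≤ 8 / ε := Nat.floor_le (by positivity)
    have e2 : (1 : ℝ) ≤ m ^ 3 := one_le_pow₀ hm'
    have e3 : 1 ≤ 1 / ε := by rw [le_div_iff₀ hε]; linarith
    have e4 : (r : ℝ) * (300 * m ^ 3 + 1 + 1) ≤ 8 / ε * (302 * m ^ 3) := by
      refine mul_le_mul e1 (by linarith) (by positivity) (by positivity)
    have e5 : 8 / ε * (302 * m ^ 3) = 2416 * ((m : ℝ) ^ 3 / ε) := by ring
    have e6 : 1 ≤ (m : ℝ) ^ 3 / ε := by rw [le_div_iff₀ hε]; linarith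
    norm_num; linarith
  · rintro σ' ⟨e1, e2⟩
    refine ⟨e1, fun hp => ?_⟩
    rcases e2 with e2 | ⟨-, e2, e3⟩
    · exact e2.2 hp
    · exfalso
      have e3 := e3 hp
      have e4 := Nat.lt_floor_add_one (8 / ε)
      rw [← hr, div_lt_iff₀ hε] at e4
      nlinarith

end Search

/-! ### The output and its accuracy -/

section Output

variable {n : ℕ} {A : Matrix (Fin n) (Fin n) ℝ} {b : Fin n → ℝ} {m : ℕ} {δ : ℝ}

/-- Compute the output from the moments. -/
def outputProg : QProg :=
  .seq (asg 40 1) <| .seq searchProg <| .seq (asg 54 (1 / 2 + .cell 41)) <|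
  -- With sign `-1` the same search approximates the largest eigenvalue of `1/2 - T`.
  .seq (asg 40 (0 - 1)) <| .seq searchProg <| .seq (asg 55 (1 / 2 - .cell 41)) <|
  -- Raising the estimate to `δ` does no harm, since the smallest Ritz value is at least `δ`, and it
  -- keeps the quotient under control.
  .seq (.ite 55 3 (asg 55 (.cell 3)) (asg 47 0)) <|
  .seq (asg 0 (.cell 54)) <| .seq (asg 1 (.cell 55)) <| asg 2 (.cell 54 / .cell 55)

/-- Over the common denominator `y lmin ≥ δ lmin`, the two parts of the numerator are at most `3/4 ε
lmax` each. Together they stay below `2 ε lmax`. -/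
theorem goodOutput_of_le {lmax lmin ε δ x y : ℝ} (hδ : 0 < δ) (hε : 0 < ε) (h1 : δ ≤ lmin)
    (h2 : lmin ≤ lmax) (hx : |x - lmax| ≤ 3 / 4 * ε) (hy : |y - lmin| ≤ 3 / 4 * ε) (hyδ : δ ≤ y) :
    |x / y - lmax / lmin| ≤ 2 * ε / δ * (lmax / lmin) := by
  have hl : 0 < lmin := by linarith
  have hy0 : 0 < y := by linarith
  have e : x / y - lmax / lmin = ((x - lmax) * lmin - lmax * (y - lmin)) / (y * lmin) := by
    field_simp; ring
  rw [e, abs_div, abs_of_pos (show 0 < y * lmin by positivity)]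
  have h3 : |(x - lmax) * lmin - lmax * (y - lmin)| ≤ 2 * ε * lmax := by
    refine (abs_sub _ _).trans ?_
    rw [abs_mul, abs_mul, abs_of_pos hl, abs_of_pos (show 0 < lmax by linarith)]
    have h4 : |x - lmax| * lmin ≤ 3 / 4 * ε * lmax :=
      mul_le_mul hx h2 hl.le (by positivity)
    have h5 : lmax * |y - lmin| ≤ lmax * (3 / 4 * ε) := by gcongr; linarith
    nlinarith [mul_pos hε (show 0 < lmax by linarith)]
  have hlm : 0 < lmax := by linarith
  calc _ ≤ 2 * ε * lmax / (δ * lmin) := by gcongr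
    _ = _ := by field_simp

theorem CGRun.det_outputProg (h : CGRun A b m δ) (hm : 1 ≤ m) {σ : ℕ → ℝ} {D : ℕ} {ε e : ℝ}
    {p : Prop} (h1 : σ 1 = m) (h2 : σ 2 = ε) (h3 : σ 3 = δ) (h4 : σ 4 = 0) (h5 : σ 5 = 1) (h12 : σ 12 = D)
    (hε : 0 < ε) (hε1 : ε ≤ 1)
    (hμ : p → ∀ k < 2 * m, |σ (96 + 2 * (k * D)) - centralMoment h.herm b k| ≤ e)
    (he : 3 * e * coordBound m δ ≤ ε / 4) :
    Det outputProg σ (5060 * (m ^ 3 / ε)) fun σ' => p → GoodOutput (maxEigenvalue (lanczosMatrix A b m))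
      (minEigenvalue (lanczosMatrix A b m)) ε δ σ' := by
  have hT := lanczosMatrix_isHermitian (A := A) (b := b) (m := m)
  have hδ := h.pos
  set lmax := maxEigenvalue (lanczosMatrix A b m) with hlmax
  set lmin := minEigenvalue (lanczosMatrix A b m) with hlmin
  obtain ⟨a1, a2⟩ := h.maxEigenvalue_mem hm
  obtain ⟨b1, b2⟩ := h.minEigenvalue_mem hm
  obtain ⟨w, w1, w2⟩ := exists_quad_eq_maxEigenvalue hm hT
  obtain ⟨v, v1, v2⟩ := exists_quad_eq_minEigenvalue hm hT
  have hle : lmin ≤ lmax := by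
    have := minEigenvalue_le_quad hT w
    rw [w2] at this
    rw [w1, mul_one] at this
    exact this
  have hm' : (1 : ℝ) ≤ m := by exact_mod_cast hm
  have hcell : ∀ k, ¬ searchCell (96 + 2 * (k * D)) := fun k => by
    unfold searchCell elimCell; omega
  have hcell' : ∀ x, x < 41 ∨ x = 54 → ¬ searchCell x := fun x hx => by
    unfold searchCell elimCell; omega
  have hs1 := fun (σ₁ : ℕ → ℝ) (hag : ∀ x, x ≠ 40 → x ≠ 54 → ¬ searchCell x → σ₁ x = σ x)
      (h40 : σ₁ 40 = 1) => det_searchProg (p := p) (σ := σ₁) (m := m) (D := D) (s := 1) (ε := ε)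
    (θ := lmax - 1 / 2) hm
    (by rw [hag 1 (by norm_num) (by norm_num) (hcell' _ (by norm_num)), h1])
    (by rw [hag 2 (by norm_num) (by norm_num) (hcell' _ (by norm_num)), h2])
    (by rw [hag 4 (by norm_num) (by norm_num) (hcell' _ (by norm_num)), h4])
    (by rw [hag 5 (by norm_num) (by norm_num) (hcell' _ (by norm_num)), h5])
    (by rw [hag 12 (by norm_num) (by norm_num) (hcell' _ (by norm_num)), h12]) h40 hε hε1
    (by linarith) (by linarith)
    (fun hp ρ hρ hlt => h.schurComp_shift_pos (θ := lmax - 1 / 2) (e := e) (by norm_num) hρ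
      (fun k hk => by rw [hag _ (by omega) (by omega) (hcell k)]; exact hμ hp k hk)
      (fun w => by linarith [quad_le_maxEigenvalue hT w]) (by linarith))
    (fun hp ρ hρ hall => by
      have := h.le_of_schurComp_shift (θ := lmax - 1 / 2) (e := e) (s := 1) (w := w) (by norm_num) hρ
        (fun k hk => by rw [hag _ (by omega) (by omega) (hcell k)]; exact hμ hp k hk) w1
        (by rw [w1, w2]; ring) hall
      linarith)
  have hs2 := fun (σ₁ : ℕ → ℝ) (hag : ∀ x, x ≠ 40 → x ≠ 54 → ¬ searchCell x → σ₁ x = σ x)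
      (h40 : σ₁ 40 = -1) => det_searchProg (p := p) (σ := σ₁) (m := m) (D := D) (s := -1) (ε := ε)
    (θ := 1 / 2 - lmin) hm
    (by rw [hag 1 (by norm_num) (by norm_num) (hcell' _ (by norm_num)), h1])
    (by rw [hag 2 (by norm_num) (by norm_num) (hcell' _ (by norm_num)), h2])
    (by rw [hag 4 (by norm_num) (by norm_num) (hcell' _ (by norm_num)), h4])
    (by rw [hag 5 (by norm_num) (by norm_num) (hcell' _ (by norm_num)), h5])
    (by rw [hag 12 (by norm_num) (by norm_num) (hcell' _ (by norm_num)), h12]) h40 hε hε1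
    (by linarith) (by linarith)
    (fun hp ρ hρ hlt => h.schurComp_shift_pos (θ := 1 / 2 - lmin) (e := e) (by norm_num) hρ
      (fun k hk => by rw [hag _ (by omega) (by omega) (hcell k)]; exact hμ hp k hk)
      (fun w => by linarith [minEigenvalue_le_quad hT w]) (by linarith))
    (fun hp ρ hρ hall => by
      have := h.le_of_schurComp_shift (θ := 1 / 2 - lmin) (e := e) (s := -1) (w := v) (by norm_num) hρ
        (fun k hk => by rw [hag _ (by omega) (by omega) (hcell k)]; exact hμ hp k hk) v1
        (by rw [v1, v2]; ring) hall
      linarith)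
  have hend : ∀ σ₃ : ℕ → ℝ, σ₃ 3 = δ → (p → |σ₃ 54 - lmax| ≤ 3 / 4 * ε) →
      (p → |σ₃ 41 - (1 / 2 - lmin)| ≤ 3 / 4 * ε) → Det (.seq (asg 55 (1 / 2 - .cell 41)) <|
        .seq (.ite 55 3 (asg 55 (.cell 3)) (asg 47 0)) <|
        .seq (asg 0 (.cell 54)) <| .seq (asg 1 (.cell 55)) <| asg 2 (.cell 54 / .cell 55)) σ₃ 40
        (fun σ' => p → GoodOutput lmax lmin ε δ σ') := by
    intro σ₃ g3 g54 g41
    have hfin : ∀ σ₄ : ℕ → ℝ, σ₄ 54 = σ₃ 54 → (p → |σ₄ 55 - lmin| ≤ 3 / 4 * ε) → δ ≤ σ₄ 55 →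
        Det (.seq (asg 0 (.cell 54)) <| .seq (asg 1 (.cell 55)) <| asg 2 (.cell 54 / .cell 55)) σ₄ 11
          (fun σ' => p → GoodOutput lmax lmin ε δ σ') := by
      intro σ₄ k54 k55 kδ
      refine Det.mono (det_asg_seq (by norm_num) (by simp) <| det_asg_seq (by norm_num) (by simp) <|
        det_asg (by norm_num) (by simp)) (by norm_num) ?_
      rintro _ rfl hp
      rw [← k54] at g54
      refine ⟨?_, ?_, ?_⟩
      · simpa using (g54 hp).trans (by linarith)
      · simpa using (k55 hp).trans (by linarith)
      · simpa using goodOutput_of_le hδ hε b1 hle (g54 hp) (k55 hp) kδ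
    refine Det.mono (det_asg_seq (by norm_num) (by simp) <| Det.seq (τ := 4) (τ' := 11)
      (Q := fun σ₄ => σ₄ 54 = σ₃ 54 ∧ (p → |σ₄ 55 - lmin| ≤ 3 / 4 * ε) ∧ δ ≤ σ₄ 55) ?_
      fun σ₄ ⟨k1, k2, k3⟩ => hfin σ₄ k1 k2 k3) (by norm_num) fun _ h => h
    have hy : p → |(1 / 2 - σ₃ 41) - lmin| ≤ 3 / 4 * ε := fun hp => by
      rw [← abs_neg]; convert g41 hp using 2; ring
    refine (det_ite (τ := 3) (by norm_num) (by norm_num) (fun hle' => ?_) (fun hlt => ?_)).mono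
      (by norm_num) fun _ h => h
    · refine (det_asg (by norm_num) (by simp)).mono (by norm_num) ?_
      rintro _ rfl
      simp [g3] at hle' ⊢
      intro hp
      have := abs_le.1 (hy hp)
      rw [abs_le]
      constructor <;> linarith
    · refine (det_asg (by norm_num) (by simp)).mono (by norm_num) ?_
      rintro _ rfl
      simp [g3] at hlt ⊢
      refine ⟨?_, by linarith⟩
      simpa using hy
  refine Det.mono (det_asg_seq (by norm_num) (by simp) <| (hs1 _ ?_ ?_).seq
    (τ' := 12 + 2500 * (m ^ 3 / ε) + 40) (Q' := fun σ' => p → GoodOutput lmax lmin ε δ σ') ?_) ?_ fun _ h => h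
  · intro x hx _ _; rw [Function.update_of_ne hx]
  · simp
  · rintro σ₂ ⟨e1, e2⟩
    refine Det.mono (det_asg_seq (by norm_num) (by simp) <| det_asg_seq (by norm_num) (by simp) <|
      (hs2 _ ?_ ?_).seq (τ' := 40) (Q' := fun σ' => p → GoodOutput lmax lmin ε δ σ') ?_) ?_ fun _ h => h
    · intro x h40 h54 hx
      rw [Function.update_of_ne h40, Function.update_of_ne h54, e1 x hx, Function.update_of_ne h40]
    · simp
    · rintro σ₃ ⟨f1, f2⟩
      refine hend σ₃ ?_ ?_ f2
      · rw [f1 3 (hcell' 3 (by norm_num)), Function.update_of_ne (by norm_num),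
          Function.update_of_ne (by norm_num), e1 3 (hcell' 3 (by norm_num)),
          Function.update_of_ne (by norm_num), h3]
      · rw [f1 54 (hcell' 54 (by norm_num)), Function.update_of_ne (by norm_num), Function.update_self]
        intro hp
        convert e2 hp using 2
        simp; ring
    · norm_num; linarith
  · have e2 : (1 : ℝ) ≤ m ^ 3 := one_le_pow₀ hm'
    have e6 : 1 ≤ (m : ℝ) ^ 3 / ε := by rw [le_div_iff₀ hε]; linarith
    norm_num; linarith

end Output
end

noncomputable section

/-! ### Parameters and their computation -/

section Setup

/-- The accuracy to which the wave moments have to be estimated. -/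
def precision (γ : ℚ) (m : ℕ) (ε δ : ℝ) : ℝ :=
  if m = 1 then ε / (4 * γ) else ε / (4 * γ) * (δ * δ / γ) ^ m

/-- The number of wave moments used in one multiplication by the shifted matrix. -/
def bandwidth (η : ℝ) : ℕ := ⌊Real.sqrt (1 / η)⌋₊ + 1

/-- Compute the number of moments and write the first one. -/
def sizeProg : QProg :=
  .seq (asg 12 (.sqrt (1 / .cell 10))) <| .seq (asg 11 1) <|
  -- Loops run for the natural-number part of their cell, so counting the rounds from 1 computes the
  -- floor plus 1.
  .seq (.loop 12 (asg 11 (.cell 11 + 1))) <| .seq (asg 31 (2 * .cell 1 * .cell 11)) <|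
  .seq (asg 12 (.cell 31 + 1)) <| .seq (asg 32 (2 * .cell 1)) <| .seq (asg 13 1) <|
  .seq (asg 30 1) <| sto 96 30

/-- Compute the constants and the parameters of the estimation. -/
def setupProg (γ : ℚ) : QProg :=
  .seq (asg 5 1) <| .seq (asg 6 2) <| .seq (asg 7 .pi) <| .seq (asg 8 (1 / 25)) <|
  .seq (asg 9 (0 - .cell 8)) <| .seq (asg 10 (.cell 2 / (4 * .rat γ))) <|
  -- The power is built up in `m` rounds; for `m = 1` it is omitted, in accordance with
  -- `coordBound`.
  .seq (.ite 1 5 (asg 47 0) (.loop 1 (asg 10 (.cell 10 * (.cell 3 * .cell 3 / .rat γ))))) sizeProg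

/-- The memory after the setup. -/
structure SetupMem (m J : ℕ) (ε δ η : ℝ) (σ : ℕ → ℝ) : Prop where
  base : BaseMem σ
  c1 : σ 1 = m
  c2 : σ 2 = ε
  c3 : σ 3 = δ
  c10 : σ 10 = η
  c11 : σ 11 = J
  c12 : σ 12 = (2 * m * J + 1 : ℕ)
  c13 : σ 13 = 1
  c31 : σ 31 = (2 * m * J : ℕ)
  c32 : σ 32 = (2 * m : ℕ)
  c96 : σ 96 = 1

theorem det_sizeProg {σ : ℕ → ℝ} {m : ℕ} {ε δ η : ℝ} (hσ : BaseMem σ) (h1 : σ 1 = m) (h2 : σ 2 = ε)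
    (h3 : σ 3 = δ) (h10 : σ 10 = η) :
    Det sizeProg σ (50 + 6 * bandwidth η) (SetupMem m (bandwidth η) ε δ η) := by
  set J := bandwidth η with hJ
  have htail : ∀ σ₁ : ℕ → ℝ, (∀ x, x ≠ 11 → x ≠ 12 → σ₁ x = σ x) → σ₁ 11 = J →
      Det (.seq (asg 31 (2 * .cell 1 * .cell 11)) <|
        .seq (asg 12 (.cell 31 + 1)) <| .seq (asg 32 (2 * .cell 1)) <| .seq (asg 13 1) <|
        .seq (asg 30 1) <| sto 96 30) σ₁ 35 (SetupMem m J ε δ η) := by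
    intro σ₁ hag h11
    refine Det.mono (det_asg_seq (by norm_num) (by simp) <| det_asg_seq (by norm_num) (by simp) <|
      det_asg_seq (by norm_num) (by simp) <| det_asg_seq (by norm_num) (by simp) <|
      det_asg_seq (by norm_num) (by simp) <| det_sto (by norm_num) (by simp) (a := 96) (by simp)
        le_rfl) (by norm_num) ?_
    rintro _ rfl
    have g : ∀ x, x < 11 ∨ (13 < x ∧ x < 30) → ∀ v1 v2 v3 v4 v5 v6, Function.update
        (Function.update (Function.update (Function.update (Function.update (Function.update σ₁
        31 v1) 12 v2) 32 v3) 13 v4) 30 v5) 96 v6 x = σ x := by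
      intro x hx v1 v2 v3 v4 v5 v6
      rw [Function.update_of_ne (by omega), Function.update_of_ne (by omega),
        Function.update_of_ne (by omega), Function.update_of_ne (by omega),
        Function.update_of_ne (by omega), Function.update_of_ne (by omega),
        hag x (by omega) (by omega)]
    refine ⟨hσ.congr fun x hx => g x (by omega) _ _ _ _ _ _, ?_, ?_, ?_, ?_, ?_, ?_, ?_, ?_, ?_, ?_⟩
    · rw [g _ (by norm_num), h1]
    · rw [g _ (by norm_num), h2]
    · rw [g _ (by norm_num), h3]
    · rw [g _ (by norm_num), h10]
    · simp [h11]
    · simp [h11, hag 1, h1]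
    · simp
    · simp [h11, hag 1, h1]
    · simp [hag 1, h1]
    · simp
  refine Det.mono (det_asg_seq (by norm_num) (by simp) <| det_asg_seq (by norm_num) (by simp) <|
    Det.seq (τ' := 35) (det_loop (k := ⌊Real.sqrt (1 / η)⌋₊) (τ := 5) (fun i σ₁ =>
      (∀ x, x ≠ 11 → x ≠ 12 → σ₁ x = σ x) ∧ σ₁ 11 = (i + 1 : ℕ)) (by norm_num) ?_ ⟨?_, ?_⟩ ?_)
      fun σ₁ ⟨e1, e2⟩ => htail σ₁ e1 e2) ?_ fun _ h => h
  · simp [h10]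
  · intro x hx hx'; rw [Function.update_of_ne hx, Function.update_of_ne hx']
  · simp
  · rintro i - σ₁ ⟨e1, e2⟩
    refine (det_asg (by norm_num) (by simp)).mono (by norm_num) ?_
    rintro _ rfl
    refine ⟨fun x hx hx' => by rw [Function.update_of_ne hx, e1 x hx hx'], by simp [e2]⟩
  · rw [hJ, bandwidth]; push_cast; norm_num; linarith

theorem det_setupProg {γ : ℚ} {σ : ℕ → ℝ} {m : ℕ} {ε δ : ℝ} (hm : 1 ≤ m) (h1 : σ 1 = m)
    (h2 : σ 2 = ε) (h3 : σ 3 = δ) (h0 : ∀ x, 3 < x → σ x = 0) :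
    Det (setupProg γ) σ (100 + 10 * m + 6 * bandwidth (precision γ m ε δ))
      (SetupMem m (bandwidth (precision γ m ε δ)) ε δ (precision γ m ε δ)) := by
  have hm' : (1 : ℝ) ≤ m := by exact_mod_cast hm
  refine Det.mono (det_asg_seq (by norm_num) (by simp) <| det_asg_seq (by norm_num) (by simp) <|
    det_asg_seq (by norm_num) (by simp) <| det_asg_seq (by norm_num) (by simp) <|
    det_asg_seq (by norm_num) (by simp) <| det_asg_seq (by norm_num) (by simp) <|
    Det.seq (τ := (2 + m * (9 + 1)) + 1) (τ' := 50 + 6 * bandwidth (precision γ m ε δ))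
      (Q := fun σ₁ => BaseMem σ₁ ∧ σ₁ 1 = m ∧ σ₁ 2 = ε ∧ σ₁ 3 = δ ∧ σ₁ 10 = precision γ m ε δ) ?_
      fun σ₁ ⟨e0, e1, e2, e3, e10⟩ => det_sizeProg e0 e1 e2 e3 e10) ?_ fun _ h => h
  · set σ₀ := Function.update (Function.update (Function.update (Function.update (Function.update
      (Function.update σ 5 _) 6 _) 7 _) 8 _) 9 _) 10 _ with hσ₀
    have hbase : BaseMem σ₀ := by
      constructor <;> simp [hσ₀, h0]
    have k1 : σ₀ 1 = m := by simp [hσ₀, h1]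
    have k2 : σ₀ 2 = ε := by simp [hσ₀, h2]
    have k3 : σ₀ 3 = δ := by simp [hσ₀, h3]
    have k10 : σ₀ 10 = ε / (4 * γ) := by simp [hσ₀, h2]
    clear_value σ₀
    refine det_ite (by norm_num) (by norm_num) (fun hle => ?_) (fun hlt => ?_)
    · rw [k1, hbase.c5] at hle
      have hm1 : m = 1 := by
        have : m ≤ 1 := by exact_mod_cast hle
        omega
      refine (det_asg (by norm_num) (by simp)).mono (by norm_num; linarith) ?_
      rintro _ rfl
      refine ⟨hbase.congr fun x hx => by rw [Function.update_of_ne (by omega)], ?_⟩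
      simp [k1, k2, k3, k10, precision, hm1]
    · rw [k1, hbase.c5] at hlt
      have hm1 : m ≠ 1 := by rintro rfl; norm_num at hlt
      refine (det_loop (τ := 9) (k := m) (fun i σ₁ => (∀ x, x ≠ 10 → σ₁ x = σ₀ x) ∧
        σ₁ 10 = ε / (4 * γ) * (δ * δ / γ) ^ i) (by norm_num) (by rw [k1, Nat.floor_natCast])
        ⟨fun _ _ => rfl, by simpa using k10⟩ ?_).mono (by linarith) ?_
      · rintro i - σ₁ ⟨e1, e2⟩
        refine (det_asg (by norm_num) (by simp)).mono (by norm_num) ?_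
        rintro _ rfl
        refine ⟨fun x hx => by rw [Function.update_of_ne hx, e1 x hx], ?_⟩
        simp [e1 3, k3, e2, pow_succ]
        ring
      · rintro σ₁ ⟨e1, e2⟩
        refine ⟨hbase.congr fun x hx => e1 x (by omega), ?_⟩
        simp [e1 1, e1 2, e1 3, k1, k2, k3, e2, precision, hm1]
  · norm_num; linarith

end Setup
end

noncomputable section

/-! ### Sufficient accuracy within the time bound -/

section Parameters

variable {g m : ℕ} {ε δ : ℝ}

theorem precision_pos (hg : 1 ≤ g) (hε : 0 < ε) (hδ : 0 < δ) : 0 < precision g m ε δ := by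
  have : (0 : ℝ) < g := by exact_mod_cast hg
  unfold precision
  push_cast
  split_ifs <;> positivity

theorem precision_le_one (hg : 1 ≤ g) (hε1 : ε ≤ 1) (hδ : 0 < δ) (hδ1 : δ ≤ 1) :
    precision g m ε δ ≤ 1 := by
  have hg' : (1 : ℝ) ≤ g := by exact_mod_cast hg
  have h1 : ε / (4 * g) ≤ 1 := by rw [div_le_one (by positivity)]; linarith
  have h2 : δ * δ / g ≤ 1 := by rw [div_le_one (by positivity)]; nlinarith
  unfold precision
  push_cast
  split_ifs
  · exact h1
  · exact mul_le_one₀ h1 (by positivity) (pow_le_one₀ (by positivity) h2)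

theorem one_le_mul_bandwidth_sq {η : ℝ} (hη : 0 < η) : 1 ≤ η * (bandwidth η : ℝ) ^ 2 := by
  have h1 : Real.sqrt (1 / η) ≤ bandwidth η := by
    rw [bandwidth]; push_cast; exact (Nat.lt_floor_add_one _).le
  have h2 : 1 / η ≤ (bandwidth η : ℝ) ^ 2 := by
    rw [← Real.sq_sqrt (show 0 ≤ 1 / η by positivity)]
    gcongr
  rwa [div_le_iff₀' hη] at h2

theorem bandwidth_sq_le {η : ℝ} (hη : 0 < η) (hη1 : η ≤ 1) : (bandwidth η : ℝ) ^ 2 ≤ 4 / η := by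
  have h0 : 1 ≤ 1 / η := by rw [le_div_iff₀ hη]; linarith
  have h1 : 1 ≤ Real.sqrt (1 / η) := Real.one_le_sqrt.2 h0
  have h2 : (bandwidth η : ℝ) ≤ 2 * Real.sqrt (1 / η) := by
    rw [bandwidth]; push_cast
    linarith [Nat.floor_le (Real.sqrt_nonneg (1 / η))]
  calc (bandwidth η : ℝ) ^ 2 ≤ (2 * Real.sqrt (1 / η)) ^ 2 := by gcongr
    _ = 4 / η := by rw [mul_pow, Real.sq_sqrt (by positivity)]; ring

/-- The losses are `(2 waveConst)^(2m)` in the table and `16^m / δ^(2m)` in the change of basis.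
Their product `(64 waveConst²)^m / δ^(2m)` is what `(δ²/g)^m` compensates. -/
theorem precision_mul_coordBound_le (hg : 64 * waveConst ^ 2 ≤ g) (hm : 1 ≤ m) (hε : 0 < ε)
    (hδ : 0 < δ) :
    3 * ((2 * waveConst) ^ (2 * m) * precision g m ε δ) * coordBound m δ ≤ ε / 4 := by
  have hK := one_le_waveConst
  have hg' : (64 : ℝ) ≤ g := by nlinarith
  unfold precision coordBound
  push_cast
  split_ifs with h1
  · subst h1
    have : ε / (4 * g) * (64 * waveConst ^ 2) ≤ ε / (4 * g) * g := by gcongr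
    have e : ε / (4 * g) * g = ε / 4 := by field_simp
    have : 0 ≤ ε / (4 * g) * waveConst ^ 2 := by positivity
    nlinarith
  · have h2 : (64 * waveConst ^ 2 / g) ^ m ≤ 1 :=
      pow_le_one₀ (by positivity) (by rw [div_le_one (by positivity)]; exact hg)
    have e : 3 * ((2 * waveConst) ^ (2 * m) * (ε / (4 * g) * (δ * δ / g) ^ m)) *
        (16 ^ m / δ ^ (2 * m)) = 3 * ε / (4 * g) * (64 * waveConst ^ 2 / g) ^ m := by
      have e1 : (64 : ℝ) ^ m = 4 ^ m * 16 ^ m := by rw [← mul_pow]; norm_num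
      rw [div_pow, div_pow, mul_pow 64, e1, ← pow_two, ← pow_mul, ← pow_mul, mul_pow, pow_mul 2]
      norm_num
      field_simp
    rw [e]
    calc _ ≤ 3 * ε / (4 * g) * 1 := by gcongr
      _ ≤ 3 * ε / (4 * 3) := by rw [mul_one]; gcongr; linarith
      _ = ε / 4 := by ring

/-- If `m > g³`, then `m δ³ ≤ 1` forces `g δ ≤ 1`, and the powers of `g` are absorbed by those of
`δ`. Otherwise `m` is bounded in terms of `g`. -/
theorem pow_mul_pow_le (hg : 1 ≤ g) (hδ : 0 < δ) (hδ1 : δ ≤ 1) (hm : 2 ≤ m)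
    (h : (m : ℝ) * δ ^ 3 ≤ 1) : (g : ℝ) ^ (m + 1) * δ ^ (m - 2) ≤ (g : ℝ) ^ (g ^ 3 + 3) := by
  have hg' : (1 : ℝ) ≤ g := by exact_mod_cast hg
  rcases Nat.lt_or_ge (g ^ 3) m with hgm | hgm
  · have h1 : (g * δ) ^ 3 ≤ (1 : ℝ) ^ 3 := by
      have : ((g : ℝ)) ^ 3 ≤ m := by exact_mod_cast hgm.le
      rw [mul_pow, one_pow]
      exact (mul_le_mul_of_nonneg_right this (by positivity)).trans h
    have h2 : (g : ℝ) * δ ≤ 1 := le_of_pow_le_pow_left₀ (by norm_num) zero_le_one h1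
    calc (g : ℝ) ^ (m + 1) * δ ^ (m - 2) = g ^ 3 * (g * δ) ^ (m - 2) := by
          rw [show m + 1 = 3 + (m - 2) by omega, pow_add, mul_pow]; ring
      _ ≤ g ^ 3 * 1 := by gcongr; exact pow_le_one₀ (by positivity) h2
      _ ≤ g ^ (g ^ 3 + 3) := by rw [mul_one]; exact pow_le_pow_right₀ hg' (by omega)
  · calc (g : ℝ) ^ (m + 1) * δ ^ (m - 2) ≤ g ^ (m + 1) * 1 := by
          gcongr; exact pow_le_one₀ hδ.le hδ1
      _ ≤ g ^ (g ^ 3 + 3) := by rw [mul_one]; exact pow_le_pow_right₀ hg' (by omega)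

/-- For `m ≥ 2` the left side is `4 g^(m+1) m² / (ε δ^(2m))`. The target has `m - 2` further powers
of `1/δ`, which pay for the power of `g` by `pow_mul_pow_le`. -/
theorem sq_div_precision_le (hg : 1 ≤ g) (hε : 0 < ε) (hδ : 0 < δ) (hδ1 : δ ≤ 1) (hm : 1 ≤ m)
    (h : (m : ℝ) * δ ^ 3 ≤ 1) :
    (m : ℝ) ^ 2 / precision g m ε δ ≤ 4 * g ^ (g ^ 3 + 3) * (m ^ 3 / (ε * δ ^ (3 * m - 2))) := by
  have hg' : (1 : ℝ) ≤ g := by exact_mod_cast hg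
  have hm' : (1 : ℝ) ≤ m := by exact_mod_cast hm
  unfold precision
  push_cast
  split_ifs with h1
  · subst h1
    have h2 : (g : ℝ) ≤ g ^ (g ^ 3 + 3) := le_self_pow₀ hg' (by omega)
    have h3 : 1 ≤ 1 / δ := by rw [le_div_iff₀ hδ]; linarith
    have h4 : (g : ℝ) * 1 ≤ g ^ (g ^ 3 + 3) * (1 / δ) := by gcongr
    have e1 : ((1 : ℕ) : ℝ) ^ 2 / (ε / (4 * g)) = 4 / ε * (g * 1) := by field_simp; norm_num
    have e2 : 4 * (g : ℝ) ^ (g ^ 3 + 3) * (((1 : ℕ) : ℝ) ^ 3 / (ε * δ ^ (3 * 1 - 2))) =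
        4 / ε * (g ^ (g ^ 3 + 3) * (1 / δ)) := by field_simp; norm_num
    rw [e1, e2]
    gcongr
  · have hm2 : 2 ≤ m := by omega
    have h2 := pow_mul_pow_le hg hδ hδ1 hm2 h
    have e1 : (m : ℝ) ^ 2 / (ε / (4 * g) * (δ * δ / g) ^ m) =
        4 * (g ^ (m + 1) * δ ^ (m - 2)) * (m ^ 2 / (ε * δ ^ (3 * m - 2))) := by
      rw [show 3 * m - 2 = 2 * m + (m - 2) by omega, ← pow_two, div_pow, ← pow_mul, pow_add δ]
      field_simp
      ring
    rw [e1]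
    gcongr
    norm_num

end Parameters

/-! ### From expectation bounds to the success probability -/

section Extraction

variable {n : ℕ} {A : Matrix (Fin n) (Fin n) ℝ} {U : Matrix (Fin n) (Fin n) ℂ}

/-- The memory of the initial configuration. -/
theorem visible_initialConfig {m : ℕ} {ε δ : ℝ} :
    visible (initialConfig n m ε δ).mem = (initialConfig n m ε δ).mem := by
  funext x
  unfold visible
  split_ifs with h
  · simp only [initialConfig]
    rw [if_neg (by omega), if_neg (by omega), if_neg (by omega), if_neg (by omega)]
  · rfl

theorem flipZeroGate_initialConfig {m : ℕ} {ε δ : ℝ} :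
    flipZeroGate 0 (initialConfig n m ε δ).state = baseState n := by
  funext s i
  have h : symmDiff s {0} = ∅ ↔ s = {0} := by
    rw [← Finset.bot_eq_empty, symmDiff_eq_bot]
  simp only [flipZeroGate, initialConfig, baseState, h]
  split_ifs <;> simp_all

-- The failure indicator has expectation at most 1/3 and no probability is lost. The leading
-- `flipZero` produces the base state: cell 4 still holds 0 and the register is in `|0⟩`, so qubit
-- 0, the permanent control, is set.
open Classical in
theorem Wp.exec {P : QProg} {m : ℕ} {ε δ τ lmax lmin : ℝ} (hn : 0 < n)
    (h : Wp A U P (initialConfig n m ε δ).mem τ (fun _ => True)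
      (fun σ => if GoodOutput lmax lmin ε δ σ then 0 else 1) (1 / 3)) :
    QProg.RunsInTime (.seq (.flipZero 4) P) A U m ε δ (1 + Real.log n + τ) ∧
      2 / 3 ≤ QProg.successProb (.seq (.flipZero 4) P) A U m ε δ (GoodOutput lmax lmin ε δ) := by
  set c₀ : QConfig n := ⟨(initialConfig n m ε δ).mem, baseState n, 1 + Real.log n⟩ with hc₀
  have hidx : (initialConfig n m ε δ).idx 4 = 0 := by simp [QConfig.idx, initialConfig]
  have hexec : QProg.exec (.seq (.flipZero 4) P) A U m ε δ = P.run A U c₀ := by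
    simp only [QProg.exec, QProg.run, List.flatMap_cons, List.flatMap_nil, List.append_nil, hidx,
      QConfig.act, QConfig.wait, flipZeroGate_initialConfig]
    congr 2
    simp [initialConfig]
  have hprob : c₀.prob = 1 := by
    have := prob_baseState hn 1 c₀.mem c₀.time
    simpa [hc₀] using this
  obtain ⟨h1, h2, h3⟩ := h c₀ 1 visible_initialConfig (by simp [hc₀])
  refine ⟨fun c hc _ => ?_, ?_⟩
  · rw [hexec] at hc
    exact (h1 c hc).2.1
  · have hvis : ∀ M : ℕ → ℝ, GoodOutput lmax lmin ε δ (visible M) ↔ GoodOutput lmax lmin ε δ M :=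
      fun M => by
        unfold GoodOutput
        rw [visible_of_lt (by norm_num), visible_of_lt (by norm_num), visible_of_lt (by norm_num)]
    have hsplit : ∀ L : List (QConfig n), (L.map QConfig.prob).sum =
        (L.map fun c => if GoodOutput lmax lmin ε δ c.mem then c.prob else 0).sum +
        (L.map fun c => c.prob * if GoodOutput lmax lmin ε δ (visible c.mem) then 0 else 1).sum := by
      intro L
      rw [← List.sum_map_add]
      congr 1
      refine List.map_congr_left fun c _ => ?_
      simp only [hvis]
      split_ifs <;> simp
    have := hsplit (P.run A U c₀)
    rw [QProg.successProb, hexec]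
    rw [hprob] at h2 h3
    linarith

end Extraction

/-! ### The algorithm, its correctness and its running time -/

section Main

variable {n : ℕ} {A : Matrix (Fin n) (Fin n) ℝ} {U : Matrix (Fin n) (Fin n) ℂ} {b : Fin n → ℝ}
  {m : ℕ} {ε δ : ℝ}

/-- The algorithm without the preparation of the control qubit. -/
def ritzProg (g : ℕ) : QProg :=
  .seq (setupProg g) <| .seq momentLoop <| .seq tableProg outputProg

/-- The time bound of the algorithm. -/
def ritzTime (n m J : ℕ) (ε η : ℝ) : ℝ :=
  100 + 10 * m + 6 * J + (1 + 201 * (2 * m * J : ℕ) + 4000000000 * Real.log n ^ 2 / η +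
    (4 + (2 * m : ℕ) * (11 + (2 * m * J + 1 : ℕ) * (31 + 131 * J)) + 5060 * (m ^ 3 / ε)))

-- All chance is in the moment loop. Table and output are deterministic and correct whenever all
-- estimates are, so the failure probability is that of `wp_momentLoop`.
open Classical in
theorem CGRun.wp_ritzProg (h : CGRun A b m δ) (hn : 2 ≤ n) (hm : 1 ≤ m) (hδ1 : δ ≤ 1)
    (hU : U ∈ Matrix.unitaryGroup (Fin n) ℂ) (hspec : ∀ i, h.herm.eigenvalues i ∈ Set.Icc (0 : ℝ) 1)
    (hUb : ∀ i, U i ⟨0, Nat.zero_lt_two.trans_le hn⟩ = (b i : ℂ)) (hε : 0 < ε) (hε1 : ε ≤ 1) {g : ℕ}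
    (hg : 64 * waveConst ^ 2 ≤ g) :
    Wp A U (ritzProg g) (initialConfig n m ε δ).mem
      (ritzTime n m (bandwidth (precision g m ε δ)) ε (precision g m ε δ)) (fun _ => True)
      (fun σ => if GoodOutput (maxEigenvalue (lanczosMatrix A b m))
        (minEigenvalue (lanczosMatrix A b m)) ε δ σ then 0 else 1) (1 / 3) := by
  have hK := one_le_waveConst
  have hg1 : 1 ≤ g := by
    have : (1 : ℝ) ≤ g := by nlinarith
    exact_mod_cast this
  set η := precision g m ε δ with hη
  set J := bandwidth η with hJ
  have hη0 : 0 < η := precision_pos hg1 hε h.pos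
  have hη1 : η ≤ 1 := precision_le_one hg1 hε1 h.pos hδ1
  refine Wp.seq (τ := 100 + 10 * m + 6 * J) ((det_setupProg hm (by simp [initialConfig])
    (by simp [initialConfig]) (by simp [initialConfig]) fun x hx => ?_).wp
    (F := fun _ => 1 / 3) fun _ _ => le_rfl) fun σ hσ => ?_
  · simp only [initialConfig]
    rw [if_neg (by omega), if_neg (by omega), if_neg (by omega), if_neg (by omega)]
  refine Wp.seq (wp_momentLoop hn h.herm hU hspec h.unit hUb hσ.base hσ.c13
    (by rw [hσ.c31, Nat.floor_natCast]) hσ.c10 hη0) fun σ₁ hag => ?_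
  refine Det.wp (Q := fun σ' => (∀ j, 1 ≤ j → j ≤ 2 * m * J →
    |σ₁ (96 + 2 * j) - waveMoment h.herm b 0 j| ≤ η * (1 + j) ^ 5) → GoodOutput
    (maxEigenvalue (lanczosMatrix A b m)) (minEigenvalue (lanczosMatrix A b m)) ε δ σ') ?_ ?_ |>.mono
    le_rfl (fun _ _ => trivial) (fun _ _ => le_rfl) le_rfl
  · refine (det_tableProg (p := ∀ j, 1 ≤ j → j ≤ 2 * m * J →
      |σ₁ (96 + 2 * j) - waveMoment h.herm b 0 j| ≤ η * (1 + j) ^ 5) h.herm hspec h.unit hη0.le (one_le_mul_bandwidth_sq hη0)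
      (by rw [hag 12 (by norm_num), hσ.c12]) (by rw [hag 11 (by norm_num), hσ.c11])
      (by rw [hag 32 (by norm_num), hσ.c32]) fun hp k hk => ?_).seq fun σ₂ ⟨e1, e2⟩ => ?_
    · rcases Nat.eq_zero_or_pos k with rfl | hk0
      · rw [mul_zero, add_zero, hag 96 (by norm_num), hσ.c96, waveMoment_zero_zero h.herm h.unit,
          sub_self, abs_zero]
        positivity
      · exact hp k hk0 (by omega)
    · have f : ∀ x, x < 13 → σ₂ x = σ x := fun x hx => by rw [e1 x (by omega), hag x (by omega)]
      refine h.det_outputProg hm (by rw [f 1 (by norm_num), hσ.c1]) (by rw [f 2 (by norm_num), hσ.c2])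
        (by rw [f 3 (by norm_num), hσ.c3]) (by rw [f 4 (by norm_num), hσ.base.c4])
        (by rw [f 5 (by norm_num), hσ.base.c5]) (by rw [f 12 (by norm_num), hσ.c12]) hε hε1
        (fun hp k hk => ?_) (precision_mul_coordBound_le hg hm hε h.pos)
      rw [← waveMoment_zero_right]
      refine (e2 hp k hk.le ?_).trans ?_
      -- The width `2 m J + 1` is just enough to keep column 0 meaningful up to row `2 m`.
      · exact Nat.lt_succ_of_le (Nat.mul_le_mul_right J hk.le)
      · gcongr
        linarith
  · intro σ' hσ'
    split_ifs with h1 h2 h2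
    · exact le_rfl
    · exact zero_le_one
    · exact absurd (hσ' h2) h1
    · exact le_rfl

/-- The estimation costs `log² n / η`, the table `m² J² ≤ 4 m² / η` and the search `m³/ε`. Factors
`log² n` may be inserted at will, since `log n ≥ 1/2`, and `sq_div_precision_le` treats `m² / η`. -/
theorem ritzTime_le (hn : 2 ≤ n) (hm : 1 ≤ m) (hε : 0 < ε) (hδ : 0 < δ) (hδ1 : δ ≤ 1)
    (hε1 : ε ≤ 1) {g : ℕ} (hg : 1 ≤ g) (h : (m : ℝ) * δ ^ 3 ≤ 1) :
    1 + Real.log n + ritzTime n m (bandwidth (precision g m ε δ)) ε (precision g m ε δ) ≤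
      (4000030000 * (4 * g ^ (g ^ 3 + 3)) + 20240) *
        (Real.log n ^ 2 * (m : ℝ) ^ 3 / (ε * δ ^ (3 * m - 2))) := by
  obtain ⟨l1, l2, -⟩ := log_bounds hn
  have h1 := sq_div_precision_le hg hε hδ hδ1 hm h
  have hη0 : 0 < precision g m ε δ := precision_pos hg hε hδ
  have hη1 : precision g m ε δ ≤ 1 := precision_le_one hg hε1 hδ hδ1
  set η := precision g m ε δ with hη
  have h2 := bandwidth_sq_le hη0 hη1
  have hJ1 : (1 : ℝ) ≤ bandwidth η := by unfold bandwidth; push_cast; simp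
  set J := bandwidth η with hJ
  have hm' : (1 : ℝ) ≤ m := by exact_mod_cast hm
  have hX : (m : ℝ) ^ 3 / ε ≤ m ^ 3 / (ε * δ ^ (3 * m - 2)) := by
    gcongr
    exact mul_le_of_le_one_right hε.le (pow_le_one₀ hδ.le hδ1)
  rw [mul_div_assoc]
  set R := (m : ℝ) ^ 3 / (ε * δ ^ (3 * m - 2)) with hR
  set Λ := Real.log n ^ 2 with hΛ
  set a := (m : ℝ) ^ 2 / η with ha
  have hma : (m : ℝ) ^ 2 * J ^ 2 ≤ 4 * a := by
    rw [ha, show 4 * ((m : ℝ) ^ 2 / η) = m ^ 2 * (4 / η) by ring]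
    gcongr
  have h1η : 1 / η ≤ a := by
    rw [ha]; gcongr; exact one_le_pow₀ hm'
  have ha1 : 1 ≤ a := le_trans (by rw [le_div_iff₀ hη0]; linarith) h1η
  have hpoly : 1 + (100 + 10 * (m : ℝ) + 6 * J + (1 + 201 * (2 * m * J) + (4 + 2 * m * (11 +
      (2 * m * J + 1) * (31 + 131 * J))))) ≤ 1600 * (m ^ 2 * J ^ 2) := by
    -- In the variables `m - 1` and `J - 1` all monomials are nonnegative, and the two sides compare
    -- coefficient by coefficient.
    obtain ⟨x, hx⟩ : ∃ x, (m : ℝ) = 1 + x := ⟨m - 1, by ring⟩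
    obtain ⟨y, hy⟩ : ∃ y, (J : ℝ) = 1 + y := ⟨J - 1, by ring⟩
    have hx0 : 0 ≤ x := by linarith
    have hy0 : 0 ≤ y := by linarith
    rw [hx, hy]
    have := mul_nonneg hx0 hy0
    have := mul_nonneg hx0 hx0
    have := mul_nonneg hy0 hy0
    have := mul_nonneg hx0 (mul_nonneg hy0 hy0)
    have := mul_nonneg hx0 (mul_nonneg hx0 hy0)
    have := mul_nonneg (mul_nonneg hx0 hx0) (mul_nonneg hy0 hy0)
    ring_nf
    nlinarith
  have t1 : 4000000000 * Λ / η ≤ 4000000000 * (Λ * a) := by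
    have := mul_le_mul_of_nonneg_left h1η (show 0 ≤ Λ by positivity)
    calc 4000000000 * Λ / η = 4000000000 * (Λ * (1 / η)) := by ring
      _ ≤ _ := by gcongr
  have t2 : a ≤ 4 * (Λ * a) := by nlinarith
  have t3 : Real.log n ≤ 2 * (Λ * a) := by nlinarith [show 0 ≤ Λ by positivity]
  have t4 : (m : ℝ) ^ 3 / ε ≤ 4 * (Λ * R) := by
    have : 0 ≤ (m : ℝ) ^ 3 / ε := by positivity
    nlinarith
  have t5 : Λ * a ≤ 4 * g ^ (g ^ 3 + 3) * (Λ * R) := by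
    have := mul_le_mul_of_nonneg_left h1 (show 0 ≤ Λ by positivity)
    linarith
  have key : 1 + Real.log n + ritzTime n m J ε η ≤ 4000030000 * (Λ * a) + 20240 * (Λ * R) := by
    unfold ritzTime
    push_cast
    linarith
  linarith

end Main
end

theorem mainTheorem9 :
    ∃ (P : QProg) (C : ℝ), 0 < C ∧
      ∀ (n m : ℕ) (hn : 2 ≤ n) (hm : 1 ≤ m)
        (ε δ : ℝ) (hε : 0 < ε) (hε1 : ε ≤ 1) (hδ : 0 < δ) (hδ1 : δ ≤ 1)
        (A : Matrix (Fin n) (Fin n) ℝ) (b : Fin n → ℝ) (U : Matrix (Fin n) (Fin n) ℂ)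
        (hA : A.PosDef) (hspec : spectrum ℝ A ⊆ Set.Icc δ 1)
        (hb : b ⬝ᵥ b = 1)
        (hU : U ∈ Matrix.unitaryGroup (Fin n) ℂ)
        (hUb : ∀ i, U i ⟨0, by omega⟩ = (b i : ℂ))
        (hrun : ∀ k < m, δ ≤ Real.sqrt ((cg A b k).r ⬝ᵥ (cg A b k).r)),
        P.RunsInTime A U m ε δ
            (C * (Real.log n ^ 2 * (m : ℝ) ^ 3 / (ε * δ ^ (3 * m - 2)))) ∧
          2 / 3 ≤ P.successProb A U m ε δ
            (GoodOutput (maxEigenvalue (lanczosMatrix A b m))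
              (minEigenvalue (lanczosMatrix A b m)) ε δ) ∧
          ((cg A b m).r = 0 → HasOverlap A b (maxEigenvalue A) →
            HasOverlap A b (minEigenvalue A) →
              maxEigenvalue (lanczosMatrix A b m) = maxEigenvalue A ∧
              minEigenvalue (lanczosMatrix A b m) = minEigenvalue A ∧
              2 / 3 ≤ P.successProb A U m ε δ
                (GoodOutput (maxEigenvalue A) (minEigenvalue A) ε δ)) := by
  -- Constants in programs are rational, so the value of an infinite series is replaced by a natural
  -- upper bound.
  obtain ⟨g, hg⟩ := exists_nat_ge (64 * waveConst ^ 2)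
  have hg1 : 1 ≤ g := by
    have : (1 : ℝ) ≤ g := by nlinarith [one_le_waveConst]
    exact_mod_cast this
  refine ⟨.seq (.flipZero 4) (ritzProg g), 4000030000 * (4 * g ^ (g ^ 3 + 3)) + 20240,
    by positivity, ?_⟩
  intro n m hn hm ε δ hε hε1 hδ hδ1 A b U hA hspec hb hU hUb hrun
  have hspec' : ∀ i, hA.isHermitian.eigenvalues i ∈ Set.Icc δ 1 := fun i =>
    hspec (eigenvalues_mem_spectrum hA.isHermitian i)
  have h : CGRun A b m δ := by
    refine ⟨hA.isHermitian, fun x => ?_, fun x => ?_, hδ, hb, fun k hk => ?_⟩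
    · rw [quad_eq_eigCoord hA.isHermitian, dotProduct_eq_eigCoord hA.isHermitian, Finset.mul_sum]
      refine Finset.sum_le_sum fun i _ => ?_
      rw [← pow_two]
      exact mul_le_mul_of_nonneg_right (hspec' i).1 (sq_nonneg _)
    · rw [quad_eq_eigCoord hA.isHermitian, dotProduct_eq_eigCoord hA.isHermitian]
      refine Finset.sum_le_sum fun i _ => ?_
      rw [← pow_two]
      exact mul_le_of_le_one_left (sq_nonneg _) (hspec' i).2
    · exact (Real.le_sqrt hδ.le (dotProduct_self_nonneg' _)).1 (hrun k hk)
  obtain ⟨h1, h2⟩ := Wp.exec (by omega) (h.wp_ritzProg hn hm hδ1 hU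
    (fun i => ⟨hδ.le.trans (hspec' i).1, (hspec' i).2⟩) hUb hε hε1 hg)
  refine ⟨fun c hc hp => (h1 c hc hp).trans
    (ritzTime_le hn hm hε hδ hδ1 hε1 hg1 h.steps_le), h2, fun hr ho1 ho2 => ?_⟩
  obtain ⟨e1, e2⟩ := h.eigenvalues_eq hm hr ho1 ho2
  exact ⟨e1, e2, by rwa [e1, e2] at h2⟩
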